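/- **Conventions.** All algorithms are randomized (Monte Carlo) word-RAM algorithms with unit-cost arithmetic, bitwise, shift, comparison, memory-access and fair-coin instructions; time bounds hold for every outcome of the coin flips. *SETH* is the hypothesis that for every $\epsilon>0$ there is a $K$ such that no randomized algorithm, on words of $O(N)$ bits, decides satisfiability of CNF formulas with $N$ variables, without repeated clauses and with at most $K$ literals per clause, correctly with probability at least $2/3$ on every input, in time $2^{(1-\epsilon)N}\,\mathrm{poly}(N)$. For a connected undirected unweighted graph $G$, the *eccentricity* of a vertex $x$ is $\max_y d(x,y)$; the *diameter* and the *radius* are the maximum and the minimum of all eccentricities. A number $\hat D$ is an *$\alpha$-approximation* of $D$ from above if $D\le\hat D\le\alpha D$, and from below if $\hat D\le D\le\alpha\hat D$. A *dynamic algorithm* uses words of $O(\log n)$ bits. It preprocesses an initial graph on a fixed set of $n$ vertices, given as a list of edges (for eccentricity, the input also contains the fixed vertex $x$), and then serves a sequence of updates and queries. In the *fully dynamic* setting an update inserts or deletes one edge; in the *incremental* (*decremental*) setting it only inserts (only deletes) one. The algorithm *maintains an $\alpha$-approximation* of a parameter if, for every initial graph and every operation sequence fixed in advance, each query is answered with probability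 at least $2/3$ by a natural number that is an $\alpha$-approximation of the parameter of the current graph (always from above, or always from below). It has preprocessing time $p(n)$ and *amortized* update and query times $u(n)$, $q(n)$ if preprocessing followed by any sequence of $a$ updates and $b$ queries takes at most $p(n)+a\,u(n)+b\,q(n)$ steps in total; it has *worst-case* update and query times $u(n)$, $q(n)$ if preprocessing takes at most $p(n)$ steps, every single update at most $u(n)$ steps, and every single query at most $q(n)$ steps. For an integer $c\ge 1$, all these requirements are made only for sequences in which the graph is at all times connected with at most $n\lfloor\log_2 n\rfloor^c$ edges. **Theorem.** Assume SETH. Let $t,\epsilon,\epsilon'>0$ be real constants and let $c\ge1$ be an integer. Consider any one of the parameters Diameter, Radius, and Eccentricity of a fixed vertex, and either type of approximation (from above or from below). 1. There is no fully dynamic algorithm that maintains a $(2-\epsilon)$-approximation of the parameter on undirected unweighted graphs with $n$ vertices that are always connected with at most $n\lfloor\log_2 n\rfloor^c$ edges, with preprocessing time $p(n)=O(n^t)$, amortized update time $u(n)=O(n^{1-\epsilon'})$ and amortized query time $q(n)=O(n^{1-\epsilon'})$. 2. There is no incremental algorithm, and no decremental algorithm, that does this with preprocessing time $p(n)=O(n^t)$,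 worst-case update time $u(n)=O(n^{1-\epsilon'})$ and worst-case query time $q(n)=O(n^{1-\epsilon'})$. -/

import Mathlib

open Filter MeasureTheory Asymptotics

noncomputable section

/-! ## Randomized word-RAM

Words are bit vectors of width `w`; the memory has `2 ^ w` cells, each holding one word, and a
program uses finitely many registers.  Programs are finite structured programs; every elementary
instruction and every test costs one step. -/

namespace WordRAM

/-- The binary unit-cost operations on words (unsigned arithmetic modulo `2 ^ w`, bitwise
operations, shifts, comparisons). -/
inductive BinOp where
  | add | sub | mul | div | mod | band | bor | bxor | shl | shr | lt | eq

/-- Value of a binary operation; comparisons return the word `1` or `0`, and division by zero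
follows the convention of `BitVec`. -/
def BinOp.eval {w : ℕ} : BinOp → BitVec w → BitVec w → BitVec w
  | .add, x, y => x + y
  | .sub, x, y => x - y
  | .mul, x, y => x * y
  | .div, x, y => x / y
  | .mod, x, y => x % y
  | .band, x, y => x &&& y
  | .bor, x, y => x ||| y
  | .bxor, x, y => x ^^^ y
  | .shl, x, y => x <<< y.toNat
  | .shr, x, y => x >>> y.toNat
  | .lt, x, y => if x < y then 1 else 0
  | .eq, x, y => if x = y then 1 else 0

/-- Programs.  Natural numbers `d`, `a`, `b`, `r` are names of registers. -/
inductive Prog where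
  /-- do nothing -/
  | skip
  /-- `reg d := c` -/
  | const (d c : ℕ)
  /-- `reg d := o (reg a) (reg b)` -/
  | bin (o : BinOp) (d a b : ℕ)
  /-- `reg d := mem[reg a]` -/
  | load (d a : ℕ)
  /-- `mem[reg a] := reg b` -/
  | store (a b : ℕ)
  /-- `reg d :=` a fresh fair random bit -/
  | coin (d : ℕ)
  /-- sequential composition -/
  | seq (P Q : Prog)
  /-- if `reg r ≠ 0` then `P` else `Q` -/
  | cond (r : ℕ) (P Q : Prog)
  /-- while `reg r ≠ 0` do `P` -/
  | loop (r : ℕ) (P : Prog)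

/-- A configuration: registers, memory, and the number of random bits consumed so far. -/
structure State (w : ℕ) where
  reg : ℕ → BitVec w
  mem : BitVec w → BitVec w
  coins : ℕ

/-- Overwrite one register. -/
def State.setReg {w : ℕ} (s : State w) (d : ℕ) (x : BitVec w) : State w :=
  { s with reg := Function.update s.reg d x }

/-- Overwrite one memory cell. -/
def State.setMem {w : ℕ} (s : State w) (a x : BitVec w) : State w :=
  { s with mem := Function.update s.mem a x }

/-- Initial configuration: the input list occupies the memory cells `0, 1, 2, …`, everything else
is zero. -/
def State.initial (w : ℕ) (input : List ℕ) : State w where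
  reg := fun _ => 0
  mem := fun a => BitVec.ofNat w (input.getD a.toNat 0)
  coins := 0

/-- `Exec ω P s k s'`: with the random bits `ω`, the program `P` started in `s` halts after exactly
`k` steps, in configuration `s'`. -/
inductive Exec {w : ℕ} (ω : ℕ → Bool) : Prog → State w → ℕ → State w → Prop where
  | skip (s : State w) : Exec ω .skip s 1 s
  | const (s : State w) (d c : ℕ) : Exec ω (.const d c) s 1 (s.setReg d (BitVec.ofNat w c))
  | bin (s : State w) (o : BinOp) (d a b : ℕ) :
      Exec ω (.bin o d a b) s 1 (s.setReg d (o.eval (s.reg a) (s.reg b)))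
  | load (s : State w) (d a : ℕ) : Exec ω (.load d a) s 1 (s.setReg d (s.mem (s.reg a)))
  | store (s : State w) (a b : ℕ) : Exec ω (.store a b) s 1 (s.setMem (s.reg a) (s.reg b))
  | coin (s : State w) (d : ℕ) :
      Exec ω (.coin d) s 1
        { s.setReg d (if ω s.coins = true then 1 else 0) with coins := s.coins + 1 }
  | seq {s s' s'' : State w} {P Q : Prog} {k l : ℕ} :
      Exec ω P s k s' → Exec ω Q s' l s'' → Exec ω (.seq P Q) s (k + l) s''
  | cond_true {s s' : State w} {r : ℕ} {P Q : Prog} {k : ℕ} :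
      s.reg r ≠ 0 → Exec ω P s k s' → Exec ω (.cond r P Q) s (k + 1) s'
  | cond_false {s s' : State w} {r : ℕ} {P Q : Prog} {k : ℕ} :
      s.reg r = 0 → Exec ω Q s k s' → Exec ω (.cond r P Q) s (k + 1) s'
  | loop_done {s : State w} {r : ℕ} {P : Prog} :
      s.reg r = 0 → Exec ω (.loop r P) s 1 s
  | loop_step {s s' s'' : State w} {r : ℕ} {P : Prog} {k l : ℕ} :
      s.reg r ≠ 0 → Exec ω P s k s' → Exec ω (.loop r P) s' l s'' →
        Exec ω (.loop r P) s (k + l + 1) s''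

/-- The law of an infinite sequence of independent fair random bits. -/
def coinLaw : Measure (ℕ → Bool) :=
  Measure.infinitePi fun _ => (PMF.uniformOfFintype Bool).toMeasure

end WordRAM

/-! ## `K`-SAT and the Strong Exponential Time Hypothesis -/

namespace SAT

/-- A literal: a variable together with its required truth value. -/
abbrev Literal (N : ℕ) := Fin N × Bool

/-- A CNF formula on `N` variables: a list of clauses, each a list of literals. -/
abbrev CNF (N : ℕ) := List (List (Literal N))

/-- The inputs of `K`-SAT: no clause is listed twice and every clause has at most `K` literals. -/
def CNF.IsKCNF {N : ℕ} (K : ℕ) (φ : CNF N) : Prop :=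
  φ.Nodup ∧ ∀ C ∈ φ, C.length ≤ K

def CNF.Satisfiable {N : ℕ} (φ : CNF N) : Prop :=
  ∃ x : Fin N → Bool, ∀ C ∈ φ, ∃ l ∈ C, x l.1 = l.2

/-- A literal as a number: `2 i + 1` for the `i`-th variable, `2 i` for its negation. -/
def Literal.code {N : ℕ} (l : Literal N) : ℕ := 2 * (l.1 : ℕ) + (if l.2 = true then 1 else 0)

/-- A formula as an input for a word-RAM: the number of variables, the number of clauses, and then
the clauses one after the other, each preceded by its length. -/
def CNF.input {N : ℕ} (φ : CNF N) : List ℕ :=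
  N :: φ.length :: φ.flatMap fun C => C.length :: C.map Literal.code

/-- The randomized algorithm `P` on words of `b * (N + 1)` bits decides `K`-SAT within `T N` steps:
it always halts in time, and on every input it is right with probability at least `2 / 3`, where
it accepts if register `0` is nonzero at the end. -/
def Decides (P : WordRAM.Prog) (b K : ℕ) (T : ℕ → ℝ) : Prop :=
  ∀ (N : ℕ) (φ : CNF N), φ.IsKCNF K →
    (∀ ω, ∃ k s, WordRAM.Exec ω P (.initial (b * (N + 1)) φ.input) k s ∧ (k : ℝ) ≤ T N) ∧
    2 / 3 ≤ WordRAM.coinLaw {ω | ∃ k s, WordRAM.Exec ω P (.initial (b * (N + 1)) φ.input) k s ∧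
      (s.reg 0 ≠ 0 ↔ φ.Satisfiable)}

end SAT

/-- The Strong Exponential Time Hypothesis: for every `ε > 0` there is a `K` such that no randomized
word-RAM algorithm decides `K`-SAT on `N` variables in time `2 ^ ((1 - ε) N) * poly(N)`.  The words
have `O(N)` bits, so that exponentially many memory cells can be addressed. -/
def SETH : Prop :=
  ∀ ε : ℝ, 0 < ε → ∃ K : ℕ, ¬ ∃ (P : WordRAM.Prog) (b a d : ℕ),
    SAT.Decides P b K fun N => a * ((2 : ℝ) ^ ((1 - ε) * (N : ℝ)) * ((N : ℝ) + 1) ^ d)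

/-! ## Dynamic graphs -/

namespace DynGraph

/-- The operations on a dynamic graph with vertex set `Fin n`. -/
inductive Op (n : ℕ) where
  | insert (u v : Fin n)
  | delete (u v : Fin n)
  | query

/-- An absent edge may be inserted, a present edge may be deleted. -/
def Op.Applicable {n : ℕ} (G : SimpleGraph (Fin n)) : Op n → Prop
  | .insert u v => u ≠ v ∧ ¬ G.Adj u v
  | .delete u v => G.Adj u v
  | .query => True

/-- The graph after an operation. -/
def Op.apply {n : ℕ} (G : SimpleGraph (Fin n)) : Op n → SimpleGraph (Fin n)
  | .insert u v => G ⊔ SimpleGraph.edge u v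
  | .delete u v => G.deleteEdges {s(u, v)}
  | .query => G

/-- Is the operation an update (rather than a query)? -/
def Op.isUpdate {n : ℕ} : Op n → Bool
  | .query => false
  | _ => true

inductive Setting where
  | fullyDynamic
  | incremental
  | decremental

/-- The operations that may occur in a setting. -/
def Setting.Allows {n : ℕ} : Setting → Op n → Prop
  | .incremental, .delete _ _ => False
  | .decremental, .insert _ _ => False
  | _, _ => True

/-- The promise on every graph in an operation sequence: connected, with at most `M` edges. -/
def Admissible {n : ℕ} (M : ℕ) (G : SimpleGraph (Fin n)) : Prop :=
  G.Connected ∧ G.edgeSet.ncard ≤ M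

/-- `Valid S M G ops`: starting from `G`, the sequence `ops` uses only operations of the setting
`S`, each one applicable, and all graphs (including `G`) are admissible. -/
def Valid {n : ℕ} (S : Setting) (M : ℕ) : SimpleGraph (Fin n) → List (Op n) → Prop
  | G, [] => Admissible M G
  | G, o :: ops => Admissible M G ∧ S.Allows o ∧ o.Applicable G ∧ Valid S M (o.apply G) ops

/-- The graph after the first `i` operations. -/
def graphAfter {n : ℕ} (G : SimpleGraph (Fin n)) (ops : List (Op n)) (i : ℕ) :
    SimpleGraph (Fin n) :=
  (ops.take i).foldl Op.apply G

/-- The graph given by a list of pairs of vertices. -/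
def ofEdgeList {n : ℕ} (E : List (Fin n × Fin n)) : SimpleGraph (Fin n) :=
  SimpleGraph.fromEdgeSet {e | ∃ p ∈ E, e = s(p.1, p.2)}

/-- The list has no loops and lists no edge twice (in either orientation). -/
def IsEdgeList {n : ℕ} (E : List (Fin n × Fin n)) : Prop :=
  (∀ p ∈ E, p.1 ≠ p.2) ∧ (E.map fun p => s(p.1, p.2)).Nodup

/-- The graph parameters; `eccentricity` is that of a fixed vertex, which belongs to the input. -/
inductive Parameter where
  | diameter
  | radius
  | eccentricity

/-- The value of a parameter (finite, as the graphs are connected); `x` is the fixed vertex. -/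
def Parameter.value {n : ℕ} (G : SimpleGraph (Fin n)) (x : Fin n) : Parameter → ℕ
  | .diameter => G.ediam.toNat
  | .radius => G.radius.toNat
  | .eccentricity => (G.eccent x).toNat

/-- The two conventions for `α`-approximations: estimates from above and estimates from below. -/
inductive Side where
  | above
  | below

/-- `side.Approx α D e`: the estimate `e` is an `α`-approximation of `D`. -/
def Side.Approx (α : ℝ) (D e : ℕ) : Side → Prop
  | .above => (D : ℝ) ≤ e ∧ (e : ℝ) ≤ α * D
  | .below => (e : ℝ) ≤ D ∧ (D : ℝ) ≤ α * e

/-- The input of the preprocessing: the numbers of vertices and edges, the fixed vertex (for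
`eccentricity` only), and the list of edges. -/
def Parameter.input {n : ℕ} (par : Parameter) (x : Fin n) (E : List (Fin n × Fin n)) : List ℕ :=
  n :: E.length ::
    ((match par with
      | .eccentricity => [(x : ℕ)]
      | _ => []) ++ E.flatMap fun p => [(p.1 : ℕ), (p.2 : ℕ)])

/-- A dynamic algorithm: three randomized word-RAM programs which share registers and memory.  On
graphs with `n` vertices it uses words of `wordConst * (⌊log₂ n⌋ + 1)` bits. -/
structure Algorithm where
  preprocess : WordRAM.Prog
  update : WordRAM.Prog
  query : WordRAM.Prog
  wordConst : ℕ

def Algorithm.width (A : Algorithm) (n : ℕ) : ℕ := A.wordConst * (Nat.log 2 n + 1)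

/-- The program that serves an operation. -/
def Algorithm.prog {n : ℕ} (A : Algorithm) : Op n → WordRAM.Prog
  | .query => A.query
  | _ => A.update

/-- An update is passed to the algorithm in registers `0` (`1` for an insertion, `0` for a
deletion), `1` and `2` (the end points). -/
def Op.feed {n w : ℕ} (s : WordRAM.State w) : Op n → WordRAM.State w
  | .insert u v => ((s.setReg 0 1).setReg 1 (BitVec.ofNat w u)).setReg 2 (BitVec.ofNat w v)
  | .delete u v => ((s.setReg 0 0).setReg 1 (BitVec.ofNat w u)).setReg 2 (BitVec.ofNat w v)
  | .query => s

/-- `A.Serves ω s ops tr`: started in `s`, the algorithm serves the operations `ops` one after the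
other; `tr` lists, for each of them, the number of steps and the final content of register `0`
(which is the answer if the operation is a query). -/
inductive Algorithm.Serves (A : Algorithm) (ω : ℕ → Bool) {n w : ℕ} :
    WordRAM.State w → List (Op n) → List (ℕ × ℕ) → Prop where
  | nil (s : WordRAM.State w) : Serves A ω s [] []
  | cons {s s' : WordRAM.State w} {o : Op n} {ops : List (Op n)} {k : ℕ} {tr : List (ℕ × ℕ)} :
      WordRAM.Exec ω (A.prog o) (o.feed s) k s' → Serves A ω s' ops tr →
        Serves A ω s (o :: ops) ((k, (s'.reg 0).toNat) :: tr)

/-- A complete run on the input `(x, E)`: the preprocessing takes `k` steps, and then the operations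
`ops` are served with record `tr`. -/
def Algorithm.Run (A : Algorithm) (par : Parameter) (ω : ℕ → Bool) {n : ℕ} (x : Fin n)
    (E : List (Fin n × Fin n)) (ops : List (Op n)) (k : ℕ) (tr : List (ℕ × ℕ)) : Prop :=
  ∃ s, WordRAM.Exec ω A.preprocess (.initial (A.width n) (par.input x E)) k s ∧ A.Serves ω s ops tr

/-- In the setting `S`, on `n`-vertex graphs with at most `M n` edges, every query is answered by
an `α`-approximation of the parameter with probability at least `2 / 3`, for every input and every
valid operation sequence fixed in advance. -/
def Algorithm.Approximates (A : Algorithm) (S : Setting) (par : Parameter) (side : Side) (α : ℝ)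
    (M : ℕ → ℕ) : Prop :=
  ∀ (n : ℕ) (x : Fin n) (E : List (Fin n × Fin n)) (ops : List (Op n)),
    IsEdgeList E → Valid S (M n) (ofEdgeList E) ops →
      ∀ i : ℕ, ops[i]? = some .query →
        2 / 3 ≤ WordRAM.coinLaw {ω | ∃ k tr, A.Run par ω x E ops k tr ∧
          ∃ c e : ℕ, tr[i]? = some (c, e) ∧
            side.Approx α (par.value (graphAfter (ofEdgeList E) ops i) x) e}

/-- Preprocessing time `p n` and amortized update and query times `u n` and `q n`: whatever the
random bits, the algorithm halts, and the preprocessing and any valid sequence of `a` updates and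
`b` queries take at most `p n + a * u n + b * q n` steps altogether. -/
def Algorithm.AmortizedTime (A : Algorithm) (S : Setting) (par : Parameter) (M : ℕ → ℕ)
    (p u q : ℕ → ℝ) : Prop :=
  ∀ (n : ℕ) (x : Fin n) (E : List (Fin n × Fin n)) (ops : List (Op n)),
    IsEdgeList E → Valid S (M n) (ofEdgeList E) ops →
      ∀ ω, ∃ k tr, A.Run par ω x E ops k tr ∧
        ((k + (tr.map Prod.fst).sum : ℕ) : ℝ) ≤
          p n + (ops.countP Op.isUpdate : ℝ) * u n +
            (ops.countP fun o => !o.isUpdate : ℝ) * q n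

/-- Preprocessing time `p n` and worst-case update and query times `u n` and `q n`: whatever the
random bits, the algorithm halts, the preprocessing takes at most `p n` steps, every update at most
`u n` steps and every query at most `q n` steps. -/
def Algorithm.WorstCaseTime (A : Algorithm) (S : Setting) (par : Parameter) (M : ℕ → ℕ)
    (p u q : ℕ → ℝ) : Prop :=
  ∀ (n : ℕ) (x : Fin n) (E : List (Fin n × Fin n)) (ops : List (Op n)),
    IsEdgeList E → Valid S (M n) (ofEdgeList E) ops →
      ∀ ω, ∃ k tr, A.Run par ω x E ops k tr ∧ (k : ℝ) ≤ p n ∧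
        ∀ (i : ℕ) (o : Op n) (c e : ℕ), ops[i]? = some o → tr[i]? = some (c, e) →
          (c : ℝ) ≤ if o.isUpdate = true then u n else q n

end DynGraph

end

/-! From a forbidden dynamic algorithm one builds a randomized algorithm for K-SAT that is too fast
for SETH.

Splitting. Let the formula have N variables and m clauses. Put the first k = N / G variables into a
graph (G is a constant slightly larger than t) and run through the 2^(N-k) assignments h of the
others in as many phases. The formula is satisfiable iff some h has a completing assignment a of the
first k variables, that is, no clause is missed by both a and h (`SAT.CNF.satisfiable_iff`).

Graph. Every a is a spider with m + 3 legs of r vertices each, and one more spider acts as a hub. A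
clause leg of spider a is joined, end to end, to the same leg of the hub iff a misses that clause.
One leg end of the hub is the centre. In phase h the centre is made adjacent to the ends ("tips") of
those hub legs whose clauses h misses. If no a completes h, every spider is joined to an active tip,
and all vertices are within 2r + 2 of the centre (`Gadget.eccent_le`). If a completes h, spider a is
joined to inactive tips only, and the end of one of its unjoined legs is at distance at least 4r - 4
(`Gadget.exists_far`, by an explicit 1-Lipschitz potential). For r large in terms of ε the ratio
exceeds 2 - ε. There are two copies of everything except the centre's role: with opposite signs of
the potential in the copies, every vertex is far from one of two ends, so the radius has the same
gap, and the diameter has the gap with both values doubled (`Gadget.value_le`, `Gadget.le_value`).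
There are at most 4 edges per vertex, so the sparsity promise holds.

Time. For fixed r the graph has n = O(m 2^k) vertices. Preprocessing costs about 2^(tk), which is
small by the choice of G; the phases need O(m) updates and one query each, in total about 2^(N-k)
n^(1-ε') = 2^(N-ε'k) up to factors polynomial in m (`Consts.budget`). As k is a constant fraction of
N, this is 2^((1-δ)N) poly(N) for some δ > 0.

Settings. In the fully dynamic setting each phase deletes what it inserted, and all phases form one
long operation sequence (`Algorithm.simulates_full`). Without one kind of update this is impossible;
instead, every phase restarts from the configuration after the preprocessing. This needs worst-case
bounds, since an amortized bound says nothing useful about repeating one expensive continuation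
(`Algorithm.simulates_partial`).

Randomness. A query is right with probability 2/3 only, and there are exponentially many. The
operations depend on the formula alone, not on the answers, so they are fixed in advance. Hence 24(N
+ 1) runs on disjoint blocks of random bits are independent, and a Chernoff-type estimate with a
union bound makes the majority right in all phases at once with probability 2/3
(`measure_forall_failures_lt`). The bits are first written to a tape in memory; a restarted phase
then reads the same bits as the true run that consists of the preprocessing and that phase.

Machine. The reduction is an actual program. `NWP` is a weakest-precondition calculus for it over
natural numbers; `Exec.simulate` runs a program for short words inside long words with constant
overhead, with memory kept as a time-stamped overlay over a base, so that a restart costs constant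
time; and `decides_of_simulates` puts the correctness together. -/

namespace WordRAM

/-! ## Determinism, locality and frames -/

/-- The registers that a program may write. -/
def Prog.writes : Prog → ℕ → Bool
  | .skip, _ => false
  | .const d _, i => i == d
  | .bin _ d _ _, i => i == d
  | .load d _, i => i == d
  | .store _ _, _ => false
  | .coin d, i => i == d
  | .seq P Q, i => P.writes i || Q.writes i
  | .cond _ P Q, i => P.writes i || Q.writes i
  | .loop _ P, i => P.writes i

/-- The program never writes to the memory and never tosses a coin. -/
def Prog.pure : Prog → Bool
  | .store _ _ => false
  | .coin _ => false
  | .seq P Q => P.pure && Q.pure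
  | .cond _ P Q => P.pure && Q.pure
  | .loop _ P => P.pure
  | _ => true

/-- All registers of the program are smaller than `M`. -/
def Prog.Below (M : ℕ) : Prog → Prop
  | .skip => True
  | .const d _ => d < M
  | .bin _ d a b => d < M ∧ a < M ∧ b < M
  | .load d a => d < M ∧ a < M
  | .store a b => a < M ∧ b < M
  | .coin d => d < M
  | .seq P Q => P.Below M ∧ Q.Below M
  | .cond r P Q => r < M ∧ P.Below M ∧ Q.Below M
  | .loop r P => r < M ∧ P.Below M

theorem Prog.Below.mono {M M' : ℕ} (h : M ≤ M') {P : Prog} (hP : P.Below M) : P.Below M' := by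
  induction P <;> simp only [Prog.Below] at * <;> grind

theorem Prog.exists_below (P : Prog) : ∃ M, P.Below M := by
  induction P with
  | skip => exact ⟨0, trivial⟩
  | const d c => exact ⟨d + 1, Nat.lt_succ_self d⟩
  | bin o d a b => exact ⟨d + a + b + 1, by simp only [Prog.Below]; omega⟩
  | load d a => exact ⟨d + a + 1, by simp only [Prog.Below]; omega⟩
  | store a b => exact ⟨a + b + 1, by simp only [Prog.Below]; omega⟩
  | coin d => exact ⟨d + 1, Nat.lt_succ_self d⟩
  | seq P Q hP hQ =>
    obtain ⟨M, hM⟩ := hP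
    obtain ⟨M', hM'⟩ := hQ
    exact ⟨max M M', hM.mono (le_max_left _ _), hM'.mono (le_max_right _ _)⟩
  | cond r P Q hP hQ =>
    obtain ⟨M, hM⟩ := hP
    obtain ⟨M', hM'⟩ := hQ
    exact ⟨max (r + 1) (max M M'), by omega, hM.mono (by omega), hM'.mono (by omega)⟩
  | loop r P hP =>
    obtain ⟨M, hM⟩ := hP
    exact ⟨max (r + 1) M, by omega, hM.mono (by omega)⟩

section Exec

variable {w : ℕ} {ω : ℕ → Bool} {P : Prog} {s s' : State w} {k : ℕ}

theorem Exec.reg_eq (h : Exec ω P s k s') {i : ℕ} (hi : P.writes i = false) :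
    s'.reg i = s.reg i := by
  induction h <;> simp_all [Prog.writes, State.setReg, State.setMem]

theorem Exec.mem_eq (h : Exec ω P s k s') (hP : P.pure = true) : s'.mem = s.mem := by
  induction h <;> simp_all [Prog.pure, State.setReg]

theorem Exec.coins_le (h : Exec ω P s k s') : s.coins ≤ s'.coins ∧ s'.coins ≤ s.coins + k := by
  induction h with
  | seq _ _ ih₁ ih₂ => omega
  | cond_true _ _ ih => omega
  | cond_false _ _ ih => omega
  | loop_step _ _ _ ih₁ ih₂ => omega
  | _ => simp [State.setReg, State.setMem]

/-- A step consumes at most one bit, so a run of `k` steps sees only the bits from `s.coins` up to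
`s.coins + k`. Measurability of events about runs, and independence of different runs, come from
this. -/
theorem Exec.congr_coins (h : Exec ω P s k s') {ω' : ℕ → Bool}
    (hω : ∀ i, s.coins ≤ i → i < s.coins + k → ω' i = ω i) : Exec ω' P s k s' := by
  induction h with
  | skip s => exact .skip s
  | const s d c => exact .const s d c
  | bin s o d a b => exact .bin s o d a b
  | load s d a => exact .load s d a
  | store s a b => exact .store s a b
  | coin s d =>
    have := Exec.coin (ω := ω') s d
    rwa [hω _ le_rfl (by omega)] at this
  | seq h₁ h₂ ih₁ ih₂ =>
    have := h₁.coins_le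
    exact .seq (ih₁ fun i hi hi' => hω i hi (by omega)) (ih₂ fun i hi hi' => hω i (by omega) (by omega))
  | cond_true hr h ih => exact .cond_true hr (ih fun i hi hi' => hω i hi (by omega))
  | cond_false hr h ih => exact .cond_false hr (ih fun i hi hi' => hω i hi (by omega))
  | loop_done hr => exact .loop_done hr
  | loop_step hr h₁ h₂ ih₁ ih₂ =>
    have := h₁.coins_le
    exact .loop_step hr (ih₁ fun i hi hi' => hω i hi (by omega))
      (ih₂ fun i hi hi' => hω i (by omega) (by omega))

/-- Time bounds and correctness come as separate existence statements about runs; determinism is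
what identifies these runs with each other and with the simulated one. -/
theorem Exec.unique (h : Exec ω P s k s') {k' : ℕ} {s'' : State w} (h' : Exec ω P s k' s'') :
    k' = k ∧ s'' = s' := by
  induction h generalizing k' s'' with
  | skip s => cases h'; simp
  | const s d c => cases h'; simp
  | bin s o d a b => cases h'; simp
  | load s d a => cases h'; simp
  | store s a b => cases h'; simp
  | coin s d => cases h'; simp
  | seq h₁ h₂ ih₁ ih₂ =>
    cases h' with
    | seq g₁ g₂ =>
      obtain ⟨rfl, rfl⟩ := ih₁ g₁
      obtain ⟨rfl, rfl⟩ := ih₂ g₂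
      simp
  | cond_true hr h ih =>
    cases h' with
    | cond_true _ g => obtain ⟨rfl, rfl⟩ := ih g; simp
    | cond_false hr' g => exact absurd hr' hr
  | cond_false hr h ih =>
    cases h' with
    | cond_true hr' g => exact absurd hr hr'
    | cond_false _ g => obtain ⟨rfl, rfl⟩ := ih g; simp
  | loop_done hr =>
    cases h' with
    | loop_done _ => simp
    | loop_step hr' _ _ => exact absurd hr hr'
  | loop_step hr h₁ h₂ ih₁ ih₂ =>
    cases h' with
    | loop_done hr' => exact absurd hr' hr
    | loop_step _ g₁ g₂ =>
      obtain ⟨rfl, rfl⟩ := ih₁ g₁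
      obtain ⟨rfl, rfl⟩ := ih₂ g₂
      simp

end Exec

/-! ## Configurations with natural numbers -/

/-- A configuration whose words are natural numbers. -/
structure NS where
  reg : ℕ → ℕ
  mem : ℕ → ℕ
  coins : ℕ

/-- Overwrite one register. -/
def NS.set (σ : NS) (d x : ℕ) : NS := { σ with reg := fun i => if i = d then x else σ.reg i }

/-- Overwrite one memory cell. -/
def NS.put (σ : NS) (a x : ℕ) : NS := { σ with mem := fun b => if b = a then x else σ.mem b }

@[simp] theorem NS.set_reg (σ : NS) (d x i : ℕ) :
    (σ.set d x).reg i = if i = d then x else σ.reg i := rfl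
@[simp] theorem NS.set_mem (σ : NS) (d x : ℕ) : (σ.set d x).mem = σ.mem := rfl
@[simp] theorem NS.set_coins (σ : NS) (d x : ℕ) : (σ.set d x).coins = σ.coins := rfl
@[simp] theorem NS.put_reg (σ : NS) (d x : ℕ) : (σ.put d x).reg = σ.reg := rfl
@[simp] theorem NS.put_mem (σ : NS) (d x b : ℕ) :
    (σ.put d x).mem b = if b = d then x else σ.mem b := rfl
@[simp] theorem NS.put_coins (σ : NS) (d x : ℕ) : (σ.put d x).coins = σ.coins := rfl

/-- The natural numbers in a configuration. -/
def State.toNS {w : ℕ} (s : State w) : NS where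
  reg i := (s.reg i).toNat
  -- Addresses outside the memory get the default 0, so that `toNS` has no aliasing modulo `2 ^ w`.
  mem a := if a < 2 ^ w then (s.mem (BitVec.ofNat w a)).toNat else 0
  coins := s.coins

theorem State.toNS_setReg {w : ℕ} (s : State w) (d : ℕ) (x : BitVec w) :
    (s.setReg d x).toNS = s.toNS.set d x.toNat := by
  simp only [State.toNS, State.setReg, NS.set, NS.mk.injEq, and_true]
  funext i
  by_cases h : i = d <;> simp [h]

theorem State.toNS_setMem {w : ℕ} (s : State w) (a x : BitVec w) :
    (s.setMem a x).toNS = s.toNS.put a.toNat x.toNat := by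
  simp only [State.toNS, State.setMem, NS.put, NS.mk.injEq, true_and, and_true]
  funext b
  by_cases hb : b < 2 ^ w
  · by_cases h : b = a.toNat
    · subst h; simp [a.isLt]
    · have : BitVec.ofNat w b ≠ a := by
        rintro rfl
        exact h (by simp [Nat.mod_eq_of_lt hb])
      simp [h, hb, this]
  · have : b ≠ a.toNat := by have := a.isLt; omega
    simp [hb, this]

theorem State.toNS_mem {w : ℕ} (s : State w) (a : BitVec w) :
    (s.mem a).toNat = s.toNS.mem a.toNat := by
  simp [State.toNS, a.isLt]

/-- The operations on natural numbers. -/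
def BinOp.nat : BinOp → ℕ → ℕ → ℕ
  | .add, x, y => x + y
  | .sub, x, y => x - y
  | .mul, x, y => x * y
  | .div, x, y => x / y
  | .mod, x, y => x % y
  | .band, x, y => x &&& y
  | .bor, x, y => x ||| y
  | .bxor, x, y => x ^^^ y
  | .shl, x, y => x <<< y
  | .shr, x, y => x >>> y
  | .lt, x, y => if x < y then 1 else 0
  | .eq, x, y => if x = y then 1 else 0

/-- No overflow occurs. -/
def BinOp.ok (w : ℕ) : BinOp → ℕ → ℕ → Prop
  | .add, x, y => x + y < 2 ^ w
  | .sub, x, y => y ≤ x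
  | .mul, x, y => x * y < 2 ^ w
  | .shl, x, y => x * 2 ^ y < 2 ^ w
  | _, _, _ => True

/-- Positivity of `w` is needed for the comparisons: on words of length 0 the word `1` equals `0`.
-/
theorem BinOp.toNat_eval {w : ℕ} (hw : 0 < w) (o : BinOp) (x y : BitVec w)
    (h : o.ok w x.toNat y.toNat) : (o.eval x y).toNat = o.nat x.toNat y.toNat := by
  have h1 : (1 : BitVec w).toNat = 1 := by
    simp [BitVec.toNat_one hw]
  cases o <;> simp only [BinOp.eval, BinOp.nat, BinOp.ok] at *
  · rw [BitVec.toNat_add, Nat.mod_eq_of_lt h]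
  · rw [BitVec.toNat_sub_of_le (by simpa [BitVec.le_def] using h)]
  · rw [BitVec.toNat_mul, Nat.mod_eq_of_lt h]
  · simp
  · simp
  · simp
  · simp
  · simp
  · rw [BitVec.toNat_shiftLeft, Nat.shiftLeft_eq, Nat.mod_eq_of_lt h]
  · simp
  · by_cases hxy : x < y
    · rw [if_pos hxy, if_pos (by simpa [BitVec.lt_def] using hxy), h1]
    · rw [if_neg hxy, if_neg (by simpa [BitVec.lt_def] using hxy)]; simp
  · by_cases hxy : x = y
    · rw [if_pos hxy, if_pos (by rw [hxy]), h1]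
    · rw [if_neg hxy, if_neg (by simpa [BitVec.toNat_inj] using hxy)]; simp

/-- All words fit into `w` bits. -/
structure NS.Valid (w : ℕ) (σ : NS) : Prop where
  reg : ∀ i, σ.reg i < 2 ^ w
  mem : ∀ a, σ.mem a < 2 ^ w

theorem State.toNS_valid {w : ℕ} (s : State w) : s.toNS.Valid w where
  reg i := (s.reg i).isLt
  mem a := by
    simp only [State.toNS]
    split
    · exact BitVec.isLt _
    · positivity

/-- Weakest preconditions: from the configuration `σ`, the program `P` halts after some number of
steps `k` in a configuration `σ'` with `Φ k σ'`. -/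
def NWP (w : ℕ) (ω : ℕ → Bool) (P : Prog) (σ : NS) (Φ : ℕ → NS → Prop) : Prop :=
  ∀ s : State w, s.toNS = σ → ∃ k s', Exec ω P s k s' ∧ Φ k s'.toNS

section NWP

variable {w : ℕ} {ω : ℕ → Bool} {P Q : Prog} {σ : NS} {Φ Ψ : ℕ → NS → Prop}

theorem NWP.mono (h : NWP w ω P σ Φ) (hΦ : ∀ k σ', Φ k σ' → Ψ k σ') : NWP w ω P σ Ψ := by
  intro s hs
  obtain ⟨k, s', h₁, h₂⟩ := h s hs
  exact ⟨k, s', h₁, hΦ _ _ h₂⟩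

theorem NWP.of_valid (h : σ.Valid w → NWP w ω P σ Φ) : NWP w ω P σ Φ := by
  intro s hs
  exact h (hs ▸ s.toNS_valid) s hs

/-- What a program leaves alone can be read off its text, so it is added to any postcondition for
free; the specifications below only have to speak of what changes. -/
theorem NWP.frame (h : NWP w ω P σ Φ) :
    NWP w ω P σ fun k σ' => Φ k σ' ∧ (∀ i, P.writes i = false → σ'.reg i = σ.reg i) ∧
      (P.pure = true → σ'.mem = σ.mem) ∧ σ'.Valid w := by
  intro s hs
  obtain ⟨k, s', h₁, h₂⟩ := h s hs
  refine ⟨k, s', h₁, h₂, fun i hi => ?_, fun hp => ?_, s'.toNS_valid⟩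
  · rw [← hs]; simp [State.toNS, h₁.reg_eq hi]
  · rw [← hs]; simp [State.toNS, h₁.mem_eq hp]

theorem NWP.skip (h : Φ 1 σ) : NWP w ω .skip σ Φ := by
  rintro s rfl
  exact ⟨1, s, .skip s, h⟩

theorem NWP.seq (h : NWP w ω P σ fun k σ' => NWP w ω Q σ' fun l => Φ (k + l)) :
    NWP w ω (.seq P Q) σ Φ := by
  intro s hs
  obtain ⟨k, s', h₁, h₂⟩ := h s hs
  obtain ⟨l, s'', h₃, h₄⟩ := h₂ s' rfl
  exact ⟨k + l, s'', .seq h₁ h₃, h₄⟩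

theorem NWP.cond {r : ℕ} (h₁ : σ.reg r ≠ 0 → NWP w ω P σ fun k => Φ (k + 1))
    (h₂ : σ.reg r = 0 → NWP w ω Q σ fun k => Φ (k + 1)) : NWP w ω (.cond r P Q) σ Φ := by
  intro s hs
  by_cases hr : s.reg r = 0
  · obtain ⟨k, s', h, h'⟩ := h₂ (by rw [← hs]; simp [State.toNS, hr]) s hs
    exact ⟨_, s', .cond_false hr h, h'⟩
  · obtain ⟨k, s', h, h'⟩ := h₁ (by
      rw [← hs]
      exact fun h => hr (BitVec.eq_of_toNat_eq (by simpa [State.toNS] using h))) s hs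
    exact ⟨_, s', .cond_true hr h, h'⟩

theorem NWP.coin {d : ℕ} (hw : 0 < w)
    (h : Φ 1 { σ.set d (if ω σ.coins = true then 1 else 0) with coins := σ.coins + 1 }) :
    NWP w ω (.coin d) σ Φ := by
  rintro s rfl
  refine ⟨1, _, .coin s d, ?_⟩
  convert h using 1
  have := s.toNS_setReg d (if ω s.coins = true then 1 else 0)
  simp only [State.toNS, NS.set, NS.mk.injEq] at this ⊢
  refine ⟨?_, this.2.1, trivial⟩
  rw [this.1]
  funext i
  by_cases hω : ω s.coins = true <;> simp [hω, BitVec.toNat_one hw]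

theorem NWP.loop_done {r : ℕ} (hr : σ.reg r = 0) (h : Φ 1 σ) : NWP w ω (.loop r P) σ Φ := by
  rintro s rfl
  exact ⟨1, s, .loop_done (BitVec.eq_of_toNat_eq (by simpa [State.toNS] using hr)), h⟩

theorem NWP.loop_step {r : ℕ} (hr : σ.reg r ≠ 0)
    (h : NWP w ω P σ fun k σ' => NWP w ω (.loop r P) σ' fun l => Φ (k + l + 1)) :
    NWP w ω (.loop r P) σ Φ := by
  intro s hs
  obtain ⟨k, s', h₁, h₂⟩ := h s hs
  obtain ⟨l, s'', h₃, h₄⟩ := h₂ s' rfl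
  refine ⟨_, s'', .loop_step (fun h0 => hr ?_) h₁ h₃, h₄⟩
  rw [← hs]; simp [State.toNS, h0]

end NWP

/-! ## Straight-line programs -/

/-- The elementary deterministic instructions. -/
inductive Instr where
  | const (d c : ℕ)
  | bin (o : BinOp) (d a b : ℕ)
  | load (d a : ℕ)
  | store (a b : ℕ)

def Instr.prog : Instr → Prog
  | .const d c => .const d c
  | .bin o d a b => .bin o d a b
  | .load d a => .load d a
  | .store a b => .store a b

def Instr.next (σ : NS) : Instr → NS
  | .const d c => σ.set d c
  | .bin o d a b => σ.set d (o.nat (σ.reg a) (σ.reg b))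
  | .load d a => σ.set d (σ.mem (σ.reg a))
  | .store a b => σ.put (σ.reg a) (σ.reg b)

def Instr.ok (w : ℕ) (σ : NS) : Instr → Prop
  | .const _ c => c < 2 ^ w
  | .bin o _ a b => o.ok w (σ.reg a) (σ.reg b)
  | _ => True

/-- A sequence of instructions as a program. -/
def block : List Instr → Prog
  | [] => .skip
  | i :: l => .seq i.prog (block l)

/-- The result of a sequence of instructions. -/
def after (σ : NS) : List Instr → NS
  | [] => σ
  | i :: l => after (i.next σ) l

/-- No instruction of the sequence overflows. -/
def Fits (w : ℕ) (σ : NS) : List Instr → Prop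
  | [] => True
  | i :: l => i.ok w σ ∧ Fits w (i.next σ) l

theorem NWP.instr {w : ℕ} {ω : ℕ → Bool} (hw : 0 < w) {i : Instr} {σ : NS} {Φ : ℕ → NS → Prop}
    (hi : i.ok w σ) (h : Φ 1 (i.next σ)) : NWP w ω i.prog σ Φ := by
  rintro s rfl
  cases i with
  | const d c =>
    refine ⟨1, _, .const s d c, ?_⟩
    rw [State.toNS_setReg, BitVec.toNat_ofNat, Nat.mod_eq_of_lt hi]
    exact h
  | bin o d a b =>
    refine ⟨1, _, .bin s o d a b, ?_⟩
    rw [State.toNS_setReg, BinOp.toNat_eval hw o _ _ hi]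
    exact h
  | load d a =>
    refine ⟨1, _, .load s d a, ?_⟩
    rw [State.toNS_setReg, State.toNS_mem]
    exact h
  | store a b =>
    refine ⟨1, _, .store s a b, ?_⟩
    rw [State.toNS_setMem]
    exact h

/-- The extra step is the `skip` that closes every block. -/
theorem NWP.blk {w : ℕ} {ω : ℕ → Bool} (hw : 0 < w) {l : List Instr} {σ : NS}
    {Φ : ℕ → NS → Prop} (hl : Fits w σ l) (h : Φ (l.length + 1) (after σ l)) :
    NWP w ω (block l) σ Φ := by
  induction l generalizing σ Φ with
  | nil => exact .skip h
  | cons i l ih =>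
    refine .seq (.instr hw hl.1 (ih hl.2 ?_))
    rwa [List.length_cons, add_right_comm, add_comm] at h

/-! ## Counting loops -/

/-- The register that holds the tests of all counting loops. -/
abbrev rTest : ℕ := 60

/-- `for reg c = 0, 1, …` below `reg lim`, do `body`. -/
def forP (c lim : ℕ) (body : Prog) : Prog :=
  .seq (block [.const c 0, .bin .lt rTest c lim])
    (.loop rTest (.seq body
      (block [.const rTest 1, .bin .add c c rTest, .bin .lt rTest c lim])))

/-- The time is an argument of the invariant. Initialisation takes 3 steps, a round 5 steps besides
the body (a block of three instructions with its `skip`, and the test), and leaving the loop 1. The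
invariant has to tolerate any value `v` in the test register. -/
theorem NWP.count {w : ℕ} {ω : ℕ → Bool} (hw : 0 < w) {c lim : ℕ} {body : Prog} {σ : NS}
    {Φ : ℕ → NS → Prop} (n : ℕ) (Inv : ℕ → ℕ → NS → Prop) (hn : σ.reg lim = n)
    (hc : body.writes c = false) (hlim : body.writes lim = false) (hcl : c ≠ lim)
    (hct : c ≠ rTest) (hlt : lim ≠ rTest)
    (h₀ : ∀ v, Inv 0 3 ((σ.set c 0).set rTest v))
    (hstep : ∀ i < n, ∀ t σ', Inv i t σ' → σ'.reg c = i → σ'.reg lim = n → σ'.Valid w →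
      NWP w ω body σ' fun k σ'' => ∀ v, Inv (i + 1) (t + k + 5) ((σ''.set c (i + 1)).set rTest v))
    (hend : ∀ t σ', Inv n t σ' → σ'.Valid w → Φ (t + 1) σ') :
    NWP w ω (forP c lim body) σ Φ := by
  have h1 : 1 < 2 ^ w := Nat.one_lt_two_pow hw.ne'
  -- Induction on the number `j` of rounds that remain, with the time `t` spent so far carried
  -- along.
  have main : ∀ j i, i + j = n → ∀ t σ', Inv i t σ' → σ'.reg c = i → σ'.reg lim = n →
      σ'.reg rTest = (if i < n then 1 else 0) →
      NWP w ω (.loop rTest (.seq body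
        (block [.const rTest 1, .bin .add c c rTest, .bin .lt rTest c lim]))) σ'
        fun k => Φ (t + k) := by
    intro j
    induction j with
    | zero =>
      intro i hi t σ' hI hci hli hti
      obtain rfl : i = n := hi
      exact .of_valid fun hv => .loop_done (by simp [hti]) (hend t σ' hI hv)
    | succ j ih =>
      intro i hi t σ' hI hci hli hti
      have hin : i < n := by omega
      refine .of_valid fun hv => ?_
      refine .loop_step (by simp [hti, hin]) (.seq ?_)
      refine (hstep i hin t σ' hI hci hli hv).frame.mono ?_
      rintro k σ'' ⟨hk, hfr, -, hv''⟩
      have hnw : n < 2 ^ w := hli ▸ hv.reg lim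
      refine .blk hw ?_ ?_
      · simp [Fits, Instr.ok, Instr.next, BinOp.ok, h1, hct, hfr c hc, hci]
        omega
      · have e : after σ'' [.const rTest 1, .bin .add c c rTest, .bin .lt rTest c lim] =
            (σ''.set c (i + 1)).set rTest (if i + 1 < n then 1 else 0) := by
          simp only [after, Instr.next, BinOp.nat]
          simp only [NS.set_reg, if_true, if_neg hct, if_neg hcl.symm, if_neg hlt, hfr c hc, hci,
            hfr lim hlim, hli]
          simp only [NS.set, NS.mk.injEq, and_true]
          funext x
          by_cases hx : x = rTest
          · simp [hx]
          · simp [hx]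
        rw [e]
        refine (ih (i + 1) (by omega) (t + k + 5) _ (hk _) (by simp [hct]) ?_ (by simp)).mono ?_
        · simp [hlt, hcl.symm, hfr lim hlim, hli]
        · intro l σ₃ hl
          convert hl using 1
          simp only [List.length_cons, List.length_nil]
          omega
  refine .seq (.blk hw ?_ ?_)
  · simp [Fits, Instr.ok, BinOp.ok]
  · simp only [List.length_cons, List.length_nil, after, Instr.next, BinOp.nat]
    refine main n 0 (by omega) 3 _ (h₀ _) (by simp [hct]) (by simp [hlt, hcl.symm, hn]) ?_
    simp [hcl.symm, hn]

end WordRAM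

namespace WordRAM

/-! ## Simulation of short words inside long words -/

abbrev rMask : ℕ := 10
abbrev rBase : ℕ := 31
abbrev rFront : ℕ := 32
abbrev rStamp : ℕ := 33
abbrev rCur : ℕ := 34
abbrev rPos : ℕ := 35
abbrev rTmp : ℕ := 61

/-- The register that holds register `i` of the simulated program. -/
abbrev simReg (i : ℕ) : ℕ := 100 + 2 * i

/-- The instructions that simulate a memory access: they leave the address of the current copy of
cell `reg a` in the register `rTmp`. -/
def locate (a : ℕ) : Prog :=
  .seq (block [.bin .add rTmp rStamp (simReg a), .load rTmp rTmp, .bin .eq rTmp rTmp rCur])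
    (.cond rTmp (block [.bin .add rTmp rFront (simReg a)]) (block [.bin .add rTmp rBase (simReg a)]))

/-- The simulating program: words are masked, the memory is an overlay (the cells that carry the
current stamp) on top of a base, and random bits are read from a tape. -/
def tr : Prog → Prog
  | .skip => .skip
  | .const d c => .seq (.const (simReg d) c) (block [.bin .band (simReg d) (simReg d) rMask])
  | .bin o d a b =>
    .seq (.bin o (simReg d) (simReg a) (simReg b)) (block [.bin .band (simReg d) (simReg d) rMask])
  | .load d a => .seq (locate a) (block [.load (simReg d) rTmp])
  | .store a b => block [.bin .add rTmp rStamp (simReg a), .store rTmp rCur,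
      .bin .add rTmp rFront (simReg a), .store rTmp (simReg b)]
  | .coin d => block [.load (simReg d) rPos, .bin .band (simReg d) (simReg d) rMask,
      .const rTmp 1, .bin .add rPos rPos rTmp]
  | .seq P Q => .seq (tr P) (tr Q)
  | .cond r P Q => .cond (simReg r) (tr P) (tr Q)
  | .loop r P => .loop (simReg r) (tr P)

theorem tr_writes {P : Prog} {i : ℕ} (hi : i < 100) (h : i ≠ rTmp) (h' : i ≠ rPos) :
    (tr P).writes i = false := by
  have hin : ∀ d, i ≠ simReg d := by intro d; simp only [simReg]; omega
  induction P <;> simp_all [tr, Prog.writes, locate, block, Instr.prog]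

/-- Simulated registers have even numbers from 100 on; the odd ones are therefore free to hold a
saved copy across simulated code. -/
theorem tr_writes_odd {P : Prog} (i : ℕ) : (tr P).writes (101 + 2 * i) = false := by
  have hin : ∀ d, 101 + 2 * i ≠ simReg d := by intro d; simp only [simReg]; omega
  have h : 101 + 2 * i ≠ rTmp := by simp only [rTmp]; omega
  have h' : 101 + 2 * i ≠ rPos := by simp only [rPos]; omega
  induction P <;> simp_all [tr, Prog.writes, locate, block, Instr.prog]

/-- Where a simulation lives: the starts of the base, the overlay, the stamps and the tape, and the
current stamp. -/
structure Region where
  base : ℕ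
  front : ℕ
  stamp : ℕ
  cur : ℕ
  tape : ℕ

/-- The parts of a region do not overlap, and end below `2 ^ W`. -/
structure Region.Ok (L : Region) (W w B : ℕ) : Prop where
  word : w ≤ W
  pos : 0 < W
  tape : L.tape + B ≤ L.base
  -- Equality means that simulated writes go through to the base, so nothing can be rolled back.
  -- Disjointness protects the base.
  front : L.front = L.base ∨ L.base + 2 ^ w ≤ L.front
  stamp : L.front + 2 ^ w ≤ L.stamp
  base : L.base + 2 ^ w ≤ L.stamp
  lt : L.stamp + 2 ^ w ≤ 2 ^ W

/-- `σ` represents the configuration `s` of the simulated program. -/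
structure Sim {w : ℕ} (L : Region) (M : ℕ) (s : State w) (σ : NS) : Prop where
  mask : σ.reg rMask = 2 ^ w - 1
  base : σ.reg rBase = L.base
  front : σ.reg rFront = L.front
  stamp : σ.reg rStamp = L.stamp
  cur : σ.reg rCur = L.cur
  pos : σ.reg rPos = L.tape + s.coins
  reg : ∀ i < M, σ.reg (simReg i) = (s.reg i).toNat
  mem : ∀ a : BitVec w, (if σ.mem (L.stamp + a.toNat) = L.cur then σ.mem (L.front + a.toNat)
    else σ.mem (L.base + a.toNat)) = (s.mem a).toNat
  -- This makes a restart cheap: after `cur` is raised by one, no cell carries the current stamp,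
  -- and the overlay is empty.
  le : ∀ a : BitVec w, σ.mem (L.stamp + a.toNat) ≤ L.cur

/-- The first `B` random bits are on the tape. -/
def Tape (L : Region) (ω : ℕ → Bool) (B : ℕ) (σ : NS) : Prop :=
  ∀ c < B, σ.mem (L.tape + c) = if ω c = true then 1 else 0

/-- A simulation changes the memory only in the overlay and in the stamps. -/
def Region.Local (L : Region) (w : ℕ) (σ σ' : NS) : Prop :=
  ∀ a, (a < L.front ∨ L.front + 2 ^ w ≤ a) → (a < L.stamp ∨ L.stamp + 2 ^ w ≤ a) →
    σ'.mem a = σ.mem a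

theorem Region.Local.refl (L : Region) (w : ℕ) (σ : NS) : L.Local w σ σ := fun _ _ _ => rfl

theorem Region.Local.trans {L : Region} {w : ℕ} {σ σ' σ'' : NS} (h : L.Local w σ σ')
    (h' : L.Local w σ' σ'') : L.Local w σ σ'' :=
  fun a h₁ h₂ => (h' a h₁ h₂).trans (h a h₁ h₂)

theorem Tape.of_local {L : Region} {W w B : ℕ} (hL : L.Ok W w B) {ω : ℕ → Bool} {σ σ' : NS}
    (h : Tape L ω B σ) (hl : L.Local w σ σ') : Tape L ω B σ' := by
  intro c hc
  have := hL.tape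
  have := hL.front
  have := hL.stamp
  have := hL.base
  rw [hl _ (by omega) (by omega)]
  exact h c hc

theorem Sim.setReg {w : ℕ} {L : Region} {M : ℕ} {s : State w} {σ : NS} (h : Sim L M s σ)
    (d : ℕ) (x : BitVec w) : Sim L M (s.setReg d x) (σ.set (simReg d) x.toNat) where
  mask := by
    have : rMask ≠ simReg d := by simp only [simReg, rMask]; omega
    simpa [this] using h.mask
  base := by
    have : rBase ≠ simReg d := by simp only [simReg, rBase]; omega
    simpa [this] using h.base
  front := by
    have : rFront ≠ simReg d := by simp only [simReg, rFront]; omega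
    simpa [this] using h.front
  stamp := by
    have : rStamp ≠ simReg d := by simp only [simReg, rStamp]; omega
    simpa [this] using h.stamp
  cur := by
    have : rCur ≠ simReg d := by simp only [simReg, rCur]; omega
    simpa [this] using h.cur
  pos := by
    have : rPos ≠ simReg d := by simp only [simReg, rPos]; omega
    simpa [this, State.setReg] using h.pos
  reg i hi := by
    by_cases hid : i = d
    · simp [State.setReg, hid]
    · simpa [State.setReg, hid, simReg] using h.reg i hi
  mem := h.mem
  le := h.le

theorem Sim.setTmp {w : ℕ} {L : Region} {M : ℕ} {s : State w} {σ : NS} (h : Sim L M s σ)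
    (x : ℕ) : Sim L M s (σ.set rTmp x) where
  mask := h.mask
  base := h.base
  front := h.front
  stamp := h.stamp
  cur := h.cur
  pos := h.pos
  reg i hi := by
    have : simReg i ≠ rTmp := by simp only [simReg, rTmp]; omega
    simpa [this] using h.reg i hi
  mem := h.mem
  le := h.le

/-- The value of an operation on words of length `w`. -/
def BinOp.wrap (w : ℕ) (o : BinOp) (x y : ℕ) : ℕ :=
  (o.eval (BitVec.ofNat w x) (BitVec.ofNat w y)).toNat

/-- Sum, difference, product and left shift are computed modulo `2 ^ W`, and `2 ^ w` divides `2 ^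
W`, so reducing afterwards gives the short result. The other operations on numbers below `2 ^ w`
stay below `2 ^ w`, apart from the comparisons when `w = 0`. Hence masking after each operation
simulates short words. -/
theorem BinOp.wrap_mod {W w : ℕ} (hW : 0 < W) (hw : w ≤ W) (o : BinOp) (x y : BitVec w) :
    o.wrap W x.toNat y.toNat % 2 ^ w = (o.eval x y).toNat := by
  have hd : 2 ^ w ∣ 2 ^ W := pow_dvd_pow 2 hw
  have hle : 2 ^ w ≤ 2 ^ W := Nat.pow_le_pow_right (by norm_num) hw
  have hx := x.isLt
  have hy := y.isLt
  have ex : x.toNat % 2 ^ W = x.toNat := Nat.mod_eq_of_lt (by omega)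
  have ey : y.toNat % 2 ^ W = y.toNat := Nat.mod_eq_of_lt (by omega)
  have h1 : ∀ v, 0 < v → (1 : BitVec v).toNat = 1 := fun v hv => by simp [BitVec.toNat_one hv]
  cases o <;> simp only [BinOp.wrap, BinOp.eval]
  · simp only [BitVec.toNat_add, BitVec.toNat_ofNat, ex, ey, Nat.mod_mod_of_dvd _ hd]
  · simp only [BitVec.toNat_sub, BitVec.toNat_ofNat, ex, ey, Nat.mod_mod_of_dvd _ hd]
    obtain ⟨q, hq⟩ := hd
    have hq0 : 0 < q := by
      rcases Nat.eq_zero_or_pos q with h | h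
      · rw [h] at hq; simp at hq
      · exact h
    -- The two representatives of the difference differ by a multiple of `2 ^ w`.
    have : 2 ^ W - y.toNat + x.toNat = 2 ^ w - y.toNat + x.toNat + 2 ^ w * (q - 1) := by
      have : 2 ^ W = 2 ^ w + 2 ^ w * (q - 1) := by
        rw [hq]; obtain ⟨t, rfl⟩ := Nat.exists_eq_succ_of_ne_zero hq0.ne'; simp; ring
      omega
    rw [this, Nat.add_mul_mod_self_left]
  · simp only [BitVec.toNat_mul, BitVec.toNat_ofNat, ex, ey, Nat.mod_mod_of_dvd _ hd]
  · simp only [BitVec.toNat_udiv, BitVec.toNat_ofNat, ex, ey]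
    exact Nat.mod_eq_of_lt (lt_of_le_of_lt (Nat.div_le_self _ _) hx)
  · simp only [BitVec.toNat_umod, BitVec.toNat_ofNat, ex, ey]
    exact Nat.mod_eq_of_lt (lt_of_le_of_lt (Nat.mod_le _ _) hx)
  · simp only [BitVec.toNat_and, BitVec.toNat_ofNat, ex, ey]
    exact Nat.mod_eq_of_lt (lt_of_le_of_lt Nat.and_le_left hx)
  · simp only [BitVec.toNat_or, BitVec.toNat_ofNat, ex, ey]
    exact Nat.mod_eq_of_lt (Nat.or_lt_two_pow hx hy)
  · simp only [BitVec.toNat_xor, BitVec.toNat_ofNat, ex, ey]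
    exact Nat.mod_eq_of_lt (Nat.xor_lt_two_pow hx hy)
  · simp only [BitVec.toNat_shiftLeft, BitVec.toNat_ofNat, ex, ey, Nat.mod_mod_of_dvd _ hd]
  · simp only [BitVec.toNat_ushiftRight, BitVec.toNat_ofNat, ex, ey]
    refine Nat.mod_eq_of_lt (lt_of_le_of_lt ?_ hx)
    rw [Nat.shiftRight_eq_div_pow]; exact Nat.div_le_self _ _
  · simp only [BitVec.lt_def, BitVec.toNat_ofNat, ex, ey]
    -- Length 0 is a genuine case, as the word constant of a dynamic algorithm may be 0; then every
    -- number reduces to 0.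
    rcases Nat.eq_zero_or_pos w with rfl | hw0
    · exact (Nat.mod_one _).trans (Nat.lt_one_iff.1 (BitVec.isLt _)).symm
    · split_ifs
      · rw [h1 W hW, h1 w hw0]; exact Nat.mod_eq_of_lt (Nat.one_lt_two_pow hw0.ne')
      · simp
  · rcases Nat.eq_zero_or_pos w with rfl | hw0
    · exact (Nat.mod_one _).trans (Nat.lt_one_iff.1 (BitVec.isLt _)).symm
    · by_cases hxy : x = y
      · rw [if_pos (by rw [hxy]), if_pos hxy, h1 W hW, h1 w hw0]
        exact Nat.mod_eq_of_lt (Nat.one_lt_two_pow hw0.ne')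
      · rw [if_neg, if_neg hxy]
        · simp
        · intro h
          have := congrArg BitVec.toNat h
          simp only [BitVec.toNat_ofNat, ex, ey] at this
          exact hxy (BitVec.eq_of_toNat_eq this)

/-- In contrast to `NWP.instr` overflow is allowed here, because the simulated program may overflow
at will. -/
theorem NWP.bin_wrap {W : ℕ} {ω : ℕ → Bool} {o : BinOp} {d a b : ℕ} {σ : NS}
    {Φ : ℕ → NS → Prop} (h : Φ 1 (σ.set d (o.wrap W (σ.reg a) (σ.reg b)))) :
    NWP W ω (.bin o d a b) σ Φ := by
  rintro s rfl
  refine ⟨1, _, .bin s o d a b, ?_⟩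
  rw [State.toNS_setReg]
  simpa [State.toNS, BinOp.wrap] using h

theorem NWP.const_mod {W : ℕ} {ω : ℕ → Bool} {d c : ℕ} {σ : NS}
    {Φ : ℕ → NS → Prop} (h : Φ 1 (σ.set d (c % 2 ^ W))) :
    NWP W ω (.const d c) σ Φ := by
  rintro s rfl
  refine ⟨1, _, .const s d c, ?_⟩
  rw [State.toNS_setReg]
  simpa using h

/-- The programs of a region preserve everything that a simulation relies on. -/
theorem Sim.store {W w B : ℕ} {L : Region} (hL : L.Ok W w B) {M : ℕ} {s : State w} {σ : NS}
    (h : Sim L M s σ) (a x : BitVec w) :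
    Sim L M (s.setMem a x) ((σ.put (L.stamp + a.toNat) L.cur).put (L.front + a.toNat) x.toNat) where
  mask := h.mask
  base := h.base
  front := h.front
  stamp := h.stamp
  cur := h.cur
  pos := h.pos
  reg := h.reg
  mem b := by
    have h1 := hL.front
    have h2 := hL.stamp
    have h3 := hL.base
    have ha := a.isLt
    have hb := b.isLt
    by_cases hba : b = a
    · subst hba
      have : L.stamp ≠ L.front := by omega
      simp [State.setMem, this]
    · have hne : b.toNat ≠ a.toNat := fun h => hba (BitVec.eq_of_toNat_eq h)
      have e1 : L.stamp + b.toNat ≠ L.front + a.toNat := by omega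
      have e2 : L.stamp + b.toNat ≠ L.stamp + a.toNat := by omega
      have e3 : L.front + b.toNat ≠ L.front + a.toNat := by omega
      have e4 : L.front + b.toNat ≠ L.stamp + a.toNat := by omega
      have e5 : L.base + b.toNat ≠ L.front + a.toNat := by omega
      have e6 : L.base + b.toNat ≠ L.stamp + a.toNat := by omega
      simp only [NS.put_mem, e1, e2, e3, e4, e5, e6, if_false, State.setMem,
        Function.update_of_ne hba]
      exact h.mem b
  le b := by
    have h2 := hL.stamp
    have ha := a.isLt
    have hb := b.isLt
    have e1 : L.stamp + b.toNat ≠ L.front + a.toNat := by omega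
    simp only [NS.put_mem, e1, if_false]
    split_ifs
    · exact le_rfl
    · exact h.le b

theorem and_mask (x w : ℕ) : x &&& (2 ^ w - 1) = x % 2 ^ w := Nat.and_two_pow_sub_one_eq_mod x w

theorem Sim.mask_block {W w : ℕ} (hW : 0 < W) {ω' : ℕ → Bool} {L : Region} {M : ℕ}
    {s : State w} {σ : NS} (h : Sim L M s σ) (d v : ℕ) (x : BitVec w) (hx : v % 2 ^ w = x.toNat)
    {Φ : ℕ → NS → Prop} (hΦ : Φ 2 (σ.set (simReg d) x.toNat)) :
    NWP W ω' (block [.bin .band (simReg d) (simReg d) rMask]) (σ.set (simReg d) v) Φ := by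
  refine .blk hW (by simp [Fits, Instr.ok, BinOp.ok]) ?_
  have hne : rMask ≠ simReg d := by simp only [simReg, rMask]; omega
  have : after (σ.set (simReg d) v) [.bin .band (simReg d) (simReg d) rMask] =
      σ.set (simReg d) x.toNat := by
    simp only [after, Instr.next, BinOp.nat, NS.set_reg, if_true, if_neg hne, h.mask, and_mask, hx]
    simp only [NS.set, NS.mk.injEq, and_true]
    funext i
    by_cases hi : i = simReg d <;> simp [hi]
  rw [this]
  exact hΦ

theorem NS.set_set (σ : NS) (d x y : ℕ) : (σ.set d x).set d y = σ.set d y := by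
  simp only [NS.set, NS.mk.injEq, and_true]
  funext i
  by_cases hi : i = d <;> simp [hi]

/-- The 7 steps are 4 for reading and testing the stamp, 1 for the branch and 2 for computing the
address in the overlay or in the base. -/
theorem Sim.locate {W w B : ℕ} {L : Region} (hL : L.Ok W w B) {ω' : ℕ → Bool} {M : ℕ}
    {s : State w} {σ : NS} (h : Sim L M s σ) {a : ℕ} (ha : a < M) {Φ : ℕ → NS → Prop}
    (hΦ : ∀ v, σ.mem v = (s.mem (s.reg a)).toNat → Φ 7 (σ.set rTmp v)) :
    NWP W ω' (locate a) σ Φ := by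
  have hlt := hL.lt
  have ho := hL.front
  have hst := hL.stamp
  have hb := hL.base
  have hlt' := (s.reg a).isLt
  have hin : simReg a ≠ rTmp := by simp only [simReg, rTmp]; omega
  refine .seq (.blk hL.pos ?_ ?_)
  · simp [Fits, Instr.ok, BinOp.ok, h.stamp, h.reg a ha]; omega
  · simp only [after, Instr.next, BinOp.nat, NS.set_reg, if_true, NS.set_mem, NS.set_set,
      h.stamp, h.reg a ha]
    have hc : (if rCur = rTmp then σ.mem (L.stamp + (s.reg a).toNat) else σ.reg rCur) = L.cur :=
      h.cur
    rw [hc]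
    have hm := h.mem (s.reg a)
    refine .cond (fun hr => ?_) (fun hr => ?_)
    · refine .blk hL.pos ?_ ?_
      · have : (if rFront = rTmp then 1 else σ.reg rFront) = L.front := h.front
        simp [Fits, Instr.ok, BinOp.ok, hin, h.front, h.reg a ha]; omega
      · simp only [after, Instr.next, BinOp.nat, NS.set_reg, NS.set_set, if_neg hin, h.reg a ha]
        have e : ∀ x, (if rFront = rTmp then x else σ.reg rFront) = L.front := fun _ => h.front
        rw [e]
        refine hΦ _ ?_
        rw [← hm, if_pos]
        by_contra hne
        simp [hne] at hr
    · refine .blk hL.pos ?_ ?_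
      · simp [Fits, Instr.ok, BinOp.ok, hin, h.base, h.reg a ha]; omega
      · simp only [after, Instr.next, BinOp.nat, NS.set_reg, NS.set_set, if_neg hin, h.reg a ha]
        have e : ∀ x, (if rBase = rTmp then x else σ.reg rBase) = L.base := fun _ => h.base
        rw [e]
        refine hΦ _ ?_
        rw [← hm, if_neg]
        intro he
        simp [he] at hr

/-- Each elementary instruction becomes a fixed program of at most 9 steps; the worst case is a
load, with 7 steps for locating the cell and 2 for reading it. The random bits `ω` of the simulated
run come from the tape, so the bits `ω'` of the simulating machine are irrelevant; the bound `B`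
keeps all reads on the tape. -/
theorem Exec.simulate {W w B : ℕ} {L : Region} (hL : L.Ok W w B) {ω ω' : ℕ → Bool} {M : ℕ}
    {P : Prog} {s s' : State w} {k : ℕ} (h : Exec ω P s k s') (hP : P.Below M)
    (hB : s.coins + k ≤ B) {σ : NS} (hs : Sim L M s σ) (ht : Tape L ω B σ) :
    NWP W ω' (tr P) σ fun k' σ' => k' ≤ 9 * k ∧ Sim L M s' σ' ∧ L.Local w σ σ' := by
  have hW := hL.pos
  have hlt := hL.lt
  have hle : 2 ^ w ≤ 2 ^ W := Nat.pow_le_pow_right (by norm_num) hL.word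
  induction h generalizing σ with
  | skip s => exact .skip ⟨by omega, hs, .refl _ _ _⟩
  | const s d c =>
    refine .seq (.const_mod (hs.mask_block hW d _ (BitVec.ofNat w c) ?_ ⟨by omega, hs.setReg d _,
      fun _ _ _ => rfl⟩))
    rw [Nat.mod_mod_of_dvd _ (pow_dvd_pow 2 hL.word)]; simp
  | bin s o d a b =>
    refine .seq (.bin_wrap (hs.mask_block hW d _ (o.eval (s.reg a) (s.reg b)) ?_
      ⟨by omega, hs.setReg d _, fun _ _ _ => rfl⟩))
    rw [hs.reg a hP.2.1, hs.reg b hP.2.2]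
    exact o.wrap_mod hW hL.word _ _
  | load s d a =>
    refine .seq (hs.locate hL hP.2 fun v hv => .blk hW (by simp [Fits, Instr.ok]) ?_)
    simp only [after, Instr.next, NS.set_mem, NS.set_reg, if_true, hv, List.length_cons,
      List.length_nil]
    exact ⟨by omega, (hs.setTmp v).setReg d _, fun _ _ _ => rfl⟩
  | store s a b =>
    have ha := (s.reg a).isLt
    have hia : simReg a ≠ rTmp := by simp only [simReg, rTmp]; omega
    have hib : simReg b ≠ rTmp := by simp only [simReg, rTmp]; omega
    have hst := hL.stamp
    refine .blk hW ?_ ?_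
    · simp [Fits, Instr.ok, Instr.next, BinOp.ok, hia, hs.stamp, hs.front, hs.reg a hP.1]
      omega
    · refine ⟨by simp, ?_⟩
      have : after σ [.bin .add rTmp rStamp (simReg a), .store rTmp rCur,
          .bin .add rTmp rFront (simReg a), .store rTmp (simReg b)] =
          ((σ.set rTmp (L.front + (s.reg a).toNat)).put (L.stamp + (s.reg a).toNat) L.cur).put
            (L.front + (s.reg a).toNat) (s.reg b).toNat := by
        have hb' := hs.reg b hP.2
        have ha' := hs.reg a hP.1
        have e1 := hs.stamp
        have e2 := hs.front
        have e3 := hs.cur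
        simp only [rStamp, rFront, rCur] at e1 e2 e3
        simp [after, Instr.next, BinOp.nat, hia, hib, ha', hb', e1, e2, e3]
        simp only [NS.set, NS.put, NS.mk.injEq, and_true]
        funext i
        by_cases hi : i = rTmp <;> simp [hi]
      rw [this]
      refine ⟨(hs.setTmp _).store hL _ _, ?_⟩
      intro x hx hx'
      have e1 : x ≠ L.front + (s.reg a).toNat := by omega
      have e2 : x ≠ L.stamp + (s.reg a).toNat := by omega
      simp [e1, e2]
  -- The next bit is in cell `L.tape + s.coins`. Masking it matters only for `w = 0`, where the word
  -- `1` is `0`.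
  | coin s d =>
    have hcB : s.coins < B := by omega
    have htp := hL.tape
    have hbs := hL.base
    have hp := hs.pos
    have hm := hs.mask
    have htape := ht s.coins hcB
    have h1 : 1 < 2 ^ W := Nat.one_lt_two_pow hW.ne'
    simp only [rPos, rMask] at hp hm
    have hid : simReg d ≠ rTmp := by simp only [simReg, rTmp]; omega
    have hid' : simReg d ≠ rPos := by simp only [simReg, rPos]; omega
    have hid2 : 35 ≠ simReg d := by simp only [simReg]; omega
    have hid3 : 10 ≠ simReg d := by simp only [simReg]; omega
    have hpw : 0 < 2 ^ w := by positivity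
    refine .blk hW ?_ ⟨by simp, ?_⟩
    · simp [Fits, Instr.ok, Instr.next, BinOp.ok, hid2, hp, h1]
      omega
    · set x : BitVec w := if ω s.coins = true then 1 else 0
      have hx : (if ω s.coins = true then 1 else 0) % 2 ^ w = x.toNat := by
        simp only [x]
        split_ifs <;> simp
      have : after σ [.load (simReg d) rPos, .bin .band (simReg d) (simReg d) rMask,
          .const rTmp 1, .bin .add rPos rPos rTmp] =
          ((σ.set rTmp 1).set (simReg d) x.toNat).set rPos (L.tape + (s.coins + 1)) := by
        simp only [after, Instr.next, BinOp.nat, NS.set_reg]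
        simp [hid3, hm, hid2, hp, htape, hx]
        simp only [NS.set, NS.mk.injEq, and_true]
        funext i
        by_cases h35 : i = 35
        · simp [h35]; omega
        · by_cases h61 : i = 61
          · have : 61 ≠ simReg d := by simp only [simReg]; omega
            simp [h61, this]
          · by_cases hd : i = simReg d <;> simp [h35, h61, hd, hid, hid']
      rw [this]
      refine ⟨?_, fun _ _ _ => rfl⟩
      have hs' := (hs.setTmp 1).setReg d x
      exact
        { mask := hs'.mask
          base := hs'.base
          front := hs'.front
          stamp := hs'.stamp
          cur := hs'.cur
          pos := by simp
          reg := fun i hi => by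
            have : simReg i ≠ rPos := by simp only [simReg, rPos]; omega
            simpa [this] using hs'.reg i hi
          mem := hs'.mem
          le := hs'.le }
  | seq h₁ h₂ ih₁ ih₂ =>
    have := h₁.coins_le
    refine .seq ((ih₁ hP.1 (by omega) hs ht).mono ?_)
    rintro k₁ σ₁ ⟨hk₁, hs₁, hl₁⟩
    refine (ih₂ hP.2 (by omega) hs₁ (ht.of_local hL hl₁)).mono ?_
    rintro k₂ σ₂ ⟨hk₂, hs₂, hl₂⟩
    exact ⟨by omega, hs₂, hl₁.trans hl₂⟩
  | cond_true hr h ih =>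
    refine .cond (fun _ => (ih hP.2.1 (by omega) hs ht).mono ?_) (fun h0 => absurd ?_ hr)
    · rintro k₁ σ₁ ⟨hk₁, hs₁, hl₁⟩
      exact ⟨by omega, hs₁, hl₁⟩
    · rw [hs.reg _ hP.1] at h0
      exact BitVec.eq_of_toNat_eq (by simpa using h0)
  | cond_false hr h ih =>
    refine .cond (fun h0 => absurd ?_ h0) (fun _ => (ih hP.2.2 (by omega) hs ht).mono ?_)
    · rw [hs.reg _ hP.1, hr]; simp
    · rintro k₁ σ₁ ⟨hk₁, hs₁, hl₁⟩
      exact ⟨by omega, hs₁, hl₁⟩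
  | loop_done hr =>
    refine .loop_done ?_ ⟨by omega, hs, .refl _ _ _⟩
    rw [hs.reg _ hP.1, hr]; simp
  | loop_step hr h₁ h₂ ih₁ ih₂ =>
    have := h₁.coins_le
    refine .loop_step ?_ ((ih₁ hP.2 (by omega) hs ht).mono ?_)
    · rw [hs.reg _ hP.1]
      exact fun h0 => hr (BitVec.eq_of_toNat_eq (by simpa using h0))
    · rintro k₁ σ₁ ⟨hk₁, hs₁, hl₁⟩
      refine (ih₂ hP (by omega) hs₁ (ht.of_local hL hl₁)).mono ?_
      rintro k₂ σ₂ ⟨hk₂, hs₂, hl₂⟩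
      exact ⟨by omega, hs₂, hl₁.trans hl₂⟩

end WordRAM

namespace DynGraph

/-! ## The gadget graph

The vertices are quadruples `(s, a, i, j)` with `s < 2`, `a ≤ n₀`, `i < I` and `j < r`.  For fixed
`s` and `a`, they form a spider with `I` legs.  The legs of a spider `a < n₀` are joined at their
ends to some of the legs of the spider `n₀`, and the end of leg `1` of the spider `n₀` in copy `0`
is the centre, whose adjacency to the ends of the other legs of the two spiders `n₀` varies. -/

/-- Three legs are special. Leg 0 is joined to nothing, and its end is the far vertex. Leg 1 of the
spiders `n₀` carries the centre and its permanent neighbour in copy 1, so it must not lead to other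
spiders. Leg 2 is joined for every spider but its tips are never active: it only keeps the graph
connected. The remaining legs stand for clauses. -/
structure Gadget where
  n₀ : ℕ
  I : ℕ
  r : ℕ
  conn : ℕ → ℕ → Bool
  two_le_I : 3 ≤ I
  two_le_r : 2 ≤ r
  conn_zero : ∀ a, conn a 0 = false
  conn_one : ∀ a, conn a 1 = false
  conn_two : ∀ a, conn a 2 = true

namespace Gadget

variable (g : Gadget)

/-- The number of vertices. -/
def n : ℕ := 2 * ((g.n₀ + 1) * (g.I * g.r))

/-- A numeral in mixed radix; the functions `cS`, `cA`, `cI`, `cJ` read its digits. The vertex with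
`i = j = 0` is the root of its spider, so leg 0 starts at the root itself while the other legs start
at neighbours of the root. -/
def code (s a i j : ℕ) : ℕ := ((s * (g.n₀ + 1) + a) * g.I + i) * g.r + j

def cJ (u : ℕ) : ℕ := u % g.r
def cI (u : ℕ) : ℕ := u / g.r % g.I
def cA (u : ℕ) : ℕ := u / g.r / g.I % (g.n₀ + 1)
def cS (u : ℕ) : ℕ := u / g.r / g.I / (g.n₀ + 1)

/-- The end of leg `i` of the spider `n₀` in copy `s`. -/
def tip (s i : ℕ) : ℕ := g.code s g.n₀ i (g.r - 1)

/-- The centre. -/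
def ctr : ℕ := g.tip 0 1

theorem r_pos : 0 < g.r := by have := g.two_le_r; omega
theorem I_pos : 0 < g.I := by have := g.two_le_I; omega

theorem n_pos : 0 < g.n := by
  have := g.r_pos
  have := g.I_pos
  unfold n
  positivity

instance : NeZero g.n := ⟨g.n_pos.ne'⟩

section decode

variable {g} {s a i j : ℕ}

theorem code_div_r (hj : j < g.r) : g.code s a i j / g.r = (s * (g.n₀ + 1) + a) * g.I + i := by
  unfold code
  rw [mul_comm, Nat.mul_add_div g.r_pos, Nat.div_eq_of_lt hj, add_zero]

theorem code_div_I (hi : i < g.I) : ((s * (g.n₀ + 1) + a) * g.I + i) / g.I = s * (g.n₀ + 1) + a := by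
  rw [mul_comm, Nat.mul_add_div g.I_pos, Nat.div_eq_of_lt hi, add_zero]

theorem cJ_code (hj : j < g.r) : g.cJ (g.code s a i j) = j := by
  unfold cJ code
  rw [mul_comm, Nat.mul_add_mod, Nat.mod_eq_of_lt hj]

theorem cI_code (hi : i < g.I) (hj : j < g.r) : g.cI (g.code s a i j) = i := by
  unfold cI
  rw [code_div_r hj, mul_comm, Nat.mul_add_mod, Nat.mod_eq_of_lt hi]

theorem cA_code (ha : a ≤ g.n₀) (hi : i < g.I) (hj : j < g.r) : g.cA (g.code s a i j) = a := by
  unfold cA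
  rw [code_div_r hj, code_div_I hi, mul_comm, Nat.mul_add_mod, Nat.mod_eq_of_lt (by omega)]

theorem cS_code (ha : a ≤ g.n₀) (hi : i < g.I) (hj : j < g.r) : g.cS (g.code s a i j) = s := by
  unfold cS
  rw [code_div_r hj, code_div_I hi, mul_comm, Nat.mul_add_div (by omega),
    Nat.div_eq_of_lt (by omega), add_zero]

theorem code_decode (u : ℕ) : g.code (g.cS u) (g.cA u) (g.cI u) (g.cJ u) = u := by
  unfold code cS cA cI cJ
  rw [Nat.div_add_mod', Nat.div_add_mod', Nat.div_add_mod']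

theorem cJ_lt (u : ℕ) : g.cJ u < g.r := Nat.mod_lt _ g.r_pos
theorem cI_lt (u : ℕ) : g.cI u < g.I := Nat.mod_lt _ g.I_pos
theorem cA_le (u : ℕ) : g.cA u ≤ g.n₀ := Nat.lt_succ_iff.1 (Nat.mod_lt _ (by omega))

theorem cS_lt {u : ℕ} (hu : u < g.n) : g.cS u < 2 := by
  unfold cS
  rw [Nat.div_div_eq_div_mul, Nat.div_div_eq_div_mul]
  refine Nat.div_lt_of_lt_mul ?_
  unfold n at hu
  calc u < _ := hu
    _ = _ := by ring

theorem code_lt (hs : s < 2) (ha : a ≤ g.n₀) (hi : i < g.I) (hj : j < g.r) :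
    g.code s a i j < g.n := by
  unfold code n
  have h1 : s * (g.n₀ + 1) + a + 1 ≤ 2 * (g.n₀ + 1) := by nlinarith
  have h2 : (s * (g.n₀ + 1) + a) * g.I + i + 1 ≤ 2 * (g.n₀ + 1) * g.I := by nlinarith
  have h3 := Nat.mul_le_mul_right g.r h2
  nlinarith

theorem exists_code {u : ℕ} (hu : u < g.n) :
    ∃ s a i j, s < 2 ∧ a ≤ g.n₀ ∧ i < g.I ∧ j < g.r ∧ u = g.code s a i j :=
  ⟨_, _, _, _, cS_lt hu, cA_le u, cI_lt u, cJ_lt u, (code_decode u).symm⟩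

end decode

theorem tip_lt {s i : ℕ} (hs : s < 2) (hi : i < g.I) : g.tip s i < g.n :=
  code_lt hs le_rfl hi (by have := g.two_le_r; omega)

theorem ctr_lt : g.ctr < g.n := g.tip_lt (by norm_num) (by have := g.two_le_I; omega)

theorem tip_inj {s i s' i' : ℕ} (hi : i < g.I) (hi' : i' < g.I) (h : g.tip s i = g.tip s' i') :
    s = s' ∧ i = i' := by
  have hj : g.r - 1 < g.r := by have := g.two_le_r; omega
  constructor
  · rw [← cS_code (g := g) (s := s) le_rfl hi hj, ← cS_code (g := g) (s := s') le_rfl hi' hj]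
    exact congrArg _ h
  · rw [← cI_code (g := g) (s := s) (a := g.n₀) hi hj,
      ← cI_code (g := g) (s := s') (a := g.n₀) hi' hj]
    exact congrArg _ h

/-- The tips other than the centre. -/
def Tips : Set ℕ := {u | ∃ s i, s < 2 ∧ i < g.I ∧ (s, i) ≠ (0, 1) ∧ u = g.tip s i}

/-- The arcs of the graph, each directed towards its larger end in some linear order; `D` is the
set of vertices that are adjacent to the centre. -/
def Arc (D : Set ℕ) (u v : ℕ) : Prop :=
  (g.cJ u + 1 < g.r ∧ v = u + 1) ∨
  (g.cJ u = 0 ∧ 1 ≤ g.cI u ∧ v = u - g.cI u * g.r) ∨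
  (g.cJ u + 1 = g.r ∧ g.cA u < g.n₀ ∧ g.conn (g.cA u) (g.cI u) = true ∧
    v = u + (g.n₀ - g.cA u) * (g.I * g.r)) ∨
  (u ∈ D ∧ v = g.ctr)

theorem Arc.mono {D D' : Set ℕ} (h : D ⊆ D') {u v : ℕ} (hu : g.Arc D u v) : g.Arc D' u v := by
  rcases hu with h1 | h1 | h1 | h1
  · exact .inl h1
  · exact .inr (.inl h1)
  · exact .inr (.inr (.inl h1))
  · exact .inr (.inr (.inr ⟨h h1.1, h1.2⟩))

/-- The arcs are defined by arithmetic on vertex numbers, as the program computes them; distances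
are easier to treat in the coordinates produced here. -/
theorem Arc.cases {D : Set ℕ} (hD : D ⊆ g.Tips) {u v : ℕ} (hu : u < g.n) (h : g.Arc D u v) :
    ∃ s a i j, s < 2 ∧ a ≤ g.n₀ ∧ i < g.I ∧ j < g.r ∧ u = g.code s a i j ∧
      ((j + 1 < g.r ∧ v = g.code s a i (j + 1)) ∨
       (j = 0 ∧ 1 ≤ i ∧ v = g.code s a 0 0) ∨
       (j + 1 = g.r ∧ a < g.n₀ ∧ g.conn a i = true ∧ v = g.tip s i) ∨
       (j + 1 = g.r ∧ a = g.n₀ ∧ u ∈ D ∧ (s, i) ≠ (0, 1) ∧ v = g.ctr)) := by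
  obtain ⟨s, a, i, j, hs, ha, hi, hj, rfl⟩ := exists_code hu
  refine ⟨s, a, i, j, hs, ha, hi, hj, rfl, ?_⟩
  unfold Arc at h
  rw [cJ_code hj, cI_code hi hj, cA_code ha hi hj] at h
  rcases h with ⟨h1, rfl⟩ | ⟨rfl, h1, rfl⟩ | ⟨h1, h2, h3, rfl⟩ | ⟨h1, rfl⟩
  · exact .inl ⟨h1, rfl⟩
  · refine .inr (.inl ⟨rfl, h1, ?_⟩)
    unfold code
    have : ((s * (g.n₀ + 1) + a) * g.I + i) * g.r + 0 - i * g.r =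
      ((s * (g.n₀ + 1) + a) * g.I) * g.r := by rw [add_zero, add_mul, Nat.add_sub_cancel]
    rw [this]; ring
  · refine .inr (.inr (.inl ⟨h1, h2, h3, ?_⟩))
    obtain ⟨t, ht⟩ := Nat.exists_eq_add_of_lt h2
    have : g.n₀ - a = t + 1 := by omega
    have hj' : g.r - 1 = j := by omega
    rw [this]
    unfold tip code
    rw [hj']
    generalize hN : g.n₀ + 1 = N
    rw [ht]; ring
  · obtain ⟨s', i', hs', hi', hne, he⟩ := hD h1
    have hj' : g.r - 1 < g.r := by have := g.r_pos; omega
    have e1 := congrArg g.cJ he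
    have e2 := congrArg g.cA he
    have e3 := congrArg g.cI he
    have e4 := congrArg g.cS he
    unfold tip at e1 e2 e3 e4
    rw [cJ_code hj, cJ_code hj'] at e1
    rw [cA_code ha hi hj, cA_code le_rfl hi' hj'] at e2
    rw [cI_code hi hj, cI_code hi' hj'] at e3
    rw [cS_code ha hi hj, cS_code le_rfl hi' hj'] at e4
    refine .inr (.inr (.inr ⟨by omega, e2, h1, ?_, rfl⟩))
    rw [e4, e3]; exact hne

theorem Arc.lt_n {D : Set ℕ} (hD : D ⊆ g.Tips) {u v : ℕ} (hu : u < g.n) (h : g.Arc D u v) :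
    v < g.n := by
  obtain ⟨s, a, i, j, hs, ha, hi, hj, rfl, h⟩ := h.cases g hD hu
  rcases h with ⟨h1, rfl⟩ | ⟨-, -, rfl⟩ | ⟨-, -, -, rfl⟩ | ⟨-, -, -, -, rfl⟩
  · exact code_lt hs ha hi h1
  · exact code_lt hs ha g.I_pos g.r_pos
  · exact g.tip_lt hs hi
  · exact g.ctr_lt

/-- A function that increases along the arcs. -/
def rank (u : ℕ) : ℕ :=
  (if g.cA u = g.n₀ then 3 * g.r else 0) + (if g.cI u = 0 then g.r else 0) + g.cJ u +
    (if u = g.ctr then 3 * g.r else 0)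

/-- The position increases outwards along a leg; the bonus `r` of leg 0 lifts the root above the
starts of the other legs; the bonus `3 r` lifts the spiders `n₀` above all others, and a further `3
r` lifts the centre to the top. Consequently no edge is represented by two opposite arcs. -/
theorem Arc.rank_lt {D : Set ℕ} (hD : D ⊆ g.Tips) {u v : ℕ} (hu : u < g.n) (h : g.Arc D u v) :
    g.rank u < g.rank v := by
  obtain ⟨s, a, i, j, hs, ha, hi, hj, rfl, h⟩ := h.cases g hD hu
  have hI := g.two_le_I
  have hr := g.two_le_r
  have hj' : g.r - 1 < g.r := by omega
  have hx : g.code s a i j = g.ctr → j = g.r - 1 ∧ a = g.n₀ ∧ i = 1 ∧ s = 0 := by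
    intro he
    unfold ctr tip at he
    have e1 := congrArg g.cJ he
    have e2 := congrArg g.cA he
    have e3 := congrArg g.cI he
    have e4 := congrArg g.cS he
    rw [cJ_code hj, cJ_code hj'] at e1
    rw [cA_code ha hi hj, cA_code le_rfl (by omega) hj'] at e2
    rw [cI_code hi hj, cI_code (by omega) hj'] at e3
    rw [cS_code ha hi hj, cS_code le_rfl (by omega) hj'] at e4
    exact ⟨e1, e2, e3, e4⟩
  unfold rank
  rw [cA_code ha hi hj, cI_code hi hj, cJ_code hj]
  rcases h with ⟨h1, rfl⟩ | ⟨h0, h1, rfl⟩ | ⟨h1, h2, h3, rfl⟩ | ⟨h1, h2, h3, h4, rfl⟩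
  · rw [if_neg (fun h => by have := hx h; omega : g.code s a i j ≠ g.ctr),
      cA_code ha hi h1, cI_code hi h1, cJ_code h1]
    omega
  · rw [if_neg (fun h => by have := hx h; omega : g.code s a i j ≠ g.ctr),
      cA_code ha g.I_pos g.r_pos, cI_code g.I_pos g.r_pos, cJ_code g.r_pos]
    rw [if_neg (by omega : i ≠ 0), if_pos rfl]
    omega
  · rw [if_neg (fun h => by have := hx h; omega : g.code s a i j ≠ g.ctr)]
    unfold tip
    rw [cA_code le_rfl hi hj', cI_code hi hj', cJ_code hj', if_neg (by omega : a ≠ g.n₀), if_pos rfl]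
    omega
  · rw [if_neg (fun h => h4 (by have := hx h; rw [this.2.2.1, this.2.2.2]) :
      g.code s a i j ≠ g.ctr), if_pos (rfl : g.ctr = g.ctr)]
    conv_rhs => unfold ctr tip
    rw [cA_code le_rfl (by omega) hj', cI_code (by omega) hj', cJ_code hj', if_pos rfl]
    split_ifs <;> omega

/-- The graph in which the centre is adjacent to the vertices in `D`. -/
def graph (D : Set ℕ) : SimpleGraph (Fin g.n) where
  Adj u v := u ≠ v ∧ (g.Arc D u v ∨ g.Arc D v u)
  symm := ⟨fun _ _ h => ⟨h.1.symm, h.2.symm⟩⟩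
  loopless := ⟨fun _ h => h.1 rfl⟩

theorem graph_adj_of_arc {D : Set ℕ} (hD : D ⊆ g.Tips) {u v : Fin g.n} (h : g.Arc D u v) :
    (g.graph D).Adj u v :=
  ⟨fun he => by have := h.rank_lt g hD u.2; rw [he] at this; exact lt_irrefl _ this, .inl h⟩

/-- The centre, as a vertex. -/
def centre : Fin g.n := ⟨g.ctr, g.ctr_lt⟩

/-! ### Updates -/

theorem not_arc_ctr {D : Set ℕ} (hD : D ⊆ g.Tips) (v : ℕ) :
    ¬ g.Arc D g.ctr v := by
  intro h
  have hr := g.two_le_r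
  have hI := g.two_le_I
  have hj' : g.r - 1 < g.r := by omega
  unfold Arc at h
  have e : g.ctr = g.code 0 g.n₀ 1 (g.r - 1) := rfl
  rw [e, cJ_code hj', cA_code le_rfl (by omega) hj', cI_code (by omega) hj'] at h
  rcases h with ⟨h, -⟩ | ⟨h, -⟩ | ⟨-, h, -⟩ | ⟨h, -⟩
  · omega
  · omega
  · omega
  · obtain ⟨s, i, hs, hi, hne, he⟩ := hD h
    obtain ⟨rfl, rfl⟩ := g.tip_inj (by omega) hi he
    exact hne rfl

theorem arc_ctr_iff {D : Set ℕ} {v : ℕ} (hv : v ∈ g.Tips) :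
    g.Arc D v g.ctr ↔ v ∈ D := by
  refine ⟨fun h => ?_, fun h => .inr (.inr (.inr ⟨h, rfl⟩))⟩
  obtain ⟨s, i, hs, hi, hne, rfl⟩ := hv
  have hr := g.two_le_r
  have hI := g.two_le_I
  have hj' : g.r - 1 < g.r := by omega
  unfold Arc tip at h
  rw [cJ_code hj', cA_code le_rfl hi hj', cI_code hi hj'] at h
  rcases h with ⟨h, -⟩ | ⟨h, -⟩ | ⟨-, h, -⟩ | ⟨h, -⟩
  · omega
  · omega
  · omega
  · exact h

theorem graph_adj_centre {D : Set ℕ} (hD : D ⊆ g.Tips) {v : Fin g.n} (hv : (v : ℕ) ∈ g.Tips) :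
    (g.graph D).Adj g.centre v ↔ (v : ℕ) ∈ D := by
  have h1 : ¬ g.Arc D g.centre v := g.not_arc_ctr hD v
  have h2 : g.Arc D v g.centre ↔ (v : ℕ) ∈ D := g.arc_ctr_iff hv
  constructor
  · rintro ⟨-, h | h⟩
    · exact absurd h h1
    · exact h2.1 h
  · intro h
    exact (g.graph_adj_of_arc hD (h2.2 h)).symm

theorem Tips.ne {v : Fin g.n} (hv : (v : ℕ) ∈ g.Tips) : g.centre ≠ v := by
  rintro rfl
  obtain ⟨s, i, hs, hi, hne, he⟩ := hv
  obtain ⟨rfl, rfl⟩ := g.tip_inj (by have := g.two_le_I; omega) hi he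
  exact hne rfl

theorem apply_insert (D : Set ℕ) {v : Fin g.n} (hv : (v : ℕ) ∈ g.Tips) :
    (Op.insert g.centre v).apply (g.graph D) = g.graph (insert (v : ℕ) D) := by
  have hne := Tips.ne g hv
  ext a b
  simp only [Op.apply, SimpleGraph.sup_adj, SimpleGraph.edge_adj]
  constructor
  · rintro (⟨h1, h2⟩ | ⟨h, h1⟩)
    · exact ⟨h1, h2.imp (fun h => h.mono g (Set.subset_insert _ _))
        fun h => h.mono g (Set.subset_insert _ _)⟩
    · refine ⟨h1, ?_⟩
      rcases h with ⟨rfl, rfl⟩ | ⟨rfl, rfl⟩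
      · exact .inr ((g.arc_ctr_iff hv).2 (Set.mem_insert _ _))
      · exact .inl ((g.arc_ctr_iff hv).2 (Set.mem_insert _ _))
  · have key : ∀ x y : Fin g.n, g.Arc (insert (v : ℕ) D) x y →
        g.Arc D x y ∨ (x = v ∧ y = g.centre) := by
      rintro x y (h | h | h | ⟨h, h'⟩)
      · exact .inl (.inl h)
      · exact .inl (.inr (.inl h))
      · exact .inl (.inr (.inr (.inl h)))
      · rcases h with h | h
        · exact .inr ⟨Fin.ext h, Fin.ext h'⟩
        · exact .inl (.inr (.inr (.inr ⟨h, h'⟩)))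
    rintro ⟨h1, h | h⟩
    · rcases key _ _ h with h | ⟨rfl, rfl⟩
      · exact .inl ⟨h1, .inl h⟩
      · exact .inr ⟨.inr ⟨rfl, rfl⟩, h1⟩
    · rcases key _ _ h with h | ⟨rfl, rfl⟩
      · exact .inl ⟨h1, .inr h⟩
      · exact .inr ⟨.inl ⟨rfl, rfl⟩, h1⟩

theorem apply_delete {D : Set ℕ} (hD : D ⊆ g.Tips) {v : Fin g.n} (hv : (v : ℕ) ∈ g.Tips) :
    (Op.delete g.centre v).apply (g.graph D) = g.graph (D \ {(v : ℕ)}) := by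
  have hsub : D \ {(v : ℕ)} ⊆ D := Set.sdiff_subset
  ext a b
  simp only [Op.apply, SimpleGraph.deleteEdges_adj, Set.mem_singleton_iff]
  constructor
  · have key : ∀ x y : Fin g.n, g.Arc D x y → s(x, y) ≠ s(g.centre, v) →
        g.Arc (D \ {(v : ℕ)}) x y := by
      rintro x y (h | h | h | ⟨h, h'⟩) hne
      · exact .inl h
      · exact .inr (.inl h)
      · exact .inr (.inr (.inl h))
      · refine .inr (.inr (.inr ⟨⟨h, fun hx => hne ?_⟩, h'⟩))
        have h1 : x = v := Fin.ext hx
        have h2 : y = g.centre := Fin.ext h'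
        rw [h1, h2, Sym2.eq_swap]
    rintro ⟨⟨h1, h⟩, hne⟩
    refine ⟨h1, h.imp (fun h => key _ _ h hne) fun h => key _ _ h ?_⟩
    rwa [Sym2.eq_swap]
  · rintro ⟨h1, h⟩
    refine ⟨⟨h1, h.imp (fun h => h.mono g hsub) fun h => h.mono g hsub⟩, fun he => ?_⟩
    have hadj : (g.graph (D \ {(v : ℕ)})).Adj a b := ⟨h1, h⟩
    have : (g.graph (D \ {(v : ℕ)})).Adj g.centre v := by
      rw [← SimpleGraph.mem_edgeSet] at hadj ⊢
      rwa [he] at hadj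
    exact ((g.graph_adj_centre (hsub.trans hD) hv).1 this).2 rfl

/-! ### Distances -/

/-- A vertex given by its coordinates. -/
def vert (s a i j : ℕ) : Fin g.n := Fin.ofNat g.n (g.code s a i j)

variable {g}

theorem vert_val {s a i j : ℕ} (hs : s < 2) (ha : a ≤ g.n₀) (hi : i < g.I) (hj : j < g.r) :
    (g.vert s a i j : ℕ) = g.code s a i j := by
  simp [vert, Fin.ofNat, Nat.mod_eq_of_lt (code_lt hs ha hi hj)]

theorem exists_vert (u : Fin g.n) :
    ∃ s a i j, s < 2 ∧ a ≤ g.n₀ ∧ i < g.I ∧ j < g.r ∧ u = g.vert s a i j := by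
  obtain ⟨s, a, i, j, hs, ha, hi, hj, h⟩ := exists_code u.2
  exact ⟨s, a, i, j, hs, ha, hi, hj, Fin.ext (by rw [vert_val hs ha hi hj, h])⟩

theorem edist_le_add_one {D : Set ℕ} {x u v : Fin g.n} {d : ℕ}
    (hu : (g.graph D).edist x u ≤ d) (h : (g.graph D).Adj u v) :
    (g.graph D).edist x v ≤ (d + 1 : ℕ) := by
  refine (SimpleGraph.edist_triangle (v := u)).trans ?_
  rw [Nat.cast_add]
  exact add_le_add hu (by rw [SimpleGraph.edist_eq_one_iff_adj.2 h]; rfl)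

section legs

variable {D : Set ℕ} (hD : D ⊆ g.Tips) {x : Fin g.n} {s a i : ℕ} (hs : s < 2) (ha : a ≤ g.n₀)
  (hi : i < g.I)

theorem adj_succ (hD : D ⊆ g.Tips) (hs : s < 2) (ha : a ≤ g.n₀) (hi : i < g.I) {j : ℕ}
    (hj : j + 1 < g.r) : (g.graph D).Adj (g.vert s a i j) (g.vert s a i (j + 1)) := by
  refine g.graph_adj_of_arc hD (.inl ?_)
  rw [vert_val hs ha hi (by omega), vert_val hs ha hi hj, cJ_code (by omega)]
  exact ⟨hj, rfl⟩

theorem adj_root (hD : D ⊆ g.Tips) (hs : s < 2) (ha : a ≤ g.n₀) (hi : i < g.I) (hi' : 1 ≤ i) :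
    (g.graph D).Adj (g.vert s a i 0) (g.vert s a 0 0) := by
  refine g.graph_adj_of_arc hD (.inr (.inl ?_))
  rw [vert_val hs ha hi g.r_pos, vert_val hs ha g.I_pos g.r_pos, cJ_code g.r_pos, cI_code hi g.r_pos]
  refine ⟨rfl, hi', ?_⟩
  unfold code
  rw [add_zero, add_zero, add_zero, add_mul _ i, Nat.add_sub_cancel]

theorem adj_tip (hD : D ⊆ g.Tips) (hs : s < 2) (ha : a < g.n₀) (hi : i < g.I)
    (hc : g.conn a i = true) :
    (g.graph D).Adj (g.vert s a i (g.r - 1)) (g.vert s g.n₀ i (g.r - 1)) := by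
  have hr := g.two_le_r
  have hj : g.r - 1 < g.r := by omega
  refine g.graph_adj_of_arc hD (.inr (.inr (.inl ?_)))
  rw [vert_val hs ha.le hi hj, vert_val hs le_rfl hi hj, cJ_code hj, cA_code ha.le hi hj,
    cI_code hi hj]
  refine ⟨by omega, ha, hc, ?_⟩
  obtain ⟨t, ht⟩ := Nat.exists_eq_add_of_lt ha
  have : g.n₀ - a = t + 1 := by omega
  rw [this]
  unfold code
  generalize hN : g.n₀ + 1 = N
  rw [ht]; ring

theorem edist_down (hD : D ⊆ g.Tips) (hs : s < 2) (ha : a ≤ g.n₀) (hi : i < g.I) {d j : ℕ}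
    (hj : j < g.r) (h : (g.graph D).edist x (g.vert s a i j) ≤ d) :
    (g.graph D).edist x (g.vert s a i 0) ≤ (d + j : ℕ) := by
  induction j generalizing d with
  | zero => exact h
  | succ j ih =>
    have := ih (d := d + 1) (by omega) (edist_le_add_one h (adj_succ hD hs ha hi hj).symm)
    rwa [add_assoc, add_comm 1] at this

theorem edist_up (hD : D ⊆ g.Tips) (hs : s < 2) (ha : a ≤ g.n₀) (hi : i < g.I) {d j : ℕ}
    (hj : j < g.r) (h : (g.graph D).edist x (g.vert s a i 0) ≤ d) :
    (g.graph D).edist x (g.vert s a i j) ≤ (d + j : ℕ) := by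
  induction j with
  | zero => exact h
  | succ j ih => exact edist_le_add_one (ih (by omega)) (adj_succ hD hs ha hi hj)

/-- A spider has diameter at most `2 r`. -/
theorem edist_spider (hD : D ⊆ g.Tips) (hs : s < 2) (ha : a ≤ g.n₀) (hi : i < g.I) {d i' j : ℕ}
    (hi' : i' < g.I) (hj : j < g.r)
    (h : (g.graph D).edist x (g.vert s a i (g.r - 1)) ≤ d) :
    (g.graph D).edist x (g.vert s a i' j) ≤ (d + 2 * g.r : ℕ) := by
  have hr := g.two_le_r
  -- From the end of leg `i` inwards `r - 1` steps, at most one step to the root, at most one to the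
  -- start of leg `i'`, and `j ≤ r - 1` steps outwards.
  have h1 := edist_down hD hs ha hi (by omega) h
  have h2 : (g.graph D).edist x (g.vert s a 0 0) ≤ (d + (g.r - 1) + 1 : ℕ) := by
    rcases Nat.eq_zero_or_pos i with rfl | h0
    · exact h1.trans (by exact_mod_cast Nat.le_succ _)
    · exact edist_le_add_one h1 (adj_root hD hs ha hi h0)
  have h3 : (g.graph D).edist x (g.vert s a i' 0) ≤ (d + (g.r - 1) + 1 + 1 : ℕ) := by
    rcases Nat.eq_zero_or_pos i' with rfl | h0
    · exact h2.trans (by exact_mod_cast Nat.le_succ _)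
    · exact edist_le_add_one h2 (adj_root hD hs ha hi' h0).symm
  refine (edist_up hD hs ha hi' hj h3).trans ?_
  exact_mod_cast (by omega : d + (g.r - 1) + 1 + 1 + j ≤ d + 2 * g.r)

theorem edist_spider_of_conn (hD : D ⊆ g.Tips) (hs : s < 2) (ha : a < g.n₀) (hi : i < g.I)
    (hc : g.conn a i = true) {d i' j : ℕ} (hi' : i' < g.I) (hj : j < g.r)
    (h : (g.graph D).edist x (g.vert s g.n₀ i (g.r - 1)) ≤ d) :
    (g.graph D).edist x (g.vert s a i' j) ≤ (d + 1 + 2 * g.r : ℕ) :=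
  edist_spider hD hs ha.le hi hi' hj (edist_le_add_one h (adj_tip hD hs ha hi hc).symm)

end legs

theorem vert_ctr : g.vert 0 g.n₀ 1 (g.r - 1) = g.centre := by
  have hr := g.two_le_r
  have hI := g.two_le_I
  exact Fin.ext (vert_val (by norm_num) le_rfl (by omega) (by omega))

theorem edist_centre_tip {D : Set ℕ} (hD : D ⊆ g.Tips) {s i : ℕ} (hs : s < 2) (hi : i < g.I)
    (h : (s, i) = (0, 1) ∨ g.tip s i ∈ D) :
    (g.graph D).edist g.centre (g.vert s g.n₀ i (g.r - 1)) ≤ (1 : ℕ) := by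
  have hr := g.two_le_r
  rcases h with h | h
  · obtain ⟨rfl, rfl⟩ := Prod.mk.inj h
    rw [vert_ctr, SimpleGraph.edist_self]
    exact bot_le
  · have hv : (g.vert s g.n₀ i (g.r - 1) : ℕ) = g.tip s i := vert_val hs le_rfl hi (by omega)
    have := (g.graph_adj_centre hD (v := g.vert s g.n₀ i (g.r - 1)) (hv ▸ hD h)).2 (hv ▸ h)
    rw [SimpleGraph.edist_eq_one_iff_adj.2 this]
    rfl

section radius

variable {D : Set ℕ}

theorem edist_hub (hD : D ⊆ g.Tips) (h1 : g.tip 1 1 ∈ D) {s i j : ℕ} (hs : s < 2) (hi : i < g.I)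
    (hj : j < g.r) : (g.graph D).edist g.centre (g.vert s g.n₀ i j) ≤ (1 + 2 * g.r : ℕ) := by
  have hI := g.two_le_I
  refine edist_spider hD hs le_rfl (i := 1) (by omega) hi hj (edist_centre_tip hD hs (by omega) ?_)
  interval_cases s
  · exact .inl rfl
  · exact .inr h1

/-- This weak bound holds whatever is active: one reaches leg 2 of the spider `n₀` through its own
root, and from there every other spider. It serves for connectedness only. -/
theorem edist_centre_le (hD : D ⊆ g.Tips) (h1 : g.tip 1 1 ∈ D) (u : Fin g.n) :
    (g.graph D).edist g.centre u ≤ (4 * g.r + 2 : ℕ) := by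
  have hI := g.two_le_I
  have hr := g.two_le_r
  obtain ⟨s, a, i, j, hs, ha, hi, hj, rfl⟩ := exists_vert u
  rcases ha.lt_or_eq with ha | rfl
  · refine (edist_spider_of_conn hD hs ha (by omega) (g.conn_two a) hi hj
      (edist_hub hD h1 hs (by omega) (by omega))).trans ?_
    exact_mod_cast (by omega : 1 + 2 * g.r + 1 + 2 * g.r ≤ 4 * g.r + 2)
  · refine (edist_hub hD h1 hs hi hj).trans ?_
    exact_mod_cast (by omega : 1 + 2 * g.r ≤ 4 * g.r + 2)

theorem connected (hD : D ⊆ g.Tips) (h1 : g.tip 1 1 ∈ D) : (g.graph D).Connected := by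
  have : ∀ u, (g.graph D).Reachable g.centre u := fun u =>
    SimpleGraph.reachable_of_edist_ne_top
      (ne_top_of_le_ne_top (ENat.natCast_ne_top _) (edist_centre_le hD h1 u))
  exact { preconnected := fun u v => (this u).symm.trans (this v), nonempty := ⟨g.centre⟩ }

/-- If every spider is joined to an active tip, then the centre is close to all vertices. -/
theorem eccent_le (hD : D ⊆ g.Tips) (h1 : g.tip 1 1 ∈ D)
    (hh : ∀ a < g.n₀, ∀ s < 2, ∃ i < g.I, g.conn a i = true ∧ g.tip s i ∈ D) :
    (g.graph D).eccent g.centre ≤ (2 * g.r + 2 : ℕ) := by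
  rw [SimpleGraph.eccent_le_iff]
  intro u
  obtain ⟨s, a, i, j, hs, ha, hi, hj, rfl⟩ := exists_vert u
  rcases ha.lt_or_eq with ha | rfl
  -- One step from the centre to the active tip, one to the spider, and at most `2 r` inside it.
  · obtain ⟨i', hi', hc, ht⟩ := hh a ha s hs
    refine (edist_spider_of_conn hD hs ha hi' hc hi hj
      (edist_centre_tip hD hs hi' (.inr ht))).trans ?_
    exact_mod_cast (by omega : 1 + 1 + 2 * g.r ≤ 2 * g.r + 2)
  · refine (edist_hub hD h1 hs hi hj).trans ?_
    exact_mod_cast (by omega : 1 + 2 * g.r ≤ 2 * g.r + 2)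

end radius

/-- The scale of a parameter relative to the eccentricity of the centre. -/
def _root_.DynGraph.Parameter.scale : Parameter → ℕ
  | .diameter => 2
  | .radius => 1
  | .eccentricity => 1

/-- All parameters are governed by the eccentricity of the centre: it bounds the radius, and twice
it bounds the diameter by the triangle inequality. -/
theorem value_le {D : Set ℕ} (hD : D ⊆ g.Tips) (h1 : g.tip 1 1 ∈ D)
    (hh : ∀ a < g.n₀, ∀ s < 2, ∃ i < g.I, g.conn a i = true ∧ g.tip s i ∈ D) (par : Parameter) :
    par.value (g.graph D) g.centre ≤ par.scale * (2 * g.r + 2) := by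
  have h := eccent_le hD h1 hh
  cases par
  · refine ENat.toNat_le_of_le_natCast ((SimpleGraph.ediam_le_two_mul_eccent g.centre).trans ?_)
    rw [Nat.cast_mul]
    exact mul_le_mul_right h _
  · refine ENat.toNat_le_of_le_natCast (SimpleGraph.radius_le_eccent.trans (h.trans ?_))
    rw [Parameter.scale, one_mul]
  · refine ENat.toNat_le_of_le_natCast (h.trans ?_)
    rw [Parameter.scale, one_mul]

/-- A function that changes by at most 1 along edges changes by at most the length along a walk. -/
theorem le_edist_of_lipschitz {V : Type*} {G : SimpleGraph V} (F : V → ℤ)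
    (hF : ∀ u v, G.Adj u v → |F u - F v| ≤ 1) {u v : V} {d : ℕ} (h : (d : ℤ) ≤ F v - F u) :
    (d : ℕ∞) ≤ G.edist u v := by
  refine le_iInf fun p => ?_
  have : ∀ {a b : V} (p : G.Walk a b), F b - F a ≤ p.length := by
    intro a b p
    induction p with
    | nil => simp
    | cons hadj p ih =>
      have := abs_le.1 (hF _ _ hadj)
      rw [SimpleGraph.Walk.length_cons, Nat.cast_add, Nat.cast_one]
      linarith
  have := this p
  exact_mod_cast (by omega : (d : ℤ) ≤ p.length)

/-- The distance to the centre, at least, when spider `b` is joined only to inactive tips. -/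
def depth (D : Set ℕ) [DecidablePred (· ∈ D)] (b s a i j : ℕ) : ℤ :=
  -- Towards the root of the spider `n₀` the depth of an active leg rises from 0 to `r - 1`, and out
  -- along an inactive leg to `2 r - 2`. The joined legs of spider `b` continue from `2 r - 2` to `3
  -- r - 3` at their starts, and its unjoined legs end at `4 r - 4`. The edges at the roots and
  -- between leg ends count as 0, which makes this a lower bound rather than the exact distance.
  if a = b then (if g.conn b i = true then 3 * g.r - 3 - j else 3 * g.r - 3 + j)
  else if (s, i) = (0, 1) ∨ g.tip s i ∈ D then g.r - 1 - j else g.r - 1 + j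

/-- The depth, with opposite signs in the two copies. -/
def pot (g : Gadget) (D : Set ℕ) [DecidablePred (· ∈ D)] (b u : ℕ) : ℤ :=
  if g.cS u = 0 then -depth (g := g) D b 0 (g.cA u) (g.cI u) (g.cJ u)
  else depth (g := g) D b (g.cS u) (g.cA u) (g.cI u) (g.cJ u)

theorem pot_code (D : Set ℕ) [DecidablePred (· ∈ D)] (b : ℕ) {s a i j : ℕ} (ha : a ≤ g.n₀)
    (hi : i < g.I) (hj : j < g.r) : g.pot D b (g.code s a i j) =
      if s = 0 then -depth (g := g) D b s a i j else depth (g := g) D b s a i j := by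
  unfold pot
  rw [cS_code ha hi hj, cA_code ha hi hj, cI_code hi hj, cJ_code hj]
  split_ifs with h
  · rw [h]
  · rfl

section far

variable {D : Set ℕ} [DecidablePred (· ∈ D)] {b : ℕ}

/-- Within a copy the sign is constant, so it suffices that the depth changes by at most 1. The
hypothesis on `b` is used exactly at the edges from spider `b` to the tips, where both ends must
have depth `2 r - 2`. -/
theorem pot_arc (hD : D ⊆ g.Tips) (hb : b < g.n₀)
    (hfar : ∀ i < g.I, g.conn b i = true → ∀ s, g.tip s i ∉ D) {u v : ℕ} (hu : u < g.n)
    (h : g.Arc D u v) : |g.pot D b u - g.pot D b v| ≤ 1 := by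
  have hr := g.two_le_r
  have hI := g.two_le_I
  obtain ⟨s, a, i, j, hs, ha, hi, hj, rfl, h⟩ := h.cases g hD hu
  have key : ∀ x y : ℤ, |x - y| ≤ 1 →
      |(if s = 0 then -x else x) - (if s = 0 then -y else y)| ≤ 1 := by
    intro x y hxy
    rw [abs_le] at hxy ⊢
    split_ifs <;> omega
  rcases h with ⟨h2, rfl⟩ | ⟨h0, h2, rfl⟩ | ⟨h2, h3, h4, rfl⟩ | ⟨h2, h3, h4, h5, rfl⟩
  · rw [pot_code D b ha hi hj, pot_code D b ha hi h2]
    refine key _ _ ?_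
    unfold depth
    rw [abs_le]
    push_cast
    split_ifs <;> omega
  · rw [pot_code D b ha hi hj, pot_code D b ha g.I_pos g.r_pos]
    refine key _ _ ?_
    unfold depth
    subst h0
    rw [abs_le]
    push_cast
    split_ifs <;> omega
  · unfold tip
    rw [pot_code D b ha hi hj, pot_code D b le_rfl hi (by omega)]
    refine key _ _ ?_
    unfold depth
    rw [if_neg (by omega : g.n₀ ≠ b)]
    have hj1 : ((g.r - 1 : ℕ) : ℤ) = j := by omega
    rw [hj1]
    by_cases hab : a = b
    · subst hab
      -- The centre itself is excluded because no spider is joined through leg 1.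
      have hni : ¬ ((s, i) = (0, 1) ∨ g.tip s i ∈ D) := by
        rintro (h | h)
        · obtain ⟨-, rfl⟩ := Prod.mk.inj h
          rw [g.conn_one] at h4
          exact Bool.noConfusion h4
        · exact hfar i hi h4 s h
      rw [if_pos rfl, if_pos h4, if_neg hni, abs_le]
      omega
    · rw [if_neg hab, sub_self, abs_zero]
      norm_num
  · unfold ctr tip
    rw [pot_code D b ha hi hj, pot_code D b le_rfl (by omega) (by omega)]
    have hDu : g.tip s i ∈ D := by
      have : g.tip s i = g.code s a i j := by
        unfold tip
        rw [h3, show g.r - 1 = j by omega]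
      rwa [this]
    -- Only edges at the centre can connect the two copies, and both of their ends have depth 0,
    -- where the change of sign does no harm.
    have d1 : depth (g := g) D b s a i j = 0 := by
      unfold depth
      rw [if_neg (by omega : a ≠ b), if_pos (.inr hDu)]
      omega
    have d2 : depth (g := g) D b 0 g.n₀ 1 (g.r - 1) = 0 := by
      unfold depth
      rw [if_neg (by omega : g.n₀ ≠ b), if_pos (.inl rfl)]
      omega
    rw [d1, d2]
    simp

/-- If some spider is joined to inactive tips only, then every vertex is far from some other. -/
theorem exists_far (hD : D ⊆ g.Tips) (hb : b < g.n₀)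
    (hfar : ∀ i < g.I, g.conn b i = true → ∀ s, g.tip s i ∉ D) :
    (∀ u, ∃ v, ((4 * g.r - 4 : ℕ) : ℕ∞) ≤ (g.graph D).edist u v) ∧
      ∃ u v, ((2 * (4 * g.r - 4) : ℕ) : ℕ∞) ≤ (g.graph D).edist u v := by
  have hr := g.two_le_r
  have hI := g.two_le_I
  have hF : ∀ u v : Fin g.n, (g.graph D).Adj u v → |g.pot D b u - g.pot D b v| ≤ 1 := by
    rintro u v ⟨-, h | h⟩
    · exact pot_arc hD hb hfar u.2 h
    · rw [abs_sub_comm]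
      exact pot_arc hD hb hfar v.2 h
  have e : ∀ s < 2, g.pot D b (g.vert s b 0 (g.r - 1)) =
      if s = 0 then -(4 * g.r - 4 : ℤ) else (4 * g.r - 4 : ℤ) := by
    intro s hs
    rw [vert_val hs hb.le (by omega) (by omega), pot_code D b hb.le (by omega) (by omega)]
    have hc : ¬ g.conn b 0 = true := by rw [g.conn_zero]; exact Bool.false_ne_true
    unfold depth
    rw [if_pos rfl, if_neg hc, Nat.cast_sub (by omega)]
    push_cast
    split_ifs <;> ring
  have e0 := e 0 (by norm_num)
  have e1 := e 1 (by norm_num)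
  rw [if_pos rfl] at e0
  rw [if_neg one_ne_zero] at e1
  constructor
  · intro u
    -- A vertex with potential at most 0 is far from the end with potential `4 r - 4` in copy 1, and
    -- the others are far from the opposite end in copy 0.
    rcases le_total (g.pot D b u) 0 with h | h
    · refine ⟨g.vert 1 b 0 (g.r - 1), le_edist_of_lipschitz (fun u : Fin g.n => g.pot D b u) hF ?_⟩
      simp only [e1]; omega
    · refine ⟨g.vert 0 b 0 (g.r - 1), ?_⟩
      rw [SimpleGraph.edist_comm]
      refine le_edist_of_lipschitz (fun u : Fin g.n => g.pot D b u) hF ?_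
      simp only [e0]; omega
  · refine ⟨g.vert 0 b 0 (g.r - 1), g.vert 1 b 0 (g.r - 1),
      le_edist_of_lipschitz (fun u : Fin g.n => g.pot D b u) hF ?_⟩
    simp only [e0, e1]; omega

end far

/-- Every eccentricity is at least `4 r - 4`, which settles the radius and the centre, and the two
opposite ends settle the diameter. Finiteness, from connectedness, is needed because `toNat` would
send an infinite value to 0. -/
theorem le_value {D : Set ℕ} (hD : D ⊆ g.Tips) (h1 : g.tip 1 1 ∈ D) {b : ℕ} (hb : b < g.n₀)
    (hfar : ∀ i < g.I, g.conn b i = true → ∀ s, g.tip s i ∉ D) (par : Parameter) :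
    par.scale * (4 * g.r - 4) ≤ par.value (g.graph D) g.centre := by
  classical
  obtain ⟨h2, u, v, h3⟩ := exists_far hD hb hfar
  have hecc : ∀ w, ((4 * g.r - 4 : ℕ) : ℕ∞) ≤ (g.graph D).eccent w := fun w => by
    obtain ⟨v, hv⟩ := h2 w
    exact hv.trans SimpleGraph.edist_le_eccent
  have hconn := connected hD h1
  have : Nonempty (Fin g.n) := ⟨g.centre⟩
  have hdt : (g.graph D).ediam ≠ ⊤ := SimpleGraph.connected_iff_ediam_ne_top.1 hconn
  have key : ∀ {a : ℕ} {b : ℕ∞}, b ≠ ⊤ → (a : ℕ∞) ≤ b → a ≤ b.toNat := by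
    intro a b hb h
    rw [← ENat.natCast_toNat hb] at h
    exact_mod_cast h
  have het : (g.graph D).eccent g.centre ≠ ⊤ :=
    ne_top_of_le_ne_top hdt SimpleGraph.eccent_le_ediam
  cases par
  · exact key hdt (h3.trans SimpleGraph.edist_le_ediam)
  · rw [Parameter.scale, one_mul]
    exact key (SimpleGraph.radius_ne_top_iff.2 hconn) (le_iInf hecc)
  · rw [Parameter.scale, one_mul]
    exact key het (hecc _)

/-! ### The list of edges -/

variable (g)

/-- The arcs that leave `u`. -/
def arcs (D : ℕ → Bool) (u : ℕ) : List (ℕ × ℕ) :=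
  (if g.cJ u + 1 < g.r then [(u, u + 1)] else []) ++
  ((if g.cJ u = 0 ∧ 1 ≤ g.cI u then [(u, u - g.cI u * g.r)] else []) ++
  ((if g.cJ u + 1 = g.r ∧ g.cA u < g.n₀ ∧ g.conn (g.cA u) (g.cI u) = true then
    [(u, u + (g.n₀ - g.cA u) * (g.I * g.r))] else []) ++
  (if D u = true then [(u, g.ctr)] else [])))

theorem mem_arcs {D : ℕ → Bool} {u : ℕ} {p : ℕ × ℕ} :
    p ∈ g.arcs D u ↔ p.1 = u ∧ g.Arc {u | D u = true} u p.2 := by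
  obtain ⟨a, b⟩ := p
  unfold arcs Arc
  simp only [List.mem_append, List.mem_ite_nil_right, List.mem_singleton, Prod.mk.injEq,
    Set.mem_ofPred_eq]
  tauto

theorem length_arcs_le (D : ℕ → Bool) (u : ℕ) : (g.arcs D u).length ≤ 4 := by
  unfold arcs
  simp only [List.length_append]
  split_ifs <;> simp

theorem nodup_arcs {D : ℕ → Bool} (hD : {u | D u = true} ⊆ g.Tips) (u : ℕ) :
    (g.arcs D u).Nodup := by
  have hr := g.two_le_r
  have hI := g.two_le_I
  have hD' : D u = true → g.cJ u + 1 = g.r ∧ g.cA u = g.n₀ := by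
    intro h
    obtain ⟨s, i, hs, hi, -, rfl⟩ := hD h
    unfold tip
    rw [cJ_code (by omega), cA_code le_rfl hi (by omega)]
    omega
  have h2 : ∀ k, 0 < k → u + 1 ≠ u + k * (g.I * g.r) := by
    intro k hk h
    have : 2 ≤ g.I * g.r := by nlinarith
    nlinarith
  unfold arcs
  split_ifs with h₁ h₂ h₃ h₄ h₄ h₃ h₄ h₄ <;> simp_all <;> omega

/-- The edges of the graph. -/
def edges (D : ℕ → Bool) : List (Fin g.n × Fin g.n) :=
  (List.range g.n).flatMap fun u =>
    (g.arcs D u).map fun p => (Fin.ofNat g.n p.1, Fin.ofNat g.n p.2)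

variable {g}

theorem mem_edges {D : ℕ → Bool} (hD : {u | D u = true} ⊆ g.Tips) {p : Fin g.n × Fin g.n} :
    p ∈ g.edges D ↔ g.Arc {u | D u = true} p.1 p.2 := by
  unfold edges
  simp only [List.mem_flatMap, List.mem_range, List.mem_map, mem_arcs]
  constructor
  · rintro ⟨u, hu, ⟨a, b⟩, ⟨rfl, h⟩, rfl⟩
    have := h.lt_n g hD hu
    simpa [Fin.ofNat, Nat.mod_eq_of_lt hu, Nat.mod_eq_of_lt this] using h
  · intro h
    refine ⟨p.1, p.1.2, (p.1, p.2), ⟨rfl, h⟩, ?_⟩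
    simp

theorem ofEdgeList_edges {D : ℕ → Bool} (hD : {u | D u = true} ⊆ g.Tips) :
    ofEdgeList (g.edges D) = g.graph {u | D u = true} := by
  ext u v
  simp only [ofEdgeList, SimpleGraph.fromEdgeSet_adj, Set.mem_ofPred_eq]
  constructor
  · rintro ⟨⟨p, hp, he⟩, hne⟩
    refine ⟨hne, ?_⟩
    rw [mem_edges hD] at hp
    rcases Sym2.eq_iff.1 he with ⟨rfl, rfl⟩ | ⟨rfl, rfl⟩
    · exact .inl hp
    · exact .inr hp
  · rintro ⟨hne, h | h⟩
    · exact ⟨⟨(u, v), (mem_edges hD).2 h, rfl⟩, hne⟩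
    · exact ⟨⟨(v, u), (mem_edges hD).2 h, Sym2.eq_swap⟩, hne⟩

/-- Two entries for the same edge would be equal arcs or opposite arcs; the rank excludes opposite
ones, and the list of arcs itself has no repetitions. -/
theorem isEdgeList_edges {D : ℕ → Bool} (hD : {u | D u = true} ⊆ g.Tips) :
    IsEdgeList (g.edges D) := by
  refine ⟨fun p hp => ?_, ?_⟩
  · rw [mem_edges hD] at hp
    exact (g.graph_adj_of_arc hD hp).ne
  · rw [List.nodup_map_iff_inj_on]
    · rintro ⟨a, b⟩ hp ⟨c, d⟩ hq he
      rw [mem_edges hD] at hp hq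
      rcases Sym2.eq_iff.1 he with ⟨h1, h2⟩ | ⟨h1, h2⟩
      · exact Prod.ext h1 h2
      · have l1 := hp.rank_lt g hD a.2
        have l2 := hq.rank_lt g hD c.2
        simp only at h1 h2 l1 l2
        rw [h1, h2] at l1
        exact absurd l1 (by omega)
    · unfold edges
      rw [List.nodup_flatMap]
      constructor
      · intro u hu
        rw [List.mem_range] at hu
        refine (List.nodup_map_iff_inj_on (g.nodup_arcs hD u)).2 ?_
        rintro ⟨a, b⟩ hp ⟨c, d⟩ hq he
        rw [mem_arcs] at hp hq
        obtain ⟨rfl, hp⟩ := hp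
        obtain ⟨h, hq⟩ := hq
        simp only at h hp hq
        subst h
        have l1 := hp.lt_n g hD hu
        have l2 := hq.lt_n g hD hu
        have := congrArg Fin.val (Prod.mk.inj he).2
        simp only [Fin.ofNat, Nat.mod_eq_of_lt l1, Nat.mod_eq_of_lt l2] at this
        rw [this]
      · refine List.Nodup.pairwise_of_forall_ne List.nodup_range ?_
        intro u hu v hv huv p hp hq
        rw [List.mem_range] at hu hv
        obtain ⟨⟨a, b⟩, hp', rfl⟩ := List.mem_map.1 hp
        obtain ⟨⟨c, d⟩, hq', he⟩ := List.mem_map.1 hq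
        rw [mem_arcs] at hp' hq'
        have h1 := hp'.1
        have h2 := hq'.1
        simp only at h1 h2
        subst h1 h2
        have := congrArg Fin.val (Prod.mk.inj he).1
        simp only [Fin.ofNat, Nat.mod_eq_of_lt hu, Nat.mod_eq_of_lt hv] at this
        exact huv this.symm

theorem length_edges_le (D : ℕ → Bool) : (g.edges D).length ≤ 4 * g.n := by
  unfold edges
  rw [List.length_flatMap]
  refine (List.sum_le_card_nsmul _ 4 ?_).trans (by simp [mul_comm])
  intro x hx
  obtain ⟨u, -, rfl⟩ := List.mem_map.1 hx
  rw [List.length_map]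
  exact g.length_arcs_le D u

theorem admissible {D : Set ℕ} (hD : D ⊆ g.Tips) (h1 : g.tip 1 1 ∈ D) {M : ℕ}
    (hM : 4 * g.n ≤ M) : Admissible M (g.graph D) := by
  classical
  refine ⟨connected hD h1, ?_⟩
  have hD' : {u | (decide (u ∈ D)) = true} = D := by ext; simp
  have hG := ofEdgeList_edges (g := g) (D := fun u => decide (u ∈ D)) (by rw [hD']; exact hD)
  rw [hD'] at hG
  rw [← hG]
  set E := g.edges fun u => decide (u ∈ D)
  have hsub : (ofEdgeList E).edgeSet ⊆ ((E.map fun p => s(p.1, p.2)).toFinset : Set _) := by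
    unfold ofEdgeList
    rw [SimpleGraph.edgeSet_fromEdgeSet]
    rintro e ⟨⟨p, hp, rfl⟩, -⟩
    simp only [List.coe_toFinset, Set.mem_ofPred_eq, List.mem_map]
    exact ⟨p, hp, rfl⟩
  refine (Set.ncard_le_ncard hsub (Finset.finite_toSet _)).trans ?_
  rw [Set.ncard_coe_finset]
  refine (List.toFinset_card_le _).trans ?_
  rw [List.length_map]
  exact (length_edges_le _).trans hM

end Gadget

end DynGraph

namespace WordRAM

/-! ## Independent repetitions -/

/-- The sequence without its first `m` entries. -/
def shift (m : ℕ) (ω : ℕ → Bool) : ℕ → Bool := fun i => ω (m + i)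

instance : IsProbabilityMeasure coinLaw := by unfold coinLaw; infer_instance

/-- Membership in `S` depends only on the first `B` random bits. -/
def DependsOnFirst (B : ℕ) (S : Set (ℕ → Bool)) : Prop :=
  ∀ ω ω' : ℕ → Bool, (∀ i < B, ω i = ω' i) → ω ∈ S → ω' ∈ S

/-- The `q`-th block of `B` random bits. -/
def bits (B q : ℕ) (ω : ℕ → Bool) : Fin B → Bool := fun i => ω (q * B + i)

theorem measurable_bits (B q : ℕ) : Measurable (bits B q) := by
  unfold bits
  fun_prop

/-- The map `(q, i) ↦ q B + i` is injective on pairs with `i < B`, so the pulled-back coordinates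
form a product measure over the pairs; currying turns it into a product over `q`. -/
theorem iIndepFun_bits (B : ℕ) : ProbabilityTheory.iIndepFun (fun q => bits B q) coinLaw := by
  have hinj : Function.Injective fun p : ℕ × Fin B => p.1 * B + (p.2 : ℕ) := by
    rintro ⟨q, i⟩ ⟨q', i'⟩ h
    have hB : 0 < B := i.pos
    simp only at h
    have h1 := congrArg (· / B) h
    have h2 := congrArg (· % B) h
    simp only [mul_comm _ B, Nat.mul_add_div hB, Nat.div_eq_of_lt i.2, Nat.div_eq_of_lt i'.2,
      Nat.mul_add_mod, Nat.mod_eq_of_lt i.2, Nat.mod_eq_of_lt i'.2, add_zero] at h1 h2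
    exact Prod.ext h1 (Fin.ext h2)
  have hlaw : coinLaw.map (fun ω q => bits B q ω) = Measure.infinitePi fun _ : ℕ =>
      Measure.infinitePi fun _ : Fin B => (PMF.uniformOfFintype Bool).toMeasure := by
    rw [← Measure.infinitePi_map_curry, ← Measure.map_infinitePi_infinitePi_of_inj
      (P := fun _ : ℕ => (PMF.uniformOfFintype Bool).toMeasure) hinj, Measure.map_map]
    · rfl
    · fun_prop
    · fun_prop
  rw [ProbabilityTheory.iIndepFun_iff_map_fun_eq_infinitePi_map (fun q => measurable_bits B q),
    hlaw]
  congr 1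
  funext q
  have : bits B q = (fun f : ℕ → Fin B → Bool => f q) ∘ fun ω q => bits B q ω := rfl
  rw [this, ← Measure.map_map (measurable_pi_apply q)
    (measurable_pi_lambda _ fun q => measurable_bits B q), hlaw, Measure.infinitePi_map_eval]

theorem map_bits (B q : ℕ) : coinLaw.map (bits B q) = coinLaw.map (bits B 0) := by
  have key : ∀ q, coinLaw.map (bits B q) =
      Measure.infinitePi fun _ : Fin B => (PMF.uniformOfFintype Bool).toMeasure := fun q =>
    Measure.map_infinitePi_infinitePi_of_inj
      (P := fun _ : ℕ => (PMF.uniformOfFintype Bool).toMeasure)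
      (f := fun i : Fin B => q * B + (i : ℕ)) (fun i j h => Fin.ext (by simpa using h))
  rw [key, key]

/-- A set of sequences, as a set of initial segments. -/
def initials (B : ℕ) (S : Set (ℕ → Bool)) : Set (Fin B → Bool) :=
  {y | (fun i => if h : i < B then y ⟨i, h⟩ else false) ∈ S}

theorem DependsOnFirst.mem_initials {B : ℕ} {S : Set (ℕ → Bool)} (hS : DependsOnFirst B S) (q : ℕ)
    (ω : ℕ → Bool) : bits B q ω ∈ initials B S ↔ shift (q * B) ω ∈ S := by
  have : ∀ i < B, (fun i => if h : i < B then bits B q ω ⟨i, h⟩ else false) i =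
      shift (q * B) ω i := by
    intro i hi
    simp [hi, bits, shift]
  exact ⟨hS _ _ this, hS _ _ fun i hi => (this i hi).symm⟩

theorem measurableSet_initials (B : ℕ) (S : Set (ℕ → Bool)) : MeasurableSet (initials B S) :=
  MeasurableSet.of_discrete

theorem DependsOnFirst.measurableSet {B : ℕ} {S : Set (ℕ → Bool)} (hS : DependsOnFirst B S)
    (q : ℕ) : MeasurableSet {ω | shift (q * B) ω ∈ S} := by
  have : {ω | shift (q * B) ω ∈ S} = bits B q ⁻¹' initials B S := by
    ext ω
    exact (hS.mem_initials q ω).symm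
  rw [this]
  exact measurable_bits B q (measurableSet_initials B S)

/-- An event about the first `B` bits becomes an event about block `q`, and all blocks have the same
law. So every repetition succeeds as often as the first. -/
theorem DependsOnFirst.measure_shift {B : ℕ} {S : Set (ℕ → Bool)} (hS : DependsOnFirst B S)
    (q : ℕ) : coinLaw {ω | shift (q * B) ω ∈ S} = coinLaw S := by
  have : ∀ q, {ω | shift (q * B) ω ∈ S} = bits B q ⁻¹' initials B S := fun q => by
    ext ω
    exact (hS.mem_initials q ω).symm
  have h0 : S = {ω | shift (0 * B) ω ∈ S} := by
    ext ω
    have : shift 0 ω = ω := funext fun i => by simp [shift]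
    simp [this]
  conv_rhs => rw [h0]
  rw [this, this, ← Measure.map_apply (measurable_bits B q) (measurableSet_initials B S),
    ← Measure.map_apply (measurable_bits B 0) (measurableSet_initials B S), map_bits]

open Classical in
/-- The number of blocks for which the event fails. -/
noncomputable def failures (B R : ℕ) (S : Set (ℕ → Bool)) (ω : ℕ → Bool) : ℕ :=
  ((Finset.range R).filter fun q => shift (q * B) ω ∉ S).card

-- An exponential-moment bound by hand: a block contributes the factor 1 for success and 2 for
-- failure, the product is 2 to the number of failures, and by independence its mean is at most
-- `(4/3) ^ (2 m)`. Markov's inequality at `2 ^ m` gives `(16/9 / 2) ^ m`.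
open Classical in
theorem DependsOnFirst.measure_failures_le {B : ℕ} {S : Set (ℕ → Bool)}
    (hS : DependsOnFirst B S) (h : 2 / 3 ≤ coinLaw S) (m : ℕ) :
    coinLaw {ω | 2 * m ≤ 2 * failures B (2 * m) S ω} ≤ (8 / 9) ^ m := by
  set X : ℕ → (ℕ → Bool) → ENNReal := fun q ω => if shift (q * B) ω ∈ S then 1 else 2 with hX
  have hXm : ∀ q, Measurable (X q) := fun q =>
    Measurable.ite (hS.measurableSet q) measurable_const measurable_const
  have hXi : ProbabilityTheory.iIndepFun X coinLaw := by
    have := (iIndepFun_bits B).comp (fun _ y => if y ∈ initials B S then (1 : ENNReal) else 2)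
      fun _ => Measurable.ite (measurableSet_initials B S) measurable_const measurable_const
    convert this using 1
    funext q ω
    simp only [hX, Function.comp_apply, hS.mem_initials]
  -- The factor plus the indicator of success is constantly 2, so its mean is 2 minus the
  -- probability of success.
  have hXint : ∀ q, ∫⁻ ω, X q ω ∂coinLaw ≤ 4 / 3 := by
    intro q
    have hc : ∀ ω, X q ω + {ω | shift (q * B) ω ∈ S}.indicator 1 ω = 2 := by
      intro ω
      by_cases hω : shift (q * B) ω ∈ S <;> simp [hX, hω, one_add_one_eq_two]
    have h2 : ∫⁻ ω, X q ω ∂coinLaw + coinLaw S = 2 := by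
      rw [← hS.measure_shift q, ← lintegral_indicator_one (hS.measurableSet q),
        ← lintegral_add_left (hXm q)]
      simp [hc]
    have h3 : ∫⁻ ω, X q ω ∂coinLaw + 2 / 3 ≤ 4 / 3 + 2 / 3 := by
      calc _ ≤ ∫⁻ ω, X q ω ∂coinLaw + coinLaw S := by gcongr
        _ = 2 := h2
        _ = 4 / 3 + 2 / 3 := by
          rw [ENNReal.div_add_div_same]
          norm_num
          rw [ENNReal.eq_div_iff] <;> norm_num
    refine (ENNReal.add_le_add_iff_right ?_).1 h3
    exact ENNReal.div_ne_top (by norm_num) (by norm_num)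
  have hprod : ∀ ω, ∏ q ∈ Finset.range (2 * m), X q ω = 2 ^ failures B (2 * m) S ω := by
    intro ω
    unfold failures
    rw [hX]
    simp only
    rw [Finset.prod_ite, Finset.prod_const_one, one_mul, Finset.prod_const]
  have hmain : ∫⁻ ω, ∏ q ∈ Finset.range (2 * m), X q ω ∂coinLaw ≤ (4 / 3) ^ (2 * m) := by
    rw [ProbabilityTheory.lintegral_prod_eq_prod_lintegral_of_indepFun _ _ hXi hXm]
    refine (Finset.prod_le_prod' fun q _ => hXint q).trans ?_
    simp
  have hmark := meas_ge_le_lintegral_div (μ := coinLaw)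
    (f := fun ω => ∏ q ∈ Finset.range (2 * m), X q ω)
    (Finset.measurable_prod _ fun q _ => hXm q).aemeasurable (ε := 2 ^ m) (by positivity)
    (ENNReal.pow_ne_top (by norm_num))
  have hsub : {ω | 2 * m ≤ 2 * failures B (2 * m) S ω} ⊆
      {ω | 2 ^ m ≤ ∏ q ∈ Finset.range (2 * m), X q ω} := by
    intro ω hω
    have hω : 2 * m ≤ 2 * failures B (2 * m) S ω := hω
    show 2 ^ m ≤ ∏ q ∈ Finset.range (2 * m), X q ω
    rw [hprod]
    exact pow_le_pow_right₀ (by norm_num) (by omega)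
  refine (measure_mono hsub).trans (hmark.trans ((ENNReal.div_le_div_right hmain _).trans ?_))
  have : (8 / 9 : ENNReal) = (4 / 3) ^ 2 / 2 := by
    refine (ENNReal.toReal_eq_toReal_iff' ?_ ?_).1 ?_
    · exact ENNReal.div_ne_top (by norm_num) (by norm_num)
    · exact ENNReal.div_ne_top (ENNReal.pow_ne_top (ENNReal.div_ne_top (by norm_num) (by norm_num)))
        (by norm_num)
    · simp only [ENNReal.toReal_div, ENNReal.toReal_pow, ENNReal.toReal_ofNat]
      norm_num
  rw [this, pow_mul]
  exact le_of_eq (by simp only [div_eq_mul_inv, mul_pow, ENNReal.inv_pow])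

/-- With `24 (N + 1)` repetitions, all of `2 ^ N` events of probability at least `2 / 3` occur in
most of the repetitions, with probability at least `2 / 3`. -/
theorem measure_forall_failures_lt {B H N : ℕ} (hH : H ≤ 2 ^ N) {S : ℕ → Set (ℕ → Bool)}
    (hS : ∀ h < H, DependsOnFirst B (S h)) (h : ∀ h < H, 2 / 3 ≤ coinLaw (S h)) :
    2 / 3 ≤ coinLaw {ω | ∀ h < H, 2 * failures B (24 * (N + 1)) (S h) ω < 24 * (N + 1)} := by
  set R := 24 * (N + 1) with hR
  have hRm : R = 2 * (12 * (N + 1)) := by rw [hR]; ring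
  set T : Set (ℕ → Bool) := {ω | ∀ h < H, 2 * failures B R (S h) ω < R} with hT
  have hcompl : Tᶜ ⊆ ⋃ h ∈ Finset.range H, {ω | R ≤ 2 * failures B R (S h) ω} := by
    intro ω hω
    have hω : ¬ ∀ h < H, 2 * failures B R (S h) ω < R := hω
    push Not at hω
    obtain ⟨h, hh, hle⟩ := hω
    simp only [Set.mem_iUnion, Finset.mem_range]
    exact ⟨h, hh, hle⟩
  -- Twelve pairs of repetitions per unit of `N + 1` give the failure bound `4 ^ (-(N + 1))`, which
  -- beats the `2 ^ N` events of the union bound; this explains the constant 24.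
  have h8 : (8 / 9 : ENNReal) ^ 12 ≤ 1 / 4 := by
    refine (ENNReal.toReal_le_toReal ?_ ?_).1 ?_
    · exact ENNReal.pow_ne_top (ENNReal.div_ne_top (by norm_num) (by norm_num))
    · exact ENNReal.div_ne_top (by norm_num) (by norm_num)
    · simp only [ENNReal.toReal_div, ENNReal.toReal_pow, ENNReal.toReal_ofNat, ENNReal.toReal_one]
      norm_num
  have hb : coinLaw Tᶜ ≤ 1 / 3 := by
    calc coinLaw Tᶜ ≤ ∑ h ∈ Finset.range H, coinLaw {ω | R ≤ 2 * failures B R (S h) ω} :=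
          (measure_mono hcompl).trans (measure_biUnion_finset_le _ _)
      _ ≤ ∑ h ∈ Finset.range H, (8 / 9 : ENNReal) ^ (12 * (N + 1)) := by
          refine Finset.sum_le_sum fun h' hh' => ?_
          rw [Finset.mem_range] at hh'
          rw [hRm]
          exact (hS h' hh').measure_failures_le (h h' hh') _
      _ = H * ((8 / 9 : ENNReal) ^ 12) ^ (N + 1) := by simp [pow_mul]
      _ ≤ 2 ^ N * (1 / 4) ^ (N + 1) := by
          gcongr
          exact_mod_cast hH
      _ ≤ 1 / 3 := by
          refine (ENNReal.toReal_le_toReal ?_ ?_).1 ?_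
          · exact ENNReal.mul_ne_top (ENNReal.pow_ne_top (by norm_num))
              (ENNReal.pow_ne_top (ENNReal.div_ne_top (by norm_num) (by norm_num)))
          · exact ENNReal.div_ne_top (by norm_num) (by norm_num)
          · simp only [ENNReal.toReal_div, ENNReal.toReal_pow, ENNReal.toReal_ofNat,
              ENNReal.toReal_one, ENNReal.toReal_mul]
            rw [pow_succ, ← mul_assoc, ← mul_pow]
            have : ((2 : ℝ) * (1 / 4)) ^ N ≤ 1 := pow_le_one₀ (by norm_num) (by norm_num)
            linarith
  have h1 : 1 ≤ coinLaw T + coinLaw Tᶜ := by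
    calc (1 : ENNReal) = coinLaw (T ∪ Tᶜ) := by rw [Set.union_compl_self, measure_univ]
      _ ≤ _ := measure_union_le _ _
  have h2 : (2 / 3 : ENNReal) + 1 / 3 ≤ coinLaw T + 1 / 3 := by
    calc (2 / 3 : ENNReal) + 1 / 3 = 1 := by
          rw [ENNReal.div_add_div_same]
          norm_num
          exact ENNReal.div_self (by norm_num) (by norm_num)
      _ ≤ coinLaw T + coinLaw Tᶜ := h1
      _ ≤ _ := by gcongr
  exact (ENNReal.add_le_add_iff_right (ENNReal.div_ne_top (by norm_num) (by norm_num))).1 h2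

end WordRAM

namespace DynGraph

/-! ## Runs of dynamic algorithms -/

/-- `A.ServesTo ω s ops tr s'`: as `A.Serves ω s ops tr`, and `s'` is the final configuration. -/
inductive Algorithm.ServesTo (A : Algorithm) (ω : ℕ → Bool) {n w : ℕ} :
    WordRAM.State w → List (Op n) → List (ℕ × ℕ) → WordRAM.State w → Prop where
  | nil (s : WordRAM.State w) : ServesTo A ω s [] [] s
  | cons {s s' s'' : WordRAM.State w} {o : Op n} {ops : List (Op n)} {k : ℕ} {tr : List (ℕ × ℕ)} :
      WordRAM.Exec ω (A.prog o) (o.feed s) k s' → ServesTo A ω s' ops tr s'' →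
        ServesTo A ω s (o :: ops) ((k, (s'.reg 0).toNat) :: tr) s''

section Serves

variable {A : Algorithm} {ω ω' : ℕ → Bool} {n w : ℕ} {s s' s'' : WordRAM.State w}
  {ops ops' : List (Op n)} {tr tr' : List (ℕ × ℕ)}

/-- The total number of steps in a record. -/
abbrev steps (tr : List (ℕ × ℕ)) : ℕ := (tr.map Prod.fst).sum

theorem Algorithm.Serves.exists_servesTo (h : A.Serves ω s ops tr) :
    ∃ s', A.ServesTo ω s ops tr s' := by
  induction h with
  | nil s => exact ⟨s, .nil s⟩
  | cons h _ ih =>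
    obtain ⟨s', hs'⟩ := ih
    exact ⟨s', .cons h hs'⟩

theorem Algorithm.ServesTo.serves (h : A.ServesTo ω s ops tr s') : A.Serves ω s ops tr := by
  induction h with
  | nil s => exact .nil s
  | cons h _ ih => exact .cons h ih

theorem Algorithm.ServesTo.of_append (h : A.ServesTo ω s (ops ++ ops') tr s'') :
    ∃ s' tr₁ tr₂, tr = tr₁ ++ tr₂ ∧ A.ServesTo ω s ops tr₁ s' ∧ A.ServesTo ω s' ops' tr₂ s'' := by
  induction ops generalizing s tr with
  | nil => exact ⟨s, [], tr, rfl, .nil s, h⟩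
  | cons o ops ih =>
    cases h with
    | cons h₁ h₂ =>
      obtain ⟨s', tr₁, tr₂, rfl, h₃, h₄⟩ := ih h₂
      exact ⟨s', _ :: tr₁, tr₂, rfl, .cons h₁ h₃, h₄⟩

theorem Algorithm.ServesTo.length_eq (h : A.ServesTo ω s ops tr s') : tr.length = ops.length := by
  induction h with
  | nil s => rfl
  | cons h _ ih => simp [ih]

theorem Algorithm.ServesTo.unique (h : A.ServesTo ω s ops tr s') (h' : A.ServesTo ω s ops tr' s'') :
    tr' = tr ∧ s'' = s' := by
  induction h generalizing tr' s'' with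
  | nil s => cases h'; simp
  | cons h₁ h₂ ih =>
    cases h' with
    | cons g₁ g₂ =>
      obtain ⟨rfl, rfl⟩ := h₁.unique g₁
      obtain ⟨rfl, rfl⟩ := ih g₂
      simp

theorem Op.feed_coins (o : Op n) : (o.feed s).coins = s.coins := by
  cases o <;> rfl

theorem Algorithm.ServesTo.coins_le (h : A.ServesTo ω s ops tr s') :
    s.coins ≤ s'.coins ∧ s'.coins ≤ s.coins + steps tr := by
  induction h with
  | nil s => simp
  | @cons s s' s'' o ops k tr h₁ h₂ ih =>
    have := h₁.coins_le
    rw [o.feed_coins] at this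
    simp only [steps, List.map_cons, List.sum_cons] at ih ⊢
    omega

theorem Algorithm.ServesTo.congr_coins (h : A.ServesTo ω s ops tr s')
    (hω : ∀ i, s.coins ≤ i → i < s.coins + steps tr → ω' i = ω i) :
    A.ServesTo ω' s ops tr s' := by
  induction h with
  | nil s => exact .nil s
  | @cons s s' s'' o ops k tr h₁ h₂ ih =>
    have := h₁.coins_le
    rw [o.feed_coins] at this
    simp only [steps, List.map_cons, List.sum_cons] at ih hω
    refine .cons (h₁.congr_coins fun i hi hi' => ?_) (ih fun i hi hi' => hω i (by omega) (by omega))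
    rw [o.feed_coins] at hi hi'
    exact hω i hi (by omega)

end Serves

section Run

variable {A : Algorithm} {par : Parameter} {ω ω' : ℕ → Bool} {n : ℕ} {x : Fin n}
  {E : List (Fin n × Fin n)} {ops : List (Op n)} {k k' : ℕ} {tr tr' : List (ℕ × ℕ)}

theorem Algorithm.Run.unique (h : A.Run par ω x E ops k tr) (h' : A.Run par ω x E ops k' tr') :
    k' = k ∧ tr' = tr := by
  obtain ⟨s, h₁, h₂⟩ := h
  obtain ⟨s', h₁', h₂'⟩ := h'
  obtain ⟨rfl, rfl⟩ := h₁.unique h₁'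
  obtain ⟨t, h₂⟩ := h₂.exists_servesTo
  obtain ⟨t', h₂'⟩ := h₂'.exists_servesTo
  exact ⟨rfl, (h₂.unique h₂').1⟩

theorem Algorithm.Run.congr_coins (h : A.Run par ω x E ops k tr)
    (hω : ∀ i < k + steps tr, ω' i = ω i) : A.Run par ω' x E ops k tr := by
  obtain ⟨s, h₁, h₂⟩ := h
  obtain ⟨t, h₂⟩ := h₂.exists_servesTo
  have := h₁.coins_le
  have h0 : (WordRAM.State.initial (A.width n) (par.input x E)).coins = 0 := rfl
  rw [h0] at this
  refine ⟨s, h₁.congr_coins fun i _ hi => hω i (by omega), (h₂.congr_coins fun i _ hi => ?_).serves⟩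
  exact hω i (by omega)

/-- The answer to operation number `i`. -/
def Algorithm.Answer (A : Algorithm) (par : Parameter) (ω : ℕ → Bool) {n : ℕ} (x : Fin n)
    (E : List (Fin n × Fin n)) (ops : List (Op n)) (i e : ℕ) : Prop :=
  ∃ k tr c, A.Run par ω x E ops k tr ∧ tr[i]? = some (c, e)

theorem Algorithm.Answer.unique {i e e' : ℕ} (h : A.Answer par ω x E ops i e)
    (h' : A.Answer par ω x E ops i e') : e' = e := by
  obtain ⟨k, tr, c, h₁, h₂⟩ := h
  obtain ⟨k', tr', c', h₁', h₂'⟩ := h'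
  obtain ⟨-, rfl⟩ := h₁.unique h₁'
  rw [h₂] at h₂'
  simpa using (Prod.mk.inj (Option.some.inj h₂')).2.symm

/-- A run of at most `B` steps cannot look beyond bit `B`; changing later bits leaves the run, and
hence the answer, as it is. -/
theorem dependsOnFirst_answer {B : ℕ}
    (hB : ∀ ω, ∃ k tr, A.Run par ω x E ops k tr ∧ k + steps tr ≤ B) (i : ℕ) (S : Set ℕ) :
    WordRAM.DependsOnFirst B {ω | ∃ e ∈ S, A.Answer par ω x E ops i e} := by
  rintro ω ω' hω ⟨e, he, k, tr, c, h₁, h₂⟩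
  obtain ⟨k', tr', h', hle⟩ := hB ω
  obtain ⟨rfl, rfl⟩ := h₁.unique h'
  exact ⟨e, he, _, _, c, h'.congr_coins fun i hi => (hω i (by omega)).symm, h₂⟩

end Run

/-! ## Operation sequences on the gadget graph -/

theorem valid_append {n : ℕ} {S : Setting} {M : ℕ} {G : SimpleGraph (Fin n)} {l l' : List (Op n)}
    (h : Valid S M G l) (h' : Valid S M (l.foldl Op.apply G) l') : Valid S M G (l ++ l') := by
  induction l generalizing G with
  | nil => exact h'
  | cons o l ih =>
    obtain ⟨h₁, h₂, h₃, h₄⟩ := h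
    exact ⟨h₁, h₂, h₃, ih h₄ h'⟩

namespace Gadget

variable {g : Gadget}

/-- The vertices of a list, as numbers. -/
def vals (L : List (Fin g.n)) : Set ℕ := {u | ∃ v ∈ L, (v : ℕ) = u}

theorem vals_nil : vals (g := g) [] = ∅ := by ext; simp [vals]

theorem vals_cons (v : Fin g.n) (L : List (Fin g.n)) : vals (v :: L) = insert (v : ℕ) (vals L) := by
  ext u
  simp [vals, eq_comm]

/-- The tip of leg 1 in copy 1 stays adjacent to the centre all the time; this keeps every
intermediate graph connected. -/
theorem inserts {S : Setting} (hS : S ≠ .decremental) {M : ℕ} (hM : 4 * g.n ≤ M) {D : Set ℕ}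
    (hD : D ⊆ g.Tips) (h1 : g.tip 1 1 ∈ D) {L : List (Fin g.n)} (hL : L.Nodup)
    (hT : ∀ v ∈ L, (v : ℕ) ∈ g.Tips) (hnew : ∀ v ∈ L, (v : ℕ) ∉ D) :
    Valid S M (g.graph D) (L.map (Op.insert g.centre)) ∧
      (L.map (Op.insert g.centre)).foldl Op.apply (g.graph D) = g.graph (D ∪ vals L) := by
  induction L generalizing D with
  | nil => exact ⟨admissible hD h1 hM, by simp [vals_nil]⟩
  | cons v L ih =>
    have hv := hT v (by simp)
    obtain ⟨hvL, hL⟩ := List.nodup_cons.1 hL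
    have hD' : insert (v : ℕ) D ⊆ g.Tips := Set.insert_subset hv hD
    have := ih hD' (Set.mem_insert_of_mem _ h1) hL (fun u hu => hT u (by simp [hu])) (by
      intro u hu h
      rcases h with h | h
      · exact hvL (Fin.ext h ▸ hu)
      · exact hnew u (by simp [hu]) h)
    rw [List.map_cons, List.foldl_cons, g.apply_insert D hv, vals_cons, Set.union_insert,
      ← Set.insert_union]
    refine ⟨⟨admissible hD h1 hM, ?_, ?_, ?_⟩, this.2⟩
    · cases S
      · trivial
      · trivial
      · exact absurd rfl hS
    · exact ⟨Tips.ne g hv, fun h => hnew v (by simp) ((g.graph_adj_centre hD hv).1 h)⟩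
    · rw [g.apply_insert D hv]
      exact this.1

theorem deletes {S : Setting} (hS : S ≠ .incremental) {M : ℕ} (hM : 4 * g.n ≤ M) {D : Set ℕ}
    (hD : D ⊆ g.Tips) (h1 : g.tip 1 1 ∈ D) {L : List (Fin g.n)} (hL : L.Nodup)
    (hT : ∀ v ∈ L, (v : ℕ) ∈ D) (hne : ∀ v ∈ L, (v : ℕ) ≠ g.tip 1 1) :
    Valid S M (g.graph D) (L.map (Op.delete g.centre)) ∧
      (L.map (Op.delete g.centre)).foldl Op.apply (g.graph D) = g.graph (D \ vals L) := by
  induction L generalizing D with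
  | nil => exact ⟨admissible hD h1 hM, by simp [vals_nil]⟩
  | cons v L ih =>
    have hv := hT v (by simp)
    obtain ⟨hvL, hL⟩ := List.nodup_cons.1 hL
    have hD' : D \ {(v : ℕ)} ⊆ g.Tips := Set.sdiff_subset.trans hD
    have := ih hD' ⟨h1, fun h => hne v (by simp) h.symm⟩ hL (fun u hu => ⟨hT u (by simp [hu]), by
      intro h
      exact hvL (Fin.ext h ▸ hu)⟩) (fun u hu => hne u (by simp [hu]))
    rw [List.map_cons, List.foldl_cons, g.apply_delete hD (hD hv), vals_cons]
    have e : D \ insert (v : ℕ) (vals L) = (D \ {(v : ℕ)}) \ vals L := by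
      ext u; simp only [Set.mem_sdiff, Set.mem_insert_iff, Set.mem_singleton_iff]; tauto
    rw [e]
    refine ⟨⟨admissible hD h1 hM, ?_, ?_, ?_⟩, this.2⟩
    · cases S
      · trivial
      · exact absurd rfl hS
      · trivial
    · exact (g.graph_adj_centre hD (hD hv)).2 hv
    · rw [g.apply_delete hD (hD hv)]
      exact this.1

/-! ### Phases -/

variable (g)

/-- The end of leg `i` of the spider `n₀` in copy `s`, as a vertex. -/
def tipV (s i : ℕ) : Fin g.n := Fin.ofNat g.n (g.tip s i)

/-- The tips of the indices `i + 3` with `act i`. -/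
def tipList (m : ℕ) (act : ℕ → Bool) : List (Fin g.n) :=
  (List.range m).flatMap fun i => if act i = true then [g.tipV 0 (i + 3), g.tipV 1 (i + 3)] else []

/-- The neighbours of the centre when the indices `i + 3` with `act i` are active. -/
def active (m : ℕ) (act : ℕ → Bool) : Set ℕ :=
  {u | u = g.tip 1 1 ∨ ∃ i < m, act i = true ∧ ∃ s < 2, u = g.tip s (i + 3)}

/-- The initial neighbours of the centre in a setting. -/
def initially (S : Setting) : ℕ → Bool := fun _ =>
  match S with
  | .decremental => true
  | _ => false

/-- The updates before the query of a phase. -/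
def ups (S : Setting) (m : ℕ) (act : ℕ → Bool) : List (Op g.n) :=
  match S with
  | .decremental => (g.tipList m fun i => !act i).map (Op.delete g.centre)
  | _ => (g.tipList m act).map (Op.insert g.centre)

/-- The updates after the query of a phase. -/
def downs (S : Setting) (m : ℕ) (act : ℕ → Bool) : List (Op g.n) :=
  match S with
  | .fullyDynamic => (g.tipList m act).map (Op.delete g.centre)
  | _ => []

variable {g}

theorem tipV_val {s i : ℕ} (hs : s < 2) (hi : i < g.I) : (g.tipV s i : ℕ) = g.tip s i := by
  simp [tipV, Fin.ofNat, Nat.mod_eq_of_lt (g.tip_lt hs hi)]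

theorem mem_tipList {m : ℕ} (hm : m + 3 ≤ g.I) {act : ℕ → Bool} {v : Fin g.n} :
    v ∈ g.tipList m act ↔ ∃ i < m, act i = true ∧ ∃ s < 2, (v : ℕ) = g.tip s (i + 3) := by
  unfold tipList
  simp only [List.mem_flatMap, List.mem_range, List.mem_ite_nil_right, List.mem_cons,
    List.not_mem_nil, or_false]
  constructor
  · rintro ⟨i, hi, ha, rfl | rfl⟩
    · exact ⟨i, hi, ha, 0, by norm_num, tipV_val (by norm_num) (by omega)⟩
    · exact ⟨i, hi, ha, 1, by norm_num, tipV_val (by norm_num) (by omega)⟩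
  · rintro ⟨i, hi, ha, s, hs, hv⟩
    refine ⟨i, hi, ha, ?_⟩
    interval_cases s
    · exact .inl (Fin.ext (by rw [hv, tipV_val (by norm_num) (by omega)]))
    · exact .inr (Fin.ext (by rw [hv, tipV_val (by norm_num) (by omega)]))

theorem nodup_tipList {m : ℕ} (hm : m + 3 ≤ g.I) (act : ℕ → Bool) : (g.tipList m act).Nodup := by
  unfold tipList
  have key : ∀ s i s' i', s < 2 → s' < 2 → i < m → i' < m →
      g.tipV s (i + 3) = g.tipV s' (i' + 3) → s = s' ∧ i = i' := by
    intro s i s' i' hs hs' hi hi' h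
    have := congrArg Fin.val h
    rw [tipV_val hs (by omega), tipV_val hs' (by omega)] at this
    have := g.tip_inj (by omega) (by omega) this
    omega
  rw [List.nodup_flatMap]
  constructor
  · intro i hi
    rw [List.mem_range] at hi
    split_ifs
    · refine List.nodup_cons.2 ⟨fun h => ?_, List.nodup_singleton _⟩
      have := key 0 i 1 i (by norm_num) (by norm_num) hi hi (by simpa using h)
      omega
    · exact List.nodup_nil
  · refine List.Nodup.pairwise_of_forall_ne List.nodup_range ?_
    intro i hi j hj hij v hv hv'
    rw [List.mem_range] at hi hj
    simp only [List.mem_ite_nil_right, List.mem_cons, List.not_mem_nil, or_false] at hv hv'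
    obtain ⟨-, rfl | rfl⟩ := hv <;> obtain ⟨-, h | h⟩ := hv'
    all_goals
      have := key _ _ _ _ (by norm_num) (by norm_num) hi hj h
      omega

theorem length_tipList_le (m : ℕ) (act : ℕ → Bool) : (g.tipList m act).length ≤ 2 * m := by
  unfold tipList
  rw [List.length_flatMap]
  refine (List.sum_le_card_nsmul _ 2 ?_).trans (by simp [mul_comm])
  intro x hx
  obtain ⟨i, -, rfl⟩ := List.mem_map.1 hx
  split_ifs <;> simp

theorem active_subset {m : ℕ} (hm : m + 3 ≤ g.I) (act : ℕ → Bool) : g.active m act ⊆ g.Tips := by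
  rintro u (rfl | ⟨i, hi, -, s, hs, rfl⟩)
  · exact ⟨1, 1, by norm_num, by omega, by simp, rfl⟩
  · exact ⟨s, i + 3, hs, by omega, by simp, rfl⟩

theorem mem_active (m : ℕ) (act : ℕ → Bool) : g.tip 1 1 ∈ g.active m act := .inl rfl

theorem tip_mem_active {m : ℕ} (hm : m + 3 ≤ g.I) {act : ℕ → Bool} {s i : ℕ} (hi : i < g.I) :
    g.tip s i ∈ g.active m act ↔
      (s = 1 ∧ i = 1) ∨ (s < 2 ∧ 3 ≤ i ∧ i < m + 3 ∧ act (i - 3) = true) := by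
  constructor
  · rintro (h | ⟨i', hi', ha, s', hs', h⟩)
    · exact .inl (g.tip_inj hi (by omega) h)
    · obtain ⟨rfl, rfl⟩ := g.tip_inj hi (by omega) h
      exact .inr ⟨hs', by omega, by omega, by simpa using ha⟩
  · rintro (⟨rfl, rfl⟩ | ⟨h₁, h₂, h₃, h₄⟩)
    · exact .inl rfl
    · exact .inr ⟨i - 3, by omega, h₄, s, h₁, by rw [Nat.sub_add_cancel h₂]⟩

theorem vals_tipList {m : ℕ} (hm : m + 3 ≤ g.I) (act : ℕ → Bool) :
    vals (g.tipList m act) = {u | ∃ i < m, act i = true ∧ ∃ s < 2, u = g.tip s (i + 3)} := by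
  ext u
  simp only [vals, Set.mem_ofPred_eq]
  constructor
  · rintro ⟨v, hv, rfl⟩
    exact (mem_tipList hm).1 hv
  · rintro ⟨i, hi, ha, s, hs, rfl⟩
    exact ⟨g.tipV s (i + 3), (mem_tipList hm).2 ⟨i, hi, ha, s, hs, tipV_val hs (by omega)⟩,
      tipV_val hs (by omega)⟩

section phases

variable {m : ℕ} (hm : m + 3 ≤ g.I) {M : ℕ} (hM : 4 * g.n ≤ M)

include hm hM

theorem ins_phase {S : Setting} (hS : S ≠ .decremental) (act : ℕ → Bool) :
    Valid S M (g.graph (g.active m fun _ => false)) ((g.tipList m act).map (Op.insert g.centre)) ∧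
    ((g.tipList m act).map (Op.insert g.centre)).foldl Op.apply
      (g.graph (g.active m fun _ => false)) = g.graph (g.active m act) := by
  have h := inserts hS hM (active_subset hm fun _ => false) (mem_active m _)
    (nodup_tipList hm act) (fun v hv => ?_) fun v hv hv' => ?_
  · refine ⟨h.1, h.2.trans (congrArg _ ?_)⟩
    rw [vals_tipList hm]
    ext u
    simp [active]
  · obtain ⟨i, hi, -, s, hs, h⟩ := (mem_tipList hm).1 hv
    exact ⟨s, i + 3, hs, by omega, by simp, h⟩
  · obtain ⟨i, hi, -, s, hs, h⟩ := (mem_tipList hm).1 hv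
    rw [h, tip_mem_active hm (by omega)] at hv'
    simp at hv'

theorem del_phase {S : Setting} (hS : S ≠ .incremental) {act act' : ℕ → Bool}
    (hle : ∀ i < m, act' i = true → act i = true) :
    Valid S M (g.graph (g.active m act)) ((g.tipList m act').map (Op.delete g.centre)) ∧
    ((g.tipList m act').map (Op.delete g.centre)).foldl Op.apply
      (g.graph (g.active m act)) = g.graph (g.active m fun i => act i && !act' i) := by
  have h := deletes hS hM (active_subset hm act) (mem_active m _)
    (nodup_tipList hm act') (fun v hv => ?_) fun v hv hv' => ?_
  · refine ⟨h.1, h.2.trans (congrArg _ ?_)⟩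
    rw [vals_tipList hm]
    ext u
    simp only [active, Set.mem_sdiff, Set.mem_ofPred_eq]
    constructor
    · rintro ⟨rfl | ⟨i, hi, ha, s, hs, rfl⟩, h2⟩
      · exact .inl rfl
      · refine .inr ⟨i, hi, ?_, s, hs, rfl⟩
        by_contra hc
        refine h2 ⟨i, hi, ?_, s, hs, rfl⟩
        simpa [ha] using hc
    · rintro (rfl | ⟨i, hi, ha, s, hs, rfl⟩)
      · refine ⟨.inl rfl, ?_⟩
        rintro ⟨i, hi, -, s, hs, h⟩
        have := g.tip_inj (by omega) (by omega) h
        omega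
      · simp only [Bool.and_eq_true, Bool.not_eq_true'] at ha
        refine ⟨.inr ⟨i, hi, ha.1, s, hs, rfl⟩, ?_⟩
        rintro ⟨i', hi', ha', s', hs', h⟩
        obtain ⟨rfl, h⟩ := g.tip_inj (by omega) (by omega) h
        obtain rfl : i = i' := by omega
        simp [ha.2] at ha'
  · obtain ⟨i, hi, ha, s, hs, h⟩ := (mem_tipList hm).1 hv
    exact .inr ⟨i, hi, hle i hi ha, s, hs, h⟩
  · obtain ⟨i, hi, ha, s, hs, h⟩ := (mem_tipList hm).1 hv
    have := g.tip_inj (by omega) (by omega) (h.symm.trans hv')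
    omega

/-- The graph queried in a phase is the same in all settings. Only the way there differs: missed
clauses are inserted, or, from the graph with all of them active, the others are deleted. -/
theorem ups_phase (S : Setting) (act : ℕ → Bool) :
    Valid S M (g.graph (g.active m (initially S))) (g.ups S m act) ∧
    (g.ups S m act).foldl Op.apply (g.graph (g.active m (initially S))) =
      g.graph (g.active m act) := by
  cases S
  · exact ins_phase hm hM (by simp) act
  · exact ins_phase hm hM (by simp) act
  · have := del_phase hm hM (S := .decremental) (by simp) (act := initially .decremental)
      (act' := fun i => !act i) (fun _ _ _ => rfl)
    refine ⟨this.1, this.2.trans (congrArg (fun f => g.graph (g.active m f)) ?_)⟩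
    funext i
    simp [initially]

theorem downs_phase (act : ℕ → Bool) :
    Valid .fullyDynamic M (g.graph (g.active m act)) (g.downs .fullyDynamic m act) ∧
    (g.downs .fullyDynamic m act).foldl Op.apply (g.graph (g.active m act)) =
      g.graph (g.active m (initially .fullyDynamic)) := by
  have := del_phase hm hM (S := .fullyDynamic) (by simp) (act := act) (act' := act)
    (fun _ _ h => h)
  refine ⟨this.1, this.2.trans (congrArg (fun f => g.graph (g.active m f)) ?_)⟩
  funext i
  simp [initially]

theorem valid_query (S : Setting) (act : ℕ → Bool) :
    Valid S M (g.graph (g.active m act)) [.query] := by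
  have := admissible (active_subset hm act) (mem_active m act) hM
  refine ⟨this, ?_, trivial, this⟩
  cases S <;> trivial

end phases

end Gadget

end DynGraph

namespace WordRAM

/-! ## Expressions and assignments

The registers from `60` to `99` are scratch registers. -/

/-- A register that is not a scratch register. -/
abbrev Keep (i : ℕ) : Prop := i < 60 ∨ 100 ≤ i

/-- Overwrite the scratch registers. -/
def NS.scr (σ : NS) (v : ℕ → ℕ) : NS :=
  { σ with reg := fun i => if Keep i then σ.reg i else v i }

@[simp] theorem NS.scr_reg (σ : NS) (v : ℕ → ℕ) (i : ℕ) :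
    (σ.scr v).reg i = if i < 60 ∨ 100 ≤ i then σ.reg i else v i := rfl
@[simp] theorem NS.scr_mem (σ : NS) (v : ℕ → ℕ) : (σ.scr v).mem = σ.mem := rfl
@[simp] theorem NS.scr_coins (σ : NS) (v : ℕ → ℕ) : (σ.scr v).coins = σ.coins := rfl

/-- The configurations agree except in the scratch registers. -/
structure NS.Agree (σ σ' : NS) : Prop where
  reg : ∀ i, Keep i → σ'.reg i = σ.reg i
  mem : σ'.mem = σ.mem
  coins : σ'.coins = σ.coins

theorem NS.Agree.eq_scr {σ σ' : NS} (h : σ.Agree σ') : σ' = σ.scr σ'.reg := by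
  obtain ⟨r, m, c⟩ := σ'
  obtain ⟨h1, h2, h3⟩ := h
  simp only at h1 h2 h3
  simp only [NS.scr, NS.mk.injEq]
  refine ⟨?_, h2, h3⟩
  funext i
  split_ifs with hi
  · exact h1 i hi
  · rfl

/-- Expressions have no side effects, so a list of assignments can be evaluated by `simp`; register
allocation and overflow are treated once and for all. -/
inductive Ex where
  | rg (i : ℕ)
  | lit (c : ℕ)
  | op (o : BinOp) (a b : Ex)
  | ld (a : Ex)

namespace Ex

instance : Add Ex := ⟨.op .add⟩
instance : Sub Ex := ⟨.op .sub⟩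
instance : Mul Ex := ⟨.op .mul⟩
instance : Div Ex := ⟨.op .div⟩
instance : Mod Ex := ⟨.op .mod⟩

/-- The value of an expression. -/
def val (σ : NS) : Ex → ℕ
  | rg i => σ.reg i
  | lit c => c
  | op o a b => o.nat (a.val σ) (b.val σ)
  | ld a => σ.mem (a.val σ)

/-- The evaluation does not overflow. -/
def Ok (w : ℕ) (σ : NS) : Ex → Prop
  | rg _ => True
  | lit c => c < 2 ^ w
  | op o a b => a.Ok w σ ∧ b.Ok w σ ∧ o.ok w (a.val σ) (b.val σ)
  | ld a => a.Ok w σ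

/-- The evaluation with result in register `d` uses the registers `d, d + 1, …` below `100`, and
reads no other scratch registers. -/
def wf : ℕ → Ex → Bool
  | d, rg i => decide (d < 100) && decide (Keep i)
  | d, lit _ => decide (d < 100)
  | d, op _ a b => a.wf d && b.wf (d + 1)
  | d, ld a => a.wf d

/-- Evaluation with result in register `d`. -/
def code : ℕ → Ex → List Instr
  | d, rg i => [.bin .bor d i i]
  | d, lit c => [.const d c]
  | d, op o a b => a.code d ++ (b.code (d + 1) ++ [.bin o d d (d + 1)])
  | d, ld a => a.code d ++ [.load d d]

variable {σ : NS} {w : ℕ} {a b : Ex}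

@[simp] theorem val_rg (i : ℕ) : (rg i).val σ = σ.reg i := rfl
@[simp] theorem val_lit (c : ℕ) : (lit c).val σ = c := rfl
@[simp] theorem val_ld : (ld a).val σ = σ.mem (a.val σ) := rfl
@[simp] theorem val_add : (a + b).val σ = a.val σ + b.val σ := rfl
@[simp] theorem val_sub : (a - b).val σ = a.val σ - b.val σ := rfl
@[simp] theorem val_mul : (a * b).val σ = a.val σ * b.val σ := rfl
@[simp] theorem val_div : (a / b).val σ = a.val σ / b.val σ := rfl
@[simp] theorem val_mod : (a % b).val σ = a.val σ % b.val σ := rfl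
@[simp] theorem val_band : (op .band a b).val σ = a.val σ &&& b.val σ := rfl
@[simp] theorem val_bor : (op .bor a b).val σ = a.val σ ||| b.val σ := rfl
@[simp] theorem val_shl : (op .shl a b).val σ = a.val σ <<< b.val σ := rfl
@[simp] theorem val_shr : (op .shr a b).val σ = a.val σ >>> b.val σ := rfl
@[simp] theorem val_lt : (op .lt a b).val σ = if a.val σ < b.val σ then 1 else 0 := rfl
@[simp] theorem val_eq : (op .eq a b).val σ = if a.val σ = b.val σ then 1 else 0 := rfl

@[simp] theorem ok_rg (i : ℕ) : (rg i).Ok w σ := trivial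
@[simp] theorem ok_lit (c : ℕ) : (lit c).Ok w σ ↔ c < 2 ^ w := .rfl
@[simp] theorem ok_ld : (ld a).Ok w σ ↔ a.Ok w σ := .rfl
@[simp] theorem ok_add : (a + b).Ok w σ ↔ a.Ok w σ ∧ b.Ok w σ ∧ a.val σ + b.val σ < 2 ^ w := .rfl
@[simp] theorem ok_sub : (a - b).Ok w σ ↔ a.Ok w σ ∧ b.Ok w σ ∧ b.val σ ≤ a.val σ := .rfl
@[simp] theorem ok_mul : (a * b).Ok w σ ↔ a.Ok w σ ∧ b.Ok w σ ∧ a.val σ * b.val σ < 2 ^ w := .rfl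
@[simp] theorem ok_div : (a / b).Ok w σ ↔ a.Ok w σ ∧ b.Ok w σ :=
  ⟨fun h => ⟨h.1, h.2.1⟩, fun h => ⟨h.1, h.2, trivial⟩⟩
@[simp] theorem ok_mod : (a % b).Ok w σ ↔ a.Ok w σ ∧ b.Ok w σ :=
  ⟨fun h => ⟨h.1, h.2.1⟩, fun h => ⟨h.1, h.2, trivial⟩⟩
@[simp] theorem ok_band : (op .band a b).Ok w σ ↔ a.Ok w σ ∧ b.Ok w σ :=
  ⟨fun h => ⟨h.1, h.2.1⟩, fun h => ⟨h.1, h.2, trivial⟩⟩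
@[simp] theorem ok_bor : (op .bor a b).Ok w σ ↔ a.Ok w σ ∧ b.Ok w σ :=
  ⟨fun h => ⟨h.1, h.2.1⟩, fun h => ⟨h.1, h.2, trivial⟩⟩
@[simp] theorem ok_shl : (op .shl a b).Ok w σ ↔
    a.Ok w σ ∧ b.Ok w σ ∧ a.val σ * 2 ^ b.val σ < 2 ^ w := .rfl
@[simp] theorem ok_shr : (op .shr a b).Ok w σ ↔ a.Ok w σ ∧ b.Ok w σ :=
  ⟨fun h => ⟨h.1, h.2.1⟩, fun h => ⟨h.1, h.2, trivial⟩⟩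
@[simp] theorem ok_lt : (op .lt a b).Ok w σ ↔ a.Ok w σ ∧ b.Ok w σ :=
  ⟨fun h => ⟨h.1, h.2.1⟩, fun h => ⟨h.1, h.2, trivial⟩⟩
@[simp] theorem ok_eq : (op .eq a b).Ok w σ ↔ a.Ok w σ ∧ b.Ok w σ :=
  ⟨fun h => ⟨h.1, h.2.1⟩, fun h => ⟨h.1, h.2, trivial⟩⟩

end Ex

theorem after_append (σ : NS) (l l' : List Instr) : after σ (l ++ l') = after (after σ l) l' := by
  induction l generalizing σ with
  | nil => rfl
  | cons i l ih => exact ih _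

theorem fits_append {w : ℕ} {σ : NS} {l l' : List Instr} :
    Fits w σ (l ++ l') ↔ Fits w σ l ∧ Fits w (after σ l) l' := by
  induction l generalizing σ with
  | nil => simp [Fits, after]
  | cons i l ih => simp [Fits, after, ih, and_assoc]

theorem Ex.val_agree {σ σ' : NS} (h : σ.Agree σ') {d : ℕ} {e : Ex} (he : e.wf d = true) :
    e.val σ' = e.val σ := by
  induction e generalizing d with
  | rg i => exact h.reg i (by simp [wf] at he; exact he.2)
  | lit c => rfl
  | op o a b iha ihb =>
    simp only [wf, Bool.and_eq_true] at he
    simp only [val, iha he.1, ihb he.2]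
  | ld a iha => simp only [val, iha he, h.mem]

theorem Ex.wf_lt {e : Ex} {d : ℕ} (h : e.wf d = true) : d < 100 := by
  induction e generalizing d with
  | rg i => simp [wf] at h; exact h.1
  | lit c => simpa [wf] using h
  | op o a b iha ihb => simp only [wf, Bool.and_eq_true] at h; exact iha h.1
  | ld a iha => exact iha h

/-- Stack discipline: the left operand is left in register `d` while the right one is evaluated from
`d + 1` on. Expressions read no scratch registers, so their values are not affected by what earlier
code left there. -/
theorem Ex.after_code {w : ℕ} {e : Ex} {d : ℕ} (he : e.wf d = true) (hd : 60 ≤ d) {σ σ' : NS}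
    (h : σ.Agree σ') :
    (after σ' (e.code d)).reg d = e.val σ ∧ σ.Agree (after σ' (e.code d)) ∧
      (∀ i < d, (after σ' (e.code d)).reg i = σ'.reg i) ∧ (e.Ok w σ → Fits w σ' (e.code d)) := by
  have set_agree : ∀ {d : ℕ} {σ' : NS} (x : ℕ), 60 ≤ d → d < 100 → σ.Agree σ' →
      σ.Agree (σ'.set d x) := by
    intro d σ' x hd hd' h
    refine ⟨fun i hi => ?_, h.mem, h.coins⟩
    rw [NS.set_reg, if_neg (by unfold Keep at hi; omega)]
    exact h.reg i hi
  induction e generalizing d σ' with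
  | rg i =>
    have hi : Keep i := by simp [wf] at he; exact he.2
    refine ⟨by simp [code, after, Instr.next, BinOp.nat, h.reg i hi],
      set_agree _ hd (wf_lt he) h, fun j hj => ?_, fun _ => ⟨trivial, trivial⟩⟩
    simp [code, after, Instr.next, hj.ne]
  | lit c =>
    refine ⟨by simp [code, after, Instr.next], set_agree _ hd (wf_lt he) h, fun j hj => ?_,
      fun h => ⟨h, trivial⟩⟩
    simp [code, after, Instr.next, hj.ne]
  | op o a b iha ihb =>
    have hd' := wf_lt he
    simp only [wf, Bool.and_eq_true] at he
    obtain ⟨a1, a2, a3, a4⟩ := iha he.1 hd h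
    obtain ⟨b1, b2, b3, b4⟩ := ihb he.2 (by omega) a2
    have hb : (after (after σ' (a.code d)) (b.code (d + 1))).reg d = a.val σ := by
      rw [b3 d (by omega), a1]
    simp only [code, after_append, fits_append]
    refine ⟨?_, set_agree _ hd hd' b2, fun j hj => ?_, fun h => ⟨a4 h.1, b4 h.2.1, ?_, trivial⟩⟩
    · simp [after, Instr.next, hb, b1, val]
    · simp [after, Instr.next, hj.ne, b3 j (by omega), a3 j hj]
    · simpa [Instr.ok, hb, b1] using h.2.2
  | ld a iha =>
    obtain ⟨a1, a2, a3, a4⟩ := iha he hd h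
    simp only [code, after_append, fits_append]
    refine ⟨?_, set_agree _ hd (wf_lt he) a2, fun j hj => ?_, fun h => ⟨a4 h, trivial, trivial⟩⟩
    · simp [after, Instr.next, a1, val, a2.mem]
    · simp [after, Instr.next, hj.ne, a3 j hj]

/-- Assignments to registers and to memory cells. -/
inductive Cmd where
  | asg (d : ℕ) (e : Ex)
  | put (a e : Ex)

namespace Cmd

def instrs : Cmd → List Instr
  | asg d e => e.code 62 ++ [.bin .bor d 62 62]
  | put a e => a.code 62 ++ (e.code 63 ++ [.store 62 63])

def wf : Cmd → Bool
  | asg d e => decide (Keep d) && e.wf 62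
  | put a e => a.wf 62 && e.wf 63

def next (σ : NS) : Cmd → NS
  | asg d e => σ.set d (e.val σ)
  | put a e => σ.put (a.val σ) (e.val σ)

def Ok (w : ℕ) (σ : NS) : Cmd → Prop
  | asg _ e => e.Ok w σ
  | put a e => a.Ok w σ ∧ e.Ok w σ

/-- The command assigns to register `i`. -/
def sets : Cmd → ℕ → Bool
  | asg d _, i => i == d
  | put _ _, _ => false

theorem after_instrs {w : ℕ} {c : Cmd} (hc : c.wf = true) {σ σ' : NS} (h : σ.Agree σ') :
    (c.next σ).Agree (after σ' c.instrs) ∧ (c.Ok w σ → Fits w σ' c.instrs) := by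
  cases c with
  | asg d e =>
    simp only [wf, Bool.and_eq_true, decide_eq_true_eq] at hc
    obtain ⟨a1, a2, a3, a4⟩ := Ex.after_code (w := w) hc.2 (by norm_num) h
    simp only [instrs, after_append, fits_append]
    refine ⟨⟨fun i hi => ?_, a2.mem, a2.coins⟩, fun h => ⟨a4 h, trivial, trivial⟩⟩
    simp only [after, Instr.next, NS.set_reg, BinOp.nat, a1, Nat.or_self, next]
    split_ifs
    · rfl
    · exact a2.reg i hi
  | put a e =>
    simp only [wf, Bool.and_eq_true] at hc
    obtain ⟨a1, a2, a3, a4⟩ := Ex.after_code (w := w) hc.1 (by norm_num) h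
    obtain ⟨b1, b2, b3, b4⟩ := Ex.after_code (w := w) hc.2 (by norm_num) a2
    simp only [instrs, after_append, fits_append]
    refine ⟨⟨fun i hi => b2.reg i hi, ?_, b2.coins⟩,
      fun h => ⟨a4 h.1, b4 h.2, trivial, trivial⟩⟩
    funext x
    simp [after, Instr.next, next, b1, b3 62, a1, b2.mem]

end Cmd

def cmds (l : List Cmd) : Prog := block (l.flatMap Cmd.instrs)

/-- The number of steps of a list of commands. -/
def cost (l : List Cmd) : ℕ := (l.flatMap Cmd.instrs).length + 1

/-- The effect of a list of commands, up to scratch registers. -/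
def effect (σ : NS) : List Cmd → NS
  | [] => σ
  | c :: l => effect (c.next σ) l

/-- No overflow occurs in a list of commands. -/
def CmdsOk (w : ℕ) (σ : NS) : List Cmd → Prop
  | [] => True
  | c :: l => c.Ok w σ ∧ CmdsOk w (c.next σ) l

/-- The final contents `v` of the scratch registers are arbitrary, so later proofs cannot depend on
temporary values. -/
theorem NWP.cmds {w : ℕ} (hw : 0 < w) {ω : ℕ → Bool} {l : List Cmd}
    (hl : l.all Cmd.wf = true) {σ : NS} {Φ : ℕ → NS → Prop} (hok : CmdsOk w σ l)
    (h : ∀ v, Φ (cost l) ((effect σ l).scr v)) : NWP w ω (cmds l) σ Φ := by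
  have key : ∀ {l : List Cmd}, l.all Cmd.wf = true → ∀ {σ σ' : NS}, σ.Agree σ' → CmdsOk w σ l →
      (effect σ l).Agree (after σ' (l.flatMap Cmd.instrs)) ∧
        Fits w σ' (l.flatMap Cmd.instrs) := by
    intro l
    induction l with
    | nil => intro _ σ σ' h _; exact ⟨h, trivial⟩
    | cons c l ih =>
      intro hl σ σ' h hok
      simp only [List.all_cons, Bool.and_eq_true] at hl
      obtain ⟨h1, h2⟩ := Cmd.after_instrs (w := w) hl.1 h
      obtain ⟨h3, h4⟩ := ih hl.2 h1 hok.2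
      rw [List.flatMap_cons, after_append, fits_append]
      exact ⟨h3, h2 hok.1, h4⟩
  obtain ⟨h1, h2⟩ := key hl (σ := σ) (σ' := σ) ⟨fun _ _ => rfl, rfl, rfl⟩ hok
  refine .blk hw h2 ?_
  rw [h1.eq_scr]
  exact h _

theorem block_append_writes {l l' : List Instr} {i : ℕ} :
    (block (l ++ l')).writes i = ((block l).writes i || (block l').writes i) := by
  induction l with
  | nil => simp [block, Prog.writes]
  | cons j l ih => simp [block, Prog.writes, ih, Bool.or_assoc]

theorem Ex.code_writes {e : Ex} {d i : ℕ} (he : e.wf d = true) (hd : 60 ≤ d) (hi : Keep i) :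
    (block (e.code d)).writes i = false := by
  unfold Keep at hi
  induction e generalizing d with
  | rg j => simp [wf] at he; simp [code, block, Prog.writes, Instr.prog]; omega
  | lit c => simp [wf] at he; simp [code, block, Prog.writes, Instr.prog]; omega
  | op o a b iha ihb =>
    simp only [wf, Bool.and_eq_true] at he
    have := wf_lt he.1
    simp only [code, block_append_writes, iha he.1 hd, ihb he.2 (by omega), Bool.false_or]
    simp [block, Prog.writes, Instr.prog]; omega
  | ld a iha =>
    have := wf_lt (e := a) he
    simp only [code, block_append_writes, iha he hd, Bool.false_or]
    simp [block, Prog.writes, Instr.prog]; omega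

theorem cmds_writes {l : List Cmd} (hl : l.all Cmd.wf = true) {i : ℕ} (hi : Keep i)
    (h : l.all (fun c => !c.sets i) = true) : (cmds l).writes i = false := by
  unfold cmds
  induction l with
  | nil => rfl
  | cons c l ih =>
    simp only [List.all_cons, Bool.and_eq_true, Bool.not_eq_true'] at hl h
    rw [List.flatMap_cons, block_append_writes, ih hl.2 h.2, Bool.or_false]
    cases c with
    | asg d e =>
      have hc := hl.1
      simp only [Cmd.wf, Bool.and_eq_true] at hc
      have hid := h.1
      simp only [Cmd.sets] at hid
      simp [Cmd.instrs, block_append_writes, Ex.code_writes hc.2 (by norm_num) hi, block,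
        Prog.writes, Instr.prog, hid]
    | put a e =>
      have hc := hl.1
      simp only [Cmd.wf, Bool.and_eq_true] at hc
      simp [Cmd.instrs, block_append_writes, Ex.code_writes hc.1 (by norm_num) hi,
        Ex.code_writes hc.2 (by norm_num) hi, block, Prog.writes, Instr.prog]

/-- If the expression is nonzero then `P` else `Q`. -/
def ifP (e : Ex) (P Q : Prog) : Prog := .seq (block (e.code 62)) (.cond 62 P Q)

theorem ifP_writes {e : Ex} {P Q : Prog} (he : e.wf 62 = true) {i : ℕ} (hi : Keep i) :
    (ifP e P Q).writes i = (P.writes i || Q.writes i) := by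
  simp [ifP, Prog.writes, Ex.code_writes he (by norm_num) hi]

theorem NWP.ifP {w : ℕ} (hw : 0 < w) {ω : ℕ → Bool} {e : Ex} {P Q : Prog}
    (he : e.wf 62 = true) {σ : NS} {Φ : ℕ → NS → Prop} (hok : e.Ok w σ)
    (h₁ : e.val σ ≠ 0 → ∀ v, NWP w ω P (σ.scr v) fun k => Φ ((e.code 62).length + 2 + k))
    (h₂ : e.val σ = 0 → ∀ v, NWP w ω Q (σ.scr v) fun k => Φ ((e.code 62).length + 2 + k)) :
    NWP w ω (ifP e P Q) σ Φ := by
  obtain ⟨a1, a2, a3, a4⟩ := Ex.after_code (w := w) he (by norm_num)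
    (σ := σ) (σ' := σ) ⟨fun _ _ => rfl, rfl, rfl⟩
  refine .seq (.blk hw (a4 hok) ?_)
  have e1 := a2.eq_scr
  refine .cond (fun hr => ?_) (fun hr => ?_)
  · rw [a1] at hr
    rw [e1]
    exact (h₁ hr _).mono fun k σ' h => by convert h using 1; omega
  · rw [a1] at hr
    rw [e1]
    exact (h₂ hr _).mono fun k σ' h => by convert h using 1; omega

theorem forP_writes {c lim : ℕ} {body : Prog} {i : ℕ} (hi : i ≠ rTest) :
    (forP c lim body).writes i = (i == c || body.writes i) := by
  have hi' : (i == rTest) = false := by simpa using hi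
  simp [forP, block, Prog.writes, Instr.prog, hi']
  rcases h : body.writes i <;> simp

/-- The counting loop with a bound `f i` for the time of round `i`. -/
theorem NWP.for {w : ℕ} {ω : ℕ → Bool} (hw : 0 < w) {c lim : ℕ} {body : Prog} {σ : NS}
    {Φ : ℕ → NS → Prop} (n : ℕ) (f : ℕ → ℕ) (Inv : ℕ → NS → Prop) (hn : σ.reg lim = n)
    (hc : body.writes c = false) (hlim : body.writes lim = false) (hcl : c ≠ lim)
    (hck : Keep c) (hlk : Keep lim)
    (h₀ : ∀ v, Inv 0 ((σ.set c 0).scr v))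
    (hstep : ∀ i < n, ∀ σ', Inv i σ' → σ'.reg c = i →
      (∀ j, Keep j → j ≠ c → body.writes j = false → σ'.reg j = σ.reg j) →
      (body.pure = true → σ'.mem = σ.mem) → σ'.Valid w →
      NWP w ω body σ' fun k σ'' => k ≤ f i ∧ ∀ v, Inv (i + 1) ((σ''.set c (i + 1)).scr v))
    (hend : ∀ k σ', k ≤ 4 + ∑ i ∈ Finset.range n, (f i + 5) → Inv n σ' →
      (∀ j, Keep j → j ≠ c → body.writes j = false → σ'.reg j = σ.reg j) →
      (body.pure = true → σ'.mem = σ.mem) → Φ k σ') :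
    NWP w ω (forP c lim body) σ Φ := by
  have hkt : ∀ {i}, Keep i → i ≠ rTest := by intro i hi; unfold Keep at hi; unfold rTest; omega
  have hct : c ≠ rTest := hkt hck
  have hlt : lim ≠ rTest := hkt hlk
  have hsc : ∀ (τ : NS) (v : ℕ), τ.set rTest v = τ.scr fun i => if i = rTest then v else τ.reg i := by
    intro τ v
    simp only [NS.set, NS.scr, NS.mk.injEq, and_true]
    funext i
    by_cases hi : i = 60
    · simp [hi]
    · simp [hi]
  refine NWP.count hw n (fun i t τ => Inv i τ ∧ t ≤ 3 + ∑ j ∈ Finset.range i, (f j + 5) ∧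
    (∀ j, Keep j → j ≠ c → body.writes j = false → τ.reg j = σ.reg j) ∧
    (body.pure = true → τ.mem = σ.mem)) hn hc hlim hcl hct hlt ?_ ?_ ?_
  · intro v
    refine ⟨hsc _ v ▸ h₀ _, by simp, fun j hj hjc _ => ?_, fun _ => rfl⟩
    simp [hjc, hkt hj]
  · rintro i hi t σ' ⟨hI, ht, hr, hm⟩ hci - hv
    refine (hstep i hi σ' hI hci hr hm hv).frame.mono ?_
    rintro k σ'' ⟨⟨hk, hI'⟩, hfr, hmem, -⟩ v
    refine ⟨hsc _ v ▸ hI' _, ?_, fun j hj hjc hw' => ?_, fun hp => ?_⟩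
    · rw [Finset.sum_range_succ]; omega
    · simp only [NS.set_reg, if_neg hjc, if_neg (hkt hj)]
      rw [hfr j hw', hr j hj hjc hw']
    · simp only [NS.set_mem]
      rw [hmem hp, hm hp]
  · rintro t σ' ⟨hI, ht, hr, hm⟩ -
    exact hend _ _ (by omega) hI hr hm

end WordRAM

namespace WordRAM

/-! ## Clauses in memory -/

/-- The list `l` occupies the cells `p, p + 1, …` -/
def Holds (μ : ℕ → ℕ) (p : ℕ) (l : List ℕ) : Prop := ∀ i < l.length, μ (p + i) = l.getD i 0

theorem holds_append {μ : ℕ → ℕ} {p : ℕ} {l l' : List ℕ} :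
    Holds μ p (l ++ l') ↔ Holds μ p l ∧ Holds μ (p + l.length) l' := by
  unfold Holds
  constructor
  · intro h
    refine ⟨fun i hi => ?_, fun i hi => ?_⟩
    · rw [h i (by simp; omega), List.getD_append _ _ _ _ hi]
    · rw [add_assoc, h _ (by simp; omega), List.getD_append_right _ _ _ _ (by omega)]
      simp
  · rintro ⟨h1, h2⟩ i hi
    rw [List.length_append] at hi
    by_cases hl : i < l.length
    · rw [h1 i hl, List.getD_append _ _ _ _ hl]
    · have := h2 (i - l.length) (by omega)
      rw [List.getD_append_right _ _ _ _ (by omega), ← this]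
      congr 1
      omega

theorem holds_cons {μ : ℕ → ℕ} {p x : ℕ} {l : List ℕ} :
    Holds μ p (x :: l) ↔ μ p = x ∧ Holds μ (p + 1) l := by
  have := holds_append (μ := μ) (p := p) (l := [x]) (l' := l)
  rw [List.singleton_append] at this
  rw [this]
  simp [Holds]

/-- Clauses one after the other, each preceded by its length. -/
def flat (cl : List (List ℕ)) : List ℕ := cl.flatMap fun C => C.length :: C

theorem length_le_flat (cl : List (List ℕ)) : cl.length ≤ (flat cl).length := by
  induction cl with
  | nil => simp
  | cons C cl ih => simp only [flat, List.flatMap_cons, List.length_append, List.length_cons] at *; omega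

theorem flat_take_succ (cl : List (List ℕ)) {i : ℕ} (hi : i < cl.length) :
    (flat (cl.take (i + 1))) = flat (cl.take i) ++ ((cl.getD i []).length :: cl.getD i []) := by
  rw [List.take_succ_eq_append_getElem hi, flat, List.flatMap_append]
  simp [flat, hi]

theorem flat_split (cl : List (List ℕ)) {i : ℕ} (hi : i < cl.length) :
    flat cl = flat (cl.take i) ++ ((cl.getD i []).length :: cl.getD i []) ++
      flat (cl.drop (i + 1)) := by
  rw [← flat_take_succ cl hi]
  unfold flat
  rw [← List.flatMap_append, List.take_append_drop]

/-- The literal `l` belongs to a variable between `lo` and `hi` and is true for the assignment `z`. -/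
def okLit (lo hi z l : ℕ) : Bool :=
  decide (lo ≤ l / 2) && decide (l / 2 < hi) && decide ((z >>> (l / 2)) % 2 = l % 2)

/-- No literal of the clause is true for the partial assignment. -/
def miss (lo hi z : ℕ) (C : List ℕ) : Bool := C.all fun l => !okLit lo hi z l

def walkBody : List Cmd := [.asg 47 (.rg 47 + .ld (.rg 47) + .lit 1)]

/-- Literal number `l` belongs to variable `l / 2` and requires the truth value `l % 2`. Register 46
is multiplied by 0 as soon as a true literal in the range occurs; products of comparison results
serve as conjunctions. -/
def litBody : List Cmd :=
  [.asg 47 (.rg 47 + .lit 1), .asg 50 (.ld (.rg 47)),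
   .asg 46 (.rg 46 * .op .eq (.op .eq (.op .lt (.rg 50 / .lit 2) (.rg 43)) (.lit 0) *
     .op .lt (.rg 50 / .lit 2) (.rg 44) *
     .op .eq (.op .shr (.rg 45) (.rg 50 / .lit 2) % .lit 2) (.rg 50 % .lit 2)) (.lit 0))]

/-- Register `46` tells whether the clause number `reg 42` is missed by the assignment `reg 45` of
the variables from `reg 43` to `reg 44`. -/
def evalP : Prog :=
  .seq (cmds [.asg 47 (.lit 2)])
    (.seq (forP 48 42 (cmds walkBody))
      (.seq (cmds [.asg 46 (.lit 1), .asg 49 (.ld (.rg 47))])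
        (forP 48 49 (cmds litBody))))

theorem evalP_writes {i : ℕ} (h : i < 46 ∨ 50 < i) (hi : Keep i) : evalP.writes i = false := by
  have h1 : i ≠ 46 := by omega
  have h2 : i ≠ 47 := by omega
  have h3 : i ≠ 48 := by omega
  have h4 : i ≠ 49 := by omega
  have h5 : i ≠ 50 := by omega
  have h6 : i ≠ rTest := by unfold Keep at hi; unfold rTest; omega
  have g1 : (46 == i) = false := by simpa using h1.symm
  simp only [evalP, Prog.writes, forP_writes h6]
  rw [cmds_writes (by rfl) hi (by simp [Cmd.sets, h2]),
    cmds_writes (by rfl) hi (by simp [walkBody, Cmd.sets, h2]),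
    cmds_writes (by rfl) hi (by simp [Cmd.sets, h1, h4]),
    cmds_writes (by rfl) hi (by simp [litBody, Cmd.sets, h1, h2, h5])]
  simp [h3]

theorem evalP_pure : evalP.pure = true := by rfl

-- Clauses have different lengths, so clause number `idx` is found by walking over the earlier ones;
-- its literals are then tested one by one. Both parts are linear in the size of the formula.
set_option maxHeartbeats 1000000 in
theorem NWP.evalP {w : ℕ} (hw : 2 < 2 ^ w) {ω : ℕ → Bool} {σ : NS} {Φ : ℕ → NS → Prop}
    {cl : List (List ℕ)} {idx lo hi z : ℕ} (hidx : idx < cl.length)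
    (hcl : Holds σ.mem 2 (flat cl)) (hlen : 3 + (flat cl).length < 2 ^ w)
    (h42 : σ.reg 42 = idx) (h43 : σ.reg 43 = lo) (h44 : σ.reg 44 = hi) (h45 : σ.reg 45 = z)
    (h : ∀ k σ', k ≤ 100 * ((flat cl).length + 1) → σ'.mem = σ.mem → σ'.coins = σ.coins →
      σ'.reg 46 = (if miss lo hi z (cl.getD idx []) = true then 1 else 0) →
      (∀ i, Keep i → i < 46 ∨ 50 < i → σ'.reg i = σ.reg i) → Φ k σ') :
    NWP w ω evalP σ Φ := by
  have hw0 : 0 < w := by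
    rcases Nat.eq_zero_or_pos w with rfl | h
    · norm_num at hw
    · exact h
  set C := cl.getD idx [] with hC
  have hsplit := flat_split cl hidx
  rw [← hC] at hsplit
  have hflat : (flat cl).length =
      (flat (cl.take idx)).length + (C.length + 1) + (flat (cl.drop (idx + 1))).length := by
    rw [hsplit]; simp; ring
  have hpos : ∀ i < cl.length, Holds σ.mem (2 + (flat (cl.take i)).length)
      ((cl.getD i []).length :: cl.getD i []) := by
    intro i hi
    have := flat_split cl hi
    rw [this, holds_append, holds_append] at hcl
    exact hcl.1.2
  have hposlen : ∀ i < cl.length, (flat (cl.take i)).length + ((cl.getD i []).length + 1) ≤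
      (flat cl).length := by
    intro i hi
    rw [flat_split cl hi]; simp
  have hidxle : idx ≤ (flat cl).length := hidx.le.trans (length_le_flat cl)
  have key : NWP w ω WordRAM.evalP σ fun k σ' => k ≤ 100 * ((flat cl).length + 1) ∧
      σ'.coins = σ.coins ∧ σ'.reg 46 = (if miss lo hi z C = true then 1 else 0) := by
    refine .seq (.cmds hw0 (by rfl) (by simp [CmdsOk, Cmd.Ok]; omega) fun v => ?_)
    simp only [effect, Cmd.next, Ex.val_lit]
    -- Register 47 points to the length cell of the current clause; the next one is that length plus
    -- 1 further on.
    refine .seq (.for hw0 idx (fun _ => cost walkBody) (fun i τ => τ.coins = σ.coins ∧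
      τ.reg 47 = 2 + (flat (cl.take i)).length) (by simp [h42])
      (cmds_writes (by rfl) (by decide) (by rfl)) (cmds_writes (by rfl) (by decide) (by rfl))
      (by decide) (by decide) (by decide) (fun v => by simp [flat]) ?_ ?_)
    · rintro i hi τ ⟨hc, h47⟩ h48 hr hm hv
      have hmem : τ.mem = σ.mem := hm (by rfl)
      have hp := hpos i (by omega)
      rw [holds_cons] at hp
      have hl := hposlen i (by omega)
      refine .cmds hw0 (by rfl) ?_ fun v => ⟨le_rfl, fun v => ?_⟩
      · simp [-List.getD_eq_getElem?_getD, walkBody, CmdsOk, Cmd.Ok, h47, hmem, hp.1]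
        omega
      · simp [-List.getD_eq_getElem?_getD, walkBody, effect, Cmd.next, h47, hmem, hp.1, hc, flat_take_succ cl (i := i) (by omega)]
        omega
    · rintro k₁ τ hk₁ ⟨hc, h47⟩ hr hm
      have hmem : τ.mem = σ.mem := hm (by rfl)
      have hp := hpos idx hidx
      rw [← hC, holds_cons] at hp
      have r43 := hr 43 (by decide) (by decide) (cmds_writes (by rfl) (by decide) (by rfl))
      have r44 := hr 44 (by decide) (by decide) (cmds_writes (by rfl) (by decide) (by rfl))
      have r45 := hr 45 (by decide) (by decide) (cmds_writes (by rfl) (by decide) (by rfl))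
      simp at r43 r44 r45
      rw [h43] at r43
      rw [h44] at r44
      rw [h45] at r45
      refine .seq (.cmds hw0 (by rfl) (by simp [CmdsOk, Cmd.Ok]; omega) fun v => ?_)
      refine .for hw0 C.length (fun _ => cost litBody) (fun i τ' => τ'.coins = σ.coins ∧
        τ'.reg 47 = 2 + (flat (cl.take idx)).length + i ∧
        τ'.reg 46 = if miss lo hi z (C.take i) = true then 1 else 0)
        (by simp [-List.getD_eq_getElem?_getD, effect, Cmd.next, h47, hmem, hp.1])
        (cmds_writes (by rfl) (by decide) (by rfl)) (cmds_writes (by rfl) (by decide) (by rfl))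
        (by decide) (by decide) (by decide) (fun v => ?_) ?_ ?_
      · simp [effect, Cmd.next, hc, h47, miss]
      · rintro i hi' τ' ⟨hc', h47', h46'⟩ h48 hr' hm' hv
        have hmem' : τ'.mem = σ.mem := (hm' (by rfl)).trans hmem
        have s43 := hr' 43 (by decide) (by decide) (cmds_writes (by rfl) (by decide) (by rfl))
        have s44 := hr' 44 (by decide) (by decide) (cmds_writes (by rfl) (by decide) (by rfl))
        have s45 := hr' 45 (by decide) (by decide) (cmds_writes (by rfl) (by decide) (by rfl))
        simp [effect, Cmd.next, r43, r44, r45] at s43 s44 s45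
        have hlit : σ.mem (2 + (flat (cl.take idx)).length + i + 1) = C.getD i 0 := by
          rw [← hp.2 i hi']; congr 1; omega
        have hok : miss lo hi z (C.take (i + 1)) =
            (miss lo hi z (C.take i) && !okLit lo hi z (C.getD i 0)) := by
          unfold miss
          rw [List.take_succ_eq_append_getElem hi', List.all_append]
          simp [hi']
        refine .cmds hw0 (by rfl) ?_ fun v => ⟨le_rfl, fun v => ⟨?_, ?_, ?_⟩⟩
        · simp [-List.getD_eq_getElem?_getD, litBody, CmdsOk, Cmd.Ok, Cmd.next, h47', h46']
          constructorm* _ ∧ _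
          all_goals first | omega | (split_ifs <;> simp <;> omega)
        · simp [-List.getD_eq_getElem?_getD, litBody, effect, Cmd.next, hc']
        · simp [-List.getD_eq_getElem?_getD, litBody, effect, Cmd.next, h47']; omega
        · rw [hok]
          simp [-List.getD_eq_getElem?_getD, litBody, effect, Cmd.next, h47', h46', hmem', hlit, s43, s44, s45, okLit]
          by_cases a0 : miss lo hi z (C.take i) = true <;>
          by_cases a1 : C.getD i 0 / 2 < lo <;> by_cases a2 : C.getD i 0 / 2 < hi <;>
          by_cases a3 : z >>> (C.getD i 0 / 2) % 2 = C.getD i 0 % 2 <;>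
          simp [-List.getD_eq_getElem?_getD, a0, a1, a2, a3]
      · rintro k₂ τ' hk₂ ⟨hc', -, h46'⟩ hr' hm'
        have e1 : cost walkBody ≤ 20 := by decide
        have e2 : cost litBody ≤ 60 := by decide
        have e3 : cost [.asg 46 (.lit 1), .asg 49 (.ld (.rg 47))] ≤ 20 := by decide
        have e4 : cost [.asg 47 (.lit 2)] ≤ 10 := by decide
        simp only [Finset.sum_const, Finset.card_range, smul_eq_mul] at hk₁ hk₂
        have b1 : idx * (cost walkBody + 5) ≤ (flat (cl.take idx)).length * 25 := by
          refine Nat.mul_le_mul ?_ (by omega)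
          have := length_le_flat (cl.take idx)
          rw [List.length_take] at this
          omega
        have b2 : C.length * (cost litBody + 5) ≤ C.length * 65 := Nat.mul_le_mul le_rfl (by omega)
        refine ⟨?_, hc', by rw [h46', List.take_length]⟩
        omega
  refine key.frame.mono ?_
  rintro k σ' ⟨⟨h1, h2, h3⟩, h4, h5, -⟩
  exact h k σ' h1 (h5 evalP_pure) h2 h3 fun i hi hi' => h4 i (evalP_writes hi' hi)

end WordRAM

namespace WordRAM

/-! ## Writing lists -/

/-- The memory after writing the list `l` to the cells `p, p + 1, …` -/
def write (μ : ℕ → ℕ) (p : ℕ) (l : List ℕ) (x : ℕ) : ℕ :=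
  if p ≤ x ∧ x < p + l.length then l.getD (x - p) 0 else μ x

theorem write_nil (μ : ℕ → ℕ) (p : ℕ) : write μ p [] = μ := by
  funext x
  simp [write]

theorem write_concat (μ : ℕ → ℕ) (p : ℕ) (l : List ℕ) (y : ℕ) :
    (fun x => if x = p + l.length then y else write μ p l x) = write μ p (l ++ [y]) := by
  funext x
  simp only [write, List.length_append, List.length_singleton]
  by_cases hx : x = p + l.length
  · subst hx
    simp
  · rw [if_neg hx]
    by_cases h : p ≤ x ∧ x < p + l.length
    · rw [if_pos h, if_pos (by omega), List.getD_append _ _ _ _ (by omega)]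
    · rw [if_neg h, if_neg (by omega)]

theorem write_cons (μ : ℕ → ℕ) (p : ℕ) (l : List ℕ) (y : ℕ) :
    (fun x => if x = p then y else write μ (p + 1) l x) = write μ p (y :: l) := by
  funext x
  simp only [write, List.length_cons]
  by_cases hx : x = p
  · subst hx
    simp
  · rw [if_neg hx]
    by_cases h : p + 1 ≤ x ∧ x < p + 1 + l.length
    · rw [if_pos h, if_pos (by omega)]
      obtain ⟨t, rfl⟩ : ∃ t, x = p + 1 + t := ⟨x - (p + 1), by omega⟩
      rw [show p + 1 + t - p = t + 1 by omega, show p + 1 + t - (p + 1) = t by omega]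
      simp
    · rw [if_neg h, if_neg (by omega)]

theorem NS.agree_scr (σ : NS) (v : ℕ → ℕ) : σ.Agree (σ.scr v) :=
  ⟨fun _ hi => if_pos hi, rfl, rfl⟩

theorem Ex.Ok.agree {W : ℕ} {σ σ' : NS} (h : σ.Agree σ') {e : Ex} {d : ℕ} (he : e.wf d = true)
    (ho : e.Ok W σ) : e.Ok W σ' := by
  induction e generalizing d with
  | rg i => trivial
  | lit c => exact ho
  | op o a b iha ihb =>
    simp only [Ex.wf, Bool.and_eq_true] at he
    refine ⟨iha he.1 ho.1, ihb he.2 ho.2.1, ?_⟩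
    rw [Ex.val_agree h he.1, Ex.val_agree h he.2]
    exact ho.2.2
  | ld a iha => exact iha he ho

/-- Write the pair of register `39` and `e` to the cell `reg 38`, if `c` holds. -/
def emitP (c e : Ex) : Prog :=
  ifP c (cmds [.asg 53 e, .put (.rg 38) (.op .band (.rg 39) (.rg 10)),
    .put (.rg 38 + .lit 1) (.op .band (.rg 53) (.rg 10)), .asg 38 (.rg 38 + .lit 2)]) .skip

/-- The pairs in `l` have been written to the cells `p, p + 1, …` -/
structure Emitted (μ : ℕ → ℕ) (p w : ℕ) (l : List (ℕ × ℕ)) (σ : NS) : Prop where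
  ptr : σ.reg 38 = p + 2 * l.length
  mem : σ.mem = write μ p (l.flatMap fun q => [q.1 % 2 ^ w, q.2 % 2 ^ w])

theorem length_flatMap_pair {α : Type*} (f g : α → ℕ) (l : List α) :
    (l.flatMap fun q => [f q, g q]).length = 2 * l.length := by
  simp [List.length_flatMap, mul_comm]

/-- The proposition `b` is the mathematical meaning of the test `c`. The expression `e` only has to
be free of overflow when `b` holds, which matters for the subtractions in the arcs. -/
theorem NWP.emitP {W : ℕ} (hW : 2 < 2 ^ W) {ω : ℕ → Bool} {c e : Ex} (hc : c.wf 62 = true)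
    (he : e.wf 62 = true) {σ : NS} {Φ : ℕ → NS → Prop} {μ : ℕ → ℕ} {p w u v : ℕ}
    {l : List (ℕ × ℕ)} (hE : Emitted μ p w l σ) (h10 : σ.reg 10 = 2 ^ w - 1)
    (h39 : σ.reg 39 = u) (hco : c.Ok W σ) {b : Prop} [Decidable b] (hb : c.val σ ≠ 0 ↔ b)
    (hv : b → e.Ok W σ ∧ e.val σ = v) (hfit : p + 2 * l.length + 2 < 2 ^ W)
    (h : ∀ k σ', k ≤ (c.code 62).length + (e.code 62).length + 40 →
      Emitted μ p w (l ++ if b then [(u, v)] else []) σ' → σ'.coins = σ.coins →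
      (∀ i, Keep i → i ≠ 38 → i ≠ 53 → σ'.reg i = σ.reg i) → Φ k σ') :
    NWP W ω (emitP c e) σ Φ := by
  have hW0 : 0 < W := by
    rcases Nat.eq_zero_or_pos W with rfl | h
    · norm_num at hW
    · exact h
  refine .ifP hW0 hc hco (fun h1 s => ?_) fun h0 s => ?_
  · obtain ⟨ho, hv⟩ := hv (hb.1 h1)
    have e1 : e.val (σ.scr s) = e.val σ := Ex.val_agree (σ.agree_scr s) he
    have e2 : e.Ok W (σ.scr s) := Ex.Ok.agree (σ.agree_scr s) he ho
    have hptr := hE.ptr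
    refine .cmds hW0 (by simp [Cmd.wf, Ex.wf, he]) ?_ fun s' => h _ _ ?_ ⟨?_, ?_⟩ ?_ ?_
    · simp [CmdsOk, Cmd.Ok, Cmd.next, e2, hptr]
      omega
    · simp [cost, Cmd.instrs, Ex.code]
      omega
    · simp [effect, Cmd.next, hptr, if_pos (hb.1 h1)]
      omega
    · simp only [if_pos (hb.1 h1), List.flatMap_append]
      have hl := length_flatMap_pair (fun q : ℕ × ℕ => q.1 % 2 ^ w) (fun q => q.2 % 2 ^ w) l
      rw [show [(u, v)].flatMap (fun q : ℕ × ℕ => [q.1 % 2 ^ w, q.2 % 2 ^ w]) =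
        [u % 2 ^ w] ++ [v % 2 ^ w] by simp, ← List.append_assoc, ← write_concat,
        ← write_concat, ← hE.mem, List.length_append, hl]
      funext x
      simp [effect, Cmd.next, hptr, e1, hv, h39, h10]
      rfl
    · simp [effect, Cmd.next]
    · intro i hi h38 h53
      simp only [Keep] at hi
      simp [effect, Cmd.next, hi, h38, h53]
  · have hnb : ¬ b := fun hb' => hb.2 hb' h0
    refine .skip (h _ _ (by omega) ⟨?_, ?_⟩ rfl ?_)
    · simp [hnb, hE.ptr]
    · simp [hnb, hE.mem]
    · intro i hi _ _
      simp only [Keep] at hi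
      simp [hi]

theorem emitP_writes {c e : Ex} (hc : c.wf 62 = true) (he : e.wf 62 = true) {i : ℕ} (hi : Keep i)
    (h38 : i ≠ 38) (h53 : i ≠ 53) : (emitP c e).writes i = false := by
  unfold emitP
  rw [ifP_writes hc hi, cmds_writes (by simp [Cmd.wf, Ex.wf, he]) hi
    (by simp [Cmd.sets, h38, h53])]
  rfl

end WordRAM

namespace DynGraph

open WordRAM

/-! ## The layout of the reduction -/

/-- The parameters of the reduction: the gadget graph, `N` variables, `k` of them in the graph, the
clauses, the length `w` of the words of the simulated algorithm, the number `H` of phases, the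
number `B` of random bits for a run, the number `R` of runs, the start `T₀` of the tape, and the
size `Z` of a part of a region. -/
structure Layout where
  g : Gadget
  N : ℕ
  k : ℕ
  cl : List (List ℕ)
  w : ℕ
  H : ℕ
  B : ℕ
  R : ℕ
  T₀ : ℕ
  Z : ℕ

namespace Layout

variable (L : Layout)

/-- The start of the votes. -/
def VB : ℕ := L.T₀ + L.R * L.B
/-- The start of the regions. -/
def V : ℕ := L.VB + L.H
/-- The start of the region of run `q`. -/
def base (q : ℕ) : ℕ := L.V + 3 * L.Z * q

/-- The parameters fit together, and the words of length `W` are long enough. -/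
structure Ok (W : ℕ) : Prop where
  I_eq : L.g.I = L.cl.length + 3
  n₀_eq : L.g.n₀ = 2 ^ L.k
  conn_eq : ∀ a i, L.g.conn a i =
    (decide (i = 2) || (decide (3 ≤ i) && miss 0 L.k a (L.cl.getD (i - 3) [])))
  tape : 2 + (flat L.cl).length ≤ L.T₀
  -- A part of a region has room for the simulated memory and also for the whole edge list, which
  -- may be longer than the `2 ^ L.w` addressable cells.
  size : 2 ^ L.w + 8 * L.g.n + 16 ≤ L.Z
  runs : 0 < L.R
  top : L.V + 3 * L.Z * L.R < 2 ^ W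
  word : L.w ≤ W
  phases : L.H * L.g.n₀ < 2 ^ W

/-- The registers hold the parameters. -/
structure Env (σ : NS) : Prop where
  r1 : σ.reg 1 = L.N
  r2 : σ.reg 2 = L.cl.length
  r3 : σ.reg 3 = L.k
  r4 : σ.reg 4 = L.g.n₀
  r5 : σ.reg 5 = L.g.I
  r6 : σ.reg 6 = L.g.r
  r7 : σ.reg 7 = L.g.n
  r10 : σ.reg 10 = 2 ^ L.w - 1
  r11 : σ.reg 11 = L.H
  r12 : σ.reg 12 = L.B
  r13 : σ.reg 13 = L.R
  r14 : σ.reg 14 = L.T₀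
  r15 : σ.reg 15 = L.VB
  r16 : σ.reg 16 = L.V
  r17 : σ.reg 17 = L.Z
  r18 : σ.reg 18 = L.g.ctr
  r20 : σ.reg 20 = L.R * L.B

variable {L}

theorem Env.congr {σ σ' : NS} (h : L.Env σ) (hr : ∀ i, 1 ≤ i → i ≤ 20 → σ'.reg i = σ.reg i) :
    L.Env σ' where
  r1 := (hr 1 (by norm_num) (by norm_num)).trans h.r1
  r2 := (hr 2 (by norm_num) (by norm_num)).trans h.r2
  r3 := (hr 3 (by norm_num) (by norm_num)).trans h.r3
  r4 := (hr 4 (by norm_num) (by norm_num)).trans h.r4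
  r5 := (hr 5 (by norm_num) (by norm_num)).trans h.r5
  r6 := (hr 6 (by norm_num) (by norm_num)).trans h.r6
  r7 := (hr 7 (by norm_num) (by norm_num)).trans h.r7
  r10 := (hr 10 (by norm_num) (by norm_num)).trans h.r10
  r11 := (hr 11 (by norm_num) (by norm_num)).trans h.r11
  r12 := (hr 12 (by norm_num) (by norm_num)).trans h.r12
  r13 := (hr 13 (by norm_num) (by norm_num)).trans h.r13
  r14 := (hr 14 (by norm_num) (by norm_num)).trans h.r14
  r15 := (hr 15 (by norm_num) (by norm_num)).trans h.r15
  r16 := (hr 16 (by norm_num) (by norm_num)).trans h.r16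
  r17 := (hr 17 (by norm_num) (by norm_num)).trans h.r17
  r18 := (hr 18 (by norm_num) (by norm_num)).trans h.r18
  r20 := (hr 20 (by norm_num) (by norm_num)).trans h.r20

section size

variable {W : ℕ} (h : L.Ok W)
include h

theorem Ok.base_add_le {q : ℕ} (hq : q < L.R) : L.base q + 3 * L.Z < 2 ^ W := by
  have := h.top
  have : 3 * L.Z * (q + 1) ≤ 3 * L.Z * L.R := Nat.mul_le_mul_left _ hq
  unfold base
  rw [Nat.mul_add, Nat.mul_one] at this
  omega

theorem Ok.Z_lt : 3 * L.Z < 2 ^ W := by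
  have := h.base_add_le h.runs
  omega

theorem Ok.n_lt : 8 * L.g.n + 16 < 2 ^ W := by
  have := h.Z_lt
  have := h.size
  have := Nat.two_pow_pos L.w
  omega

theorem Ok.two_lt : 2 < 2 ^ W := by
  have := h.n_lt
  omega

theorem Ok.W_pos : 0 < W := by
  rcases Nat.eq_zero_or_pos W with rfl | h'
  · have := h.two_lt; norm_num at this
  · exact h'

theorem Ok.cl_lt : 3 + (flat L.cl).length < 2 ^ W := by
  have := h.tape
  have := h.Z_lt
  have := h.size
  have := h.base_add_le h.runs
  have := Nat.two_pow_pos L.w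
  unfold base V VB at *
  omega

end size

end Layout

/-! ## The initial graph -/

/-- The test whether the vertex in the registers `39` (number), `40` (position on its leg), `41`
(leg), `51` (spider) and `52` (copy) is a neighbour of the centre initially. -/
def Setting.test (S : Setting) : Ex :=
  .op .eq (.rg 40 + .lit 1) (.rg 6) * .op .eq (.rg 51) (.rg 4) *
    match S with
    | .decremental => .op .bor (.op .eq (.rg 41) (.lit 1) * .op .eq (.rg 52) (.lit 1))
        (.op .lt (.lit 2) (.rg 41))
    | _ => .op .eq (.rg 41) (.lit 1) * .op .eq (.rg 52) (.lit 1)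

/-- The cells before the list of edges. -/
def Parameter.header : Parameter → ℕ
  | .eccentricity => 3
  | _ => 2

/-- Register `46` tells whether leg `reg 41` is connected to spider `reg 51`. -/
def connP : Prog :=
  ifP (.op .lt (.rg 41) (.lit 3)) (cmds [.asg 46 (.op .eq (.rg 41) (.lit 2))])
    (.seq (cmds [.asg 42 (.rg 41 - .lit 3), .asg 43 (.lit 0), .asg 44 (.rg 3), .asg 45 (.rg 51)])
      evalP)

/-- The four tests come in the same order as the four kinds of arcs in `Gadget.arcs`, so the output
agrees with that list literally. -/
def vertexP (S : Setting) : Prog :=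
  .seq (cmds [.asg 40 (.rg 39 % .rg 6), .asg 41 (.rg 39 / .rg 6 % .rg 5),
      .asg 51 (.rg 39 / .rg 6 / .rg 5 % (.rg 4 + .lit 1)),
      .asg 52 (.rg 39 / .rg 6 / .rg 5 / (.rg 4 + .lit 1))])
    (.seq (emitP (.op .lt (.rg 40 + .lit 1) (.rg 6)) (.rg 39 + .lit 1))
      (.seq (emitP (.op .eq (.rg 40) (.lit 0) * .op .lt (.lit 0) (.rg 41))
          (.rg 39 - .rg 41 * .rg 6))
        (.seq connP
          (.seq (emitP (.op .eq (.rg 40 + .lit 1) (.rg 6) * .op .lt (.rg 51) (.rg 4) * .rg 46)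
              (.rg 39 + (.rg 4 - .rg 51) * (.rg 5 * .rg 6)))
            (emitP S.test (.rg 18))))))

/-- Write the cells before the list of edges. -/
def Parameter.headerCmds (par : Parameter) : List Cmd :=
  (match par with
    | .eccentricity => [.put (.rg 31 + .lit 2) (.op .band (.rg 18) (.rg 10))]
    | _ => []) ++
  [.put (.rg 31 + .lit 1) (.op .band ((.rg 38 - (.rg 31 + .lit par.header)) / .lit 2) (.rg 10)),
   .put (.rg 31) (.op .band (.rg 7) (.rg 10))]

/-- Write the initial graph to the cells from `reg 31` on. -/
def graphP (S : Setting) (par : Parameter) : Prog :=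
  .seq (cmds [.asg 38 (.rg 31 + .lit par.header)])
    (.seq (forP 39 7 (vertexP S))
      (cmds par.headerCmds))

theorem connP_writes {i : ℕ} (h : i < 42 ∨ 50 < i) (hi : Keep i) : connP.writes i = false := by
  have h1 : i ≠ 46 := by omega
  have h2 : i ≠ 42 := by omega
  have h3 : i ≠ 43 := by omega
  have h4 : i ≠ 44 := by omega
  have h5 : i ≠ 45 := by omega
  unfold connP
  rw [ifP_writes (by rfl) hi]
  simp only [Prog.writes]
  rw [evalP_writes (by omega) hi, cmds_writes (by rfl) hi (by simp [Cmd.sets, h1]),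
    cmds_writes (by rfl) hi (by simp [Cmd.sets, h2, h3, h4, h5])]
  rfl

theorem vertexP_writes (S : Setting) {i : ℕ} (h : i < 38 ∨ i = 39 ∨ 53 < i) (hi : Keep i) :
    (vertexP S).writes i = false := by
  have h1 : i ≠ 38 := by omega
  have h2 : i ≠ 53 := by omega
  have h3 : i ≠ 40 := by omega
  have h4 : i ≠ 41 := by omega
  have h5 : i ≠ 51 := by omega
  have h6 : i ≠ 52 := by omega
  simp only [vertexP, Prog.writes]
  rw [connP_writes (by omega) hi, cmds_writes (by rfl) hi (by simp [Cmd.sets, h3, h4, h5, h6]),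
    emitP_writes (by rfl) (by rfl) hi h1 h2, emitP_writes (by rfl) (by rfl) hi h1 h2,
    emitP_writes (by rfl) (by rfl) hi h1 h2, emitP_writes (by cases S <;> rfl) (by rfl) hi h1 h2]
  rfl

theorem nwp_connP {L : Layout} {W : ℕ} (hL : L.Ok W) {ω : ℕ → Bool} {σ : NS}
    {Φ : ℕ → NS → Prop} {a i : ℕ} (hE : L.Env σ) (hcl : Holds σ.mem 2 (flat L.cl))
    (h41 : σ.reg 41 = i) (h51 : σ.reg 51 = a) (hi : i < L.g.I)
    (h : ∀ k σ', k ≤ 100 * (flat L.cl).length + 200 → σ'.mem = σ.mem → σ'.coins = σ.coins →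
      σ'.reg 46 = (if L.g.conn a i = true then 1 else 0) →
      (∀ j, Keep j → j < 42 ∨ 50 < j → σ'.reg j = σ.reg j) → Φ k σ') :
    NWP W ω connP σ Φ := by
  have hW := hL.W_pos
  have h2 := hL.two_lt
  have hn := hL.n_lt
  refine .ifP hW (by rfl) (by simp; omega) (fun hlt v => ?_) fun hge v => ?_
  · have hi3 : i < 3 := by simp [h41] at hlt; exact hlt
    refine .cmds hW (by rfl) (by simp [CmdsOk, Cmd.Ok]; omega) fun v' => h _ _ ?_ rfl rfl ?_ ?_
    · have : ((Ex.op .lt (.rg 41) (.lit 3)).code 62).length + 2 +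
        cost [.asg 46 (.op .eq (.rg 41) (.lit 2))] ≤ 100 := by decide
      omega
    · have : ¬ 3 ≤ i := by omega
      simp [effect, Cmd.next, h41, hL.conn_eq, this]
    · intro j hj hj'
      simp only [Keep] at hj
      have : j ≠ 46 := by omega
      simp [effect, Cmd.next, hj, this]
  · have hi3 : 3 ≤ i := by simp [h41] at hge; exact hge
    have hI := hL.I_eq
    refine .seq (.cmds hW (by rfl) (by simp [CmdsOk, Cmd.Ok, h41]; omega) fun v' => ?_)
    refine .evalP h2 (cl := L.cl) (idx := i - 3) (lo := 0) (hi := L.k) (z := a) (by omega)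
      (by simpa [effect, Cmd.next] using hcl) hL.cl_lt (by simp [effect, Cmd.next, h41])
      (by simp [effect, Cmd.next]) (by simp [effect, Cmd.next, hE.r3])
      (by simp [effect, Cmd.next, h51]) fun k σ' hk hm hc h46 hr => h _ _ ?_ ?_ ?_ ?_ ?_
    · have e1 : ((Ex.op .lt (.rg 41) (.lit 3)).code 62).length ≤ 20 := by decide
      have e2 : cost [.asg 42 (.rg 41 - .lit 3), .asg 43 (.lit 0), .asg 44 (.rg 3),
        .asg 45 (.rg 51)] ≤ 40 := by decide
      omega
    · simpa [effect, Cmd.next] using hm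
    · simpa [effect, Cmd.next] using hc
    · have : i ≠ 2 := by omega
      rw [h46, hL.conn_eq]
      simp [hi3, this]
    · intro j hj hj'
      have a1 : j ≠ 42 := by omega
      have a2 : j ≠ 43 := by omega
      have a3 : j ≠ 44 := by omega
      have a4 : j ≠ 45 := by omega
      rw [hr j hj (by omega)]
      simp only [Keep] at hj
      simp [effect, Cmd.next, hj, a1, a2, a3, a4]

end DynGraph

/-! ### Computing the arcs at a vertex of the initial graph -/

namespace DynGraph

open WordRAM

namespace Gadget

variable (g : Gadget)

/-- The neighbours of the centre in the initial graph. -/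
def start (S : Setting) (u : ℕ) : Bool :=
  decide (u < g.n) && decide (g.cJ u + 1 = g.r) && decide (g.cA u = g.n₀) &&
    (decide (g.cI u = 1) && decide (g.cS u = 1) ||
      match S with
      | .decremental => decide (3 ≤ g.cI u)
      | _ => false)

variable {g}

theorem start_eq {m : ℕ} (hI : g.I = m + 3) (S : Setting) :
    {u | g.start S u = true} = g.active m (initially S) := by
  have hr := g.two_le_r
  ext u
  have hst : g.start S u = true ↔ (((u < g.n ∧ g.cJ u + 1 = g.r) ∧ g.cA u = g.n₀) ∧
      (g.cI u = 1 ∧ g.cS u = 1 ∨ (initially S 0 = true ∧ 3 ≤ g.cI u))) := by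
    cases S <;> simp [start, initially]
  have hact : ∀ i, initially S i = initially S 0 := fun i => rfl
  rw [Set.mem_ofPred_eq, hst]
  constructor
  · rintro ⟨⟨⟨hu, hj⟩, ha⟩, h⟩
    have hc := g.code_decode u
    rw [ha, show g.cJ u = g.r - 1 by omega] at hc
    rcases h with ⟨h1, h2⟩ | ⟨h1, h2⟩
    · refine .inl ?_
      rw [← hc, h1, h2]
      rfl
    · have := g.cI_lt u
      refine .inr ⟨g.cI u - 3, by omega, h1, g.cS u, g.cS_lt hu, ?_⟩
      rw [Nat.sub_add_cancel h2]
      exact hc.symm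
  · rintro (rfl | ⟨i, hi, ha, s, hs, rfl⟩)
    · refine ⟨⟨⟨g.tip_lt (by norm_num) (by omega), ?_⟩, ?_⟩, .inl ⟨?_, ?_⟩⟩
      · rw [tip, cJ_code (by omega)]; omega
      · rw [tip, cA_code le_rfl (by omega) (by omega)]
      · rw [tip, cI_code (by omega) (by omega)]
      · rw [tip, cS_code le_rfl (by omega) (by omega)]
    · refine ⟨⟨⟨g.tip_lt hs (by omega), ?_⟩, ?_⟩, .inr ⟨(hact i).symm.trans ha, ?_⟩⟩
      · rw [tip, cJ_code (by omega)]; omega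
      · rw [tip, cA_code le_rfl (by omega) (by omega)]
      · rw [tip, cI_code (by omega) (by omega)]
        omega

theorem start_subset {m : ℕ} (hI : g.I = m + 3) (S : Setting) :
    {u | g.start S u = true} ⊆ g.Tips := by
  rw [start_eq hI]
  exact active_subset hI.ge _

theorem flatMap_edges {D : ℕ → Bool} (hD : {u | D u = true} ⊆ g.Tips) :
    (g.edges D).flatMap (fun p => [(p.1 : ℕ), (p.2 : ℕ)]) =
      ((List.range g.n).flatMap (g.arcs D)).flatMap fun p => [p.1, p.2] := by
  unfold edges
  rw [List.flatMap_assoc, List.flatMap_assoc]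
  refine List.flatMap_congr fun u hu => ?_
  rw [List.mem_range] at hu
  rw [List.flatMap_map]
  refine List.flatMap_congr fun p hp => ?_
  obtain ⟨h1, h2⟩ := (g.mem_arcs).1 hp
  have := h2.lt_n g hD hu
  simp [Fin.ofNat, h1, Nat.mod_eq_of_lt hu, Nat.mod_eq_of_lt this]

theorem length_edges (D : ℕ → Bool) :
    (g.edges D).length = ((List.range g.n).flatMap (g.arcs D)).length := by
  unfold edges
  simp [List.length_flatMap]

end Gadget

theorem holds_write {μ : ℕ → ℕ} {p q : ℕ} {l l' : List ℕ} (h : Holds μ p l)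
    (hq : p + l.length ≤ q) : Holds (write μ q l') p l := by
  intro i hi
  rw [write, if_neg (by omega)]
  exact h i hi

theorem bit_le (p : Prop) [Decidable p] : (if p then 1 else 0) ≤ 1 := by split_ifs <;> simp

theorem bit_or_le {x y : ℕ} (hx : x ≤ 1) (hy : y ≤ 1) : x ||| y ≤ 1 := by
  have := Nat.or_lt_two_pow (n := 1) (x := x) (y := y) (by omega) (by omega)
  omega

/-- The registers while vertex `u` is treated. -/
structure VertexRegs (L : Layout) (u : ℕ) (σ : NS) : Prop where
  env : L.Env σ
  r39 : σ.reg 39 = u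
  r40 : σ.reg 40 = L.g.cJ u
  r41 : σ.reg 41 = L.g.cI u
  r51 : σ.reg 51 = L.g.cA u
  r52 : σ.reg 52 = L.g.cS u

theorem VertexRegs.congr {L : Layout} {u : ℕ} {σ σ' : NS} (h : VertexRegs L u σ)
    (hr : ∀ i, Keep i → i ≠ 38 → i ≠ 53 → i < 42 ∨ 50 < i → σ'.reg i = σ.reg i) :
    VertexRegs L u σ' where
  env := h.env.congr fun i h1 h2 =>
    hr i (.inl (by omega)) (by omega) (by omega) (by omega)
  r39 := (hr 39 (by decide) (by decide) (by decide) (by decide)).trans h.r39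
  r40 := (hr 40 (by decide) (by decide) (by decide) (by decide)).trans h.r40
  r41 := (hr 41 (by decide) (by decide) (by decide) (by decide)).trans h.r41
  r51 := (hr 51 (by decide) (by decide) (by decide) (by decide)).trans h.r51
  r52 := (hr 52 (by decide) (by decide) (by decide) (by decide)).trans h.r52

/-- Only the test for the joined legs has to consult the formula, once per vertex; this gives the
time linear in the size of the formula. Every vertex adds at most 4 arcs, which keeps the output
inside the region. -/
theorem nwp_vertexP {L : Layout} {W : ℕ} (hL : L.Ok W) {ω : ℕ → Bool} (S : Setting) {σ : NS}
    {Φ : ℕ → NS → Prop} {μ : ℕ → ℕ} {p u : ℕ} {l : List (ℕ × ℕ)} (hE : L.Env σ)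
    (hcl : Holds μ 2 (flat L.cl)) (hp : L.T₀ ≤ p) (hpW : p + 8 * L.g.n + 8 < 2 ^ W)
    (hl : l.length ≤ 4 * u) (hu : u < L.g.n) (h39 : σ.reg 39 = u)
    (he : Emitted μ p L.w l σ)
    (h : ∀ k σ', k ≤ 100 * (flat L.cl).length + 1000 →
      Emitted μ p L.w (l ++ L.g.arcs (L.g.start S) u) σ' → σ'.coins = σ.coins → Φ k σ') :
    NWP W ω (vertexP S) σ Φ := by
  have hW := hL.W_pos
  have h2 := hL.two_lt
  have hn := hL.n_lt
  have hr := L.g.two_le_r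
  have hT := hL.tape
  have hcJ := L.g.cJ_lt u
  have hcI := L.g.cI_lt u
  have hcA := L.g.cA_le u
  have hrn : L.g.r ≤ L.g.n ∧ L.g.n₀ + 1 ≤ L.g.n ∧ L.g.I * L.g.r ≤ L.g.n ∧
      (L.g.n₀ + 1) * (L.g.I * L.g.r) ≤ L.g.n := by
    have h1 := L.g.I_pos
    have h3 := L.g.r_pos
    unfold Gadget.n
    have : 0 < L.g.I * L.g.r := Nat.mul_pos h1 h3
    refine ⟨?_, ?_, ?_, ?_⟩ <;> nlinarith [Nat.zero_le (L.g.n₀ * (L.g.I * L.g.r))]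
  have hIr : L.g.cI u * L.g.r ≤ u := by
    calc L.g.cI u * L.g.r ≤ u / L.g.r * L.g.r := Nat.mul_le_mul_right _ (Nat.mod_le _ _)
      _ ≤ u := Nat.div_mul_le_self _ _
  have hA : (L.g.n₀ - L.g.cA u) * (L.g.I * L.g.r) ≤ L.g.n :=
    (Nat.mul_le_mul_right _ (by omega)).trans hrn.2.2.2
  refine .seq (.cmds hW (by rfl) ?_ fun v => ?_)
  · simp [CmdsOk, Cmd.Ok, Cmd.next, hE.r4]
    omega
  have hV : VertexRegs L u ((effect σ [.asg 40 (.rg 39 % .rg 6), .asg 41 (.rg 39 / .rg 6 % .rg 5),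
      .asg 51 (.rg 39 / .rg 6 / .rg 5 % (.rg 4 + .lit 1)),
      .asg 52 (.rg 39 / .rg 6 / .rg 5 / (.rg 4 + .lit 1))]).scr v) := by
    refine ⟨hE.congr fun i h1 h2 => ?_, ?_, ?_, ?_, ?_, ?_⟩
    · have a1 : i ≠ 40 := by omega
      have a2 : i ≠ 41 := by omega
      have a3 : i ≠ 51 := by omega
      have a4 : i ≠ 52 := by omega
      have a5 : i < 60 := by omega
      simp [effect, Cmd.next, a1, a2, a3, a4, a5]
    · simp [effect, Cmd.next, h39]
    · simp [effect, Cmd.next, h39, hE.r6, Gadget.cJ]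
    · simp [effect, Cmd.next, h39, hE.r6, hE.r5, Gadget.cI]
    · simp [effect, Cmd.next, h39, hE.r6, hE.r5, hE.r4, Gadget.cA]
    · simp [effect, Cmd.next, h39, hE.r6, hE.r5, hE.r4, Gadget.cS]
  have he1 : Emitted μ p L.w l ((effect σ [.asg 40 (.rg 39 % .rg 6),
      .asg 41 (.rg 39 / .rg 6 % .rg 5), .asg 51 (.rg 39 / .rg 6 / .rg 5 % (.rg 4 + .lit 1)),
      .asg 52 (.rg 39 / .rg 6 / .rg 5 / (.rg 4 + .lit 1))]).scr v) :=
    ⟨by simp [effect, Cmd.next, he.ptr], by simp [effect, Cmd.next, he.mem]⟩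
  have hc1 : ((effect σ [.asg 40 (.rg 39 % .rg 6), .asg 41 (.rg 39 / .rg 6 % .rg 5),
      .asg 51 (.rg 39 / .rg 6 / .rg 5 % (.rg 4 + .lit 1)),
      .asg 52 (.rg 39 / .rg 6 / .rg 5 / (.rg 4 + .lit 1))]).scr v).coins = σ.coins := rfl
  have c1 : cost [.asg 40 (.rg 39 % .rg 6), .asg 41 (.rg 39 / .rg 6 % .rg 5),
      .asg 51 (.rg 39 / .rg 6 / .rg 5 % (.rg 4 + .lit 1)),
      .asg 52 (.rg 39 / .rg 6 / .rg 5 / (.rg 4 + .lit 1))] ≤ 100 := by decide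
  revert hV he1 hc1 c1
  generalize (effect σ _).scr v = σ₁
  generalize cost _ = k₁
  intro hV₁ he₁ hc₁ hk₁
  have len1 : ∀ (b : Prop) [Decidable b] (q : ℕ × ℕ), (if b then [q] else []).length ≤ 1 := by
    intro b _ q; split_ifs <;> simp
  refine .seq (.emitP h2 (by rfl) (by rfl) (u := u) (v := u + 1) (b := L.g.cJ u + 1 < L.g.r) he₁
    hV₁.env.r10 hV₁.r39 ?_ ?_ ?_ (by omega) fun k₂ σ₂ hk₂ he₂ hc₂ hr₂ => ?_)
  · simp [hV₁.r40]; omega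
  · simp [hV₁.r40, hV₁.env.r6]
  · simp [hV₁.r39]; omega
  have hV₂ := hV₁.congr fun i a b c _ => hr₂ i a b c
  have l2 := len1 (L.g.cJ u + 1 < L.g.r) (u, u + 1)
  refine .seq (.emitP h2 (by rfl) (by rfl) (u := u) (v := u - L.g.cI u * L.g.r)
    (b := L.g.cJ u = 0 ∧ 1 ≤ L.g.cI u) he₂
    hV₂.env.r10 hV₂.r39 ?_ ?_ ?_ (by rw [List.length_append]; omega) fun k₃ σ₃ hk₃ he₃ hc₃ hr₃ => ?_)
  · simp only [Ex.ok_mul, Ex.ok_eq, Ex.ok_rg, Ex.ok_lit, Ex.ok_lt, Ex.val_eq, Ex.val_lt, true_and,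
      and_true]
    refine ⟨by omega, by omega, ?_⟩
    split_ifs <;> omega
  · simp [hV₂.r40, hV₂.r41]; omega
  · intro _
    simp [hV₂.r39, hV₂.r41, hV₂.env.r6]
    omega
  have hV₃ := hV₂.congr fun i a b c _ => hr₃ i a b c
  have l3 := len1 (L.g.cJ u = 0 ∧ 1 ≤ L.g.cI u) (u, u - L.g.cI u * L.g.r)
  refine .seq (nwp_connP hL hV₃.env ?_ hV₃.r41 hV₃.r51 hcI fun k₄ σ₄ hk₄ hm₄ hc₄ h46 hr₄ => ?_)
  · rw [he₃.mem]
    exact holds_write hcl (by omega)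
  have hV₄ := hV₃.congr fun i a b c d => hr₄ i a d
  have he₄ : Emitted μ p L.w _ σ₄ :=
    ⟨(hr₄ 38 (by decide) (by decide)).trans he₃.ptr, hm₄.trans he₃.mem⟩
  refine .seq (.emitP h2 (by rfl) (by rfl) (u := u)
    (v := u + (L.g.n₀ - L.g.cA u) * (L.g.I * L.g.r))
    (b := L.g.cJ u + 1 = L.g.r ∧ L.g.cA u < L.g.n₀ ∧ L.g.conn (L.g.cA u) (L.g.cI u) = true) he₄
    hV₄.env.r10 hV₄.r39 ?_ ?_ ?_ (by simp only [List.length_append]; omega)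
    fun k₅ σ₅ hk₅ he₅ hc₅ hr₅ => ?_)
  · simp only [Ex.ok_mul, Ex.ok_eq, Ex.ok_rg, Ex.ok_lit, Ex.ok_lt, Ex.val_eq, Ex.val_lt, true_and,
      and_true, Ex.ok_add, Ex.val_rg, Ex.val_lit, Ex.val_mul, Ex.val_add, h46, hV₄.r40]
    exact ⟨⟨⟨by omega, by omega⟩,
      lt_of_le_of_lt (Nat.mul_le_mul (bit_le _) (bit_le _)) (by omega)⟩, lt_of_le_of_lt
        (Nat.mul_le_mul (Nat.mul_le_mul (bit_le _) (bit_le _)) (bit_le _)) (by omega)⟩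
  · simp [hV₄.r40, hV₄.r51, hV₄.env.r6, hV₄.env.r4, h46]
    tauto
  · rintro ⟨-, hlt, -⟩
    simp [hV₄.r39, hV₄.r51, hV₄.env.r6, hV₄.env.r4, hV₄.env.r5]
    omega
  have hV₅ := hV₄.congr fun i a b c _ => hr₅ i a b c
  have l5 := len1 (L.g.cJ u + 1 = L.g.r ∧ L.g.cA u < L.g.n₀ ∧
    L.g.conn (L.g.cA u) (L.g.cI u) = true) (u, u + (L.g.n₀ - L.g.cA u) * (L.g.I * L.g.r))
  refine .emitP h2 (by cases S <;> rfl) (by rfl) (u := u) (v := L.g.ctr)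
    (b := L.g.start S u = true) he₅
    hV₅.env.r10 hV₅.r39 ?_ ?_ ?_ (by simp only [List.length_append]; omega)
    fun k₆ σ₆ hk₆ he₆ hc₆ hr₆ => ?_
  · cases S
    all_goals
      simp only [Setting.test, Ex.ok_mul, Ex.ok_eq, Ex.ok_rg, Ex.ok_lit, Ex.ok_lt, Ex.val_eq,
        Ex.val_lt, true_and, and_true, Ex.ok_add, Ex.val_rg, Ex.val_lit, Ex.val_mul, Ex.val_add,
        hV₅.r40, Ex.ok_bor, Ex.val_bor]
      constructorm* _ ∧ _
    all_goals first
      | omega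
      | exact lt_of_le_of_lt (Nat.mul_le_mul (bit_le _) (bit_le _)) (by omega)
      | exact lt_of_le_of_lt (Nat.mul_le_mul (Nat.mul_le_mul (bit_le _) (bit_le _))
          (Nat.mul_le_mul (bit_le _) (bit_le _))) (by omega)
      | exact lt_of_le_of_lt (Nat.mul_le_mul (Nat.mul_le_mul (bit_le _) (bit_le _))
          (bit_or_le (Nat.mul_le_mul (bit_le _) (bit_le _)) (bit_le _))) (by omega)
  · cases S
    · simp [Setting.test, Gadget.start, hV₅.r40, hV₅.r51, hV₅.r41, hV₅.r52, hV₅.env.r4,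
        hV₅.env.r6, hu]
      tauto
    · simp [Setting.test, Gadget.start, hV₅.r40, hV₅.r51, hV₅.r41, hV₅.r52, hV₅.env.r4,
        hV₅.env.r6, hu]
      tauto
    · simp only [Setting.test, Gadget.start, hV₅.r40, hV₅.r51, hV₅.r41, hV₅.r52, hV₅.env.r4,
        hV₅.env.r6, hu, Ex.val_eq, Ex.val_lt, Ex.val_rg, Ex.val_lit, Ex.val_mul, Ex.val_add,
        Ex.val_bor]
      by_cases a1 : L.g.cJ u + 1 = L.g.r <;> by_cases a2 : L.g.cA u = L.g.n₀ <;>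
      by_cases a3 : L.g.cI u = 1 <;> by_cases a4 : L.g.cS u = 1 <;>
      by_cases a5 : 2 < L.g.cI u <;>
      simp [a1, a2, a3, a4, a5] <;> omega
  · intro _
    exact ⟨trivial, hV₅.env.r18⟩
  · refine h _ _ ?_ ?_ (by omega)
    · have t₂ : k₂ ≤ 120 := hk₂.trans (by decide)
      have t₃ : k₃ ≤ 120 := hk₃.trans (by decide)
      have t₅ : k₅ ≤ 120 := hk₅.trans (by decide)
      have t₆ : k₆ ≤ 120 := hk₆.trans (by cases S <;> decide)
      omega
    · convert he₆ using 1
      simp only [Gadget.arcs, List.append_assoc]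

end DynGraph

/-! ### Writing the input of the preprocessing -/

namespace DynGraph

open WordRAM

theorem graphP_writes (S : Setting) (par : Parameter) {i : ℕ} (h : i < 38 ∨ 53 < i)
    (hi : Keep i) : (graphP S par).writes i = false := by
  have h1 : i ≠ 38 := by omega
  have h2 : i ≠ rTest := by unfold Keep at hi; unfold rTest; omega
  have h3 : i ≠ 39 := by omega
  simp only [graphP, Prog.writes, forP_writes h2]
  rw [vertexP_writes S (by omega) hi, cmds_writes (by cases par <;> rfl) hi (by simp [Cmd.sets, h1]),
    cmds_writes (by cases par <;> rfl) hi (by cases par <;> rfl)]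
  simp [h3]

theorem Gadget.length_range_arcs_le (g : Gadget) (D : ℕ → Bool) (u : ℕ) :
    ((List.range u).flatMap (g.arcs D)).length ≤ 4 * u := by
  rw [List.length_flatMap]
  refine (List.sum_le_card_nsmul _ 4 ?_).trans (by simp [mul_comm])
  intro x hx
  obtain ⟨u, -, rfl⟩ := List.mem_map.1 hx
  exact g.length_arcs_le D u

theorem Layout.length_input_le (L : Layout) (S : Setting) (par : Parameter) :
    (par.input L.g.centre (L.g.edges (L.g.start S))).length ≤ 8 * L.g.n + 3 := by
  have := L.g.length_edges_le (L.g.start S)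
  cases par <;> simp [Parameter.input] <;> omega

/-- The number of edges is known only after the list has been written, so the header is filled in
last, from the final position of the pointer. All numbers are reduced modulo `2 ^ L.w`, as in the
initial configuration of the simulated machine. -/
theorem nwp_graphP {L : Layout} {W : ℕ} (hL : L.Ok W) {ω : ℕ → Bool} (S : Setting)
    (par : Parameter) {σ : NS} {Φ : ℕ → NS → Prop} {p : ℕ} (hE : L.Env σ)
    (hcl : Holds σ.mem 2 (flat L.cl)) (h31 : σ.reg 31 = p) (hp : L.T₀ ≤ p)
    (hpW : p + 8 * L.g.n + 16 < 2 ^ W)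
    (h : ∀ k σ', k ≤ L.g.n * (100 * (flat L.cl).length + 1005) + 200 →
      σ'.mem = write σ.mem p ((par.input L.g.centre (L.g.edges (L.g.start S))).map (· % 2 ^ L.w)) →
      σ'.coins = σ.coins → (∀ i, Keep i → i < 38 ∨ 53 < i → σ'.reg i = σ.reg i) → Φ k σ') :
    NWP W ω (graphP S par) σ Φ := by
  have hW := hL.W_pos
  have h2 := hL.two_lt
  have hn := hL.n_lt
  have hD := Gadget.start_subset hL.I_eq S
  have hh : par.header = 2 ∨ par.header = 3 := by cases par <;> simp [Parameter.header]
  have hctr : ∀ x, (L.g.centre : ℕ) % x = L.g.ctr % x := fun _ => rfl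
  have key : NWP W ω (graphP S par) σ fun k σ' =>
      k ≤ L.g.n * (100 * (flat L.cl).length + 1005) + 200 ∧ σ'.mem = write σ.mem p
        ((par.input L.g.centre (L.g.edges (L.g.start S))).map (· % 2 ^ L.w)) ∧
      σ'.coins = σ.coins := by
    have wf3 : par.headerCmds.all Cmd.wf = true := by cases par <;> rfl
    have cost3 : cost par.headerCmds ≤ 100 := by clear * -; cases par <;> decide
    have cost1 : cost [.asg 38 (.rg 31 + .lit par.header)] ≤ 50 := by
      clear * -; cases par <;> decide
    refine .seq (.cmds hW (by rfl) ?_ fun v => ?_)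
    · simp [CmdsOk, Cmd.Ok, h31]; omega
    refine .seq (.for hW L.g.n (fun _ => 100 * (flat L.cl).length + 1000) (fun u τ =>
      τ.coins = σ.coins ∧ L.Env τ ∧ τ.reg 31 = p ∧
      Emitted σ.mem (p + par.header) L.w ((List.range u).flatMap (L.g.arcs (L.g.start S))) τ) ?_
      (vertexP_writes S (by omega) (by decide)) (vertexP_writes S (by omega) (by decide))
      (by decide) (by decide) (by decide) (fun v' => ?_) ?_ ?_)
    · simp [effect, Cmd.next, hE.r7]
    · refine ⟨rfl, hE.congr fun i h1 h2 => ?_, ?_, ⟨?_, ?_⟩⟩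
      · have a1 : i ≠ 38 := by omega
        have a2 : i ≠ 39 := by omega
        have a3 : i < 60 := by omega
        simp [effect, Cmd.next, a1, a2, a3]
      · simp [effect, Cmd.next, h31]
      · simp [effect, Cmd.next, h31]
      · simp [effect, Cmd.next, write_nil]
    · rintro u hu τ ⟨hc, hEτ, h31τ, hem⟩ h39 hr hm hv
      refine NWP.mono (nwp_vertexP hL S hEτ hcl (p := p + par.header) (u := u) (by omega)
        (by omega) (L.g.length_range_arcs_le _ u) hu h39 hem
        (Φ := fun k σ' => k ≤ 100 * (flat L.cl).length + 1000 ∧ Emitted σ.mem (p + par.header) L.w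
          ((List.range u).flatMap (L.g.arcs (L.g.start S)) ++ L.g.arcs (L.g.start S) u) σ' ∧
          σ'.coins = τ.coins) fun k σ' h1 h2 h3 => ⟨h1, h2, h3⟩).frame ?_
      rintro k σ' ⟨⟨h1, h2, h3⟩, hfr, -, -⟩
      refine ⟨h1, fun v => ⟨h3.trans hc, hEτ.congr fun i a1 a2 => ?_, ?_, ⟨?_, ?_⟩⟩⟩
      · have a4 : i ≠ 39 := by omega
        have a3 : i < 60 := by omega
        simp only [NS.scr_reg, NS.set_reg, a4, a3, true_or, if_true, if_false]
        exact hfr i (vertexP_writes S (by omega) (.inl a3))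
      · have := hfr 31 (vertexP_writes S (by omega) (by decide))
        simp [this, h31τ]
      · rw [List.range_succ, List.flatMap_append, List.flatMap_singleton]
        simpa using h2.ptr
      · rw [List.range_succ, List.flatMap_append, List.flatMap_singleton]
        simpa using h2.mem
    · rintro k₁ τ hk₁ ⟨hc, hEτ, h31τ, hem⟩ hr hm
      have hlen := L.g.length_range_arcs_le (L.g.start S) L.g.n
      have hptr := hem.ptr
      refine .cmds hW wf3 ?_ fun v => ⟨?_, ?_, ?_⟩
      · cases par <;> simp [Parameter.header] at hptr <;>
          simp [Parameter.headerCmds, CmdsOk, Cmd.Ok, Cmd.next, h31τ, hptr, Parameter.header] <;> omega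
      · simp only [Finset.sum_const, Finset.card_range, smul_eq_mul] at hk₁
        have : L.g.n * (100 * (flat L.cl).length + 1000 + 5) =
          L.g.n * (100 * (flat L.cl).length + 1005) := rfl
        omega
      · have hfl := L.g.flatMap_edges hD
        have hle := L.g.length_edges (L.g.start S)
        have hmm : ((List.range L.g.n).flatMap (L.g.arcs (L.g.start S))).flatMap
            (fun q => [q.1 % 2 ^ L.w, q.2 % 2 ^ L.w]) =
            ((L.g.edges (L.g.start S)).flatMap fun p => [(p.1 : ℕ), (p.2 : ℕ)]).map
              (· % 2 ^ L.w) := by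
          rw [hfl, List.map_flatMap]
          simp
        have hmem := hem.mem
        rw [hmm] at hmem
        cases par
        all_goals
          simp only [Parameter.header] at hmem hptr
          simp only [Parameter.input, List.map_cons, List.nil_append, List.cons_append]
          simp only [← write_cons]
          simp only [show p + 2 = p + 1 + 1 from rfl, show p + 3 = p + 1 + 1 + 1 from rfl] at hmem
          rw [← hmem]
          funext x
          simp [Parameter.headerCmds, effect, Cmd.next, h31τ, hptr, hle, Parameter.header, hEτ.r7, hEτ.r10,
            hEτ.r18, hctr]
      · cases par <;> simp [Parameter.headerCmds, effect, Cmd.next, hc]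
  refine key.frame.mono ?_
  rintro k σ' ⟨⟨h1, h2, h3⟩, h4, -, -⟩
  exact h k σ' h1 h2 h3 fun i hi hi' => h4 i (graphP_writes S par hi' hi)

end DynGraph

/-! ### Simulating the updates of a phase -/

namespace WordRAM

/-- A simulation only depends on the memory, the registers of the simulation and the simulated
registers. -/
theorem Sim.congr {w : ℕ} {L : Region} {M : ℕ} {s : State w} {σ σ' : NS} (h : Sim L M s σ)
    (hm : σ'.mem = σ.mem)
    (hr : ∀ i, i = 10 ∨ (31 ≤ i ∧ i ≤ 35) ∨ (∃ j, i = simReg j) → σ'.reg i = σ.reg i) :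
    Sim L M s σ' where
  mask := (hr _ (.inl rfl)).trans h.mask
  base := (hr _ (.inr (.inl (by decide)))).trans h.base
  front := (hr _ (.inr (.inl (by decide)))).trans h.front
  stamp := (hr _ (.inr (.inl (by decide)))).trans h.stamp
  cur := (hr _ (.inr (.inl (by decide)))).trans h.cur
  pos := (hr _ (.inr (.inl (by decide)))).trans h.pos
  reg i hi := (hr _ (.inr (.inr ⟨i, rfl⟩))).trans (h.reg i hi)
  mem := by rw [hm]; exact h.mem
  le := by rw [hm]; exact h.le

end WordRAM

namespace DynGraph

open WordRAM

/-- An insertion or a deletion. -/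
def opOf {n : ℕ} (ins : Bool) (u v : Fin n) : Op n := if ins = true then .insert u v else .delete u v

theorem Algorithm.prog_opOf (A : Algorithm) {n : ℕ} (ins : Bool) (u v : Fin n) :
    A.prog (opOf ins u v) = A.update := by
  cases ins <;> rfl

/-- Pass the insertion or deletion of the edge from the centre to the tip of leg `reg 29 + 3` in
copy `s` to the simulated algorithm. -/
def feedCmds (ins : Bool) (s : ℕ) : List Cmd :=
  [.asg (simReg 0) (.op .band (.lit (if ins = true then 1 else 0)) (.rg 10)),
   .asg (simReg 1) (.op .band (.rg 18) (.rg 10)),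
   .asg (simReg 2) (.op .band (((.lit s * (.rg 4 + .lit 1) + .rg 4) * .rg 5 + (.rg 29 + .lit 3)) *
      .rg 6 + (.rg 6 - .lit 1)) (.rg 10))]

/-- The end points are computed from the digits of the tip in mixed radix and masked, exactly as
`Op.feed` truncates them to words. -/
theorem effect_feedCmds {L : Layout} {w M : ℕ} (hw : w = L.w) {Rg : Region} {st : State w} {σ : NS}
    (h : Sim Rg M st σ) (hE : L.Env σ) {ins : Bool} {s i : ℕ} (hs : s < 2) (h29 : σ.reg 29 = i)
    (hi : i + 3 < L.g.I) (v : ℕ → ℕ) :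
    Sim Rg M ((opOf ins L.g.centre (L.g.tipV s (i + 3))).feed st)
      ((effect σ (feedCmds ins s)).scr v) := by
  subst hw
  have e : (opOf ins L.g.centre (L.g.tipV s (i + 3))).feed st =
      ((st.setReg 0 (BitVec.ofNat L.w (if ins = true then 1 else 0))).setReg 1
        (BitVec.ofNat L.w L.g.ctr)).setReg 2 (BitVec.ofNat L.w (L.g.tip s (i + 3))) := by
    rw [← Gadget.tipV_val hs hi]
    cases ins <;> rfl
  rw [e]
  refine (((h.setReg 0 _).setReg 1 _).setReg 2 _).congr (by simp [effect, feedCmds, Cmd.next]) ?_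
  intro j hj
  have hk : j < 60 ∨ 100 ≤ j := by
    rcases hj with rfl | h | ⟨j, rfl⟩
    · norm_num
    · omega
    · simp only [simReg]; omega
  simp only [effect, feedCmds, Cmd.next, NS.scr_reg, NS.set_reg, hk, if_true, Ex.val_band,
    Ex.val_lit, Ex.val_rg, BitVec.toNat_ofNat]
  have n1 : ∀ x y, x ≠ y → simReg x ≠ simReg y := by intro x y h; simp only [simReg]; omega
  have n2 : ∀ x y, x < 60 → x ≠ simReg y := by intro x y h; simp only [simReg]; omega
  have m0 : ∀ x, x &&& (2 ^ L.w - 1) = x % 2 ^ L.w := fun x => and_mask x _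
  simp only [Ex.val_add, Ex.val_mul, Ex.val_sub, Ex.val_rg, Ex.val_lit, NS.set_reg,
    n2 10 0 (by norm_num), n2 10 1 (by norm_num), n2 4 0 (by norm_num), n2 4 1 (by norm_num),
    n2 5 0 (by norm_num), n2 5 1 (by norm_num), n2 6 0 (by norm_num), n2 6 1 (by norm_num),
    n2 29 0 (by norm_num), n2 29 1 (by norm_num), n2 18 0 (by norm_num), if_false, hE.r10, hE.r4,
    hE.r5, hE.r6, hE.r18, h29, m0]
  rfl

/-- Update the graph for phase `reg 37`: treat the clauses that are missed (or, if `flip` holds,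
those that are not missed). -/
def updateP (U : Prog) (flip ins : Bool) : Prog :=
  forP 29 2
    (.seq (cmds [.asg 42 (.rg 29), .asg 43 (.rg 3), .asg 44 (.rg 1), .asg 45 (.rg 37 * .rg 4)])
      (.seq evalP
        (ifP (if flip = true then .op .eq (.rg 46) (.lit 0) else .rg 46)
          (.seq (cmds (feedCmds ins 0)) (.seq (tr U) (.seq (cmds (feedCmds ins 1)) (tr U))))
          .skip)))

theorem feedCmds_writes (ins : Bool) (s : ℕ) {i : ℕ} (hi : Keep i)
    (h : i < 100 ∨ ∃ j, i = 101 + 2 * j) : (cmds (feedCmds ins s)).writes i = false := by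
  refine cmds_writes (by cases ins <;> rfl) hi ?_
  have n1 : ∀ j, i ≠ simReg j := by
    intro j
    rcases h with h | ⟨j', rfl⟩
    · simp only [simReg]; omega
    · simp only [simReg]; omega
  simp [feedCmds, Cmd.sets, n1 0, n1 1, n1 2]

theorem tr_writes_keep {U : Prog} {i : ℕ} (hi : Keep i) (h : i < 100 ∨ ∃ j, i = 101 + 2 * j)
    (h35 : i ≠ 35) : (tr U).writes i = false := by
  rcases h with h | ⟨j, rfl⟩
  · refine tr_writes h ?_ h35
    unfold Keep at hi
    unfold rTmp
    omega
  · exact tr_writes_odd j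

theorem updateBody_writes {U : Prog} (flip ins : Bool) {i : ℕ} (hi : Keep i)
    (h : i < 42 ∨ 50 < i) (h' : i < 100 ∨ ∃ j, i = 101 + 2 * j) (h35 : i ≠ 35) :
    (Prog.seq (cmds [.asg 42 (.rg 29), .asg 43 (.rg 3), .asg 44 (.rg 1), .asg 45 (.rg 37 * .rg 4)])
      (.seq evalP
        (ifP (if flip = true then .op .eq (.rg 46) (.lit 0) else .rg 46)
          (.seq (cmds (feedCmds ins 0)) (.seq (tr U) (.seq (cmds (feedCmds ins 1)) (tr U))))
          .skip))).writes i = false := by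
  have h2 : i ≠ 42 := by omega
  have h3 : i ≠ 43 := by omega
  have h4 : i ≠ 44 := by omega
  have h5 : i ≠ 45 := by omega
  simp only [Prog.writes]
  rw [ifP_writes (by cases flip <;> rfl) hi, evalP_writes (by omega) hi,
    cmds_writes (by rfl) hi (by simp [Cmd.sets, h2, h3, h4, h5])]
  simp only [Prog.writes, feedCmds_writes ins _ hi h', tr_writes_keep hi h' h35, Bool.or_self]

theorem updateP_writes {U : Prog} (flip ins : Bool) {i : ℕ} (hi : Keep i)
    (h : i < 42 ∨ 50 < i) (h' : i < 100 ∨ ∃ j, i = 101 + 2 * j) (h35 : i ≠ 35) (h29 : i ≠ 29) :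
    (updateP U flip ins).writes i = false := by
  have hT : i ≠ rTest := by unfold Keep at hi; unfold rTest; omega
  rw [updateP, forP_writes hT, updateBody_writes flip ins hi h h' h35]
  simp [h29]

theorem Algorithm.ServesTo.of_nil {A : Algorithm} {ω : ℕ → Bool} {n w : ℕ} {s s' : State w}
    {tr : List (ℕ × ℕ)} (h : A.ServesTo (n := n) ω s [] tr s') : tr = [] ∧ s' = s := by
  cases h
  exact ⟨rfl, rfl⟩

/-- Cuts one long run into pieces with their intermediate configurations. The bound on the coins
says how much of the tape can have been used before piece `i`. -/
theorem Algorithm.ServesTo.flatMap {A : Algorithm} {ω : ℕ → Bool} {n w : ℕ} {s s' : State w}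
    {f : ℕ → List (Op n)} {m : ℕ} {tr : List (ℕ × ℕ)}
    (h : A.ServesTo ω s ((List.range m).flatMap f) tr s') :
    ∃ (σ : ℕ → State w) (τ : ℕ → List (ℕ × ℕ)), σ 0 = s ∧ σ m = s' ∧
      (∀ i < m, A.ServesTo ω (σ i) (f i) (τ i) (σ (i + 1))) ∧
      tr = (List.range m).flatMap τ ∧
      (∀ i ≤ m, (σ i).coins ≤ s.coins + ∑ j ∈ Finset.range i, steps (τ j)) ∧
      steps tr = ∑ i ∈ Finset.range m, steps (τ i) := by
  induction m generalizing s' tr with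
  | zero =>
    cases h
    exact ⟨fun _ => s, fun _ => [], rfl, rfl, by simp, rfl, by simp, by simp [steps]⟩
  | succ m ih =>
    rw [List.range_succ, List.flatMap_append, List.flatMap_singleton] at h
    obtain ⟨s₁, tr₁, tr₂, rfl, h₁, h₂⟩ := h.of_append
    obtain ⟨σ, τ, e0, em, hi, htr, hc, hs⟩ := ih h₁
    refine ⟨fun i => if i ≤ m then σ i else s', fun i => if i < m then τ i else tr₂, by simp [e0],
      by simp, fun i hi' => ?_, ?_, ?_, ?_⟩
    · by_cases him : i < m
      · simpa [him, him.le, Nat.succ_le_of_lt him] using hi i him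
      · obtain rfl : i = m := by omega
        simpa [em] using h₂
    · rw [List.range_succ, List.flatMap_append, List.flatMap_singleton, htr]
      congr 1
      · refine List.flatMap_congr fun i hi => ?_
        simp [List.mem_range.1 hi]
      · simp
    · intro i hi'
      by_cases him : i ≤ m
      · simp only [him, if_true]
        refine (hc i him).trans (Nat.add_le_add_left (Finset.sum_le_sum fun j hj => ?_) _)
        have := Finset.mem_range.1 hj
        rw [if_pos (by omega)]
      · obtain rfl : i = m + 1 := by omega
        have c1 := h₁.coins_le
        have c2 := h₂.coins_le
        simp only [him, if_false]
        rw [Finset.sum_range_succ, if_neg (by omega), Finset.sum_congr rfl (g := fun j => steps (τ j))]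
        · omega
        · intro j hj
          rw [if_pos (Finset.mem_range.1 hj)]
    · rw [Finset.sum_range_succ, Finset.sum_congr rfl (g := fun j => steps (τ j))]
      · simp only [lt_irrefl, if_false]
        simp only [steps, List.map_append, List.sum_append] at hs ⊢
        omega
      · intro j hj
        simp only [Finset.mem_range.1 hj, if_true]

namespace Layout

/-- Clause `i` is missed by the assignment of phase `h`. -/
def act (L : Layout) (h i : ℕ) : Bool := miss L.k L.N (h * 2 ^ L.k) (L.cl.getD i [])

end Layout

/-- For each clause the program evaluates the assignment of the phase and, if the clause is to be
treated, simulates the two updates for the copies 0 and 1. Simulated code writes only inside its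
region, so formula, parameters and tape survive from one clause to the next. -/
theorem nwp_updateP {L : Layout} {W : ℕ} (hL : L.Ok W) {ω ω' : ℕ → Bool} {σ : NS}
    {A : Algorithm} {flip ins : Bool} {h M : ℕ} {Rg : Region} {s s' : State L.w}
    {tr : List (ℕ × ℕ)} {B : ℕ} (hE : L.Env σ) (hcl : Holds σ.mem 2 (flat L.cl))
    (hf : L.T₀ ≤ Rg.front) (hst : L.T₀ ≤ Rg.stamp) (hRg : Rg.Ok W L.w B) (hT : Tape Rg ω B σ)
    (h37 : σ.reg 37 = h) (hh : h < L.H) (hs : Sim Rg M s σ) (hM : A.update.Below M)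
    (hops : A.ServesTo ω s ((L.g.tipList L.cl.length fun i => flip ^^ L.act h i).map
      (opOf ins L.g.centre)) tr s') (hB : s.coins + steps tr ≤ B) :
    NWP W ω' (updateP A.update flip ins) σ fun k σ' =>
      k ≤ 10 + L.cl.length * (100 * (flat L.cl).length + 600) + 9 * steps tr ∧
      Sim Rg M s' σ' ∧ Rg.Local L.w σ σ' := by
  have hW := hL.W_pos
  have h2 := hL.two_lt
  have hn := hL.n_lt
  have hI := hL.I_eq
  have hr := L.g.two_le_r
  have hphase := hL.phases
  have hhn : h * L.g.n₀ ≤ L.H * L.g.n₀ := Nat.mul_le_mul_right _ hh.le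
  rw [Gadget.tipList, List.map_flatMap] at hops
  obtain ⟨S, τ, hS0, hSm, hSi, -, hSc, hsum⟩ := hops.flatMap
  have htip : ∀ s i, s < 2 → i < L.g.I →
      ((s * (L.g.n₀ + 1) + L.g.n₀) * L.g.I + i) * L.g.r + (L.g.r - 1) < L.g.n := fun s i hs hi =>
    L.g.tip_lt hs hi
  have hfeed : ∀ {σ : NS} {s i : ℕ}, L.Env σ → σ.reg 29 = i → i < L.cl.length → s < 2 →
      CmdsOk W σ (feedCmds ins s) := by
    intro σ s i hE h29 hi hs
    have := htip s (i + 3) hs (by omega)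
    have t1 : s * (L.g.n₀ + 1) + L.g.n₀ ≤ (s * (L.g.n₀ + 1) + L.g.n₀) * L.g.I :=
      Nat.le_mul_of_pos_right _ L.g.I_pos
    have t2 : (s * (L.g.n₀ + 1) + L.g.n₀) * L.g.I + (i + 3) ≤
        ((s * (L.g.n₀ + 1) + L.g.n₀) * L.g.I + (i + 3)) * L.g.r :=
      Nat.le_mul_of_pos_right _ (by omega)
    have hc : (if ins = true then 1 else 0) ≤ 1 := bit_le _
    simp only [CmdsOk, feedCmds, Cmd.Ok, Cmd.next, Ex.ok_band, Ex.ok_lit, Ex.ok_rg, Ex.ok_add,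
      Ex.ok_mul, Ex.ok_sub, Ex.val_add, Ex.val_mul, Ex.val_sub, Ex.val_rg, Ex.val_lit, NS.set_reg,
      true_and, and_true, simReg]
    simp [hE.r4, hE.r5, hE.r6, h29]
    omega
  have e1 : cost (feedCmds ins 0) ≤ 60 := by clear * -; cases ins <;> decide
  have e2 : cost (feedCmds ins 1) ≤ 60 := by clear * -; cases ins <;> decide
  have e3 : cost [.asg 42 (.rg 29), .asg 43 (.rg 3), .asg 44 (.rg 1), .asg 45 (.rg 37 * .rg 4)]
    ≤ 40 := by decide
  have e4 : ((if flip = true then Ex.op .eq (.rg 46) (.lit 0) else .rg 46).code 62).length ≤ 10 := by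
    clear * -; cases flip <;> decide
  refine .for hW L.cl.length (fun i => 100 * (flat L.cl).length + 400 + 9 * steps (τ i))
    (fun i ρ => Sim Rg M (S i) ρ ∧ Rg.Local L.w σ ρ) hE.r2
    (updateBody_writes flip ins (by decide) (by decide) (.inl (by decide)) (by decide))
    (updateBody_writes flip ins (by decide) (by decide) (.inl (by decide)) (by decide))
    (by decide) (by decide) (by decide) (fun v => ⟨?_, fun _ _ _ => rfl⟩) ?_ ?_
  · rw [hS0]
    refine hs.congr rfl fun i hi => ?_
    have : i ≠ 29 ∧ (i < 60 ∨ 100 ≤ i) := by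
      rcases hi with rfl | h | ⟨j, rfl⟩
      · norm_num
      · omega
      · simp only [simReg]; omega
    simp [this.1, this.2]
  · rintro i hi ρ ⟨hρ, hloc⟩ h29 hreg - -
    have hkeep : ∀ j, j < 42 → j ≠ 29 → j ≠ 35 → ρ.reg j = σ.reg j := fun j hj h1 h2 =>
      hreg j (.inl (by omega)) h1
        (updateBody_writes flip ins (.inl (by omega)) (.inl hj) (.inl (by omega)) h2)
    have hEρ : L.Env ρ := hE.congr fun j h1 h2 => hkeep j (by omega) (by omega) (by omega)
    have hclρ : Holds ρ.mem 2 (flat L.cl) := by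
      intro j hj
      have := hL.tape
      rw [hloc _ (by omega) (by omega)]
      exact hcl j hj
    refine .seq (.cmds hW (by rfl) ?_ fun v => ?_)
    · simp [CmdsOk, Cmd.Ok, Cmd.next, hkeep 37, h37, hEρ.r4]
      omega
    refine .seq (.evalP h2 (cl := L.cl) (idx := i) (lo := L.k) (hi := L.N) (z := h * 2 ^ L.k) hi
      (by simpa [effect, Cmd.next] using hclρ) hL.cl_lt (by simp [effect, Cmd.next, h29])
      (by simp [effect, Cmd.next, hEρ.r3]) (by simp [effect, Cmd.next, hEρ.r1])
      (by simp [effect, Cmd.next, hEρ.r4, hkeep 37, h37, hL.n₀_eq])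
      fun k₁ σ₁ hk₁ hm₁ hc₁ h46 hr₁ => ?_)
    have hact : σ₁.reg 46 = if L.act h i = true then 1 else 0 := h46
    have hm₁' : σ₁.mem = ρ.mem := by simpa [effect, Cmd.next] using hm₁
    have hr₁' : ∀ j, Keep j → j < 42 ∨ 50 < j → σ₁.reg j = ρ.reg j := by
      intro j hj hj'
      rw [hr₁ j hj (by omega)]
      have a1 : j ≠ 42 := by omega
      have a2 : j ≠ 43 := by omega
      have a3 : j ≠ 44 := by omega
      have a4 : j ≠ 45 := by omega
      simp only [Keep] at hj
      simp [effect, Cmd.next, hj, a1, a2, a3, a4]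
    have simKeep : ∀ {j}, j = 10 ∨ (31 ≤ j ∧ j ≤ 35) ∨ (∃ l, j = simReg l) →
        Keep j ∧ (j < 42 ∨ 50 < j) ∧ j ≠ 29 := by
      intro j hj
      unfold Keep
      rcases hj with rfl | h | ⟨j, rfl⟩
      · norm_num
      · omega
      · simp only [simReg]; omega
    have hs₁ : Sim Rg M (S i) σ₁ :=
      hρ.congr hm₁' fun j hj => hr₁' j (simKeep hj).1 (simKeep hj).2.1
    have hE₁ : L.Env σ₁ := hEρ.congr fun j a b => hr₁' j (.inl (by omega)) (by omega)
    have h29₁ : σ₁.reg 29 = i := (hr₁' 29 (by decide) (by decide)).trans h29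
    have hl₁ : Rg.Local L.w σ σ₁ := fun a x y => by rw [hm₁']; exact hloc a x y
    -- The bits used before clause `i` and those used for it are within the budget of the whole
    -- sequence.
    have hcoin : (S i).coins + steps (τ i) ≤ B := by
      have c1 := hSc i hi.le
      have c2 : ∑ j ∈ Finset.range (i + 1), steps (τ j) ≤ ∑ j ∈ Finset.range L.cl.length,
          steps (τ j) := Finset.sum_le_sum_of_subset (Finset.range_mono hi)
      rw [Finset.sum_range_succ] at c2
      omega
    have hserve := hSi i hi
    have simFinal : ∀ {σ₂ : NS}, Sim Rg M (S (i + 1)) σ₂ → ∀ v,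
        Sim Rg M (S (i + 1)) ((σ₂.set 29 (i + 1)).scr v) := by
      intro σ₂ h v
      refine h.congr rfl fun j hj => ?_
      obtain ⟨a1, a2, a3⟩ := simKeep hj
      simp only [Keep] at a1
      simp [a1, a3]
    have hflip : (if flip = true then Ex.op .eq (.rg 46) (.lit 0) else .rg 46).val σ₁ ≠ 0 ↔
        (flip ^^ L.act h i) = true := by
      cases flip <;> simp [hact]
    refine .ifP hW (by cases flip <;> rfl) (by cases flip <;> simp) (fun hne v => ?_)
      fun heq v => ?_
    · rw [if_pos (hflip.1 hne)] at hserve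
      simp only [List.map_cons, List.map_nil] at hserve
      generalize hτ : τ i = t at hserve hcoin
      cases hserve with
      | @cons _ u₁ _ _ _ a₁ t₁ x₁ hserve =>
      cases hserve with
      | @cons _ u₂ _ _ _ a₂ t₂ x₂ hserve =>
      cases hserve
      rw [A.prog_opOf] at x₁ x₂
      simp only [steps, List.map_cons, List.map_nil, List.sum_cons, List.sum_nil] at hcoin
      have y₁ := x₁.coins_le
      rw [Op.feed_coins] at y₁
      have hs₁' : Sim Rg M (S i) (σ₁.scr v) := hs₁.congr rfl fun j hj => by
        have := (simKeep hj).1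
        simp only [Keep] at this
        simp [this]
      have hE₁' : L.Env (σ₁.scr v) := hE₁.congr fun j a b => by
        have : j < 60 := by omega
        simp [this]
      refine .seq (.cmds hW (by cases ins <;> rfl)
        (hfeed hE₁' (by simpa using h29₁) hi (by norm_num)) fun v₂ => ?_)
      have hs₂ := effect_feedCmds rfl hs₁' hE₁' (ins := ins) (s := 0) (by norm_num)
        (by simpa using h29₁) (by omega) v₂
      have hT₂ : Tape Rg ω B σ₁ := hT.of_local hRg hl₁
      refine .seq ((Exec.simulate hRg x₁ hM (by rw [Op.feed_coins]; omega) hs₂ hT₂).frame.mono ?_)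
      rintro k₂ σ₂ ⟨⟨hk₂, hs₂', hl₂⟩, hf₂, -, -⟩
      have keep₂ : ∀ j, 1 ≤ j → j ≤ 30 → σ₂.reg j = σ₁.reg j := by
        intro j h1 h2
        rw [hf₂ j (tr_writes_keep (.inl (by omega)) (.inl (by omega)) (by omega))]
        have : j < 60 := by omega
        have n : ∀ l, j ≠ simReg l := by intro l; simp only [simReg]; omega
        simp [effect, feedCmds, Cmd.next, this, n]
      have hE₂ : L.Env σ₂ := hE₁.congr fun j a b => keep₂ j a (by omega)
      have h29₂ : σ₂.reg 29 = i := (keep₂ 29 (by norm_num) (by norm_num)).trans h29₁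
      have hl₂' : Rg.Local L.w σ₁ σ₂ := hl₂
      refine .seq (.cmds hW (by cases ins <;> rfl) (hfeed hE₂ h29₂ hi (by norm_num)) fun v₃ => ?_)
      have hs₃ := effect_feedCmds rfl hs₂' hE₂ (ins := ins) (s := 1) (by norm_num) h29₂
        (by omega) v₃
      have hT₃ : Tape Rg ω B σ₂ := hT₂.of_local hRg hl₂'
      refine (Exec.simulate hRg x₂ hM (by rw [Op.feed_coins]; omega) hs₃ hT₃).mono ?_
      rintro k₃ σ₃ ⟨hk₃, hs₃', hl₃⟩
      have hl₃' : Rg.Local L.w σ₂ σ₃ := hl₃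
      refine ⟨?_, fun v => ⟨simFinal hs₃' v, (hl₁.trans hl₂').trans hl₃'⟩⟩
      simp only [steps, List.map_cons, List.map_nil, List.sum_cons, List.sum_nil]
      omega
    · rw [if_neg (fun hc => (hflip.2 hc) heq)] at hserve
      simp only [List.map_nil] at hserve
      obtain ⟨-, hS⟩ := hserve.of_nil
      refine .skip ⟨by omega, fun v' => ⟨?_, fun a x y => hl₁ a x y⟩⟩
      refine simFinal (hS ▸ hs₁.congr rfl fun j hj => ?_) v'
      have := (simKeep hj).1
      simp only [Keep] at this
      simp [this]
  · rintro k ρ hk ⟨h1, h2⟩ - -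
    rw [hSm] at h1
    refine ⟨?_, h1, h2⟩
    rw [hsum]
    simp only [Finset.sum_add_distrib, ← Finset.mul_sum, Finset.sum_const, Finset.card_range,
      smul_eq_mul] at hk
    have : L.cl.length * (100 * (flat L.cl).length + 600) =
      100 * (L.cl.length * (flat L.cl).length) + 600 * L.cl.length := by ring
    omega

end DynGraph

/-! ### Lists of register copies -/

namespace WordRAM

theorem effect_append (σ : NS) (l l' : List Cmd) :
    effect σ (l ++ l') = effect (effect σ l) l' := by
  induction l generalizing σ with
  | nil => rfl
  | cons c l ih => exact ih _

theorem cmdsOk_append {w : ℕ} {σ : NS} {l l' : List Cmd} :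
    CmdsOk w σ (l ++ l') ↔ CmdsOk w σ l ∧ CmdsOk w (effect σ l) l' := by
  induction l generalizing σ with
  | nil => simp [CmdsOk, effect]
  | cons c l ih => simp [CmdsOk, effect, ih, and_assoc]

theorem cmdsOk_of_forall {w : ℕ} {l : List Cmd} (h : ∀ c ∈ l, ∀ σ, c.Ok w σ) {σ : NS} :
    CmdsOk w σ l := by
  induction l generalizing σ with
  | nil => trivial
  | cons c l ih => exact ⟨h c (by simp) σ, ih fun c hc => h c (by simp [hc])⟩

/-- The assignments `reg (d i) := e i` for `i < M`. -/
def copyCmds (M : ℕ) (d : ℕ → ℕ) (e : ℕ → Ex) : List Cmd :=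
  (List.range M).map fun i => .asg (d i) (e i)

/-- The sources do not depend on any of the destinations, so the order of the assignments is
irrelevant and they act simultaneously. -/
theorem effect_copyCmds {d : ℕ → ℕ} (hd : Function.Injective d) {e : ℕ → Ex} {σ : NS} {x : ℕ → ℕ}
    (he : ∀ i τ, (∀ j, (∀ i, j ≠ d i) → τ.reg j = σ.reg j) → (e i).val τ = x i) (M : ℕ) :
    (effect σ (copyCmds M d e)).mem = σ.mem ∧ (effect σ (copyCmds M d e)).coins = σ.coins ∧
      (∀ i < M, (effect σ (copyCmds M d e)).reg (d i) = x i) ∧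
      ∀ j, (∀ i, j ≠ d i) → (effect σ (copyCmds M d e)).reg j = σ.reg j := by
  induction M with
  | zero => exact ⟨rfl, rfl, by simp, fun _ _ => rfl⟩
  | succ M ih =>
    obtain ⟨h1, h2, h3, h4⟩ := ih
    unfold copyCmds at *
    rw [List.range_succ, List.map_append, effect_append]
    simp only [List.map_cons, List.map_nil, effect, Cmd.next]
    refine ⟨h1, h2, fun i hi => ?_, fun j hj => ?_⟩
    · rw [NS.set_reg]
      by_cases hiM : i = M
      · subst hiM
        rw [if_pos rfl]
        exact he i _ h4
      · rw [if_neg fun h => hiM (hd h)]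
        exact h3 i (by omega)
    · rw [NS.set_reg, if_neg (hj M)]
      exact h4 j hj

end WordRAM

namespace DynGraph

open WordRAM

/-! ## Phases -/

/-- The flag in register 0 is raised as soon as the vote of some phase exceeds half of the number of
runs. Votes never decrease, so no final pass over the phases is needed. -/
def voteCmds (thr : ℕ) : List Cmd :=
  [.put (.rg 15 + .rg 37) (.ld (.rg 15 + .rg 37) + .op .lt (.lit thr) (.rg (simReg 0))),
   .asg 0 (.op .bor (.rg 0) (.op .lt (.rg 13) (.lit 2 * .ld (.rg 15 + .rg 37))))]

def upsP (U : Prog) : Setting → Prog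
  | .decremental => updateP U true false
  | _ => updateP U false true

def downsP (U : Prog) : Setting → Prog
  | .fullyDynamic => updateP U false false
  | _ => .skip

/-- Serve a phase and count its vote. -/
def coreP (A : Algorithm) (S : Setting) (thr : ℕ) : Prog :=
  .seq (upsP A.update S) (.seq (tr A.query) (.seq (cmds (voteCmds thr)) (downsP A.update S)))

theorem coreP_writes {A : Algorithm} (S : Setting) (thr : ℕ) {i : ℕ} (hi : Keep i)
    (h : i < 42 ∨ 50 < i) (h' : i < 100 ∨ ∃ j, i = 101 + 2 * j) (h35 : i ≠ 35) (h29 : i ≠ 29)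
    (h0 : i ≠ 0) : (coreP A S thr).writes i = false := by
  have e1 : (upsP A.update S).writes i = false := by
    cases S <;> exact updateP_writes _ _ hi h h' h35 h29
  have e2 : (downsP A.update S).writes i = false := by
    cases S
    · exact updateP_writes _ _ hi h h' h35 h29
    · rfl
    · rfl
  simp only [coreP, Prog.writes, e1, e2, tr_writes_keep hi h' h35]
  rw [cmds_writes (by rfl) hi (by simp [voteCmds, Cmd.sets, h0])]
  rfl

/-- The memory outside the regions, and the flag: the clauses, the random bits `ω`, the votes `v`,
and whether some vote exceeds half of the runs. -/
structure Outer (L : Layout) (ω : ℕ → Bool) (v : ℕ → ℕ) (σ : NS) : Prop where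
  clauses : Holds σ.mem 2 (flat L.cl)
  tape : ∀ i < L.R * L.B, σ.mem (L.T₀ + i) = if ω i = true then 1 else 0
  votes : ∀ h < L.H, σ.mem (L.VB + h) = v h
  flag_le : σ.reg 0 ≤ 1
  flag : σ.reg 0 ≠ 0 ↔ ∃ h < L.H, L.R < 2 * v h

theorem Outer.congr {L : Layout} {W : ℕ} (hL : L.Ok W) {ω : ℕ → Bool} {v : ℕ → ℕ} {σ σ' : NS}
    (h : Outer L ω v σ) (hm : ∀ a < L.V, σ'.mem a = σ.mem a) (h0 : σ'.reg 0 = σ.reg 0) :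
    Outer L ω v σ' where
  clauses i hi := by
    have := hL.tape
    rw [hm _ (by unfold Layout.V Layout.VB; omega)]
    exact h.clauses i hi
  tape i hi := by
    rw [hm _ (by unfold Layout.V Layout.VB; omega)]
    exact h.tape i hi
  votes i hi := by
    rw [hm _ (by unfold Layout.V; omega)]
    exact h.votes i hi
  flag_le := h0 ▸ h.flag_le
  flag := h0 ▸ h.flag

/-- The region of run `q`. -/
def Layout.region (L : Layout) (q : ℕ) (roll : Bool) (cur : ℕ) : Region where
  base := L.base q
  -- With `roll` the writes go to a separate overlay; without it the overlay is the base itself.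
  front := if roll = true then L.base q + L.Z else L.base q
  stamp := L.base q + 2 * L.Z
  cur := cur
  tape := L.T₀ + q * L.B

theorem Layout.Ok.region {L : Layout} {W : ℕ} (hL : L.Ok W) {q : ℕ} (hq : q < L.R) (roll : Bool)
    (cur : ℕ) : (L.region q roll cur).Ok W L.w L.B := by
  have h1 := hL.base_add_le hq
  have h2 := hL.size
  have h3 : (q + 1) * L.B ≤ L.R * L.B := Nat.mul_le_mul_right _ hq
  have h4 : L.V ≤ L.base q := Nat.le_add_right _ _
  have h5 : L.VB ≤ L.V := Nat.le_add_right _ _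
  unfold Layout.VB at h5
  rw [Nat.add_mul, Nat.one_mul] at h3
  refine ⟨hL.word, hL.W_pos, ?_, ?_, ?_, ?_, ?_⟩ <;> simp only [Layout.region]
  · omega
  · cases roll
    · exact .inl rfl
    · exact .inr (by simp; omega)
  · split_ifs <;> omega
  · omega
  · omega

theorem Outer.region_tape {L : Layout} {ω : ℕ → Bool} {v : ℕ → ℕ} {σ : NS} (h : Outer L ω v σ)
    {q : ℕ} (hq : q < L.R) (roll : Bool) (cur : ℕ) :
    Tape (L.region q roll cur) (shift (q * L.B) ω) L.B σ := by
  intro c hc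
  have h3 : (q + 1) * L.B ≤ L.R * L.B := Nat.mul_le_mul_right _ hq
  rw [Nat.add_mul, Nat.one_mul] at h3
  have := h.tape (q * L.B + c) (by omega)
  simp only [Layout.region, shift]
  rw [add_assoc, this]
  congr

/-- Phase `h` leads from `s` to `s'`, with answer `e`, in `τ` steps. -/
def Algorithm.Phase (A : Algorithm) (L : Layout) (S : Setting) (ω : ℕ → Bool) (h : ℕ)
    (s s' : State L.w) (e τ : ℕ) : Prop :=
  ∃ a b t t' k, A.ServesTo ω s (L.g.ups S L.cl.length (L.act h)) t a ∧ Exec ω A.query a k b ∧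
    A.ServesTo ω b (L.g.downs S L.cl.length (L.act h)) t' s' ∧ (b.reg 0).toNat = e ∧
    steps t + k + steps t' = τ

/-- All programs of the algorithm use registers below `M` only. -/
structure Algorithm.Below (A : Algorithm) (M : ℕ) : Prop where
  preprocess : A.preprocess.Below M
  update : A.update.Below M
  query : A.query.Below M
  pos : 0 < M

theorem Algorithm.exists_below (A : Algorithm) : ∃ M, A.Below M := by
  obtain ⟨M₁, h₁⟩ := A.preprocess.exists_below
  obtain ⟨M₂, h₂⟩ := A.update.exists_below
  obtain ⟨M₃, h₃⟩ := A.query.exists_below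
  exact ⟨M₁ + M₂ + M₃ + 1, h₁.mono (by omega), h₂.mono (by omega), h₃.mono (by omega), by omega⟩

theorem sim_regs_keep {j : ℕ} (hj : j = 10 ∨ (31 ≤ j ∧ j ≤ 35) ∨ (∃ l, j = simReg l)) :
    Keep j ∧ (j < 36 ∨ 60 < j) ∧ j ≠ 0 := by
  unfold Keep
  rcases hj with rfl | h | ⟨j, rfl⟩
  · norm_num
  · omega
  · simp only [simReg]; omega

theorem opOf_true {n : ℕ} : (opOf true : Fin n → Fin n → Op n) = Op.insert := rfl

theorem opOf_false {n : ℕ} : (opOf false : Fin n → Fin n → Op n) = Op.delete := rfl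

theorem nwp_upsP {L : Layout} {W : ℕ} (hL : L.Ok W) {ω ω' : ℕ → Bool} {σ : NS}
    {A : Algorithm} {S : Setting} {h M : ℕ} {Rg : Region} {s s' : State L.w}
    {tr : List (ℕ × ℕ)} {B : ℕ} (hE : L.Env σ) (hcl : Holds σ.mem 2 (flat L.cl))
    (hf : L.T₀ ≤ Rg.front) (hst : L.T₀ ≤ Rg.stamp) (hRg : Rg.Ok W L.w B) (hT : Tape Rg ω B σ)
    (h37 : σ.reg 37 = h) (hh : h < L.H) (hs : Sim Rg M s σ) (hM : A.Below M)
    (hops : A.ServesTo ω s (L.g.ups S L.cl.length (L.act h)) tr s')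
    (hB : s.coins + steps tr ≤ B) :
    NWP W ω' (upsP A.update S) σ fun k σ' =>
      k ≤ 10 + L.cl.length * (100 * (flat L.cl).length + 600) + 9 * steps tr ∧
      Sim Rg M s' σ' ∧ Rg.Local L.w σ σ' := by
  cases S
  · exact nwp_updateP hL hE hcl hf hst hRg hT h37 hh hs hM.update
      (by simpa [Gadget.ups, opOf_true, opOf_false] using hops) hB
  · exact nwp_updateP hL hE hcl hf hst hRg hT h37 hh hs hM.update
      (by simpa [Gadget.ups, opOf_true, opOf_false] using hops) hB
  · exact nwp_updateP hL hE hcl hf hst hRg hT h37 hh hs hM.update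
      (by simpa [Gadget.ups, opOf_true, opOf_false] using hops) hB

theorem nwp_downsP {L : Layout} {W : ℕ} (hL : L.Ok W) {ω ω' : ℕ → Bool} {σ : NS}
    {A : Algorithm} {S : Setting} {h M : ℕ} {Rg : Region} {s s' : State L.w}
    {tr : List (ℕ × ℕ)} {B : ℕ} (hE : L.Env σ) (hcl : Holds σ.mem 2 (flat L.cl))
    (hf : L.T₀ ≤ Rg.front) (hst : L.T₀ ≤ Rg.stamp) (hRg : Rg.Ok W L.w B) (hT : Tape Rg ω B σ)
    (h37 : σ.reg 37 = h) (hh : h < L.H) (hs : Sim Rg M s σ) (hM : A.Below M)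
    (hops : A.ServesTo ω s (L.g.downs S L.cl.length (L.act h)) tr s')
    (hB : s.coins + steps tr ≤ B) :
    NWP W ω' (downsP A.update S) σ fun k σ' =>
      k ≤ 10 + L.cl.length * (100 * (flat L.cl).length + 600) + 9 * steps tr ∧
      Sim Rg M s' σ' ∧ Rg.Local L.w σ σ' := by
  cases S
  · exact nwp_updateP hL hE hcl hf hst hRg hT h37 hh hs hM.update
      (by simpa [Gadget.downs, opOf_true, opOf_false] using hops) hB
  · obtain ⟨rfl, rfl⟩ := hops.of_nil
    exact .skip ⟨by omega, hs, .refl _ _ _⟩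
  · obtain ⟨rfl, rfl⟩ := hops.of_nil
    exact .skip ⟨by omega, hs, .refl _ _ _⟩

theorem upsP_writes (U : Prog) (S : Setting) {i : ℕ} (hi : Keep i)
    (h : i < 42 ∨ 50 < i) (h' : i < 100 ∨ ∃ j, i = 101 + 2 * j) (h35 : i ≠ 35) (h29 : i ≠ 29) :
    (upsP U S).writes i = false := by
  cases S <;> exact updateP_writes _ _ hi h h' h35 h29

theorem downsP_writes (U : Prog) (S : Setting) {i : ℕ} (hi : Keep i)
    (h : i < 42 ∨ 50 < i) (h' : i < 100 ∨ ∃ j, i = 101 + 2 * j) (h35 : i ≠ 35) (h29 : i ≠ 29) :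
    (downsP U S).writes i = false := by
  cases S
  · exact updateP_writes _ _ hi h h' h35 h29
  · rfl
  · rfl

/-- Updates, query, vote and undoing are specified together, because a phase of the algorithm is one
continuous run. The hypothesis on `v h` ensures that an added vote stays within the number of runs.
-/
theorem nwp_coreP {L : Layout} {W : ℕ} (hL : L.Ok W) {ω ω' : ℕ → Bool} {σ : NS}
    {A : Algorithm} {S : Setting} {thr h M q : ℕ} {roll : Bool} {cur : ℕ} {s s' : State L.w}
    {e τ : ℕ} {v : ℕ → ℕ} (hE : L.Env σ) (hO : Outer L ω v σ) (hq : q < L.R)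
    (h37 : σ.reg 37 = h) (hh : h < L.H) (hs : Sim (L.region q roll cur) M s σ) (hM : A.Below M)
    (hP : A.Phase L S (shift (q * L.B) ω) h s s' e τ) (hB : s.coins + τ ≤ L.B)
    (hthr : thr < 2 ^ W) (hv : v h < L.R) :
    NWP W ω' (coreP A S thr) σ fun k σ' =>
      k ≤ 200 + 2 * (L.cl.length * (100 * (flat L.cl).length + 600)) + 9 * τ ∧
      Sim (L.region q roll cur) M s' σ' ∧
      Outer L ω (fun h' => if h' = h then v h + (if thr < e then 1 else 0) else v h') σ' ∧
      ∀ a, L.V ≤ a → (a < (L.region q roll cur).front ∨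
        (L.region q roll cur).front + 2 ^ L.w ≤ a) →
        (a < (L.region q roll cur).stamp ∨ (L.region q roll cur).stamp + 2 ^ L.w ≤ a) →
        σ'.mem a = σ.mem a := by
  obtain ⟨a, b, t, t', kq, p1, p2, p3, rfl, rfl⟩ := hP
  set Rg := L.region q roll cur with hRgdef
  have hRg : Rg.Ok W L.w L.B := hL.region hq roll cur
  have hW := hL.W_pos
  have hbase : L.V ≤ L.base q := Nat.le_add_right _ _
  have hVV : L.T₀ ≤ L.V := by unfold Layout.V Layout.VB; omega
  have hfV : L.V ≤ Rg.front := by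
    rw [hRgdef]; simp only [Layout.region]; split_ifs <;> omega
  have hsV : L.V ≤ Rg.stamp := by
    rw [hRgdef]; simp only [Layout.region]; omega
  have c1 := p1.coins_le
  have c2 := p2.coins_le
  have c3 := p3.coins_le
  have htop := hL.base_add_le hq
  have htop' := hL.top
  have hsize := hL.size
  have h2w := Nat.two_pow_pos L.w
  have hZR : 16 * L.R ≤ 3 * L.Z * L.R := Nat.mul_le_mul_right _ (by omega)
  have hT : Tape Rg (shift (q * L.B) ω) L.B σ := hO.region_tape hq roll cur
  refine .seq ((nwp_upsP hL hE hO.clauses (hVV.trans hfV) (hVV.trans hsV) hRg hT h37 hh hs hM p1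
    (by omega)).frame.mono ?_)
  rintro k₁ σ₁ ⟨⟨hk₁, hs₁, hl₁⟩, hf₁, -, -⟩
  have keep₁ : ∀ i, i < 42 → i ≠ 35 → i ≠ 29 → σ₁.reg i = σ.reg i := fun i h1 h2 h3 =>
    hf₁ i (upsP_writes _ S (.inl (by omega)) (.inl h1) (.inl (by omega)) h2 h3)
  have hT₁ := hT.of_local hRg hl₁
  refine .seq ((Exec.simulate hRg p2 hM.query (by omega) hs₁ hT₁).frame.mono ?_)
  rintro k₂ σ₂ ⟨⟨hk₂, hs₂, hl₂⟩, hf₂, -, -⟩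
  have keep₂ : ∀ i, i < 42 → i ≠ 35 → i ≠ 29 → σ₂.reg i = σ.reg i := fun i h1 h2 h3 =>
    (hf₂ i (tr_writes_keep (.inl (by omega)) (.inl (by omega)) h2)).trans (keep₁ i h1 h2 h3)
  have hE₂ : L.Env σ₂ := hE.congr fun i h1 h2 => keep₂ i (by omega) (by omega) (by omega)
  have hl₂' := hl₁.trans hl₂
  have hO₂ : Outer L ω v σ₂ := hO.congr hL (fun a ha => hl₂' a (.inl (by omega)) (.inl (by omega)))
    (keep₂ 0 (by norm_num) (by norm_num) (by norm_num))
  have h37₂ : σ₂.reg 37 = h := (keep₂ 37 (by norm_num) (by norm_num) (by norm_num)).trans h37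
  have hvote := hO₂.votes h hh
  have hans := hs₂.reg 0 hM.pos
  simp only [simReg, mul_zero, add_zero] at hans
  have hflag := hO₂.flag_le
  have hbit : (if thr < (b.reg 0).toNat then 1 else 0) ≤ 1 := bit_le _
  have hVH : L.VB + h < L.V := by unfold Layout.V; omega
  have hkc : cost (voteCmds thr) ≤ 100 := by simp [cost, voteCmds, Cmd.instrs, Ex.code]
  have h2w := Nat.two_pow_pos L.w
  set w := v h + (if thr < (b.reg 0).toNat then 1 else 0) with hw
  have hbit2 : (if L.R < 2 * w then 1 else 0) ≤ 1 := bit_le _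
  refine .seq (.cmds hW (by rfl) ?_ fun x => ?_)
  · simp [CmdsOk, voteCmds, Cmd.Ok, Cmd.next, hE₂.r15, h37₂, hvote, hthr, hans, ← hw]
    omega
  have hmem₃ : ∀ y, ((effect σ₂ (voteCmds thr)).scr x).mem y =
      if y = L.VB + h then w else σ₂.mem y := by
    intro y
    simp [effect, voteCmds, Cmd.next, hE₂.r15, h37₂, hvote, hans, hw]
  have hreg0 : ((effect σ₂ (voteCmds thr)).scr x).reg 0 =
      σ₂.reg 0 ||| (if L.R < 2 * w then 1 else 0) := by
    simp [effect, voteCmds, Cmd.next, hE₂.r15, h37₂, hvote, hans, hw, hE₂.r13]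
  have hreg₃ : ∀ i, Keep i → i ≠ 0 →
      ((effect σ₂ (voteCmds thr)).scr x).reg i = σ₂.reg i := by
    intro i hi h0
    simp only [Keep] at hi
    simp [effect, voteCmds, Cmd.next, hi, h0]
  generalize (effect σ₂ (voteCmds thr)).scr x = σ₃ at hmem₃ hreg0 hreg₃
  -- The vote lies below `L.V`, outside every region, so the represented configuration is the same.
  have hs₃ : Sim Rg M b σ₃ := by
    have hrr : ∀ i, i = 10 ∨ (31 ≤ i ∧ i ≤ 35) ∨ (∃ j, i = simReg j) → σ₃.reg i = σ₂.reg i :=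
      fun i hi => hreg₃ i (sim_regs_keep hi).1 (sim_regs_keep hi).2.2
    have hb' : L.V ≤ Rg.base := hbase
    have := (hs₂.congr (σ' := { σ₃ with mem := σ₂.mem }) rfl hrr)
    exact
      { mask := this.mask
        base := this.base
        front := this.front
        stamp := this.stamp
        cur := this.cur
        pos := this.pos
        reg := this.reg
        mem := fun y => by
          have hfar : ∀ b, L.V ≤ b → σ₃.mem (b + y.toNat) = σ₂.mem (b + y.toNat) := fun b hb => by
            rw [hmem₃, if_neg (by omega)]
          rw [hfar _ hsV, hfar _ hfV, hfar _ hb']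
          exact this.mem y
        le := fun y => by
          rw [hmem₃, if_neg (by omega)]
          exact this.le y }
  have hE₃ : L.Env σ₃ := hE₂.congr fun i h1 h2 => hreg₃ i (.inl (by omega)) (by omega)
  have hO₃ : Outer L ω (fun h' => if h' = h then w else v h') σ₃ := by
    have hT0 := hL.tape
    refine ⟨fun i hi => ?_, fun i hi => ?_, fun i hi => ?_, ?_, ?_⟩
    · rw [hmem₃, if_neg (by unfold Layout.VB; omega)]
      exact hO₂.clauses i hi
    · rw [hmem₃, if_neg (by unfold Layout.VB; omega)]
      exact hO₂.tape i hi
    · rw [hmem₃]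
      by_cases hih : i = h
      · simp [hih]
      · rw [if_neg (by omega), if_neg hih]
        exact hO₂.votes i hi
    · rw [hreg0]
      exact bit_or_le hflag hbit2
    · rw [hreg0]
      have hor : ∀ x y : ℕ, x ≤ 1 → y ≤ 1 → (x ||| y ≠ 0 ↔ x ≠ 0 ∨ y ≠ 0) := by
        intro x y hx hy
        interval_cases x <;> interval_cases y <;> simp
      rw [hor _ _ hflag hbit2, hO₂.flag]
      constructor
      · rintro (⟨h', hh', hlt⟩ | hne)
        · refine ⟨h', hh', ?_⟩
          split_ifs with heq
          · subst heq; omega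
          · exact hlt
        · refine ⟨h, hh, ?_⟩
          rw [if_pos rfl]
          by_contra hc
          simp [hc] at hne
      · rintro ⟨h', hh', hlt⟩
        by_cases heq : h' = h
        · rw [if_pos heq] at hlt
          exact .inr (by simp [hlt])
        · rw [if_neg heq] at hlt
          exact .inl ⟨h', hh', hlt⟩
  have h37₃ : σ₃.reg 37 = h := (hreg₃ 37 (by decide) (by decide)).trans h37₂
  refine (nwp_downsP hL hE₃ hO₃.clauses (hVV.trans hfV) (hVV.trans hsV) hRg
    (hO₃.region_tape hq roll cur) h37₃ hh hs₃ hM p3 (by omega)).frame.mono ?_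
  rintro k₄ σ₄ ⟨⟨hk₄, hs₄, hl₄⟩, hf₄, -, -⟩
  refine ⟨by omega, hs₄, hO₃.congr hL (fun a ha => hl₄ a (.inl (by omega)) (.inl (by omega)))
    (hf₄ 0 (downsP_writes _ S (by decide) (by decide) (.inl (by decide)) (by decide) (by decide))),
    fun y hy h1 h2 => ?_⟩
  rw [hl₄ y h1 h2, hmem₃, if_neg (by omega)]
  exact hl₂' y h1 h2

end DynGraph

namespace DynGraph

open WordRAM

/-! ## Runs -/

/-- Resume from the saved configuration. -/
def enterCmds (M : ℕ) : List Cmd :=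
  [.asg 34 (.rg 34 + .lit 1), .asg 35 (.rg 36)] ++ copyCmds M simReg fun i => .rg (101 + 2 * i)

/-- Save the configuration. -/
def parkCmds (M : ℕ) : List Cmd :=
  [.asg 32 (.rg 31 + .rg 17), .asg 36 (.rg 35)] ++
    copyCmds M (fun i => 101 + 2 * i) fun i => .rg (simReg i)

/-- The current stamp starts at 1, because fresh cells carry the stamp 0. -/
def initCmds (M : ℕ) : List Cmd :=
  [.asg 31 (.rg 16 + .lit 3 * .rg 17 * .rg 30), .asg 32 (.rg 31), .asg 33 (.rg 31 + .lit 2 * .rg 17),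
    .asg 34 (.lit 1), .asg 35 (.rg 14 + .rg 30 * .rg 12)] ++ copyCmds M simReg fun _ => .lit 0

/-- In the fully dynamic setting a phase continues from the previous one; otherwise it resumes from
the configuration saved after the preprocessing. -/
def phaseP (A : Algorithm) (S : Setting) (thr M : ℕ) : Prog :=
  match S with
  | .fullyDynamic => coreP A S thr
  | _ => .seq (cmds (enterCmds M)) (coreP A S thr)

def parkP (S : Setting) (M : ℕ) : Prog :=
  match S with
  | .fullyDynamic => .skip
  | _ => cmds (parkCmds M)

def runP (A : Algorithm) (S : Setting) (par : Parameter) (thr M : ℕ) : Prog :=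
  .seq (cmds (initCmds M)) (.seq (graphP S par) (.seq (tr A.preprocess)
    (.seq (parkP S M) (forP 37 11 (phaseP A S thr M)))))

theorem copyCmds_wf {M : ℕ} {d : ℕ → ℕ} {e : ℕ → Ex} (h : ∀ i, (Cmd.asg (d i) (e i)).wf = true) :
    (copyCmds M d e).all Cmd.wf = true := by
  simp [copyCmds, h]

theorem copyCmds_sets {M : ℕ} {d : ℕ → ℕ} {e : ℕ → Ex} {i : ℕ} (h : ∀ j, i ≠ d j) :
    (copyCmds M d e).all (fun c => !c.sets i) = true := by
  simp [copyCmds, Cmd.sets, h]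

theorem enterCmds_wf (M : ℕ) : (enterCmds M).all Cmd.wf = true := by
  rw [enterCmds, List.all_append, copyCmds_wf fun i => ?_]
  · rfl
  · simp [Cmd.wf, Ex.wf, simReg, Keep]; omega

theorem parkCmds_wf (M : ℕ) : (parkCmds M).all Cmd.wf = true := by
  rw [parkCmds, List.all_append, copyCmds_wf fun i => ?_]
  · rfl
  · simp [Cmd.wf, Ex.wf, simReg, Keep]; omega

theorem initCmds_wf (M : ℕ) : (initCmds M).all Cmd.wf = true := by
  rw [initCmds, List.all_append, copyCmds_wf fun i => ?_]
  · rfl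
  · simp [Cmd.wf, Ex.wf, simReg, Keep]

theorem phaseP_writes {A : Algorithm} (S : Setting) (thr M : ℕ) {i : ℕ} (hi : i < 29 ∨ i = 30 ∨
    i = 31 ∨ i = 32 ∨ i = 33 ∨ i = 36 ∨ i = 37 ∨ ∃ j, i = 101 + 2 * j) (h0 : i ≠ 0) :
    (phaseP A S thr M).writes i = false := by
  have hi' : (i < 29 ∨ i = 30 ∨ i = 31 ∨ i = 32 ∨ i = 33 ∨ i = 36 ∨ i = 37) ∨
      (101 ≤ i ∧ ∃ j, i = 101 + 2 * j) := by
    by_cases h : ∃ j, i = 101 + 2 * j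
    · obtain ⟨j, rfl⟩ := h
      exact .inr ⟨by omega, j, rfl⟩
    · exact .inl (by tauto)
  clear hi
  have hk : Keep i ∧ (i < 42 ∨ 50 < i) ∧ i ≠ 34 ∧ i ≠ 35 ∧ i ≠ 29 ∧ ∀ j, i ≠ simReg j := by
    unfold Keep simReg
    rcases hi' with h | ⟨h, j, rfl⟩ <;> refine ⟨?_, ?_, ?_, ?_, ?_, fun l => ?_⟩ <;> omega
  obtain ⟨hk, h42, h1, h2, h29, hsim⟩ := hk
  have hc : (coreP A S thr).writes i = false :=
    coreP_writes S thr hk h42 (hi'.imp (fun h => by omega) And.right) h2 h29 h0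
  have he : (cmds (enterCmds M)).writes i = false := by
    refine cmds_writes (enterCmds_wf M) hk ?_
    rw [enterCmds, List.all_append, copyCmds_sets hsim]
    simp [Cmd.sets, h1, h2]
  cases S
  · exact hc
  · simp only [phaseP, Prog.writes, hc, he, Bool.or_self]
  · simp only [phaseP, Prog.writes, hc, he, Bool.or_self]

theorem runP_writes {A : Algorithm} (S : Setting) (par : Parameter) (thr M : ℕ) {i : ℕ}
    (hi : i < 29 ∨ i = 30) (h0 : i ≠ 0) : (runP A S par thr M).writes i = false := by
  have hk : Keep i := by unfold Keep; omega
  have h1 : (cmds (initCmds M)).writes i = false := by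
    refine cmds_writes (initCmds_wf M) hk ?_
    rw [initCmds, List.all_append, copyCmds_sets fun j => by unfold simReg; omega]
    simp only [List.all_cons, Cmd.sets, List.all_nil, Bool.and_true, Bool.and_eq_true,
      Bool.not_eq_true', beq_eq_false_iff_ne]
    omega
  have h2 : (parkP S M).writes i = false := by
    have : (cmds (parkCmds M)).writes i = false := by
      refine cmds_writes (parkCmds_wf M) hk ?_
      rw [parkCmds, List.all_append, copyCmds_sets fun j => by omega]
      simp only [List.all_cons, Cmd.sets, List.all_nil, Bool.and_true, Bool.and_eq_true,
        Bool.not_eq_true', beq_eq_false_iff_ne]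
      omega
    cases S
    · rfl
    · exact this
    · exact this
  have h3 : i ≠ 37 := by omega
  simp only [runP, Prog.writes, h1, h2, graphP_writes S par (.inl (by omega)) hk,
    tr_writes_keep hk (.inl (by omega)) (by omega : i ≠ 35),
    forP_writes (c := 37) (lim := 11) (show i ≠ rTest by unfold Keep rTest at *; omega),
    phaseP_writes S thr M (i := i) (by omega) h0]
  simp [h3]

/-- The configuration between phases: `s` is simulated directly in the fully dynamic setting, and
saved, to be resumed in every phase, in the other settings. -/
def Layout.Rest (L : Layout) (q M : ℕ) (s : State L.w) (h : ℕ) (σ : NS) : Setting → Prop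
  | .fullyDynamic => Sim (L.region q false 1) M s σ
  | _ => σ.reg 31 = L.base q ∧ σ.reg 32 = L.base q + L.Z ∧ σ.reg 33 = L.base q + 2 * L.Z ∧
      σ.reg 34 = h + 1 ∧ σ.reg 36 = L.T₀ + q * L.B + s.coins ∧
      (∀ i < M, σ.reg (101 + 2 * i) = (s.reg i).toNat) ∧
      (∀ a : BitVec L.w, σ.mem (L.base q + a.toNat) = (s.mem a).toNat) ∧
      ∀ a : BitVec L.w, σ.mem (L.base q + 2 * L.Z + a.toNat) ≤ h + 1

theorem Layout.Rest.congr {L : Layout} {q M : ℕ} {s : State L.w} {h : ℕ} {σ σ' : NS} {S : Setting}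
    (hR : L.Rest q M s h σ S) (hm : σ'.mem = σ.mem)
    (hr : ∀ i, Keep i → i ≠ 37 → σ'.reg i = σ.reg i) : L.Rest q M s h σ' S := by
  cases S
  · exact Sim.congr hR hm fun i hi => hr i (sim_regs_keep hi).1 (by unfold simReg at hi; omega)
  all_goals
    obtain ⟨h1, h2, h3, h4, h5, h6, h7, h8⟩ := hR
    refine ⟨?_, ?_, ?_, ?_, ?_, fun i hi => ?_, ?_, ?_⟩
    · rw [hr 31 (by decide) (by decide), h1]
    · rw [hr 32 (by decide) (by decide), h2]
    · rw [hr 33 (by decide) (by decide), h3]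
    · rw [hr 34 (by decide) (by decide), h4]
    · rw [hr 36 (by decide) (by decide), h5]
    · rw [hr _ (.inr (by omega)) (by omega), h6 i hi]
    · rwa [hm]
    · rwa [hm]

/-- The configuration from which the next phase starts, if a phase leads from `s` to `s'`. -/
def Setting.rest {α : Type*} (s s' : α) : Setting → α
  | .fullyDynamic => s'
  | _ => s

theorem simReg_injective : Function.Injective simReg := fun i j h => by unfold simReg at h; omega

/-- Resuming restores the registers and the position on the tape and raises the stamp; the memory
comes back by itself, since the base was never written and the overlay is now empty. The cost
depends on the number of registers only, not on the size of the memory. -/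
theorem nwp_enter_core {L : Layout} {W : ℕ} (hL : L.Ok W) {ω ω' : ℕ → Bool} {σ : NS}
    {A : Algorithm} {S : Setting} {thr h M q : ℕ} {s s' : State L.w} {e τ : ℕ} {v : ℕ → ℕ}
    (hE : L.Env σ) (hO : Outer L ω v σ) (hq : q < L.R) (h37 : σ.reg 37 = h) (hh : h < L.H)
    (hs : L.Rest q M s h σ .incremental) (hM : A.Below M)
    (hP : A.Phase L S (shift (q * L.B) ω) h s s' e τ) (hB : s.coins + τ ≤ L.B)
    (hthr : thr < 2 ^ W) (hv : v h < L.R) :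
    NWP W ω' (.seq (cmds (enterCmds M)) (coreP A S thr)) σ fun k σ' =>
      k ≤ cost (enterCmds M) + 200 + 2 * (L.cl.length * (100 * (flat L.cl).length + 600)) + 9 * τ ∧
      L.Rest q M s (h + 1) σ' .incremental ∧
      Outer L ω (fun h' => if h' = h then v h + (if thr < e then 1 else 0) else v h') σ' ∧
      ∀ a, L.base (q + 1) ≤ a → σ'.mem a = σ.mem a := by
  obtain ⟨h1, h2, h3, h4, h5, h6, h7, h8⟩ := hs
  have hW := hL.W_pos
  have hbase := hL.base_add_le hq
  have hsize := hL.size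
  have h2w := Nat.two_pow_pos L.w
  have hV : L.V ≤ L.base q := Nat.le_add_right _ _
  have hHV : L.H ≤ L.V := by unfold Layout.V; omega
  have hsucc : L.base (q + 1) = L.base q + 3 * L.Z := by unfold Layout.base; ring
  have hcopy : ∀ i (x : NS), (∀ j, (∀ i, j ≠ simReg i) →
      x.reg j = (effect σ [.asg 34 (.rg 34 + .lit 1), .asg 35 (.rg 36)]).reg j) →
      (Ex.rg (101 + 2 * i)).val x = σ.reg (101 + 2 * i) := by
    intro i x hx
    have hi : ∀ j, 101 + 2 * i ≠ simReg j := fun j => by unfold simReg; omega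
    have e1 : 101 + 2 * i ≠ 35 := by omega
    have e2 : 101 + 2 * i ≠ 34 := by omega
    simp [Ex.val, hx _ hi, effect, Cmd.next, e1, e2]
  obtain ⟨e1, e2, e3, e4⟩ := effect_copyCmds simReg_injective hcopy M
  have hreg : ∀ j, Keep j → j ≠ 34 → j ≠ 35 → (∀ i, j ≠ simReg i) → ∀ x,
      ((effect σ (enterCmds M)).scr x).reg j = σ.reg j := by
    intro j hj n34 n35 hjs x
    rw [enterCmds, effect_append, (NS.agree_scr _ x).reg j hj, e4 j hjs]
    simp [effect, Cmd.next, n34, n35]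
  have hmem : ∀ x, ((effect σ (enterCmds M)).scr x).mem = σ.mem := by
    intro x
    rw [enterCmds, effect_append]
    exact e1
  have hcur : ∀ x, ((effect σ (enterCmds M)).scr x).reg 34 = h + 2 := by
    intro x
    rw [enterCmds, effect_append, (NS.agree_scr _ x).reg 34 (by decide),
      e4 34 fun i => by unfold simReg; omega]
    simp [effect, Cmd.next, h4]
  have hpos : ∀ x, ((effect σ (enterCmds M)).scr x).reg 35 = L.T₀ + q * L.B + s.coins := by
    intro x
    rw [enterCmds, effect_append, (NS.agree_scr _ x).reg 35 (by decide),
      e4 35 fun i => by unfold simReg; omega]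
    simp [effect, Cmd.next, h5]
  have hsim : ∀ x, ∀ i < M, ((effect σ (enterCmds M)).scr x).reg (simReg i) = (s.reg i).toNat := by
    intro x i hi
    rw [enterCmds, effect_append, (NS.agree_scr _ x).reg _ (.inr (by unfold simReg; omega)),
      e3 i hi, h6 i hi]
  refine .seq (.cmds hW (enterCmds_wf M) ?_ fun x => ?_)
  · rw [enterCmds, cmdsOk_append]
    refine ⟨?_, cmdsOk_of_forall fun c hc y => ?_⟩
    · simp [CmdsOk, Cmd.Ok, h4]; omega
    · obtain ⟨i, -, rfl⟩ := List.mem_map.1 hc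
      trivial
  specialize hmem x
  specialize hcur x
  specialize hpos x
  specialize hsim x
  replace hreg := fun j h1 h2 h3 h4 => hreg j h1 h2 h3 h4 x
  have hclt : ∀ i, 101 + 2 * i ≠ 34 ∧ 101 + 2 * i ≠ 35 ∧ ∀ j, 101 + 2 * i ≠ simReg j := by
    intro i
    exact ⟨by omega, by omega, fun j => by unfold simReg; omega⟩
  generalize (effect σ (enterCmds M)).scr x = σ₁ at hmem hcur hpos hsim hreg
  have low : ∀ j < 60, j ≠ 34 → j ≠ 35 → σ₁.reg j = σ.reg j := fun j hj n1 n2 =>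
    hreg j (.inl hj) n1 n2 fun i => by unfold simReg; omega
  have hs₁ : Sim (L.region q true (h + 2)) M s σ₁ :=
    { mask := (low 10 (by decide) (by decide) (by decide)).trans hE.r10
      base := (low 31 (by decide) (by decide) (by decide)).trans h1
      front := (low 32 (by decide) (by decide) (by decide)).trans h2
      stamp := (low 33 (by decide) (by decide) (by decide)).trans h3
      cur := hcur
      pos := hpos
      reg := hsim
      mem := fun a => by
        have := h8 a
        simp only [Layout.region, hmem]
        -- Stamps are at most `h + 1` and the current stamp is `h + 2`, so every read goes to the
        -- base.
        rw [if_neg (by omega)]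
        exact h7 a
      le := fun a => by
        rw [hmem]
        exact (h8 a).trans (Nat.le_succ _) }
  have hE₁ : L.Env σ₁ := hE.congr fun i h1 h2 => low i (by omega) (by omega) (by omega)
  refine (nwp_coreP hL hE₁ (hO.congr hL (fun a _ => by rw [hmem])
    (low 0 (by decide) (by decide) (by decide))) hq
    ((low 37 (by decide) (by decide) (by decide)).trans h37) hh hs₁ hM hP hB hthr hv).frame.mono ?_
  rintro k σ₂ ⟨⟨hk, hs₂, hO₂, hm₂⟩, hf, -, -⟩
  have keep₂ : ∀ i, i < 42 → i ≠ 34 → i ≠ 35 → i ≠ 29 → i ≠ 0 → σ₂.reg i = σ.reg i :=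
    fun i n1 n2 n3 n4 n5 => (hf i (coreP_writes S thr (.inl (by omega)) (.inl n1) (.inl (by omega))
      n3 n4 n5)).trans (low i (by omega) n2 n3)
  simp only [Layout.region, ite_true] at hm₂
  refine ⟨by omega, ⟨?_, ?_, ?_, hs₂.cur, ?_, fun i hi => ?_, fun a => ?_, hs₂.le⟩, hO₂, fun a ha => ?_⟩
  · rw [keep₂ 31 (by decide) (by decide) (by decide) (by decide) (by decide), h1]
  · rw [keep₂ 32 (by decide) (by decide) (by decide) (by decide) (by decide), h2]
  · rw [keep₂ 33 (by decide) (by decide) (by decide) (by decide) (by decide), h3]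
  · rw [keep₂ 36 (by decide) (by decide) (by decide) (by decide) (by decide), h5]
  · rw [hf _ (coreP_writes S thr (.inr (by omega)) (.inr (by omega)) (.inr ⟨i, rfl⟩) (by omega)
      (by omega) (by omega)), hreg _ (.inr (by omega)) (hclt i).1 (hclt i).2.1 (hclt i).2.2, h6 i hi]
  · have := a.isLt
    rw [hm₂ _ (by omega) (.inl (by omega)) (.inl (by omega)), hmem, h7 a]
  · rw [hm₂ a (by omega) (.inr (by omega)) (.inr (by omega)), hmem]

theorem nwp_phaseP {L : Layout} {W : ℕ} (hL : L.Ok W) {ω ω' : ℕ → Bool} {σ : NS}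
    {A : Algorithm} {S : Setting} {thr h M q : ℕ} {s s' : State L.w} {e τ : ℕ} {v : ℕ → ℕ}
    (hE : L.Env σ) (hO : Outer L ω v σ) (hq : q < L.R) (h37 : σ.reg 37 = h) (hh : h < L.H)
    (hs : L.Rest q M s h σ S) (hM : A.Below M)
    (hP : A.Phase L S (shift (q * L.B) ω) h s s' e τ) (hB : s.coins + τ ≤ L.B)
    (hthr : thr < 2 ^ W) (hv : v h < L.R) :
    NWP W ω' (phaseP A S thr M) σ fun k σ' =>
      k ≤ cost (enterCmds M) + 200 + 2 * (L.cl.length * (100 * (flat L.cl).length + 600)) + 9 * τ ∧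
      L.Rest q M (S.rest s s') (h + 1) σ' S ∧
      Outer L ω (fun h' => if h' = h then v h + (if thr < e then 1 else 0) else v h') σ' ∧
      ∀ a, L.base (q + 1) ≤ a → σ'.mem a = σ.mem a := by
  cases S
  · refine (nwp_coreP hL hE hO hq h37 hh hs hM hP hB hthr hv).mono ?_
    rintro k σ' ⟨hk, hs', hO', hm⟩
    refine ⟨by omega, hs', hO', fun a ha => ?_⟩
    have hsize := hL.size
    have hsucc : L.base (q + 1) = L.base q + 3 * L.Z := by unfold Layout.base; ring
    have hV : L.V ≤ L.base q := Nat.le_add_right _ _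
    refine hm a (by omega) (.inr ?_) (.inr ?_)
    · simp [Layout.region]; omega
    · simp [Layout.region]; omega
  · exact nwp_enter_core hL hE hO hq h37 hh hs hM hP hB hthr hv
  · exact nwp_enter_core hL hE hO hq h37 hh hs hM hP hB hthr hv

end DynGraph

/-! ### Correctness and time of repeated runs -/

namespace DynGraph

open WordRAM

/-- With the random bits `ω`, the algorithm gives the answer `ans h` in phase `h`, for all phases,
in at most `L.B` steps altogether. -/
def Algorithm.Inner (A : Algorithm) (L : Layout) (S : Setting) (par : Parameter) (ω : ℕ → Bool)
    (ans : ℕ → ℕ) : Prop :=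
  ∃ (st st' : ℕ → State L.w) (k₀ : ℕ) (τ : ℕ → ℕ),
    Exec ω A.preprocess (.initial L.w (par.input L.g.centre (L.g.edges (L.g.start S)))) k₀ (st 0) ∧
    (∀ h < L.H, A.Phase L S ω h (st h) (st' h) (ans h) (τ h) ∧ (st h).coins + τ h ≤ L.B ∧
      st (h + 1) = S.rest (st h) (st' h)) ∧
    k₀ + ∑ h ∈ Finset.range L.H, τ h ≤ L.B

/-- The number of votes above `thr` in phase `h`, among the first `q` runs. -/
def votes (thr : ℕ) (ans : ℕ → ℕ → ℕ) (q h : ℕ) : ℕ :=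
  ∑ q' ∈ Finset.range q, if thr < ans q' h then 1 else 0

theorem votes_le (thr : ℕ) (ans : ℕ → ℕ → ℕ) (q h : ℕ) : votes thr ans q h ≤ q := by
  refine (Finset.sum_le_sum fun q' _ => bit_le _).trans ?_
  simp

theorem getD_map_mod (l : List ℕ) (x i : ℕ) : (l.map (· % x)).getD i 0 = l.getD i 0 % x := by
  simp only [List.getD_eq_getElem?_getD, List.getElem?_map]
  cases l[i]? <;> simp

/-- The time of a run. -/
def Layout.runTime (L : Layout) (M : ℕ) : ℕ :=
  cost (initCmds M) + cost (parkCmds M) + 300 + L.g.n * (100 * (flat L.cl).length + 1005) +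
    L.H * (cost (enterCmds M) + 205 + 2 * (L.cl.length * (100 * (flat L.cl).length + 600))) + 9 * L.B

theorem effect_initCmds {L : Layout} {σ : NS} (hE : L.Env σ) {q : ℕ} (h30 : σ.reg 30 = q) (M : ℕ)
    (x : ℕ → ℕ) :
    ((effect σ (initCmds M)).scr x).mem = σ.mem ∧
    ((effect σ (initCmds M)).scr x).reg 31 = L.base q ∧
    ((effect σ (initCmds M)).scr x).reg 32 = L.base q ∧
    ((effect σ (initCmds M)).scr x).reg 33 = L.base q + 2 * L.Z ∧
    ((effect σ (initCmds M)).scr x).reg 34 = 1 ∧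
    ((effect σ (initCmds M)).scr x).reg 35 = L.T₀ + q * L.B ∧
    (∀ i < M, ((effect σ (initCmds M)).scr x).reg (simReg i) = 0) ∧
    ∀ i < 31, ((effect σ (initCmds M)).scr x).reg i = σ.reg i := by
  obtain ⟨e1, e2, e3, e4⟩ := effect_copyCmds simReg_injective (σ := effect σ
    [.asg 31 (.rg 16 + .lit 3 * .rg 17 * .rg 30), .asg 32 (.rg 31),
      .asg 33 (.rg 31 + .lit 2 * .rg 17), .asg 34 (.lit 1), .asg 35 (.rg 14 + .rg 30 * .rg 12)])
    (e := fun _ => .lit 0) (x := fun _ => 0) (fun _ _ _ => rfl) M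
  have low : ∀ i < 60, ((effect σ (initCmds M)).scr x).reg i = (effect σ
    [.asg 31 (.rg 16 + .lit 3 * .rg 17 * .rg 30), .asg 32 (.rg 31),
      .asg 33 (.rg 31 + .lit 2 * .rg 17), .asg 34 (.lit 1),
      .asg 35 (.rg 14 + .rg 30 * .rg 12)]).reg i := by
    intro i hi
    rw [(NS.agree_scr _ x).reg i (.inl hi), initCmds, effect_append,
      e4 i fun j => by unfold simReg; omega]
  refine ⟨?_, ?_, ?_, ?_, ?_, ?_, fun i hi => ?_, fun i hi => ?_⟩
  · rw [(NS.agree_scr _ x).mem, initCmds, effect_append, e1]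
    rfl
  · rw [low 31 (by decide)]
    simp [effect, Cmd.next, hE.r16, hE.r17, h30, Layout.base]
  · rw [low 32 (by decide)]
    simp [effect, Cmd.next, hE.r16, hE.r17, h30, Layout.base]
  · rw [low 33 (by decide)]
    simp [effect, Cmd.next, hE.r16, hE.r17, h30, Layout.base]
  · rw [low 34 (by decide)]
    simp [effect, Cmd.next]
  · rw [low 35 (by decide)]
    simp [effect, Cmd.next, hE.r14, hE.r12, h30]
  · rw [(NS.agree_scr _ x).reg _ (.inr (by unfold simReg; omega)), initCmds, effect_append, e3 i hi]
  · rw [low i (by omega)]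
    have : i ≠ 31 ∧ i ≠ 32 ∧ i ≠ 33 ∧ i ≠ 34 ∧ i ≠ 35 := by omega
    simp [effect, Cmd.next, this]

theorem nwp_parkP {L : Layout} {W : ℕ} (hL : L.Ok W) {ω : ℕ → Bool} {σ : NS} {M q : ℕ}
    {s : State L.w} {S : Setting} (hq : q < L.R) (hE : L.Env σ)
    (hs : Sim (L.region q false 1) M s σ) :
    NWP W ω (parkP S M) σ fun k σ' => k ≤ cost (parkCmds M) + 1 ∧ L.Rest q M s 0 σ' S ∧
      σ'.mem = σ.mem ∧ ∀ i < 31, σ'.reg i = σ.reg i := by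
  have hW := hL.W_pos
  have hbase := hL.base_add_le hq
  have key : NWP W ω (cmds (parkCmds M)) σ fun k σ' => k ≤ cost (parkCmds M) + 1 ∧
      L.Rest q M s 0 σ' .incremental ∧ σ'.mem = σ.mem ∧ ∀ i < 31, σ'.reg i = σ.reg i := by
    have hinj : Function.Injective fun i => 101 + 2 * i := fun i j h => by simp at h; exact h
    have h31 : σ.reg 31 = L.base q := hs.base
    have h33 : σ.reg 33 = L.base q + 2 * L.Z := hs.stamp
    have h34 : σ.reg 34 = 1 := hs.cur
    have h35 : σ.reg 35 = L.T₀ + q * L.B + s.coins := hs.pos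
    have hcopy : ∀ i (x : NS), (∀ j, (∀ i, j ≠ 101 + 2 * i) →
        x.reg j = (effect σ [.asg 32 (.rg 31 + .rg 17), .asg 36 (.rg 35)]).reg j) →
        (Ex.rg (simReg i)).val x = σ.reg (simReg i) := by
      intro i x hx
      have hi : ∀ j, simReg i ≠ 101 + 2 * j := fun j => by unfold simReg; omega
      have e1 : simReg i ≠ 32 := by unfold simReg; omega
      have e2 : simReg i ≠ 36 := by unfold simReg; omega
      simp [Ex.val, hx _ hi, effect, Cmd.next, e1, e2]
    obtain ⟨e1, e2, e3, e4⟩ := effect_copyCmds hinj hcopy M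
    refine .cmds hW (parkCmds_wf M) ?_ fun x => ?_
    · rw [parkCmds, cmdsOk_append]
      refine ⟨?_, cmdsOk_of_forall fun c hc y => ?_⟩
      · simp [CmdsOk, Cmd.Ok, h31, hE.r17]; omega
      · obtain ⟨i, -, rfl⟩ := List.mem_map.1 hc
        trivial
    have low : ∀ i < 60, ((effect σ (parkCmds M)).scr x).reg i =
        (effect σ [.asg 32 (.rg 31 + .rg 17), .asg 36 (.rg 35)]).reg i := by
      intro i hi
      rw [(NS.agree_scr _ x).reg i (.inl hi), parkCmds, effect_append, e4 i fun j => by omega]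
    have hmem : ((effect σ (parkCmds M)).scr x).mem = σ.mem := by
      rw [(NS.agree_scr _ x).mem, parkCmds, effect_append]
      exact e1
    refine ⟨by omega, ⟨?_, ?_, ?_, ?_, ?_, fun i hi => ?_, fun a => ?_, fun a => ?_⟩, hmem,
      fun i hi => ?_⟩
    · rw [low 31 (by decide)]; simp [effect, Cmd.next, h31]
    · rw [low 32 (by decide)]; simp [effect, Cmd.next, h31, hE.r17]
    · rw [low 33 (by decide)]; simp [effect, Cmd.next, h33]
    · rw [low 34 (by decide)]; simp [effect, Cmd.next, h34]
    · rw [low 36 (by decide)]; simp [effect, Cmd.next, h35]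
    · rw [(NS.agree_scr _ x).reg _ (.inr (by omega)), parkCmds, effect_append, e3 i hi, hs.reg i hi]
    · rw [hmem]
      have := hs.mem a
      simpa [Layout.region] using this
    · rw [hmem]
      exact hs.le a
    · rw [low i (by omega)]
      have : i ≠ 32 ∧ i ≠ 36 := by omega
      simp [effect, Cmd.next, this]
  cases S
  · exact .skip ⟨by omega, hs, rfl, fun _ _ => rfl⟩
  · exact key
  · exact key

/-- Builds the graph in a fresh region, simulates the preprocessing there and then serves all
phases. Every run has a region of its own and leaves the later ones at zero, as the next run
requires; its random bits are the block that starts at `q * L.B`. -/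
theorem nwp_runP {L : Layout} {W : ℕ} (hL : L.Ok W) {ω ω' : ℕ → Bool} {σ : NS}
    {A : Algorithm} {S : Setting} {par : Parameter} {thr M q : ℕ} {ans : ℕ → ℕ → ℕ}
    (hE : L.Env σ) (hO : Outer L ω (votes thr ans q) σ) (hq : q < L.R) (h30 : σ.reg 30 = q)
    (hfresh : ∀ a, L.base q ≤ a → σ.mem a = 0) (hM : A.Below M)
    (hI : A.Inner L S par (shift (q * L.B) ω) (ans q)) (hthr : thr < 2 ^ W) :
    NWP W ω' (runP A S par thr M) σ fun k σ' => k ≤ L.runTime M ∧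
      Outer L ω (votes thr ans (q + 1)) σ' ∧ ∀ a, L.base (q + 1) ≤ a → σ'.mem a = 0 := by
  obtain ⟨st, st', k₀, τ, hpre, hphase, htime⟩ := hI
  have hW := hL.W_pos
  have hbase := hL.base_add_le hq
  have hsize := hL.size
  have h2w := Nat.two_pow_pos L.w
  have hV : L.V ≤ L.base q := Nat.le_add_right _ _
  have hVT : L.T₀ + L.R * L.B + L.H = L.V := rfl
  have hsucc : L.base (q + 1) = L.base q + 3 * L.Z := by unfold Layout.base; ring
  have hqB : q * L.B ≤ L.R * L.B := Nat.mul_le_mul_right _ hq.le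
  have hlen := L.length_input_le S par
  set inp := par.input L.g.centre (L.g.edges (L.g.start S)) with hinp
  refine .seq (.cmds hW (initCmds_wf M) ?_ fun x => ?_)
  · rw [initCmds, cmdsOk_append]
    refine ⟨?_, cmdsOk_of_forall fun c hc y => ?_⟩
    · have h1 : 3 * L.Z * q = L.base q - L.V := by unfold Layout.base; omega
      have h3 : 3 < 2 ^ W := by omega
      have h4 : 3 * L.Z < 2 ^ W := by omega
      have hZq : L.V + 3 * L.Z * q = L.base q := rfl
      simp [CmdsOk, Cmd.Ok, Cmd.next, hE.r16, hE.r17, h30, hE.r14, hE.r12]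
      omega
    · obtain ⟨i, -, rfl⟩ := List.mem_map.1 hc
      simp [Cmd.Ok]
  obtain ⟨m₁, r31, r32, r33, r34, r35, rsim, rlow⟩ := effect_initCmds hE h30 M x
  generalize (effect σ (initCmds M)).scr x = σ₁ at m₁ r31 r32 r33 r34 r35 rsim rlow
  have hE₁ : L.Env σ₁ := hE.congr fun i h1 h2 => rlow i (by omega)
  refine .seq (nwp_graphP hL S par hE₁ (p := L.base q) (by rw [m₁]; exact hO.clauses) r31 (by omega)
    (by omega) fun k₁ σ₂ hk₁ m₂ _ r₂ => ?_)
  have hlenw : (inp.map (· % 2 ^ L.w)).length ≤ 8 * L.g.n + 3 := by simpa using hlen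
  have hm₂ : ∀ a, (a < L.base q ∨ L.base q + (8 * L.g.n + 3) ≤ a) → σ₂.mem a = σ.mem a := by
    intro a ha
    rw [m₂, ← hinp, ← m₁, write]
    rw [if_neg]
    omega
  have hin : ∀ a, σ₂.mem (L.base q + a) = inp.getD a 0 % 2 ^ L.w := by
    intro a
    rw [m₂, ← hinp, write, m₁]
    split_ifs with h
    · rw [Nat.add_sub_cancel_left, getD_map_mod]
    · rw [hfresh _ (by omega), List.getD_eq_default _ _ (by simp at h; omega), Nat.zero_mod]
  have hs₂ : Sim (L.region q false 1) M (.initial L.w inp) σ₂ :=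
    { mask := (r₂ 10 (by decide) (.inl (by decide))).trans hE₁.r10
      base := (r₂ 31 (by decide) (.inl (by decide))).trans r31
      front := (r₂ 32 (by decide) (.inl (by decide))).trans r32
      stamp := (r₂ 33 (by decide) (.inl (by decide))).trans r33
      cur := (r₂ 34 (by decide) (.inl (by decide))).trans r34
      pos := (r₂ 35 (by decide) (.inl (by decide))).trans r35
      reg := fun i hi => (r₂ _ (.inr (by unfold simReg; omega)) (.inr (by unfold simReg; omega))).trans
        (by simp [rsim i hi, State.initial])
      mem := fun a => by
        -- The edge list ends before the stamps, which are therefore still zero and different from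
        -- the current stamp 1.
        have h0 : σ₂.mem (L.base q + 2 * L.Z + a.toNat) = 0 := by
          rw [hm₂ _ (.inr (by omega)), hfresh _ (by omega)]
        refine (if_neg (by simp [Layout.region, h0])).trans ?_
        simp [Layout.region, hin, State.initial]
      le := fun a => by
        simp only [Layout.region]
        rw [hm₂ _ (.inr (by omega)), hfresh _ (by omega)]
        exact Nat.zero_le _ }
  have hO₂ : Outer L ω (votes thr ans q) σ₂ := hO.congr hL (fun a ha => hm₂ a (.inl (by omega)))
    ((r₂ 0 (by decide) (.inl (by decide))).trans (rlow 0 (by decide)))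
  have hE₂ : L.Env σ₂ := hE₁.congr fun i h1 h2 => r₂ i (.inl (by omega)) (.inl (by omega))
  have hRg := hL.region hq false 1
  refine .seq ((Exec.simulate hRg hpre hM.preprocess (by simp [State.initial]; omega) hs₂
    (hO₂.region_tape hq false 1)).frame.mono ?_)
  rintro k₂ σ₃ ⟨⟨hk₂, hs₃, hl₃⟩, hf₃, -, -⟩
  have r₃ : ∀ i < 31, σ₃.reg i = σ₂.reg i := fun i hi =>
    hf₃ i (tr_writes_keep (.inl (by omega)) (.inl (by omega)) (by omega))
  have hm₃ : ∀ a, (a < L.V ∨ L.base (q + 1) ≤ a) → σ₃.mem a = σ.mem a := by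
    intro a ha
    rw [hl₃ a (by simp [Layout.region]; omega) (by simp [Layout.region]; omega)]
    exact hm₂ a (by omega)
  refine .seq ((nwp_parkP hL hq (hE₂.congr fun i _ h2 => r₃ i (by omega)) hs₃).mono ?_)
  rintro k₃ σ₄ ⟨hk₃, hR, hm₄, r₄⟩
  have r04 : ∀ i < 31, σ₄.reg i = σ.reg i := fun i hi =>
    (r₄ i hi).trans ((r₃ i hi).trans ((r₂ i (.inl (by omega)) (.inl (by omega))).trans (rlow i hi)))
  have hE₄ : L.Env σ₄ := hE.congr fun i _ h2 => r04 i (by omega)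
  have hO₄ : Outer L ω (votes thr ans q) σ₄ :=
    hO.congr hL (fun a ha => by rw [hm₄]; exact hm₃ a (.inl ha)) (r04 0 (by decide))
  set κ := cost (enterCmds M) + 200 + 2 * (L.cl.length * (100 * (flat L.cl).length + 600)) with hκ
  refine .for hW L.H (fun h => κ + 9 * τ h) (fun h σ' => L.Rest q M (st h) h σ' S ∧
      Outer L ω (fun h' => votes thr ans (if h' < h then q + 1 else q) h') σ' ∧
      ∀ a, L.base (q + 1) ≤ a → σ'.mem a = 0) hE₄.r11
    (phaseP_writes S thr M (by simp) (by decide)) (phaseP_writes S thr M (by simp) (by decide))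
    (by decide) (by decide) (by decide) (fun v => ⟨hR.congr rfl fun i hi hn => ?_, ?_, ?_⟩) ?_ ?_
  · rw [(NS.agree_scr _ v).reg i hi, NS.set_reg, if_neg hn]
  · simp only [not_lt_zero, if_false]
    exact hO₄.congr hL (fun _ _ => rfl) rfl
  · intro a ha
    have : σ₄.mem a = 0 := by rw [hm₄, hm₃ a (.inr ha), hfresh a (by omega)]
    exact this
  · rintro h hh σ' ⟨hR', hO', hz'⟩ h37 hkeep - -
    obtain ⟨hp, hB, hnext⟩ := hphase h hh
    have hE' : L.Env σ' := hE₄.congr fun i _ h2 =>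
      hkeep i (.inl (by omega)) (by omega) (phaseP_writes S thr M (.inl (by omega)) (by omega))
    refine (nwp_phaseP hL hE' hO' hq h37 hh hR' hM hp hB hthr ?_).mono ?_
    · simp only [lt_self_iff_false, if_false]
      exact (votes_le _ _ _ _).trans_lt hq
    · rintro k σ'' ⟨hk, hR'', hO'', hz''⟩
      refine ⟨hk, fun v => ⟨?_, ?_, fun a ha => ?_⟩⟩
      · rw [hnext]
        refine hR''.congr rfl fun i hi hn => ?_
        rw [(NS.agree_scr _ v).reg i hi, NS.set_reg, if_neg hn]
      -- During run `q`, the phases below the current one have the votes of `q + 1` runs, the others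
      -- those of `q` runs.
      · have : (fun h' => votes thr ans (if h' < h + 1 then q + 1 else q) h') = fun h' =>
            if h' = h then votes thr ans (if h < h then q + 1 else q) h +
              (if thr < ans q h then 1 else 0) else votes thr ans (if h' < h then q + 1 else q) h' := by
          funext h'
          by_cases e : h' = h
          · rw [if_pos e, e, if_pos (Nat.lt_succ_self h), if_neg (lt_irrefl h)]
            exact Finset.sum_range_succ _ _
          · rw [if_neg e]
            congr 1
            exact if_congr (by omega) rfl rfl
        rw [this]
        exact hO''.congr hL (fun _ _ => rfl) rfl
      · have : σ''.mem a = 0 := by rw [hz'' a ha, hz' a ha]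
        exact this
  · rintro k σ' hk ⟨-, hO', hz'⟩ - -
    refine ⟨?_, ?_, hz'⟩
    · have hsum : ∑ h ∈ Finset.range L.H, (κ + 9 * τ h + 5) =
          L.H * (κ + 5) + 9 * ∑ h ∈ Finset.range L.H, τ h := by
        rw [Finset.mul_sum, Finset.sum_congr rfl fun h _ =>
          (by ring : κ + 9 * τ h + 5 = (κ + 5) + 9 * τ h), Finset.sum_add_distrib]
        simp
      have hκ5 : cost (enterCmds M) + 205 + 2 * (L.cl.length * (100 * (flat L.cl).length + 600)) =
          κ + 5 := by omega
      unfold Layout.runTime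
      rw [hκ5]
      rw [hsum] at hk
      omega
    · have hvv : ∀ h < L.H, (if h < L.H then q + 1 else q) = q + 1 := fun h hh => if_pos hh
      refine ⟨hO'.clauses, hO'.tape, fun h hh => ?_, hO'.flag_le, hO'.flag.trans ?_⟩
      · rw [hO'.votes h hh, if_pos hh]
      · refine exists_congr fun h => and_congr_right fun hh => ?_
        simp only [if_pos hh]

/-- At the end the flag tells whether in some phase a strict majority of the runs gave an answer
above the threshold. -/
theorem nwp_runs {L : Layout} {W : ℕ} (hL : L.Ok W) {ω ω' : ℕ → Bool} {σ : NS}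
    {A : Algorithm} {S : Setting} {par : Parameter} {thr M : ℕ} {ans : ℕ → ℕ → ℕ}
    (hE : L.Env σ) (hO : Outer L ω (fun _ => 0) σ)
    (hfresh : ∀ a, L.V ≤ a → σ.mem a = 0) (hM : A.Below M)
    (hI : ∀ q < L.R, A.Inner L S par (shift (q * L.B) ω) (ans q)) (hthr : thr < 2 ^ W) :
    NWP W ω' (forP 30 13 (runP A S par thr M)) σ fun k σ' => k ≤ 4 + L.R * (L.runTime M + 5) ∧
      (σ'.reg 0 ≠ 0 ↔ ∃ h < L.H, L.R < 2 * votes thr ans L.R h) := by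
  refine .for hL.W_pos L.R (fun _ => L.runTime M) (fun q σ' => Outer L ω (votes thr ans q) σ' ∧
      ∀ a, L.base q ≤ a → σ'.mem a = 0) hE.r13
    (runP_writes S par thr M (.inr rfl) (by decide)) (runP_writes S par thr M (by simp) (by decide))
    (by decide) (by decide) (by decide) (fun v => ⟨?_, ?_⟩) ?_ ?_
  · have : votes thr ans 0 = fun _ => 0 := by funext h; simp [votes]
    rw [this]
    exact hO.congr hL (fun _ _ => rfl) rfl
  · intro a ha
    have : σ.mem a = 0 := hfresh a (by simpa [Layout.base] using ha)
    exact this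
  · rintro q hq σ' ⟨hO', hz'⟩ h30 hkeep - -
    have hE' : L.Env σ' := hE.congr fun i _ h2 =>
      hkeep i (.inl (by omega)) (by omega) (runP_writes S par thr M (.inl (by omega)) (by omega))
    refine (nwp_runP hL hE' hO' hq h30 hz' hM (hI q hq) hthr).mono ?_
    rintro k σ'' ⟨hk, hO'', hz''⟩
    exact ⟨hk, fun v => ⟨hO''.congr hL (fun _ _ => rfl) rfl, hz''⟩⟩
  · rintro k σ' hk ⟨hO', -⟩ - -
    refine ⟨?_, hO'.flag⟩
    simpa using hk

end DynGraph

namespace WordRAM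

/-- `e ^ n`. -/
def Ex.pow (e : Ex) : ℕ → Ex
  | 0 => .lit 1
  | n + 1 => e.pow n * e

theorem Ex.val_pow (σ : NS) (e : Ex) (n : ℕ) : (e.pow n).val σ = e.val σ ^ n := by
  induction n with
  | zero => rfl
  | succ n ih => simp [Ex.pow, ih, pow_succ]

theorem Ex.wf_pow {e : Ex} {d : ℕ} (hd : d < 100) (he : e.wf (d + 1) = true) (n : ℕ) :
    (e.pow n).wf d = true := by
  induction n with
  | zero => simpa [Ex.pow, Ex.wf] using hd
  | succ n ih =>
    change ((e.pow n).wf d && e.wf (d + 1)) = true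
    rw [ih, he, Bool.and_self]

theorem Ex.ok_pow {w : ℕ} {σ : NS} {e : Ex} (he : e.Ok w σ) (h0 : 0 < e.val σ) {n : ℕ}
    (h : e.val σ ^ n < 2 ^ w) : (e.pow n).Ok w σ := by
  induction n with
  | zero => simpa [Ex.pow, Ex.Ok] using h
  | succ n ih =>
    have := Nat.pow_le_pow_right h0 (Nat.le_succ n)
    refine ⟨ih (this.trans_lt h), he, ?_⟩
    simpa [Ex.val_pow, BinOp.ok, ← pow_succ] using h

end WordRAM

namespace DynGraph

open WordRAM

/-! ## The parameters of the reduction -/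

/-- A graph encodes `k = N / G` variables; `k / v` is the saving in the exponent; `T` bounds the
exponent of the preprocessing time; `D` is the constant factor in the budget of a run; `K` is the
width of the clauses; `wc` is the word constant of the dynamic algorithm; `r` is the number of
vertices of a leg. -/
structure Consts where
  G : ℕ
  v : ℕ
  T : ℕ
  D : ℕ
  K : ℕ
  wc : ℕ
  r : ℕ
  two_le_r : 2 ≤ r
  D_pos : 0 < D

namespace Consts

variable (c : Consts)

/-- Vertices stand for assignments to the first `k` variables, and legs for clauses. -/
def gadget (k : ℕ) (cl : List (List ℕ)) : Gadget where
  n₀ := 2 ^ k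
  I := cl.length + 3
  r := c.r
  conn a i := decide (i = 2) || (decide (3 ≤ i) && miss 0 k a (cl.getD (i - 3) []))
  two_le_I := by omega
  two_le_r := c.two_le_r
  conn_zero a := by simp
  conn_one a := by simp
  conn_two a := by simp

/-- In the budget `B`, the power `T` of the number of legs comes from the preprocessing time; the
exponent `T + 2` also covers a square, one factor for the size of the graph and one for the updates
of a phase. The tape starts at an upper bound for the length of the input that depends on the number
of clauses only. -/
def layout (N : ℕ) (cl : List (List ℕ)) : Layout where
  g := c.gadget (N / c.G) cl
  N := N
  k := N / c.G
  cl := cl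
  w := c.wc * (Nat.log 2 (c.gadget (N / c.G) cl).n + 1)
  H := 2 ^ (N - N / c.G)
  B := c.D * 2 ^ (N - N / c.G / c.v) * (cl.length + 3) ^ (c.T + 2)
  R := 24 * (N + 1)
  T₀ := 2 + cl.length * (c.K + 1)
  Z := 2 ^ (c.wc * (Nat.log 2 (c.gadget (N / c.G) cl).n + 1)) + 8 * (c.gadget (N / c.G) cl).n + 16

def setup₁ : List Cmd :=
  [.asg 1 (.ld (.lit 0)), .asg 2 (.ld (.lit 1)), .asg 3 (.rg 1 / .lit c.G),
    .asg 4 (.op .shl (.lit 1) (.rg 3)), .asg 5 (.rg 2 + .lit 3), .asg 6 (.lit c.r),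
    .asg 7 (.lit 2 * ((.rg 4 + .lit 1) * (.rg 5 * .rg 6))), .asg 21 (.lit 1)]

/-- There is no instruction for logarithms. The smallest power of 2 above the number of vertices,
needed for the word length of the simulation, is found by doubling; running the loop too often is
harmless, as it becomes stationary. -/
def doubleP : Prog :=
  forP 22 7 (cmds [.asg 21 (.rg 21 + .rg 21 * .op .lt (.rg 21) (.rg 7 + .lit 1))])

def setup₂ : List Cmd :=
  [.asg 23 ((Ex.rg 21).pow c.wc), .asg 10 (.rg 23 - .lit 1),
    .asg 11 (.op .shl (.lit 1) (.rg 1 - .rg 3)),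
    .asg 12 (.lit c.D * .op .shl (.lit 1) (.rg 1 - .rg 3 / .lit c.v) * (Ex.rg 5).pow (c.T + 2)),
    .asg 13 (.lit 24 * (.rg 1 + .lit 1)), .asg 14 (.lit 2 + .rg 2 * .lit (c.K + 1)),
    .asg 17 (.rg 23 + .lit 8 * .rg 7 + .lit 16),
    .asg 18 ((.rg 4 * .rg 5 + .lit 1) * .rg 6 + (.rg 6 - .lit 1)), .asg 20 (.rg 13 * .rg 12),
    .asg 15 (.rg 14 + .rg 20), .asg 16 (.rg 15 + .rg 11)]

/-- All random bits are tossed before the simulations, so that they can be read again after a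
restart. -/
def fillP : Prog :=
  forP 29 20 (.seq (.coin 51) (cmds [.put (.rg 14 + .rg 29) (.rg 51)]))

def setupP : Prog :=
  .seq (cmds c.setup₁) (.seq doubleP (.seq (cmds c.setup₂) fillP))

variable {c}

theorem setup₂_wf : c.setup₂.all Cmd.wf = true := by
  have h1 : (Cmd.asg 23 ((Ex.rg 21).pow c.wc)).wf = true := by
    simp only [Cmd.wf, Ex.wf_pow (e := .rg 21) (d := 62) (by norm_num) rfl, Bool.and_true]
    rfl
  have h2 : (Cmd.asg 12 (.lit c.D * .op .shl (.lit 1) (.rg 1 - .rg 3 / .lit c.v) *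
      (Ex.rg 5).pow (c.T + 2))).wf = true := by
    have := Ex.wf_pow (e := .rg 5) (d := 63) (by norm_num) rfl (c.T + 2)
    change (decide (Keep 12) && (_ && ((Ex.rg 5).pow (c.T + 2)).wf 63)) = true
    rw [this]
    rfl
  rw [setup₂, List.all_cons, h1, List.all_cons, List.all_cons, List.all_cons, h2]
  rfl

theorem layout_ok {N W : ℕ} {cl : List (List ℕ)} (hG : 2 + (flat cl).length ≤ (c.layout N cl).T₀)
    (htop : (c.layout N cl).V + 3 * (c.layout N cl).Z * (c.layout N cl).R < 2 ^ W)
    (hph : (c.layout N cl).H * (c.layout N cl).g.n₀ < 2 ^ W) :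
    (c.layout N cl).Ok W where
  I_eq := rfl
  n₀_eq := rfl
  conn_eq _ _ := rfl
  tape := hG
  size := le_of_eq (by simp only [layout])
  runs := by simp [layout]
  top := htop
  word := by
    refine (Nat.pow_le_pow_iff_right (a := 2) (by norm_num)).1 ?_
    have h1 : 2 ^ (c.layout N cl).w ≤ (c.layout N cl).Z := by simp only [layout]; omega
    have h2 : (c.layout N cl).Z * 1 ≤ (c.layout N cl).Z * (3 * (c.layout N cl).R) :=
      Nat.mul_le_mul_left _ (by simp only [layout]; omega)
    have h3 : 3 * (c.layout N cl).Z * (c.layout N cl).R =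
      (c.layout N cl).Z * (3 * (c.layout N cl).R) := by ring
    omega
  phases := hph

/-- After `i` steps, starting from `1`, doubling while the number is at most `n`. -/
theorem double_min {n i : ℕ} (hn : 0 < n) :
    2 ^ min i (Nat.log 2 n + 1) + 2 ^ min i (Nat.log 2 n + 1) *
      (if 2 ^ min i (Nat.log 2 n + 1) < n + 1 then 1 else 0) = 2 ^ min (i + 1) (Nat.log 2 n + 1) := by
  have h1 := Nat.pow_log_le_self 2 hn.ne'
  have h2 := Nat.lt_pow_succ_log_self (b := 2) (by norm_num) n
  by_cases hi : i ≤ Nat.log 2 n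
  · have h3 : 2 ^ i ≤ 2 ^ Nat.log 2 n := Nat.pow_le_pow_right (by norm_num) hi
    rw [min_eq_left (by omega), min_eq_left (by omega), if_pos (by omega), pow_succ]
    ring
  · rw [min_eq_right (by omega), min_eq_right (by omega), if_neg (by rw [Nat.succ_eq_add_one] at h2; omega)]
    ring

theorem nwp_doubleP {W : ℕ} (hW : 0 < W) {ω : ℕ → Bool} {σ : NS} {n : ℕ} (hn : 0 < n)
    (h7 : σ.reg 7 = n) (h21 : σ.reg 21 = 1) (hlt : 4 * n < 2 ^ W) :
    NWP W ω doubleP σ fun k σ' => k ≤ 100 * n + 4 ∧ σ'.mem = σ.mem ∧ σ'.coins = σ.coins ∧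
      σ'.reg 21 = 2 ^ (Nat.log 2 n + 1) ∧ ∀ i < 21, σ'.reg i = σ.reg i := by
  have hw : ∀ i, Keep i → i ≠ 21 →
      (cmds [.asg 21 (.rg 21 + .rg 21 * .op .lt (.rg 21) (.rg 7 + .lit 1))]).writes i = false :=
    fun i hi hn => cmds_writes (by rfl) hi (by simp [Cmd.sets, hn])
  have hlog := Nat.pow_log_le_self 2 hn.ne'
  refine .for hW n (fun _ => 90) (fun i σ' => σ'.coins = σ.coins ∧
    σ'.reg 21 = 2 ^ min i (Nat.log 2 n + 1)) h7 (hw 22 (by decide) (by decide))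
    (hw 7 (by decide) (by decide)) (by decide) (by decide) (by decide)
    (fun v => ⟨rfl, by simp [h21]⟩) ?_ ?_
  · rintro i hi σ' ⟨hc, h21'⟩ h22 hkeep hpure hval
    have h7' : σ'.reg 7 = n := (hkeep 7 (by decide) (by decide) (hw 7 (by decide) (by decide))).trans h7
    have hle : 2 ^ min i (Nat.log 2 n + 1) ≤ 2 * n := by
      calc 2 ^ min i (Nat.log 2 n + 1) ≤ 2 ^ (Nat.log 2 n + 1) :=
            Nat.pow_le_pow_right (by norm_num) (min_le_right _ _)
        _ ≤ 2 * n := by rw [pow_succ]; omega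
    have hcost : cost [.asg 21 (.rg 21 + .rg 21 * .op .lt (.rg 21) (.rg 7 + .lit 1))] ≤ 90 := by
      clear * -; decide
    refine .cmds hW (by rfl) ?_ fun v => ⟨hcost, fun v' => ⟨?_, ?_⟩⟩
    · have := bit_le (p := 2 ^ min i (Nat.log 2 n + 1) < n + 1)
      have h2 : 2 ^ min i (Nat.log 2 n + 1) * (if 2 ^ min i (Nat.log 2 n + 1) < n + 1 then 1 else 0)
        ≤ 2 ^ min i (Nat.log 2 n + 1) * 1 := Nat.mul_le_mul_left _ this
      simp [CmdsOk, Cmd.Ok, h21', h7']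
      split_ifs at h2 ⊢ <;> omega
    · exact hc
    · have := double_min (i := i) hn
      simpa [effect, Cmd.next, h21', h7'] using this
  · rintro k σ' hk ⟨hc, h21'⟩ hkeep hpure
    refine ⟨?_, hpure (by decide), hc, ?_, fun i hi => ?_⟩
    · simp at hk; omega
    · rw [h21', min_eq_right]
      exact Nat.log_lt_self 2 hn.ne'
    · exact hkeep i (.inl (by omega)) (by omega) (hw i (.inl (by omega)) (by omega))

theorem nwp_fillP {W : ℕ} (hW : 0 < W) {ω : ℕ → Bool} {σ : NS} {p l : ℕ} (h20 : σ.reg 20 = l)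
    (h14 : σ.reg 14 = p) (hlt : p + l < 2 ^ W) (hcoins : σ.coins = 0) :
    NWP W ω fillP σ fun k σ' => k ≤ 100 * l + 4 ∧ (∀ i < 29, σ'.reg i = σ.reg i) ∧
      ∀ a, σ'.mem a = if p ≤ a ∧ a < p + l then (if ω (a - p) = true then 1 else 0) else σ.mem a := by
  have hw : ∀ i, Keep i → i ≠ 51 →
      (Prog.seq (.coin 51) (cmds [.put (.rg 14 + .rg 29) (.rg 51)])).writes i = false := by
    intro i hi hn
    simp only [Prog.writes]
    rw [cmds_writes (by rfl) hi (by simp [Cmd.sets])]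
    simp [hn]
  refine .for hW l (fun _ => 90) (fun i σ' => σ'.coins = i ∧ ∀ a, σ'.mem a =
    if p ≤ a ∧ a < p + i then (if ω (a - p) = true then 1 else 0) else σ.mem a) h20
    (hw 29 (by decide) (by decide)) (hw 20 (by decide) (by decide)) (by decide) (by decide)
    (by decide) (fun v => ⟨hcoins, fun a => ?_⟩) ?_ ?_
  · rw [if_neg (by omega)]; rfl
  · rintro i hi σ' ⟨hc, hm⟩ h29 hkeep - -
    have h14' : σ'.reg 14 = p :=
      (hkeep 14 (by decide) (by decide) (hw 14 (by decide) (by decide))).trans h14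
    have hcost : cost [.put (.rg 14 + .rg 29) (.rg 51)] ≤ 80 := by clear * -; decide
    refine .seq (.coin hW (.cmds hW (by rfl) ?_ fun v => ⟨by omega, fun v' => ⟨?_, fun a => ?_⟩⟩))
    · simp [CmdsOk, Cmd.Ok, h14', h29]; omega
    · simp [effect, Cmd.next, hc]
    · simp only [effect, Cmd.next]
      have e1 : ∀ τ : NS, ∀ v, (τ.scr v).mem = τ.mem := fun _ _ => rfl
      have e2 : ∀ τ : NS, ∀ d x, (τ.set d x).mem = τ.mem := fun _ _ _ => rfl
      simp [h14', h29, hc, hm]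
      by_cases ha : a = p + i
      · subst ha; simp
      · rw [if_neg ha]
        exact if_congr (by omega) rfl rfl
  · rintro k σ' hk ⟨-, hm⟩ hkeep -
    exact ⟨by simp at hk; omega, fun i hi => hkeep i (.inl (by omega)) (by omega)
      (hw i (.inl (by omega)) (by omega)), hm⟩

/-- Every quantity that is computed lies below the end of the last region or below a multiple of the
number of vertices, and both fit into a word; this excludes overflow. Cells behind the input are
zero initially, which provides zero votes and fresh regions. -/
theorem nwp_setupP {N W : ℕ} {cl : List (List ℕ)} (hL : (c.layout N cl).Ok W) (hG : c.G < 2 ^ W)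
    (hv : c.v < 2 ^ W) (hK : c.K + 1 < 2 ^ W) {ω : ℕ → Bool} {σ : NS} (h0 : σ.mem 0 = N)
    (h1 : σ.mem 1 = cl.length) (hcl : Holds σ.mem 2 (flat cl))
    (hz : ∀ a, 2 + (flat cl).length ≤ a → σ.mem a = 0) (hr : σ.reg 0 = 0) (hcoins : σ.coins = 0) :
    NWP W ω c.setupP σ fun k σ' =>
      k ≤ cost c.setup₁ + cost c.setup₂ + 100 * (c.layout N cl).g.n +
        100 * ((c.layout N cl).R * (c.layout N cl).B) + 8 ∧
      (c.layout N cl).Env σ' ∧ Outer (c.layout N cl) ω (fun _ => 0) σ' ∧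
      ∀ a, (c.layout N cl).V ≤ a → σ'.mem a = 0 := by
  have hW := hL.W_pos
  have hZ := hL.Z_lt
  have htop := hL.top
  have hsize := hL.size
  have hT0 := hL.tape
  set L := c.layout N cl with hLdef
  have hnW := hL.n_lt
  have hn0 := L.g.n_pos
  have hn : L.g.n = 2 * ((2 ^ (N / c.G) + 1) * ((cl.length + 3) * c.r)) := rfl
  have hQ : L.Z = (2 ^ (Nat.log 2 L.g.n + 1)) ^ c.wc + 8 * L.g.n + 16 := by
    rw [← pow_mul, mul_comm _ c.wc]; rfl
  have hB : L.B = c.D * 2 ^ (N - N / c.G / c.v) * (cl.length + 3) ^ (c.T + 2) := rfl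
  have hR : L.R = 24 * (N + 1) := rfl
  have hT : L.T₀ = 2 + cl.length * (c.K + 1) := rfl
  have hVB : L.VB = L.T₀ + L.R * L.B := rfl
  have hV : L.V = L.VB + L.H := rfl
  have hH : L.H = 2 ^ (N - N / c.G) := rfl
  have hr1 : 1 ≤ c.r := by have := c.two_le_r; omega
  have a1 : (cl.length + 3) * 1 ≤ (cl.length + 3) * c.r := Nat.mul_le_mul_left _ hr1
  have a1' : 1 * c.r ≤ (cl.length + 3) * c.r := Nat.mul_le_mul_right _ (by omega)
  have h2k := Nat.two_pow_pos (N / c.G)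
  have a2 : 1 * ((cl.length + 3) * c.r) ≤ (2 ^ (N / c.G) + 1) * ((cl.length + 3) * c.r) :=
    Nat.mul_le_mul_right _ (by omega)
  have a3 : (2 ^ (N / c.G) + 1) * 1 ≤ (2 ^ (N / c.G) + 1) * ((cl.length + 3) * c.r) :=
    Nat.mul_le_mul_left _ (by omega)
  have a4 : ((2 ^ (N / c.G)) * (cl.length + 3) + 1) * c.r ≤
      (2 ^ (N / c.G) + 1) * ((cl.length + 3) * c.r) := by
    rw [← mul_assoc]
    exact Nat.mul_le_mul_right _ (by rw [Nat.add_mul, Nat.one_mul]; omega)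
  have a5 : 2 ^ (N / c.G) * (cl.length + 3) * 1 ≤ ((2 ^ (N / c.G)) * (cl.length + 3) + 1) * c.r :=
    Nat.mul_le_mul (by omega) hr1
  replace hT0 : 2 + (flat cl).length ≤ L.T₀ := hT0
  have hZR : L.Z * 1 ≤ 3 * L.Z * L.R := by
    rw [mul_comm 3, mul_assoc]; exact Nat.mul_le_mul_left _ (by omega)
  have hRB : L.R * L.B < 2 ^ W := by omega
  have hB1 : 1 ≤ c.D := c.D_pos
  have h2e := Nat.two_pow_pos (N - N / c.G / c.v)
  have hIp : 0 < (cl.length + 3) ^ (c.T + 2) := by positivity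
  have hR1 : 24 ≤ L.R := by omega
  have hBW : L.B < 2 ^ W := lt_of_le_of_lt (Nat.le_mul_of_pos_left _ (by omega)) hRB
  have b1 : c.D * 2 ^ (N - N / c.G / c.v) ≤ L.B := by rw [hB]; exact Nat.le_mul_of_pos_right _ hIp
  have b2 : (cl.length + 3) ^ (c.T + 2) ≤ L.B := by
    rw [hB]; exact Nat.le_mul_of_pos_left _ (Nat.mul_pos hB1 h2e)
  have b3 : c.D ≤ c.D * 2 ^ (N - N / c.G / c.v) := Nat.le_mul_of_pos_right _ h2e
  have b4 : 2 ^ (N - N / c.G / c.v) ≤ c.D * 2 ^ (N - N / c.G / c.v) :=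
    Nat.le_mul_of_pos_left _ hB1
  have hBpos : 0 < L.B := by omega
  have hRBR : L.R ≤ L.R * L.B := Nat.le_mul_of_pos_right _ hBpos
  have hlog := Nat.two_pow_pos (Nat.log 2 L.g.n + 1)
  have hQpos : 0 < (2 ^ (Nat.log 2 L.g.n + 1)) ^ c.wc := by positivity
  have hkG : N / c.G ≤ N := Nat.div_le_self _ _
  have hkv : N / c.G / c.v ≤ N := (Nat.div_le_self _ _).trans hkG
  refine .seq (.cmds hW (by rfl) ?_ fun x => ?_)
  · simp [CmdsOk, Cmd.Ok, Cmd.next, setup₁, h0, h1, Nat.one_shiftLeft]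
    omega
  have r₁ : ∀ i, Keep i → ((effect σ c.setup₁).scr x).reg i = (effect σ c.setup₁).reg i :=
    fun i hi => (NS.agree_scr _ x).reg i hi
  refine .seq ((nwp_doubleP hW hn0 (σ := (effect σ c.setup₁).scr x) ?_ ?_ (by omega)).mono ?_)
  · simp [effect, Cmd.next, setup₁, h0, h1, hn, Nat.one_shiftLeft]
  · simp [effect, Cmd.next, setup₁]
  rintro k₁ σ₁ ⟨hk₁, hm₁, hc₁, h21, hlow₁⟩
  have e1 : σ₁.reg 1 = N := by
    rw [hlow₁ 1 (by decide)]; simp [effect, Cmd.next, setup₁, h0]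
  have e2 : σ₁.reg 2 = cl.length := by
    rw [hlow₁ 2 (by decide)]; simp [effect, Cmd.next, setup₁, h1]
  have e3 : σ₁.reg 3 = N / c.G := by
    rw [hlow₁ 3 (by decide)]; simp [effect, Cmd.next, setup₁, h0]
  have e4 : σ₁.reg 4 = 2 ^ (N / c.G) := by
    rw [hlow₁ 4 (by decide)]; simp [effect, Cmd.next, setup₁, h0, Nat.one_shiftLeft]
  have e5 : σ₁.reg 5 = cl.length + 3 := by
    rw [hlow₁ 5 (by decide)]; simp [effect, Cmd.next, setup₁, h1]
  have e6 : σ₁.reg 6 = c.r := by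
    rw [hlow₁ 6 (by decide)]; simp [effect, Cmd.next, setup₁]
  have e7 : σ₁.reg 7 = L.g.n := by
    rw [hlow₁ 7 (by decide)]; simp [effect, Cmd.next, setup₁, h0, h1, hn, Nat.one_shiftLeft]
  have e0 : σ₁.reg 0 = 0 := by
    rw [hlow₁ 0 (by decide)]; simp [effect, Cmd.next, setup₁, hr]
  have em : σ₁.mem = σ.mem := hm₁.trans rfl
  have ec : σ₁.coins = 0 := hc₁.trans hcoins
  have hsh : ∀ i, 1 <<< i = 2 ^ i := Nat.one_shiftLeft
  have vp := fun τ : NS => Ex.val_pow τ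
  have opow1 : ((Ex.rg 21).pow c.wc).Ok W σ₁ :=
    Ex.ok_pow (e := .rg 21) trivial (by simp [h21]) (by simp only [Ex.val_rg, h21]; omega)
  have hval12 : ((Ex.rg 5).pow (c.T + 2)).val σ₁ = (cl.length + 3) ^ (c.T + 2) := by
    simp [vp, e5]
  have hok : CmdsOk W σ₁ c.setup₂ := by
    refine ⟨opow1, ?_⟩
    have opow2 : ∀ τ : NS, τ.reg 5 = cl.length + 3 → ((Ex.rg 5).pow (c.T + 2)).Ok W τ :=
      fun τ hτ => Ex.ok_pow (e := .rg 5) trivial (by simp [hτ]) (by simp only [Ex.val_rg, hτ]; omega)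
    simp [CmdsOk, Cmd.Ok, Cmd.next, e1, e2, e3, e4, e5, e6, e7, h21, hsh, vp, opow2, ← hB, ← hR]
    omega
  refine .seq (.cmds hW setup₂_wf hok fun x' => ?_)
  have ev : ∀ i, Keep i → ((effect σ₁ c.setup₂).scr x').reg i = (effect σ₁ c.setup₂).reg i :=
    fun i hi => (NS.agree_scr _ x').reg i hi
  have em₂ : ((effect σ₁ c.setup₂).scr x').mem = σ.mem := em
  have ec₂ : ((effect σ₁ c.setup₂).scr x').coins = 0 := ec
  have f10 : ((effect σ₁ c.setup₂).scr x').reg 10 = 2 ^ L.w - 1 := by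
    rw [ev 10 (by decide)]
    simp [effect, Cmd.next, setup₂, vp, h21, ← pow_mul]
    rw [mul_comm]
    rfl
  have f11 : ((effect σ₁ c.setup₂).scr x').reg 11 = L.H := by
    rw [ev 11 (by decide)]; simp [effect, Cmd.next, setup₂, e1, e3, hsh, hH]
  have f12 : ((effect σ₁ c.setup₂).scr x').reg 12 = L.B := by
    rw [ev 12 (by decide)]; simp [effect, Cmd.next, setup₂, e1, e3, e5, hsh, hB, vp]
  have f13 : ((effect σ₁ c.setup₂).scr x').reg 13 = L.R := by
    rw [ev 13 (by decide)]; simp [effect, Cmd.next, setup₂, e1, hR]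
  have f14 : ((effect σ₁ c.setup₂).scr x').reg 14 = L.T₀ := by
    rw [ev 14 (by decide)]; simp [effect, Cmd.next, setup₂, e2, hT]
  have f17 : ((effect σ₁ c.setup₂).scr x').reg 17 = L.Z := by
    rw [ev 17 (by decide)]; simp [effect, Cmd.next, setup₂, e7, vp, h21, hQ]
  have f18 : ((effect σ₁ c.setup₂).scr x').reg 18 = L.g.ctr := by
    rw [ev 18 (by decide)]; simp [effect, Cmd.next, setup₂, e4, e5, e6]
    have : L.g.ctr = ((0 * (2 ^ (N / c.G) + 1) + 2 ^ (N / c.G)) * (cl.length + 3) + 1) * c.r +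
      (c.r - 1) := rfl
    rw [this, zero_mul, zero_add]
  have f20 : ((effect σ₁ c.setup₂).scr x').reg 20 = L.R * L.B := by
    rw [ev 20 (by decide)]; simp [effect, Cmd.next, setup₂, e1, e3, e5, hsh, hB, vp, hR]
  have f15 : ((effect σ₁ c.setup₂).scr x').reg 15 = L.VB := by
    rw [ev 15 (by decide)]
    simp [effect, Cmd.next, setup₂, e1, e2, e3, e5, hsh, hB, vp, hR, hVB, hT]
  have f16 : ((effect σ₁ c.setup₂).scr x').reg 16 = L.V := by
    rw [ev 16 (by decide)]
    simp [effect, Cmd.next, setup₂, e1, e2, e3, e5, hsh, hB, vp, hR, hVB, hT, hV, hH]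
  have flow : ∀ i < 8, ((effect σ₁ c.setup₂).scr x').reg i = σ₁.reg i := by
    intro i hi
    rw [ev i (.inl (by omega))]
    have : i ≠ 23 ∧ i ≠ 10 ∧ i ≠ 11 ∧ i ≠ 12 ∧ i ≠ 13 ∧ i ≠ 14 ∧ i ≠ 17 ∧ i ≠ 18 ∧ i ≠ 20 ∧ i ≠ 15 ∧
      i ≠ 16 := by omega
    simp [effect, Cmd.next, setup₂, this]
  generalize (effect σ₁ c.setup₂).scr x' = σ₂ at *
  refine (nwp_fillP hW f20 f14 (by omega) ec₂).mono ?_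
  rintro k₂ σ₃ ⟨hk₂, r₃, m₃⟩
  refine ⟨by omega, ?_, ⟨fun i hi => ?_, fun i hi => ?_, fun h hh => ?_, ?_, ?_⟩, fun a ha => ?_⟩
  · exact
      { r1 := (r₃ 1 (by decide)).trans ((flow 1 (by decide)).trans e1)
        r2 := (r₃ 2 (by decide)).trans ((flow 2 (by decide)).trans e2)
        r3 := (r₃ 3 (by decide)).trans ((flow 3 (by decide)).trans e3)
        r4 := (r₃ 4 (by decide)).trans ((flow 4 (by decide)).trans e4)
        r5 := (r₃ 5 (by decide)).trans ((flow 5 (by decide)).trans e5)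
        r6 := (r₃ 6 (by decide)).trans ((flow 6 (by decide)).trans e6)
        r7 := (r₃ 7 (by decide)).trans ((flow 7 (by decide)).trans e7)
        r10 := (r₃ 10 (by decide)).trans f10
        r11 := (r₃ 11 (by decide)).trans f11
        r12 := (r₃ 12 (by decide)).trans f12
        r13 := (r₃ 13 (by decide)).trans f13
        r14 := (r₃ 14 (by decide)).trans f14
        r15 := (r₃ 15 (by decide)).trans f15
        r16 := (r₃ 16 (by decide)).trans f16
        r17 := (r₃ 17 (by decide)).trans f17
        r18 := (r₃ 18 (by decide)).trans f18
        r20 := (r₃ 20 (by decide)).trans f20 }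
  · change i < (flat cl).length at hi
    rw [m₃, if_neg (by omega), em₂]
    exact hcl i hi
  · rw [m₃, if_pos (by omega), Nat.add_sub_cancel_left]
  · rw [m₃, if_neg (by omega), em₂, hz _ (by omega)]
  · rw [r₃ 0 (by decide), flow 0 (by decide), e0]; exact Nat.zero_le _
  · rw [r₃ 0 (by decide), flow 0 (by decide), e0]; simp
  · rw [m₃, if_neg (by omega), em₂, hz _ (by omega)]

end Consts

end DynGraph

/-! ### Splitting assignments into two groups of variables -/

namespace SAT

open WordRAM

def CNF.codes {N : ℕ} (φ : CNF N) : List (List ℕ) := φ.map (List.map Literal.code)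

theorem CNF.input_eq {N : ℕ} (φ : CNF N) : φ.input = N :: φ.codes.length :: flat φ.codes := by
  simp [CNF.input, CNF.codes, flat, List.flatMap_map]

theorem Literal.code_div {N : ℕ} (l : Literal N) : l.code / 2 = l.1 := by
  unfold Literal.code; split_ifs <;> omega

theorem Literal.code_mod {N : ℕ} (l : Literal N) : l.code % 2 = l.2.toNat := by
  unfold Literal.code; cases l.2 <;> simp

theorem okLit_code {N lo hi z : ℕ} (l : Literal N) :
    okLit lo hi z l.code = true ↔ lo ≤ l.1 ∧ (l.1 : ℕ) < hi ∧ z.testBit l.1 = l.2 := by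
  have : z >>> (l.1 : ℕ) % 2 = l.2.toNat ↔ z.testBit l.1 = l.2 := by
    rw [Nat.shiftRight_eq_div_pow, ← Nat.toNat_testBit]
    constructor
    · intro h
      cases h' : z.testBit l.1 <;> cases h'' : l.2 <;> simp [h', h''] at h ⊢
    · exact fun h => congrArg _ h
  simp only [okLit, Literal.code_div, Literal.code_mod, Bool.and_eq_true, decide_eq_true_eq, this,
    and_assoc]

/-- The low `k` bits of `2 ^ k * h + a` are those of `a`, and the higher ones are those of `h * 2 ^
k`. Each literal is thus tested in exactly one of the two ranges. -/
theorem miss_iff {N k a h : ℕ} (ha : a < 2 ^ k) (C : List (Literal N)) :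
    (miss 0 k a (C.map Literal.code) = true ∧ miss k N (h * 2 ^ k) (C.map Literal.code) = true) ↔
      ∀ l ∈ C, (2 ^ k * h + a).testBit l.1 ≠ l.2 := by
  have e1 : ∀ j, (2 ^ k * h + a).testBit j = if j < k then a.testBit j else (h * 2 ^ k).testBit j := by
    intro j
    have := Nat.testBit_two_pow_mul_add h (Nat.two_pow_pos k) j
    rw [add_zero, mul_comm] at this
    rw [Nat.testBit_two_pow_mul_add h ha, this]
    split_ifs <;> rfl
  simp only [miss, List.all_map, List.all_eq_true, Function.comp, Bool.not_eq_true',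
    ← Bool.not_eq_true, okLit_code, e1]
  constructor
  · rintro ⟨h1, h2⟩ l hl
    have := l.1.isLt
    split_ifs with hlk
    · exact fun hc => h1 l hl ⟨Nat.zero_le _, hlk, hc⟩
    · exact fun hc => h2 l hl ⟨not_lt.1 hlk, by omega, hc⟩
  · refine fun hC => ⟨fun l hl hc => hC l hl ?_, fun l hl hc => hC l hl ?_⟩
    · rw [if_pos hc.2.1, hc.2.2]
    · rw [if_neg (by omega), hc.2.2]

/-- Split assignments into the first `k` variables and the others. -/
theorem CNF.satisfiable_iff {N : ℕ} (φ : CNF N) {k : ℕ} (hk : k ≤ N) :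
    φ.Satisfiable ↔ ∃ h < 2 ^ (N - k), ∃ a < 2 ^ k, ∀ i < φ.codes.length,
      ¬ (miss 0 k a (φ.codes.getD i []) = true ∧ miss k N (h * 2 ^ k) (φ.codes.getD i []) = true) := by
  have key : ∀ h a, a < 2 ^ k → ((∀ i < φ.codes.length, ¬ (miss 0 k a (φ.codes.getD i []) = true ∧
      miss k N (h * 2 ^ k) (φ.codes.getD i []) = true)) ↔
      ∀ C ∈ φ, ∃ l ∈ C, (2 ^ k * h + a).testBit l.1 = l.2) := by
    intro h a ha
    have hlen : φ.codes.length = φ.length := by simp [codes]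
    rw [hlen]
    constructor
    · intro H C hC
      obtain ⟨i, hi, rfl⟩ := List.getElem_of_mem hC
      have := H i hi
      rw [show φ.codes.getD i [] = φ[i].map Literal.code by simp [codes, hi], miss_iff ha] at this
      push Not at this
      exact this
    · intro H i hi
      rw [show φ.codes.getD i [] = φ[i].map Literal.code by simp [codes, hi], miss_iff ha]
      push Not
      exact H _ (List.getElem_mem hi)
  constructor
  · rintro ⟨x, hx⟩
    have hlt := Nat.ofBits_lt_two_pow x
    -- Quotient and remainder of the number whose binary digits are the assignment.
    refine ⟨Nat.ofBits x / 2 ^ k, ?_, Nat.ofBits x % 2 ^ k, Nat.mod_lt _ (Nat.two_pow_pos k), ?_⟩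
    · rw [Nat.div_lt_iff_lt_mul (Nat.two_pow_pos k), ← pow_add, Nat.sub_add_cancel hk]
      exact hlt
    · rw [key _ _ (Nat.mod_lt _ (Nat.two_pow_pos k)), Nat.div_add_mod]
      intro C hC
      obtain ⟨l, hl, h⟩ := hx C hC
      exact ⟨l, hl, by rw [Nat.testBit_ofBits_lt x _ l.1.isLt, ← h]⟩
  · rintro ⟨h, -, a, ha, H⟩
    exact ⟨fun j => (2 ^ k * h + a).testBit j, (key h a ha).1 H⟩

end SAT

/-! ### From the formula to the parameter, and from estimates to a decision -/

namespace DynGraph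

open WordRAM

/-- Some assignment to the first `k` variables satisfies all clauses, together with the assignment
number `h` to the other variables. -/
def Layout.Far (L : Layout) (h : ℕ) : Prop :=
  ∃ a < 2 ^ L.k, ∀ i < L.cl.length,
    ¬ (miss 0 L.k a (L.cl.getD i []) = true ∧ L.act h i = true)

/-- A joined leg with an active tip would be a clause missed by both partial assignments. The
special legs cause no exception: leg 1 has an active tip but is not joined, and leg 2 is joined but
has no active tip. -/
theorem Layout.Ok.le_value {L : Layout} {W : ℕ} (hL : L.Ok W) {h : ℕ} (hF : L.Far h)
    (par : Parameter) : par.scale * (4 * L.g.r - 4) ≤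
      par.value (L.g.graph (L.g.active L.cl.length (L.act h))) L.g.centre := by
  obtain ⟨a, ha, H⟩ := hF
  refine Gadget.le_value (Gadget.active_subset hL.I_eq.ge _) (Gadget.mem_active _ _)
    (b := a) (by rw [hL.n₀_eq]; exact ha) (fun i hi hc s hmem => ?_) par
  rw [Gadget.tip_mem_active hL.I_eq.ge hi] at hmem
  rw [hL.conn_eq] at hc
  simp only [Bool.or_eq_true, decide_eq_true_eq, Bool.and_eq_true] at hc
  rcases hmem with ⟨-, rfl⟩ | ⟨-, h3, hlt, hact⟩
  · omega
  · refine H (i - 3) (by omega) ⟨?_, hact⟩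
    rcases hc with rfl | hc
    · omega
    · exact hc.2

/-- Every `a` leaves some clause missed by both assignments; the leg of that clause is joined and
its tips are active in both copies. -/
theorem Layout.Ok.value_le {L : Layout} {W : ℕ} (hL : L.Ok W) {h : ℕ} (hF : ¬ L.Far h)
    (par : Parameter) : par.value (L.g.graph (L.g.active L.cl.length (L.act h))) L.g.centre ≤
      par.scale * (2 * L.g.r + 2) := by
  refine Gadget.value_le (Gadget.active_subset hL.I_eq.ge _) (Gadget.mem_active _ _)
    (fun a ha s hs => ?_) par
  unfold Far at hF
  push Not at hF
  obtain ⟨i, hi, hmiss, hact⟩ := hF a (by rw [← hL.n₀_eq]; exact ha)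
  have hI := hL.I_eq
  refine ⟨i + 3, by omega, ?_, .inr ⟨i, hi, hact, s, hs, rfl⟩⟩
  rw [hL.conn_eq]
  simp [-List.getD_eq_getElem?_getD, hmiss]

/-- Estimates above this number are estimates of large values. -/
def Side.threshold (par : Parameter) (r : ℕ) : Side → ℕ
  | .above => par.scale * (4 * r - 4) - 1
  | .below => par.scale * (2 * r + 2)

theorem Parameter.scale_pos (par : Parameter) : 0 < par.scale := by
  cases par <;> simp [Parameter.scale]

/-- The gap between the two values is wider than the approximation factor, so one comparison
separates them. For estimates from above small values stay small after multiplication by `α`; for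
estimates from below a large value forces a large estimate. -/
theorem Side.Approx.threshold_lt_iff {side : Side} {α : ℝ} {par : Parameter} {D e r : ℕ} {P : Prop}
    (h : side.Approx α D e) (hr : 2 ≤ r) (hα : α * (2 * r + 2 : ℕ) < (4 * r - 4 : ℕ))
    (hfar : P → par.scale * (4 * r - 4) ≤ D) (hnear : ¬ P → D ≤ par.scale * (2 * r + 2)) :
    side.threshold par r < e ↔ P := by
  have hs := par.scale_pos
  have hs' : (0 : ℝ) < par.scale := by exact_mod_cast hs
  have hpos : 0 < par.scale * (4 * r - 4) := Nat.mul_pos hs (by omega)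
  have key : ∀ x : ℕ, x ≤ par.scale * (2 * r + 2) → α * x < (par.scale * (4 * r - 4) : ℕ) := by
    intro x hx
    -- The factor `2 - ε` may be negative, as `ε` is not bounded.
    rcases le_total α 0 with h0 | h0
    · have : α * x ≤ 0 := mul_nonpos_of_nonpos_of_nonneg h0 (Nat.cast_nonneg _)
      have : (0 : ℝ) < (par.scale * (4 * r - 4) : ℕ) := by exact_mod_cast hpos
      linarith
    · calc α * x ≤ α * (par.scale * (2 * r + 2) : ℕ) :=
            mul_le_mul_of_nonneg_left (by exact_mod_cast hx) h0
        _ = par.scale * (α * (2 * r + 2 : ℕ)) := by push_cast; ring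
        _ < par.scale * (4 * r - 4 : ℕ) := mul_lt_mul_of_pos_left hα hs'
        _ = _ := by push_cast; ring
  cases side
  · obtain ⟨h1, h2⟩ := h
    replace h1 : D ≤ e := by exact_mod_cast h1
    constructor
    · intro hlt
      by_contra hP
      have := key D (hnear hP)
      have : e < par.scale * (4 * r - 4) := by exact_mod_cast h2.trans_lt this
      simp only [threshold] at hlt
      omega
    · intro hP
      have := hfar hP
      simp only [threshold]
      omega
  · obtain ⟨h1, h2⟩ := h
    replace h1 : e ≤ D := by exact_mod_cast h1
    constructor
    · intro hlt
      by_contra hP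
      have := hnear hP
      simp only [threshold] at hlt
      omega
    · intro hP
      by_contra hlt
      have h3 := key e (by simpa [threshold] using hlt)
      have h4 : (D : ℝ) < (par.scale * (4 * r - 4) : ℕ) := h2.trans_lt h3
      have := hfar hP
      have : D < par.scale * (4 * r - 4) := by exact_mod_cast h4
      omega

end DynGraph

namespace DynGraph

open WordRAM

/-! ## Runs of the dynamic algorithm -/

/-- The operations of a phase. -/
def Layout.phase (L : Layout) (S : Setting) (h : ℕ) : List (Op L.g.n) :=
  L.g.ups S L.cl.length (L.act h) ++ .query :: L.g.downs S L.cl.length (L.act h)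

theorem Algorithm.ServesTo.phase {A : Algorithm} {L : Layout} {S : Setting} {ω : ℕ → Bool}
    {s s' : State L.w} {h : ℕ} {tr : List (ℕ × ℕ)} (hs : A.ServesTo ω s (L.phase S h) tr s') :
    ∃ c e, A.Phase L S ω h s s' e (steps tr) ∧
      tr[(L.g.ups S L.cl.length (L.act h)).length]? = some (c, e) := by
  obtain ⟨a, t, t₁, rfl, h1, h2⟩ := hs.of_append
  cases h2 with
  | cons hq h3 =>
    rename_i b k t'
    refine ⟨k, (b.reg 0).toNat, ⟨a, b, t, t', k, h1, hq, h3, rfl, ?_⟩, ?_⟩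
    · simp [steps, add_assoc]
    · rw [← h1.length_eq, List.getElem?_append_right le_rfl]
      simp

theorem List.range_flatMap_split {α : Type*} (f : ℕ → List α) {h H : ℕ} (hh : h < H) :
    ∃ l, (List.range H).flatMap f = (List.range h).flatMap f ++ (f h ++ l) := by
  obtain ⟨d, rfl⟩ := Nat.exists_eq_add_of_le hh
  refine ⟨((List.range d).map (h + 1 + ·)).flatMap f, ?_⟩
  rw [List.range_add, List.flatMap_append, List.range_succ, List.flatMap_append]
  simp

/-- The sequence `ops h`, fixed in advance, has as its operation number `idx h` the query of phase
`h`, and gives the same runs as the simulation. -/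
structure Algorithm.Simulates (A : Algorithm) (L : Layout) (S : Setting) (par : Parameter)
    (M : ℕ) (ops : ℕ → List (Op L.g.n)) (idx : ℕ → ℕ) : Prop where
  valid : ∀ h, Valid S M (L.g.graph (L.g.active L.cl.length (Gadget.initially S))) (ops h)
  query : ∀ h < L.H, (ops h)[idx h]? = some .query
  graph : ∀ h < L.H, graphAfter (L.g.graph (L.g.active L.cl.length (Gadget.initially S))) (ops h)
    (idx h) = L.g.graph (L.g.active L.cl.length (L.act h))
  time : ∀ h < L.H, ∀ ω, ∃ k tr, A.Run par ω L.g.centre (L.g.edges (L.g.start S)) (ops h) k tr ∧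
    k + steps tr ≤ L.B
  inner : ∀ ω, ∃ ans, A.Inner L S par ω ans ∧ ∀ h < L.H,
    A.Answer par ω L.g.centre (L.g.edges (L.g.start S)) (ops h) (idx h) (ans h)

theorem Layout.Ok.ofEdgeList {L : Layout} {W : ℕ} (hL : L.Ok W) (S : Setting) :
    DynGraph.ofEdgeList (L.g.edges (L.g.start S)) =
      L.g.graph (L.g.active L.cl.length (Gadget.initially S)) := by
  rw [Gadget.ofEdgeList_edges (Gadget.start_subset hL.I_eq S), Gadget.start_eq hL.I_eq S]

/-- By determinism the answers of the simulation are those of true runs on sequences fixed in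
advance, to which the guarantee of probability 2/3 applies. It transfers to the decisions of the
single phases, as events that depend on the first `L.B` bits. -/
theorem Algorithm.Simulates.exists_answers {A : Algorithm} {L : Layout} {W : ℕ} (hL : L.Ok W)
    {S : Setting} {par : Parameter} {side : Side} {α : ℝ} {M : ℕ → ℕ}
    {ops : ℕ → List (Op L.g.n)} {idx : ℕ → ℕ} (hs : A.Simulates L S par (M L.g.n) ops idx)
    (hA : A.Approximates S par side α M) (hα : α * (2 * L.g.r + 2 : ℕ) < (4 * L.g.r - 4 : ℕ)) :
    ∃ ans : (ℕ → Bool) → ℕ → ℕ, (∀ ω, A.Inner L S par ω (ans ω)) ∧ ∀ h < L.H,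
      DependsOnFirst L.B {ω | side.threshold par L.g.r < ans ω h ↔ L.Far h} ∧
      2 / 3 ≤ coinLaw {ω | side.threshold par L.g.r < ans ω h ↔ L.Far h} := by
  choose ans hI hans using hs.inner
  refine ⟨ans, hI, fun h hh => ⟨?_, ?_⟩⟩
  · have := dependsOnFirst_answer (hs.time h hh) (idx h)
      {e | side.threshold par L.g.r < e ↔ L.Far h}
    convert this using 1
    ext ω
    constructor
    · exact fun hω => ⟨_, hω, hans ω h hh⟩
    · rintro ⟨e, he, hAe⟩
      rw [(hans ω h hh).unique hAe] at he
      exact he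
  · have hE := Gadget.isEdgeList_edges (Gadget.start_subset hL.I_eq S)
    refine (hA L.g.n L.g.centre _ (ops h) hE (by rw [hL.ofEdgeList]; exact hs.valid h) (idx h)
      (hs.query h hh)).trans (measure_mono ?_)
    rintro ω ⟨k, tr, hrun, c, e, htr, happ⟩
    rw [(hans ω h hh).unique ⟨k, tr, c, hrun, htr⟩, hL.ofEdgeList, hs.graph h hh] at happ
    exact happ.threshold_lt_iff L.g.two_le_r hα (fun hF => hL.le_value hF par)
      (fun hF => hL.value_le hF par)

section

variable {A : Algorithm} {L : Layout} {W : ℕ} {par : Parameter} {M : ℕ → ℕ} {p u q : ℕ → ℝ}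

theorem Algorithm.Run.exists_servesTo {n w : ℕ} {x : Fin n} {E : List (Fin n × Fin n)}
    {ops : List (Op n)} {k : ℕ} {tr : List (ℕ × ℕ)} {ω : ℕ → Bool} (hw : w = A.width n)
    (h : A.Run par ω x E ops k tr) : ∃ s s' : State w,
      Exec ω A.preprocess (.initial w (par.input x E)) k s ∧ A.ServesTo ω s ops tr s' := by
  subst hw
  obtain ⟨s, h1, h2⟩ := h
  obtain ⟨s', h2⟩ := h2.exists_servesTo
  exact ⟨s, s', h1, h2⟩

theorem List.countP_flatMap_range_le {α : Type*} {P : α → Bool} {f : ℕ → List α} {x : ℕ}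
    (h : ∀ i, (f i).countP P ≤ x) (H : ℕ) : ((List.range H).flatMap f).countP P ≤ H * x := by
  induction H with
  | zero => simp
  | succ H ih =>
    rw [List.range_succ, List.flatMap_append, List.flatMap_singleton, List.countP_append,
      Nat.succ_mul]
    exact Nat.add_le_add ih (h H)

theorem List.length_flatMap_congr {α β : Type*} {f : ℕ → List α} {g : ℕ → List β} {h : ℕ}
    (hfg : ∀ i < h, (f i).length = (g i).length) :
    ((List.range h).flatMap f).length = ((List.range h).flatMap g).length := by
  rw [List.length_flatMap, List.length_flatMap]
  congr 1
  exact List.map_congr_left fun i hi => hfg i (List.mem_range.1 hi)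

theorem Layout.countP_phase_le (L : Layout) (S : Setting) (h : ℕ) :
    (L.phase S h).countP Op.isUpdate ≤ 4 * L.cl.length ∧
      (L.phase S h).countP (fun o => !o.isUpdate) ≤ 1 := by
  have hu : ∀ o ∈ L.g.ups S L.cl.length (L.act h), o.isUpdate = true := by
    intro o ho
    cases S <;> simp only [Gadget.ups, List.mem_map] at ho <;> obtain ⟨v, -, rfl⟩ := ho <;> rfl
  have hd : ∀ o ∈ L.g.downs S L.cl.length (L.act h), o.isUpdate = true := by
    intro o ho
    cases S <;> simp only [Gadget.downs, List.mem_map, List.not_mem_nil] at ho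
    obtain ⟨v, -, rfl⟩ := ho; rfl
  have lu : (L.g.ups S L.cl.length (L.act h)).length ≤ 2 * L.cl.length := by
    cases S <;> simpa [Gadget.ups] using Gadget.length_tipList_le _ _
  have ld : (L.g.downs S L.cl.length (L.act h)).length ≤ 2 * L.cl.length := by
    cases S
    · simpa [Gadget.downs] using Gadget.length_tipList_le _ _
    · simp [Gadget.downs]
    · simp [Gadget.downs]
  unfold phase
  constructor
  · rw [List.countP_append, List.countP_cons]
    have h1 := List.countP_le_length (p := Op.isUpdate) (l := L.g.ups S L.cl.length (L.act h))
    have h2 := List.countP_le_length (p := Op.isUpdate) (l := L.g.downs S L.cl.length (L.act h))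
    simp only [Op.isUpdate, Bool.false_eq_true, if_false]
    omega
  · rw [List.countP_append, List.countP_cons, List.countP_eq_zero.2, List.countP_eq_zero.2]
    · split_ifs <;> simp
    · intro o ho; simp [hd o ho]
    · intro o ho; simp [hu o ho]

theorem Layout.phase_graph (hL : L.Ok W) (S : Setting) (h : ℕ) :
    (L.g.ups S L.cl.length (L.act h)).foldl Op.apply
      (L.g.graph (L.g.active L.cl.length (Gadget.initially S))) =
      L.g.graph (L.g.active L.cl.length (L.act h)) :=
  (Gadget.ups_phase hL.I_eq.ge le_rfl S _).2

/-- All phases form one sequence, because each phase returns to the initial graph; an amortized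
bound for the whole sequence suffices. -/
theorem Algorithm.simulates_full (hL : L.Ok W) (hw : L.w = A.width L.g.n)
    (hM : 4 * L.g.n ≤ M L.g.n)
    (hT : A.AmortizedTime .fullyDynamic par M p u q)
    (hB : |p L.g.n| + L.H * (4 * L.cl.length * |u L.g.n| + |q L.g.n|) ≤ L.B) :
    ∃ ops idx, A.Simulates L .fullyDynamic par (M L.g.n) ops idx := by
  have hI := hL.I_eq.ge
  have hv : ∀ H, Valid .fullyDynamic (M L.g.n)
      (L.g.graph (L.g.active L.cl.length (Gadget.initially .fullyDynamic)))
      ((List.range H).flatMap (L.phase .fullyDynamic)) ∧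
      ((List.range H).flatMap (L.phase .fullyDynamic)).foldl Op.apply
        (L.g.graph (L.g.active L.cl.length (Gadget.initially .fullyDynamic))) =
      L.g.graph (L.g.active L.cl.length (Gadget.initially .fullyDynamic)) := by
    intro H
    induction H with
    | zero => exact ⟨Gadget.admissible (Gadget.active_subset hI _) (Gadget.mem_active _ _) hM, rfl⟩
    | succ H ih =>
      obtain ⟨u1, u2⟩ := Gadget.ups_phase hI hM .fullyDynamic (L.act H)
      obtain ⟨d1, d2⟩ := Gadget.downs_phase hI hM (L.act H)
      have hq := Gadget.valid_query hI hM .fullyDynamic (L.act H)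
      have hphase : L.phase .fullyDynamic H = L.g.ups .fullyDynamic L.cl.length (L.act H) ++
        ([.query] ++ L.g.downs .fullyDynamic L.cl.length (L.act H)) := rfl
      rw [List.range_succ, List.flatMap_append, List.flatMap_singleton, hphase]
      refine ⟨valid_append ih.1 (valid_append ?_ (valid_append ?_ ?_)), ?_⟩
      · rw [ih.2]; exact u1
      · rw [ih.2, u2]; exact hq
      · rw [ih.2, u2]; exact d1
      · rw [List.foldl_append, ih.2, List.foldl_append, u2, List.foldl_append]
        exact d2
  have hops := (hv L.H).1
  have htime : ∀ ω, ∃ k tr, A.Run par ω L.g.centre (L.g.edges (L.g.start .fullyDynamic))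
      ((List.range L.H).flatMap (L.phase .fullyDynamic)) k tr ∧ k + steps tr ≤ L.B := by
    intro ω
    obtain ⟨k, tr, hrun, hle⟩ := hT L.g.n L.g.centre _ _
      (Gadget.isEdgeList_edges (Gadget.start_subset hL.I_eq .fullyDynamic))
      (by rw [hL.ofEdgeList]; exact hops) ω
    refine ⟨k, tr, hrun, ?_⟩
    have c1 := List.countP_flatMap_range_le (fun h => (L.countP_phase_le .fullyDynamic h).1) L.H
    have c2 := List.countP_flatMap_range_le (fun h => (L.countP_phase_le .fullyDynamic h).2) L.H
    rify at c1 c2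
    have d1 := mul_le_mul_of_nonneg_right c1 (abs_nonneg (u L.g.n))
    have d2 := mul_le_mul_of_nonneg_right c2 (abs_nonneg (q L.g.n))
    have d3 := mul_le_mul_of_nonneg_left (le_abs_self (u L.g.n)) (Nat.cast_nonneg (α := ℝ)
      (((List.range L.H).flatMap (L.phase .fullyDynamic)).countP Op.isUpdate))
    have d4 := mul_le_mul_of_nonneg_left (le_abs_self (q L.g.n)) (Nat.cast_nonneg (α := ℝ)
      (((List.range L.H).flatMap (L.phase .fullyDynamic)).countP fun o => !o.isUpdate))
    have d5 := le_abs_self (p L.g.n)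
    have : ((k + steps tr : ℕ) : ℝ) ≤ L.B := hle.trans (by linarith)
    exact_mod_cast this
  refine ⟨fun _ => (List.range L.H).flatMap (L.phase .fullyDynamic), fun h =>
    ((List.range h).flatMap (L.phase .fullyDynamic)).length +
      (L.g.ups .fullyDynamic L.cl.length (L.act h)).length, fun _ => hops, fun h hh => ?_,
    fun h hh => ?_, ?_, ?_⟩
  · obtain ⟨l, hl⟩ := List.range_flatMap_split (L.phase .fullyDynamic) hh
    rw [hl, List.getElem?_append_right (by omega), Nat.add_sub_cancel_left]
    simp [Layout.phase]
  · obtain ⟨l, hl⟩ := List.range_flatMap_split (L.phase .fullyDynamic) hh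
    unfold graphAfter
    rw [hl, List.take_length_add_append, Layout.phase, List.append_assoc, List.take_left',
      List.foldl_append, (hv h).2, Layout.phase_graph hL]
    rfl
  · exact fun _ _ ω => htime ω
  · intro ω
    obtain ⟨k, tr, hrun, hle⟩ := htime ω
    obtain ⟨s, s', h1, h2⟩ := hrun.exists_servesTo hw
    obtain ⟨st, τ, rfl, -, h3, h4, h5, h6⟩ := h2.flatMap
    have h7 := fun h hh => (h3 h hh).phase
    choose c e h8 h9 using h7
    have hcoins : (st 0).coins ≤ k := by simpa [State.initial] using h1.coins_le.2
    refine ⟨fun h => if hh : h < L.H then e h hh else 0, ⟨st, fun h => st (h + 1), k,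
      fun h => steps (τ h), h1, fun h hh => ⟨?_, ?_, rfl⟩, ?_⟩, fun h hh => ?_⟩
    · beta_reduce
      rw [dif_pos hh]
      exact h8 h hh
    · beta_reduce
      have := h5 h hh.le
      have h10 := Finset.sum_range_succ (fun i => steps (τ i)) h
      have h11 : ∑ i ∈ Finset.range (h + 1), steps (τ i) ≤ ∑ i ∈ Finset.range L.H, steps (τ i) :=
        Finset.sum_le_sum_of_subset (Finset.range_mono hh)
      omega
    · rw [← h6]; exact hle
    · refine ⟨k, tr, c h hh, hrun, ?_⟩
      beta_reduce
      rw [dif_pos hh, h4]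
      obtain ⟨l, hl⟩ := List.range_flatMap_split τ hh
      rw [hl, List.length_flatMap_congr (g := τ) fun i hi => (h3 i (hi.trans hh)).length_eq.symm,
        List.getElem?_append_right (by omega), Nat.add_sub_cancel_left, List.getElem?_append_left]
      · exact h9 h hh
      · exact (List.getElem?_eq_some_iff.1 (h9 h hh)).1

theorem steps_le_of_forall {n : ℕ} {f : Op n → ℝ} {l : List (Op n)} {tr : List (ℕ × ℕ)}
    (hlen : tr.length = l.length)
    (h : ∀ (i : ℕ) (o : Op n) (c e : ℕ), l[i]? = some o → tr[i]? = some (c, e) → (c : ℝ) ≤ f o) :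
    (steps tr : ℝ) ≤ (l.map f).sum := by
  induction l generalizing tr with
  | nil =>
    rw [List.length_eq_zero_iff.1 hlen]
    simp [steps]
  | cons o l ih =>
    cases tr with
    | nil => simp at hlen
    | cons x tr =>
      have h1 := h 0 o x.1 x.2 rfl rfl
      have h2 := ih (by simpa using hlen) fun i o c e ho hc => h (i + 1) o c e (by simpa using ho)
        (by simpa using hc)
      simp only [steps, List.map_cons, List.sum_cons, Nat.cast_add] at h2 ⊢
      linarith

/-- Here the sequence for `h` consists of phase `h` alone. Restarting from the configuration after
the preprocessing reproduces the run on that sequence with the same random bits. The costs of all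
restarted phases are added, which is where worst-case bounds are needed. -/
theorem Algorithm.simulates_partial {S : Setting} (hS : S = .incremental ∨ S = .decremental)
    (hL : L.Ok W) (hw : L.w = A.width L.g.n) (hM : 4 * L.g.n ≤ M L.g.n) (hH : 0 < L.H)
    (hT : A.WorstCaseTime S par M p u q)
    (hB : |p L.g.n| + L.H * (4 * L.cl.length * |u L.g.n| + |q L.g.n|) ≤ L.B) :
    ∃ ops idx, A.Simulates L S par (M L.g.n) ops idx := by
  have hI := hL.I_eq.ge
  have hphase : ∀ h, L.phase S h = L.g.ups S L.cl.length (L.act h) ++ [.query] := by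
    intro h
    rcases hS with rfl | rfl <;> rfl
  have hrest : ∀ s s' : State L.w, S.rest s s' = s := by
    intro s s'
    rcases hS with rfl | rfl <;> rfl
  have hv : ∀ h, Valid S (M L.g.n) (L.g.graph (L.g.active L.cl.length (Gadget.initially S)))
      (L.phase S h) := by
    intro h
    obtain ⟨u1, u2⟩ := Gadget.ups_phase hI hM S (L.act h)
    rw [hphase]
    refine valid_append u1 ?_
    rw [u2]
    exact Gadget.valid_query hI hM S (L.act h)
  have hrun := fun ω h => hT L.g.n L.g.centre _ (L.phase S h)
    (Gadget.isEdgeList_edges (Gadget.start_subset hL.I_eq S)) (by rw [hL.ofEdgeList]; exact hv h) ω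
  choose k tr hrun hk hc using hrun
  have hsteps : ∀ ω h, (steps (tr ω h) : ℝ) ≤ 4 * L.cl.length * |u L.g.n| + |q L.g.n| := by
    intro ω h
    obtain ⟨s, s', -, h2⟩ := (hrun ω h).exists_servesTo (w := L.w) hw
    refine (steps_le_of_forall (f := fun o => if o.isUpdate = true then |u L.g.n| else |q L.g.n|)
      h2.length_eq fun i o c e ho hce => (hc ω h i o c e ho hce).trans ?_).trans ?_
    · split_ifs <;> exact le_abs_self _
    · have hsum : ∀ l : List (Op L.g.n), (l.map fun o => if o.isUpdate = true then |u L.g.n| else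
          |q L.g.n|).sum = l.countP Op.isUpdate * |u L.g.n| +
            l.countP (fun o => !o.isUpdate) * |q L.g.n| := by
        intro l
        induction l with
        | nil => simp
        | cons o l ih =>
          rw [List.map_cons, List.sum_cons, ih]
          cases ho : o.isUpdate <;> simp [ho] <;> ring
      obtain ⟨c1, c2⟩ := L.countP_phase_le S h
      rw [hsum]
      have c1' : (((L.phase S h).countP Op.isUpdate : ℕ) : ℝ) ≤ 4 * L.cl.length := by exact_mod_cast c1
      have c2' : (((L.phase S h).countP (fun o => !o.isUpdate) : ℕ) : ℝ) ≤ 1 := by exact_mod_cast c2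
      have := mul_le_mul_of_nonneg_right c1' (abs_nonneg (u L.g.n))
      have := mul_le_mul_of_nonneg_right c2' (abs_nonneg (q L.g.n))
      linarith
  have hkp : ∀ ω h, (k ω h : ℝ) ≤ |p L.g.n| := fun ω h => (hk ω h).trans (le_abs_self _)
  have hY : 0 ≤ 4 * L.cl.length * |u L.g.n| + |q L.g.n| := by positivity
  have hH1 : (1 : ℝ) ≤ L.H := by exact_mod_cast hH
  have hkB : ∀ ω h h', k ω h + steps (tr ω h') ≤ L.B := by
    intro ω h h'
    have h1 := hkp ω h
    have h2 := hsteps ω h'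
    have h3 := mul_le_mul_of_nonneg_right hH1 hY
    have : ((k ω h + steps (tr ω h') : ℕ) : ℝ) ≤ L.B := by rw [Nat.cast_add]; linarith
    exact_mod_cast this
  refine ⟨L.phase S, fun h => (L.g.ups S L.cl.length (L.act h)).length, hv, fun h _ => ?_,
    fun h _ => ?_, fun h _ ω => ⟨_, _, hrun ω h, hkB ω h h⟩, fun ω => ?_⟩
  · simp [hphase]
  · unfold graphAfter
    rw [hphase, List.take_left', Layout.phase_graph hL]
    rfl
  -- For fixed `ω` the preprocessing does not depend on the phase, so by determinism all runs pass
  -- through the same configuration `s`.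
  · obtain ⟨s, -, h1, -⟩ := (hrun ω 0).exists_servesTo (w := L.w) hw
    have hserve : ∀ h, ∃ s', A.ServesTo ω s (L.phase S h) (tr ω h) s' := by
      intro h
      obtain ⟨t, s', h3, h4⟩ := (hrun ω h).exists_servesTo (w := L.w) hw
      obtain ⟨-, rfl⟩ := h1.unique h3
      exact ⟨s', h4⟩
    choose s' hserve using hserve
    have h7 := fun h => (hserve h).phase
    choose c e h8 h9 using h7
    have hcoins : s.coins ≤ k ω 0 := by simpa [State.initial] using h1.coins_le.2
    refine ⟨e, ⟨fun _ => s, s', k ω 0, fun h => steps (tr ω h), h1,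
      fun h hh => ⟨h8 h, (Nat.add_le_add_right hcoins _).trans (hkB ω 0 h), (hrest _ _).symm⟩, ?_⟩,
      fun h hh => ⟨_, _, c h, hrun ω h, h9 h⟩⟩
    have hsum : ((∑ h ∈ Finset.range L.H, steps (tr ω h) : ℕ) : ℝ) ≤
        L.H * (4 * L.cl.length * |u L.g.n| + |q L.g.n|) := by
      rw [Nat.cast_sum]
      refine (Finset.sum_le_sum fun h _ => hsteps ω h).trans ?_
      rw [Finset.sum_const, Finset.card_range, nsmul_eq_mul]
    have : ((k ω 0 + ∑ h ∈ Finset.range L.H, steps (tr ω h) : ℕ) : ℝ) ≤ L.B := by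
      have := hkp ω 0
      rw [Nat.cast_add]
      linarith
    exact_mod_cast this

end

end DynGraph

namespace DynGraph

open WordRAM

/-! ## The decision procedure -/

def decideP (A : Algorithm) (S : Setting) (par : Parameter) (thr M : ℕ) (c : Consts) : Prog :=
  .seq c.setupP (forP 30 13 (runP A S par thr M))

/-- The time of the decision procedure. -/
def Consts.time (c : Consts) (M N : ℕ) (cl : List (List ℕ)) : ℕ :=
  cost c.setup₁ + cost c.setup₂ + 100 * (c.layout N cl).g.n +
    100 * ((c.layout N cl).R * (c.layout N cl).B) + 12 +
    (c.layout N cl).R * ((c.layout N cl).runTime M + 5)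

/-- Combines setup and runs on the actual input. The words are long enough to store every number of
the encoded formula without truncation. -/
theorem exec_decideP {N W : ℕ} {φ : SAT.CNF N} {c : Consts} {A : Algorithm} {S : Setting}
    {par : Parameter} {thr M : ℕ} (hL : (c.layout N φ.codes).Ok W) (hG : c.G < 2 ^ W)
    (hv : c.v < 2 ^ W) (hK : c.K + 1 < 2 ^ W) (hthr : thr < 2 ^ W) (hM : A.Below M)
    (ω : ℕ → Bool) {ans : ℕ → ℕ → ℕ}
    (hI : ∀ q < (c.layout N φ.codes).R, A.Inner (c.layout N φ.codes) S par
      (shift (q * (c.layout N φ.codes).B) ω) (ans q)) :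
    ∃ k s, Exec ω (decideP A S par thr M c) (.initial W φ.input) k s ∧ k ≤ c.time M N φ.codes ∧
      (s.reg 0 ≠ 0 ↔ ∃ h < (c.layout N φ.codes).H,
        (c.layout N φ.codes).R < 2 * votes thr ans (c.layout N φ.codes).R h) := by
  set L := c.layout N φ.codes with hLdef
  have hW := hL.W_pos
  have hcl : L.cl = φ.codes := rfl
  have hflat := hL.cl_lt
  rw [hcl] at hflat
  have hNW : 2 * N < 2 ^ W := by
    have h1 := hL.top
    have h2 : L.R = 24 * (N + 1) := rfl
    have h3 : 1 * L.R ≤ 3 * L.Z * L.R := by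
      have := hL.size
      have := Nat.two_pow_pos L.w
      exact Nat.mul_le_mul_right _ (by omega)
    omega
  have hlen := length_le_flat φ.codes
  have hmem : ∀ a, (State.initial W φ.input).toNS.mem a = φ.input.getD a 0 := by
    intro a
    have hlt : ∀ x ∈ φ.input, x < 2 ^ W := by
      intro x hx
      rw [SAT.CNF.input_eq] at hx
      simp only [List.mem_cons, flat, List.mem_flatMap] at hx
      rcases hx with rfl | rfl | ⟨C, hC, rfl | hx⟩
      · omega
      · omega
      · have : C.length ≤ (flat φ.codes).length := by
          obtain ⟨i, hi, rfl⟩ := List.getElem_of_mem hC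
          rw [flat_split φ.codes hi]
          simp [hi]
          omega
        omega
      · obtain ⟨C', -, rfl⟩ := List.mem_map.1 hC
        obtain ⟨l, -, rfl⟩ := List.mem_map.1 hx
        have := l.1.isLt
        unfold SAT.Literal.code
        split_ifs <;> omega
    have hlen' : φ.input.length ≤ 2 ^ W := by
      rw [SAT.CNF.input_eq]
      simp only [List.length_cons]
      omega
    simp only [State.toNS, State.initial]
    by_cases ha : a < 2 ^ W
    · rw [if_pos ha, BitVec.toNat_ofNat, BitVec.toNat_ofNat, Nat.mod_eq_of_lt ha]
      refine Nat.mod_eq_of_lt ?_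
      by_cases hal : a < φ.input.length
      · rw [List.getD_eq_getElem _ _ hal]
        exact hlt _ (List.getElem_mem hal)
      · rw [List.getD_eq_default _ _ (not_lt.1 hal)]
        omega
    · rw [if_neg ha, List.getD_eq_default _ _ (by omega)]
  have key : NWP W ω (decideP A S par thr M c) (State.initial W φ.input).toNS fun k σ' =>
      k ≤ c.time M N φ.codes ∧
      (σ'.reg 0 ≠ 0 ↔ ∃ h < L.H, L.R < 2 * votes thr ans L.R h) := by
    refine .seq ((Consts.nwp_setupP hL hG hv hK ?_ ?_ ?_ ?_ ?_ rfl).mono ?_)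
    · rw [hmem, SAT.CNF.input_eq]; rfl
    · rw [hmem, SAT.CNF.input_eq]; rfl
    · intro i hi
      rw [hmem, SAT.CNF.input_eq, add_comm]
      rfl
    · intro a ha
      rw [hmem, List.getD_eq_default _ _ (by rw [SAT.CNF.input_eq]; simp; omega)]
    · simp [State.toNS, State.initial]
    · rintro k₁ σ₁ ⟨hk₁, hE, hO, hz⟩
      refine (nwp_runs hL hE hO hz hM hI hthr).mono ?_
      rintro k₂ σ₂ ⟨hk₂, hiff⟩
      refine ⟨?_, hiff⟩
      unfold Consts.time
      rw [← hLdef] at hk₁ ⊢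
      omega
  obtain ⟨k, s, hexec, hk, hiff⟩ := key _ rfl
  refine ⟨k, s, hexec, hk, ?_⟩
  rw [← hiff]
  simp only [State.toNS, ne_eq]
  rw [← BitVec.toNat_inj]
  simp

/-- With probability 2/3, in every phase fewer than half of the runs decide wrongly. Then the strict
majority vote of each phase is right, and the flag tells whether some phase has a completing
assignment, which is satisfiability. -/
theorem decides_of_simulates {N W : ℕ} {φ : SAT.CNF N} {c : Consts} {A : Algorithm} {S : Setting}
    {par : Parameter} {side : Side} {α : ℝ} {M : ℕ} {m : ℕ → ℕ} (hL : (c.layout N φ.codes).Ok W)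
    (hG : c.G < 2 ^ W) (hv : c.v < 2 ^ W) (hK : c.K + 1 < 2 ^ W)
    (hthr : side.threshold par c.r < 2 ^ W) (hM : A.Below M)
    (hs : ∃ ops idx, A.Simulates (c.layout N φ.codes) S par (m (c.layout N φ.codes).g.n) ops idx)
    (hA : A.Approximates S par side α m) (hα : α * (2 * c.r + 2 : ℕ) < (4 * c.r - 4 : ℕ)) :
    (∀ ω, ∃ k s, Exec ω (decideP A S par (side.threshold par c.r) M c) (.initial W φ.input) k s ∧
      k ≤ c.time M N φ.codes) ∧
    2 / 3 ≤ coinLaw {ω | ∃ k s, Exec ω (decideP A S par (side.threshold par c.r) M c)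
      (.initial W φ.input) k s ∧ (s.reg 0 ≠ 0 ↔ φ.Satisfiable)} := by
  classical
  obtain ⟨ops, idx, hs⟩ := hs
  obtain ⟨ans, hI, hans⟩ := hs.exists_answers hL hA hα
  have hrun := fun ω => exec_decideP (thr := side.threshold par c.r) hL hG hv hK hthr hM ω
    (ans := fun q => ans (shift (q * (c.layout N φ.codes).B) ω)) fun q _ => hI _
  set L := c.layout N φ.codes with hLdef
  constructor
  · intro ω
    obtain ⟨k, s, h1, h2, -⟩ := hrun ω
    exact ⟨k, s, h1, h2⟩
  · have hHN : L.H ≤ 2 ^ N := Nat.pow_le_pow_right (by norm_num) (Nat.sub_le _ _)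
    refine (measure_forall_failures_lt (N := N) hHN (fun h hh => (hans h hh).1)
      fun h hh => (hans h hh).2).trans (measure_mono fun ω hω => ?_)
    obtain ⟨k, s, h1, -, h2⟩ := hrun ω
    refine ⟨k, s, h1, h2.trans ?_⟩
    rw [φ.satisfiable_iff (k := N / c.G) (Nat.div_le_self _ _)]
    refine exists_congr fun h => and_congr_right fun hh => ?_
    -- A run fails for `h` when its vote differs from the truth. If the truth is yes, the failures
    -- are the missing votes; if it is no, they are the votes cast.
    have hfail := hω h hh
    have hR : 24 * (N + 1) = L.R := rfl
    rw [hR] at hfail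
    set P : ℕ → Prop := fun q => side.threshold par c.r < ans (shift (q * L.B) ω) h with hP
    have hvotes : votes (side.threshold par c.r) (fun q => ans (shift (q * L.B) ω)) L.R h =
        ((Finset.range L.R).filter P).card := by
      rw [votes, Finset.card_filter]
    have hcard := Finset.card_filter_add_card_filter_not (s := Finset.range L.R) P
    rw [Finset.card_range] at hcard
    rw [hvotes]
    change _ ↔ L.Far h
    have hfe : failures L.B L.R {ω | side.threshold par c.r < ans ω h ↔ L.Far h} ω =
        ((Finset.range L.R).filter fun q => ¬ (P q ↔ L.Far h)).card := by
      unfold failures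
      congr 1
      ext q
      simp only [Finset.mem_filter]
      exact Iff.rfl
    change 2 * failures L.B L.R {ω | side.threshold par c.r < ans ω h ↔ L.Far h} ω < L.R at hfail
    rw [hfe] at hfail
    by_cases hF : L.Far h
    · have e : ((Finset.range L.R).filter fun q => ¬ (P q ↔ L.Far h)) =
          (Finset.range L.R).filter fun q => ¬ P q := Finset.filter_congr (by simp [hF])
      rw [e] at hfail
      simp only [hF, iff_true]
      omega
    · have e : ((Finset.range L.R).filter fun q => ¬ (P q ↔ L.Far h)) =
          (Finset.range L.R).filter P := Finset.filter_congr (by simp [hF])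
      rw [e] at hfail
      simp only [hF, iff_false]
      omega

end DynGraph

/-! ### The size of formulas without repeated clauses -/

namespace SAT

open WordRAM

/-- A clause is determined by its entries at the positions below `K`, each a literal or absent, and
there are `2 N + 1` possibilities for an entry. For fixed `K` the number of clauses is thus
polynomial. -/
theorem CNF.IsKCNF.length_le {N K : ℕ} {φ : CNF N} (h : φ.IsKCNF K) :
    φ.length ≤ (2 * N + 1) ^ K := by
  have hnd : (φ.map fun C (i : Fin K) => C[(i : ℕ)]?).Nodup := by
    refine h.1.map_on fun C hC C' hC' heq => List.ext_getElem? fun i => ?_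
    by_cases hi : i < K
    · exact congrFun heq ⟨i, hi⟩
    · have h1 := h.2 C hC
      have h2 := h.2 C' hC'
      rw [List.getElem?_eq_none (by omega), List.getElem?_eq_none (by omega)]
  have := hnd.length_le_card
  rw [List.length_map] at this
  refine this.trans (le_of_eq ?_)
  simp [mul_comm]

theorem CNF.IsKCNF.length_flat_le {N K : ℕ} {φ : CNF N} (h : φ.IsKCNF K) :
    (flat φ.codes).length ≤ φ.codes.length * (K + 1) := by
  unfold flat
  rw [List.length_flatMap, ← smul_eq_mul]
  refine (List.sum_le_card_nsmul _ (K + 1) ?_).trans (by rw [List.length_map])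
  intro x hx
  obtain ⟨C, hC, rfl⟩ := List.mem_map.1 hx
  obtain ⟨C', hC', rfl⟩ := List.mem_map.1 hC
  simpa using h.2 C' hC'

end SAT

namespace DynGraph

open WordRAM

/-! ## Bounds -/

namespace Consts

variable {c : Consts}

theorem k_add_le (hG : 2 ≤ c.G) (N : ℕ) : N / c.G + N / c.G / c.v ≤ N := by
  have h1 : N / c.G / c.v ≤ N / c.G := Nat.div_le_self _ _
  have h2 : N / c.G ≤ N / 2 := Nat.div_le_div_left hG (by norm_num)
  omega

theorem n_le (N : ℕ) (cl : List (List ℕ)) :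
    (c.layout N cl).g.n ≤ 4 * c.r * (cl.length + 3) * 2 ^ (N / c.G) := by
  have h : (c.layout N cl).g.n = 2 * ((2 ^ (N / c.G) + 1) * ((cl.length + 3) * c.r)) := rfl
  have h1 : 1 ≤ 2 ^ (N / c.G) := Nat.one_le_two_pow
  calc (c.layout N cl).g.n ≤ 2 * ((2 ^ (N / c.G) + 2 ^ (N / c.G)) * ((cl.length + 3) * c.r)) := by
        rw [h]; gcongr
    _ = _ := by ring

/-- Besides the budget of the simulated runs there is only the cost of writing the graphs, of
evaluating the clauses in each phase and of filling the tape. As `G ≥ 2`, the factor `2 ^ k` in the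
size of the graph is at most `2 ^ (N - k / v)`, and so is the number of phases. -/
theorem time_le (hG : 2 ≤ c.G) (M : ℕ) : ∃ C, ∀ (N : ℕ) (cl : List (List ℕ)),
    (flat cl).length ≤ cl.length * (c.K + 1) → c.time M N cl ≤
      C * ((N + 1) * (2 ^ (N - N / c.G / c.v) * (cl.length + 3) ^ (c.T + 2))) := by
  set C₁ := cost (initCmds M) + cost (parkCmds M) + 300 with hC₁
  set C₂ := 4 * c.r * (100 * (c.K + 1) + 1005) with hC₂
  set C₃ := cost (enterCmds M) + 205 with hC₃
  set C₄ := 2 * (100 * (c.K + 1) + 600) with hC₄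
  set C₅ := C₁ + C₂ + C₃ + C₄ + 9 * c.D with hC₅
  refine ⟨cost c.setup₁ + cost c.setup₂ + 400 * c.r + 2400 * c.D + 12 + 24 * (C₅ + 5),
    fun N cl hF => ?_⟩
  have hn := c.n_le N cl
  have hk := k_add_le hG N
  have h1 : 2 ^ (N / c.G) ≤ 2 ^ (N - N / c.G / c.v) :=
    Nat.pow_le_pow_right (by norm_num) (by omega)
  have h2 : (c.layout N cl).H ≤ 2 ^ (N - N / c.G / c.v) :=
    Nat.pow_le_pow_right (by norm_num) (Nat.sub_le_sub_left (Nat.div_le_self _ _) _)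
  have hB : (c.layout N cl).B =
      c.D * (2 ^ (N - N / c.G / c.v) * (cl.length + 3) ^ (c.T + 2)) := by
    rw [← mul_assoc]; rfl
  have hR : (c.layout N cl).R = 24 * (N + 1) := rfl
  have hcl : (c.layout N cl).cl = cl := rfl
  have hE : 1 ≤ 2 ^ (N - N / c.G / c.v) := Nat.one_le_two_pow
  set E := 2 ^ (N - N / c.G / c.v) with hEdef
  set I := cl.length + 3 with hI
  set J := I ^ (c.T + 2) with hJ
  have hJ1 : 1 ≤ J := Nat.one_le_pow _ _ (by omega)
  have hIJ : I * I ≤ J := by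
    rw [← pow_two, hJ]
    exact Nat.pow_le_pow_right (by omega) (by omega)
  have hIJ' : I ≤ J := (Nat.le_mul_self I).trans hIJ
  have hEJ : 1 ≤ E * J := Nat.mul_pos hE hJ1
  have hFI : (flat cl).length ≤ (c.K + 1) * I := by
    rw [mul_comm]
    exact hF.trans (Nat.mul_le_mul_right _ (by omega))
  have hn' : (c.layout N cl).g.n ≤ 4 * c.r * I * E := hn.trans (Nat.mul_le_mul_left _ h1)
  have hrun : (c.layout N cl).runTime M ≤ C₅ * (E * J) := by
    have a1 : (c.layout N cl).g.n * (100 * (flat cl).length + 1005) ≤ C₂ * (E * J) := by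
      calc (c.layout N cl).g.n * (100 * (flat cl).length + 1005)
          ≤ (4 * c.r * I * E) * (100 * ((c.K + 1) * I) + 1005 * I) :=
            Nat.mul_le_mul hn' (by omega)
        _ = C₂ * (E * (I * I)) := by rw [hC₂]; ring
        _ ≤ C₂ * (E * J) := by gcongr
    have a2 : (c.layout N cl).H *
        (C₃ + 2 * (cl.length * (100 * (flat cl).length + 600))) ≤ (C₃ + C₄) * (E * J) := by
      have a3 : cl.length * (100 * (flat cl).length + 600) ≤
          I * (100 * ((c.K + 1) * I) + 600 * I) := Nat.mul_le_mul (by omega) (by omega)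
      calc (c.layout N cl).H * (C₃ + 2 * (cl.length * (100 * (flat cl).length + 600)))
          ≤ E * (C₃ * 1 + 2 * (I * (100 * ((c.K + 1) * I) + 600 * I))) :=
            Nat.mul_le_mul h2 (by omega)
        _ = E * (C₃ * 1 + C₄ * (I * I)) := by rw [hC₄]; ring
        _ ≤ E * (C₃ * J + C₄ * J) := by gcongr
        _ = _ := by ring
    unfold Layout.runTime
    rw [hcl, hB, ← hC₁, ← hC₃]
    calc C₁ + (c.layout N cl).g.n * (100 * (flat cl).length + 1005) + (c.layout N cl).H *
          (C₃ + 2 * (cl.length * (100 * (flat cl).length + 600))) + 9 * (c.D * (E * J))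
        ≤ C₁ * (E * J) + C₂ * (E * J) + (C₃ + C₄) * (E * J) + 9 * (c.D * (E * J)) := by
          gcongr
          exact Nat.le_mul_of_pos_right _ hEJ
      _ = _ := by rw [hC₅]; ring
  have hN : 1 ≤ N + 1 := by omega
  have hY : E * J ≤ (N + 1) * (E * J) := Nat.le_mul_of_pos_left _ hN
  have hY1 : 1 ≤ (N + 1) * (E * J) := hEJ.trans hY
  have hIE : I * E ≤ (N + 1) * (E * J) := by
    refine le_trans ?_ hY
    rw [mul_comm]
    exact Nat.mul_le_mul_left _ hIJ'
  unfold time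
  rw [hR, hB]
  set Y := (N + 1) * (E * J) with hYdef
  calc cost c.setup₁ + cost c.setup₂ + 100 * (c.layout N cl).g.n +
        100 * (24 * (N + 1) * (c.D * (E * J))) + 12 +
        24 * (N + 1) * ((c.layout N cl).runTime M + 5)
      ≤ cost c.setup₁ * Y + cost c.setup₂ * Y + 100 * (4 * c.r * Y) +
        100 * (24 * (N + 1) * (c.D * (E * J))) + 12 * Y +
        24 * (N + 1) * (C₅ * (E * J) + 5 * (E * J)) := by
        gcongr
        · exact Nat.le_mul_of_pos_right _ hY1
        · exact Nat.le_mul_of_pos_right _ hY1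
        · refine hn'.trans ?_
          rw [mul_assoc]
          exact Nat.mul_le_mul_left _ hIE
        · omega
        · omega
    _ = _ := by rw [hYdef]; ring

end Consts

/-- The numbers `f i` have `O(s i)` bits. -/
def ExpBounded {ι : Type*} (s f : ι → ℕ) : Prop := ∃ b, ∀ i, f i < 2 ^ (b * (s i + 1))

namespace ExpBounded

variable {ι : Type*} {s f f' : ι → ℕ}

theorem mono (h : ExpBounded s f) (hf : ∀ i, f' i ≤ f i) : ExpBounded s f' := by
  obtain ⟨b, hb⟩ := h
  exact ⟨b, fun i => (hf i).trans_lt (hb i)⟩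

theorem const (x : ℕ) : ExpBounded s fun _ => x :=
  ⟨x, fun i => Nat.lt_two_pow_self.trans_le
    (Nat.pow_le_pow_right (by norm_num) (Nat.le_mul_of_pos_right _ (by omega)))⟩

theorem size : ExpBounded s s :=
  ⟨1, fun i => Nat.lt_two_pow_self.trans_le (Nat.pow_le_pow_right (by norm_num) (by omega))⟩

theorem two_pow : ExpBounded s fun i => 2 ^ s i :=
  ⟨1, fun i => Nat.pow_lt_pow_right (by norm_num) (by omega)⟩

theorem mul (h : ExpBounded s f) (h' : ExpBounded s f') : ExpBounded s fun i => f i * f' i := by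
  obtain ⟨b, hb⟩ := h
  obtain ⟨b', hb'⟩ := h'
  refine ⟨b + b', fun i => ?_⟩
  rw [add_mul, pow_add]
  exact Nat.mul_lt_mul'' (hb i) (hb' i)

theorem add (h : ExpBounded s f) (h' : ExpBounded s f') : ExpBounded s fun i => f i + f' i := by
  have key : ExpBounded s fun i => (f i + 1) + (f' i + 1) := by
    obtain ⟨b, hb⟩ := h
    obtain ⟨b', hb'⟩ := h'
    refine ⟨b + b' + 2, fun i => ?_⟩
    have h1 := hb i
    have h2 := hb' i
    have h3 : 2 ^ (b * (s i + 1)) ≤ 2 ^ ((b + b') * (s i + 1)) :=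
      Nat.pow_le_pow_right (by norm_num) (Nat.mul_le_mul_right _ (by omega))
    have h4 : 2 ^ (b' * (s i + 1)) ≤ 2 ^ ((b + b') * (s i + 1)) :=
      Nat.pow_le_pow_right (by norm_num) (Nat.mul_le_mul_right _ (by omega))
    have h5 : 2 ^ ((b + b') * (s i + 1)) * 4 ≤ 2 ^ ((b + b' + 2) * (s i + 1)) := by
      rw [add_mul (b + b') 2, pow_add]
      refine Nat.mul_le_mul_left _ ?_
      exact (by norm_num : 4 = 2 ^ 2).trans_le (Nat.pow_le_pow_right (by norm_num) (by omega))
    have h6 := Nat.two_pow_pos ((b + b') * (s i + 1))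
    beta_reduce
    omega
  exact key.mono fun i => by omega

theorem pow (h : ExpBounded s f) (n : ℕ) : ExpBounded s fun i => f i ^ n := by
  induction n with
  | zero => simpa using const 1
  | succ n ih => simpa only [pow_succ] using ih.mul h

end ExpBounded

end DynGraph

/-! ### Word length and time budget -/

namespace DynGraph

open WordRAM

namespace Consts

variable {c : Consts}

/-- The word length in SETH is `b (N + 1)` with one `b` for all formulas. Formulas are therefore the
index type, and all sizes are built by sums, products and fixed powers from quantities that are at
most exponential in `N`. -/
theorem exists_width (hK : ∀ (N : ℕ) (φ : SAT.CNF N), φ.IsKCNF c.K →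
      (flat φ.codes).length ≤ φ.codes.length * (c.K + 1)) (thr : ℕ) :
    ∃ b, ∀ (N : ℕ) (φ : SAT.CNF N), φ.IsKCNF c.K →
      (c.layout N φ.codes).Ok (b * (N + 1)) ∧ c.G < 2 ^ (b * (N + 1)) ∧ c.v < 2 ^ (b * (N + 1)) ∧
      c.K + 1 < 2 ^ (b * (N + 1)) ∧ thr < 2 ^ (b * (N + 1)) := by
  let ι := Σ N, {φ : SAT.CNF N // φ.IsKCNF c.K}
  let s : ι → ℕ := fun x => x.1
  let cl : ι → List (List ℕ) := fun x => x.2.1.codes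
  have hN : ExpBounded s s := .size
  have hI : ExpBounded s fun x => (cl x).length + 3 :=
    ((((ExpBounded.const 2).mul hN).add (.const 1)).pow c.K |>.add (.const 3)).mono fun x => by
      have := x.2.2.length_le
      simpa [cl, SAT.CNF.codes, s] using this
  have hm : ExpBounded s fun x => (cl x).length := hI.mono fun x => by omega
  have h2 : ∀ {f : ι → ℕ}, (∀ x, f x ≤ s x) → ExpBounded s fun x => 2 ^ f x := fun hf =>
    ExpBounded.two_pow.mono fun x => Nat.pow_le_pow_right (by norm_num) (hf x)
  have hn : ExpBounded s fun x => (c.layout x.1 (cl x)).g.n :=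
    ((((ExpBounded.const (4 * c.r)).mul hI).mul
      (h2 (f := fun x => x.1 / c.G) fun x => Nat.div_le_self _ _))).mono fun x => c.n_le _ _
  have hw : ExpBounded s fun x => 2 ^ (c.layout x.1 (cl x)).w :=
    (((ExpBounded.const 2).mul hn).pow c.wc).mono fun x => by
      have h : (c.layout x.1 (cl x)).w = (Nat.log 2 (c.layout x.1 (cl x)).g.n + 1) * c.wc :=
        mul_comm _ _
      rw [h, pow_mul, pow_succ, mul_comm]
      exact Nat.pow_le_pow_left (Nat.mul_le_mul_left _
        (Nat.pow_log_le_self 2 (c.layout x.1 (cl x)).g.n_pos.ne')) _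
  have hZ : ExpBounded s fun x => (c.layout x.1 (cl x)).Z :=
    (hw.add ((ExpBounded.const 8).mul hn)).add (.const 16)
  have hR : ExpBounded s fun x => (c.layout x.1 (cl x)).R :=
    (ExpBounded.const 24).mul (hN.add (.const 1))
  have hB : ExpBounded s fun x => (c.layout x.1 (cl x)).B :=
    ((ExpBounded.const c.D).mul (h2 (f := fun x => x.1 - x.1 / c.G / c.v) fun x =>
      Nat.sub_le _ _)).mul (hI.pow (c.T + 2))
  have hH : ExpBounded s fun x => (c.layout x.1 (cl x)).H :=
    h2 (f := fun x => x.1 - x.1 / c.G) fun x => Nat.sub_le _ _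
  have hT : ExpBounded s fun x => (c.layout x.1 (cl x)).T₀ :=
    (ExpBounded.const 2).add (hm.mul (.const (c.K + 1)))
  have hV : ExpBounded s fun x => (c.layout x.1 (cl x)).V := (hT.add (hR.mul hB)).add hH
  have hn₀ : ExpBounded s fun x => (c.layout x.1 (cl x)).g.n₀ :=
    h2 (f := fun x => x.1 / c.G) fun x => Nat.div_le_self _ _
  obtain ⟨b, hb⟩ := (((((((hV.add (((ExpBounded.const 3).mul hZ).mul hR)).add (hH.mul hn₀)).add
    hN).add (.const c.G)).add (.const c.v)).add (.const (c.K + 1))).add (.const thr))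
  refine ⟨b, fun N φ hφ => ?_⟩
  have h := hb ⟨N, φ, hφ⟩
  simp only [s, cl] at h
  refine ⟨layout_ok ?_ ?_ ?_, ?_, ?_, ?_, ?_⟩
  · exact Nat.add_le_add_left (hK N φ hφ) 2
  all_goals omega

/-- The time of the dynamic algorithm is within the budget of a run. -/
theorem budget (hG : c.T + 1 ≤ c.G) {t ε' : ℝ} (ht : t ≤ c.T) (hε' : 0 ≤ ε') (hv : 1 ≤ c.v * ε')
    {C : ℕ}
    (hD : C * (4 * c.r) ^ c.T + 16 * c.r * C ≤ c.D) (N : ℕ) (cl : List (List ℕ)) {p u q : ℝ}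
    (hp : |p| ≤ C * ((c.layout N cl).g.n : ℝ) ^ t)
    (hu : |u| ≤ C * ((c.layout N cl).g.n : ℝ) ^ (1 - ε'))
    (hq : |q| ≤ C * ((c.layout N cl).g.n : ℝ) ^ (1 - ε')) :
    |p| + (c.layout N cl).H * (4 * (c.layout N cl).cl.length * |u| + |q|) ≤ (c.layout N cl).B := by
  have hcl : (c.layout N cl).cl = cl := rfl
  have hH : (c.layout N cl).H = 2 ^ (N - N / c.G) := rfl
  have hB : (c.layout N cl).B = c.D * 2 ^ (N - N / c.G / c.v) * (cl.length + 3) ^ (c.T + 2) := rfl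
  have hn := c.n_le N cl
  have hn0 := (c.layout N cl).g.n_pos
  have hk2 : 2 ^ (N / c.G) ≤ (c.layout N cl).g.n := by
    have h : (c.layout N cl).g.n = 2 * ((2 ^ (N / c.G) + 1) * ((cl.length + 3) * c.r)) := rfl
    have h1 : 1 ≤ (cl.length + 3) * c.r :=
      Nat.mul_pos (by omega) (by have := c.two_le_r; omega)
    have := Nat.mul_le_mul_left (2 ^ (N / c.G) + 1) h1
    omega
  rw [hcl, hH, hB]
  generalize (c.layout N cl).g.n = n at *
  set k := N / c.G with hk
  set I := cl.length + 3 with hI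
  set E := 2 ^ (N - k / c.v) with hE
  have hkN : k ≤ N := Nat.div_le_self _ _
  have hkv : k / c.v ≤ k := Nat.div_le_self _ _
  have hnR : (1 : ℝ) ≤ n := by exact_mod_cast hn0
  have hI2 : I * I ≤ I ^ (c.T + 2) := by
    rw [← pow_two]
    exact Nat.pow_le_pow_right (by omega) (by omega)
  -- preprocessing
  have h1 : n ^ c.T ≤ (4 * c.r) ^ c.T * (E * I ^ (c.T + 2)) := by
    -- Here `k T + k / v ≤ k (T + 1) ≤ N`, by the choice of `G`.
    have h2 : (2 ^ k) ^ c.T ≤ E := by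
      rw [← pow_mul]
      refine Nat.pow_le_pow_right (by norm_num) ?_
      have h3 : k * (c.T + 1) ≤ N :=
        (Nat.mul_le_mul_left _ hG).trans (Nat.div_mul_le_self N c.G)
      rw [Nat.mul_add, Nat.mul_one] at h3
      omega
    calc n ^ c.T ≤ (4 * c.r * I * 2 ^ k) ^ c.T := Nat.pow_le_pow_left hn _
      _ = (4 * c.r) ^ c.T * ((2 ^ k) ^ c.T * I ^ c.T) := by rw [mul_pow, mul_pow]; ring
      _ ≤ _ := by
        gcongr
        · omega
        · omega
  have hp' : |p| ≤ C * ((4 * c.r) ^ c.T * (E * I ^ (c.T + 2)) : ℕ) := by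
    refine hp.trans (mul_le_mul_of_nonneg_left ?_ (Nat.cast_nonneg _))
    calc (n : ℝ) ^ t ≤ (n : ℝ) ^ (c.T : ℝ) := Real.rpow_le_rpow_of_exponent_le hnR ht
      _ = ((n ^ c.T : ℕ) : ℝ) := by rw [Real.rpow_natCast, Nat.cast_pow]
      _ ≤ _ := by exact_mod_cast h1
  -- updates and queries
  set X := (n : ℝ) ^ (1 - ε') with hX
  have hX0 : 0 ≤ X := Real.rpow_nonneg (Nat.cast_nonneg _) _
  -- As `n ≥ 2 ^ k` and `v ε' ≥ 1`, the gain `n ^ ε'` over linear time is at least `2 ^ (k / v)`.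
  have h4 : X * 2 ^ (k / c.v) ≤ n := by
    have h5 : (2 : ℝ) ^ (k / c.v) ≤ (n : ℝ) ^ ε' := by
      have h6 : ((k / c.v : ℕ) : ℝ) ≤ k * ε' := by
        have h7 : ((k / c.v : ℕ) : ℝ) * c.v ≤ k := by exact_mod_cast Nat.div_mul_le_self k c.v
        calc ((k / c.v : ℕ) : ℝ) = ((k / c.v : ℕ) : ℝ) * 1 := (mul_one _).symm
          _ ≤ ((k / c.v : ℕ) : ℝ) * (c.v * ε') := by gcongr
          _ = ((k / c.v : ℕ) : ℝ) * c.v * ε' := by ring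
          _ ≤ k * ε' := by gcongr
      calc (2 : ℝ) ^ (k / c.v) = (2 : ℝ) ^ ((k / c.v : ℕ) : ℝ) := (Real.rpow_natCast _ _).symm
        _ ≤ (2 : ℝ) ^ (k * ε') := Real.rpow_le_rpow_of_exponent_le (by norm_num) h6
        _ = ((2 : ℝ) ^ k) ^ ε' := by rw [Real.rpow_mul (by norm_num), Real.rpow_natCast]
        _ ≤ (n : ℝ) ^ ε' := Real.rpow_le_rpow (by positivity) (by exact_mod_cast hk2) hε'
    calc X * 2 ^ (k / c.v) ≤ X * (n : ℝ) ^ ε' := by gcongr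
      _ = n := by rw [hX, ← Real.rpow_add (by linarith)]; simp
  -- One operation in each phase: the factor `2 ^ k` of the size of the graph restores `2 ^ N`, and
  -- the gain of the previous estimate reduces it to `E`.
  have h8 : (2 : ℝ) ^ (N - k) * X ≤ (4 * c.r * I * E : ℕ) := by
    have h9 : E * 2 ^ (k / c.v) = 2 ^ (N - k) * 2 ^ k := by
      rw [hE, ← pow_add, ← pow_add]
      congr 1
      omega
    refine le_of_mul_le_mul_right ?_ (by positivity : (0 : ℝ) < 2 ^ (k / c.v))
    calc (2 : ℝ) ^ (N - k) * X * 2 ^ (k / c.v) = 2 ^ (N - k) * (X * 2 ^ (k / c.v)) := by ring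
      _ ≤ 2 ^ (N - k) * n := by gcongr
      _ ≤ 2 ^ (N - k) * (4 * c.r * I * 2 ^ k : ℕ) := by gcongr
      _ = (4 * c.r * I * (2 ^ (N - k) * 2 ^ k) : ℕ) := by push_cast; ring
      _ = (4 * c.r * I * (E * 2 ^ (k / c.v)) : ℕ) := by rw [h9]
      _ = _ := by push_cast; ring
  have h10 : ((2 ^ (N - k) : ℕ) : ℝ) * (4 * cl.length * |u| + |q|) ≤
      (16 * c.r * C * (E * I ^ (c.T + 2)) : ℕ) := by
    have h11 : (4 * cl.length + 1 : ℝ) ≤ 4 * I := by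
      rw [hI]; push_cast; linarith
    calc ((2 ^ (N - k) : ℕ) : ℝ) * (4 * cl.length * |u| + |q|)
        ≤ ((2 ^ (N - k) : ℕ) : ℝ) * (4 * cl.length * (C * X) + C * X) := by gcongr
      _ = (4 * cl.length + 1) * C * (2 ^ (N - k) * X) := by push_cast; ring
      _ ≤ (4 * I) * C * (4 * c.r * I * E : ℕ) := by gcongr
      _ = (16 * c.r * C * (E * (I * I)) : ℕ) := by push_cast; ring
      _ ≤ _ := by
        norm_cast
        gcongr
  calc |p| + ((2 ^ (N - k) : ℕ) : ℝ) * (4 * cl.length * |u| + |q|)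
      ≤ C * ((4 * c.r) ^ c.T * (E * I ^ (c.T + 2)) : ℕ) +
        (16 * c.r * C * (E * I ^ (c.T + 2)) : ℕ) := add_le_add hp' h10
    _ = ((C * (4 * c.r) ^ c.T + 16 * c.r * C) * (E * I ^ (c.T + 2)) : ℕ) := by push_cast; ring
    _ ≤ (c.D * E * I ^ (c.T + 2) : ℕ) := by
      rw [mul_assoc c.D]
      exact_mod_cast Nat.mul_le_mul_right _ hD

end Consts

end DynGraph

/-! ### Choice of the constants and contradiction with SETH -/

namespace DynGraph

open WordRAM

theorem exists_bound {f : ℕ → ℝ} {x : ℝ} (h : f =O[atTop] fun n : ℕ => (n : ℝ) ^ x) :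
    ∃ C n₁ : ℕ, ∀ n ≥ n₁, |f n| ≤ C * (n : ℝ) ^ x := by
  obtain ⟨C, hC⟩ := h.bound
  obtain ⟨n₁, h₁⟩ := eventually_atTop.1 hC
  refine ⟨⌈C⌉₊, n₁, fun n hn => ?_⟩
  have := h₁ n hn
  have h0 : 0 ≤ (n : ℝ) ^ x := Real.rpow_nonneg (Nat.cast_nonneg _) _
  rw [Real.norm_eq_abs, Real.norm_of_nonneg h0] at this
  exact this.trans (mul_le_mul_of_nonneg_right (Nat.le_ceil C) h0)

/-- If `A` simulates all phases, within the budget of a run, then it refutes SETH. -/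
theorem not_SETH {t ε ε' : ℝ} (hε : 0 < ε) (hε' : 0 < ε') {A : Algorithm} {S : Setting}
    {par : Parameter} {side : Side} {m : ℕ → ℕ} {p u q : ℕ → ℝ}
    (hp : p =O[atTop] (fun n : ℕ => (n : ℝ) ^ t))
    (hu : u =O[atTop] (fun n : ℕ => (n : ℝ) ^ (1 - ε')))
    (hq : q =O[atTop] (fun n : ℕ => (n : ℝ) ^ (1 - ε')))
    (hA : A.Approximates S par side (2 - ε) m) (hm : ∀ n ≥ 16, 4 * n ≤ m n)
    (hsim : ∀ (L : Layout) (W : ℕ), L.Ok W → L.w = A.width L.g.n → 4 * L.g.n ≤ m L.g.n → 0 < L.H →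
      |p L.g.n| + L.H * (4 * L.cl.length * |u L.g.n| + |q L.g.n|) ≤ L.B →
      ∃ ops idx, A.Simulates L S par (m L.g.n) ops idx) : ¬ SETH := by
  intro hSETH
  obtain ⟨C₁, n₁, h₁⟩ := exists_bound hp
  obtain ⟨C₂, n₂, h₂⟩ := exists_bound hu
  obtain ⟨C₃, n₃, h₃⟩ := exists_bound hq
  obtain ⟨M, hM⟩ := A.exists_below
  set T := ⌈t⌉₊ with hT
  set v := ⌈1 / ε'⌉₊ with hv
  have hv1 : 1 ≤ v * ε' := by
    have := Nat.le_ceil (1 / ε')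
    rwa [div_le_iff₀ hε'] at this
  have hv0 : 0 < v := Nat.ceil_pos.2 (by positivity)
  set G := T + 2 with hG
  -- The saving `k / v` in the exponent is about `N / (G v)`.
  obtain ⟨K, hK⟩ := hSETH (1 / (G * v)) (by positivity)
  -- The term `4 / ε` makes the gap wider than `2 - ε`. The terms `n₁`, `n₂`, `n₃` make every gadget
  -- graph so large that the asymptotic time bounds apply to it, whatever the formula; no small
  -- cases remain.
  set r := 2 + n₁ + n₂ + n₃ + ⌈4 / ε⌉₊ with hr
  set C := C₁ + C₂ + C₃ with hC
  let c : Consts :=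
    { G := G, v := v, T := T, D := C * (4 * r) ^ T + 16 * r * C + 1, K := K, wc := A.wordConst
      r := r, two_le_r := by omega, D_pos := Nat.succ_pos _ }
  have hα : (2 - ε) * (2 * c.r + 2 : ℕ) < (4 * c.r - 4 : ℕ) := by
    have h4 : 4 / ε ≤ r := (Nat.le_ceil _).trans (by exact_mod_cast (by omega : ⌈4 / ε⌉₊ ≤ r))
    rw [div_le_iff₀ hε] at h4
    change (2 - ε) * (2 * r + 2 : ℕ) < (4 * r - 4 : ℕ)
    rw [Nat.cast_sub (by omega)]
    push_cast
    nlinarith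
  obtain ⟨b, hb⟩ := c.exists_width (fun N φ hφ => hφ.length_flat_le) (side.threshold par c.r)
  obtain ⟨C', hC'⟩ := c.time_le (by change 2 ≤ T + 2; omega) M
  -- The powers of 4 and of `2 ^ K` come from `m + 3 ≤ 4 (2 (N + 1)) ^ K`, and the factor 2 from
  -- rounding down `N / G / v`.
  refine hK ⟨decideP A S par (side.threshold par c.r) M c, b, 2 * C' * 4 ^ (T + 2) * 2 ^ (K * (T + 2)),
    K * (T + 2) + 1, fun N φ hφ => ?_⟩
  obtain ⟨hL, b1, b2, b3, b4⟩ := hb N φ hφ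
  have hrn : r ≤ (c.layout N φ.codes).g.n ∧ 16 ≤ (c.layout N φ.codes).g.n := by
    have h : (c.layout N φ.codes).g.n = 2 * ((2 ^ (N / G) + 1) * ((φ.codes.length + 3) * r)) := rfl
    have h1 : (1 + 1) * (3 * r) ≤ (2 ^ (N / G) + 1) * ((φ.codes.length + 3) * r) :=
      Nat.mul_le_mul (Nat.add_le_add_right Nat.one_le_two_pow _)
        (Nat.mul_le_mul_right _ (by omega))
    omega
  have habs : ∀ {f : ℕ → ℝ} {x : ℝ} {C₀ n₀ : ℕ}, (∀ n ≥ n₀, |f n| ≤ C₀ * (n : ℝ) ^ x) → C₀ ≤ C →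
      n₀ ≤ r → |f (c.layout N φ.codes).g.n| ≤ C * ((c.layout N φ.codes).g.n : ℝ) ^ x :=
    fun h hC hr => (h _ (hr.trans hrn.1)).trans (mul_le_mul_of_nonneg_right
      (by exact_mod_cast hC) (Real.rpow_nonneg (Nat.cast_nonneg _) _))
  have hbudget := c.budget (t := t) (ε' := ε') (C := C) (by change T + 1 ≤ T + 2; omega) (Nat.le_ceil t)
    hε'.le hv1 (Nat.le_succ _) N φ.codes (habs h₁ (by omega) (by omega))
    (habs h₂ (by omega) (by omega)) (habs h₃ (by omega) (by omega))
  obtain ⟨hrun, hprob⟩ := decides_of_simulates (α := 2 - ε) hL b1 b2 b3 b4 hM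
    (hsim _ _ hL rfl (hm _ hrn.2) (Nat.two_pow_pos _) hbudget) hA hα
  refine ⟨fun ω => ?_, hprob⟩
  obtain ⟨k, s, hexec, hk⟩ := hrun ω
  refine ⟨k, s, hexec, ?_⟩
  have htime := hk.trans (hC' N φ.codes hφ.length_flat_le)
  have hI : φ.codes.length + 3 ≤ 4 * (2 ^ K * (N + 1) ^ K) := by
    have h1 := hφ.length_le
    have h2 : (2 * N + 1) ^ K ≤ (2 * (N + 1)) ^ K := Nat.pow_le_pow_left (by omega) _
    rw [mul_pow] at h2
    have h3 : 0 < 2 ^ K * (N + 1) ^ K := by positivity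
    have h4 : φ.codes.length = φ.length := by simp [SAT.CNF.codes]
    omega
  have hE : (2 : ℝ) ^ (N - N / G / v) ≤ 2 * 2 ^ ((1 - 1 / (G * v)) * (N : ℝ)) := by
    have h1 : N < G * v * (N / G / v + 1) := by
      rw [Nat.div_div_eq_div_mul]
      exact Nat.lt_mul_div_succ N (by positivity)
    have h2 : (N : ℝ) / (G * v) ≤ (N / G / v : ℕ) + 1 := by
      rw [div_le_iff₀ (by positivity), mul_comm]
      exact_mod_cast h1.le
    have h3 : N / G / v ≤ N := (Nat.div_le_self _ _).trans (Nat.div_le_self _ _)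
    calc (2 : ℝ) ^ (N - N / G / v) = (2 : ℝ) ^ ((N - N / G / v : ℕ) : ℝ) :=
          (Real.rpow_natCast _ _).symm
      _ ≤ (2 : ℝ) ^ (1 + (1 - 1 / (G * v)) * (N : ℝ)) := by
        refine Real.rpow_le_rpow_of_exponent_le (by norm_num) ?_
        rw [Nat.cast_sub h3]
        have : (1 - 1 / (G * v)) * (N : ℝ) = N - N / (G * v) := by ring
        linarith
      _ = _ := by rw [Real.rpow_add (by norm_num), Real.rpow_one]
  have hle : (C' * ((N + 1) * (2 ^ (N - N / G / v) * (φ.codes.length + 3) ^ (T + 2))) : ℕ) ≤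
      C' * ((N + 1) * (2 ^ (N - N / G / v) * (4 * (2 ^ K * (N + 1) ^ K)) ^ (T + 2))) := by
    gcongr
  calc (k : ℝ) ≤ (C' * ((N + 1) * (2 ^ (N - N / G / v) *
        (4 * (2 ^ K * (N + 1) ^ K)) ^ (T + 2))) : ℕ) := by exact_mod_cast htime.trans hle
    _ = C' * (N + 1) * (4 * (2 ^ K * (N + 1) ^ K)) ^ (T + 2) * (2 : ℝ) ^ (N - N / G / v) := by
      push_cast; ring
    _ ≤ C' * (N + 1) * (4 * (2 ^ K * (N + 1) ^ K)) ^ (T + 2) *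
        (2 * 2 ^ ((1 - 1 / (G * v)) * (N : ℝ))) := by gcongr
    _ = _ := by
      have e : ((4 : ℝ) * (2 ^ K * ((N : ℝ) + 1) ^ K)) ^ (T + 2) =
          4 ^ (T + 2) * (2 ^ (K * (T + 2)) * ((N : ℝ) + 1) ^ (K * (T + 2))) := by
        rw [mul_pow, mul_pow, ← pow_mul, ← pow_mul]
      push_cast
      rw [e, pow_succ ((N : ℝ) + 1) (K * (T + 2))]
      ring

end DynGraph

theorem mainTheorem4 (hSETH : SETH) (t ε ε' : ℝ) (ht : 0 < t) (hε : 0 < ε) (hε' : 0 < ε')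
    (c : ℕ) (hc : 1 ≤ c) (par : DynGraph.Parameter) (side : DynGraph.Side) :
    (¬ ∃ (A : DynGraph.Algorithm) (p u q : ℕ → ℝ),
      p =O[atTop] (fun n : ℕ => (n : ℝ) ^ t) ∧
      u =O[atTop] (fun n : ℕ => (n : ℝ) ^ (1 - ε')) ∧
      q =O[atTop] (fun n : ℕ => (n : ℝ) ^ (1 - ε')) ∧
      A.Approximates .fullyDynamic par side (2 - ε) (fun n => n * Nat.log 2 n ^ c) ∧
      A.AmortizedTime .fullyDynamic par (fun n => n * Nat.log 2 n ^ c) p u q) ∧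
    ∀ S : DynGraph.Setting, S = .incremental ∨ S = .decremental →
      ¬ ∃ (A : DynGraph.Algorithm) (p u q : ℕ → ℝ),
        p =O[atTop] (fun n : ℕ => (n : ℝ) ^ t) ∧
        u =O[atTop] (fun n : ℕ => (n : ℝ) ^ (1 - ε')) ∧
        q =O[atTop] (fun n : ℕ => (n : ℝ) ^ (1 - ε')) ∧
        A.Approximates S par side (2 - ε) (fun n => n * Nat.log 2 n ^ c) ∧
        A.WorstCaseTime S par (fun n => n * Nat.log 2 n ^ c) p u q := by
  -- From 16 vertices on the logarithm is at least 4, so the promise leaves room for the 4 edges per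
  -- vertex of the gadget graph.
  have hm : ∀ n ≥ 16, 4 * n ≤ n * Nat.log 2 n ^ c := by
    intro n hn
    have h1 : 4 ≤ Nat.log 2 n := Nat.le_log_of_pow_le (by norm_num) (by norm_num; exact hn)
    have h2 : Nat.log 2 n ^ 1 ≤ Nat.log 2 n ^ c := Nat.pow_le_pow_right (by omega) hc
    rw [mul_comm]
    exact Nat.mul_le_mul_left _ (by rw [pow_one] at h2; omega)
  refine ⟨?_, fun S hS => ?_⟩
  · rintro ⟨A, p, u, q, hp, hu, hq, hA, hT⟩
    exact DynGraph.not_SETH hε hε' hp hu hq hA hm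
      (fun L W hL hw hM _ hB => A.simulates_full hL hw hM hT hB) hSETH
  · rintro ⟨A, p, u, q, hp, hu, hq, hA, hT⟩
    exact DynGraph.not_SETH hε hε' hp hu hq hA hm
      (fun L W hL hw hM hH hB => A.simulates_partial hS hL hw hM hH hT hB) hSETH
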